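/- Let $\Omega=(a,b)\times(c,d)\subset\mathbb R^2$ be a rectangle and consider $-\operatorname{div}(A\nabla u)+c\,u=f$ in $\Omega$, $u=0$ on $\partial\Omega$, where $f\in L_2(\Omega)$, $A=(a_{ij})_{2\times2}\in[W^{1,\infty}(\Omega)]^{2\times 2}$ (continuous representative) satisfies $C_1\xi^T\xi\le\xi^TA(x,y)\xi\le C_2\xi^T\xi$ for all $\xi\in\mathbb R^2$, $(x,y)\in\Omega$, with constants $C_1,C_2>0$, and $c\in L_\infty(\Omega)$, $c\ge0$. Let $T_h$ be a conforming partition of $\Omega$ into axis-parallel rectangles $K$, let $h_K$ be the diameter of $K$, $\rho_K$ the diameter of the biggest disc in $K$ and $h=\max_K h_K$; assume $h_K/\rho_K\le\gamma$ for all $K$. Let $N_h$ be the set of nodes (vertices of elements). For $P\in N_h$ let $K_P^*$ be the dual element of $P$: the rectangle around $P$, within $\overline\Omega$, cut out by the segments that join the centres of the elements to the midpoints of their edges. Let $U_h$ be the space of functions in $C^0(\overline\Omega)$ that are bilinear on each $K\in T_h$ and vanish on $\partial\Omega$, let $\Pi_h u$ be the piecewise bilinear interpolant of a continuous function $u$ at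 the nodes, and put $\Pi_h^*v=\sum_{P\in N_h}v(P)\chi_{K_P^*}$ for $v\in U_h$. Let $$a_h(w,\Pi_h^*v)=\sum_{P\in N_h}\Big(-\int_{\partial K_P^*}n\cdot(A\nabla w)\,\Pi_h^*v\,ds+\int_{K_P^*}c\,w\,\Pi_h^*v\Big),\qquad w,v\in U_h,$$ where $n$ is the outward unit normal and $\Pi_h^*v$ takes on $\partial K_P^*$ its constant value $v(P)$ on $K_P^*$ (so the nodes $P\in\partial\Omega$ contribute nothing). The finite volume element (FVE) solution is a $u_h\in U_h$ with $a_h(u_h,\Pi_h^*v)=(f,\Pi_h^*v)_{L_2(\Omega)}$ for all $v\in U_h$. Then there are constants $C>0$ and $h_0>0$, depending only on $\Omega$, $A$, $c$ and $\gamma$, such that for every such partition with $h\le h_0$, every $f\in L_2(\Omega)$, every solution $u\in H^3(\Omega)$ of the boundary value problem (identified with its continuous representative on $\overline\Omega$) and every FVE solution $u_h$, $$\|\Pi_hu-u_h\|_{1}\le C\,h^2\,\|u\|_{3},$$ where $\|\cdot\|_m$ is the norm of $H^m(\Omega)$. -/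

import Mathlib

open MeasureTheory
open scoped ContDiff Matrix

namespace FVE

noncomputable section

/-! ### Sobolev spaces on an open subset of the plane -/

/-- The coordinate vectors of the plane `ℝ × ℝ`. -/
def coordVec (i : Fin 2) : ℝ × ℝ := if i = 0 then (1, 0) else (0, 1)

/-- The classical first partial derivative in the direction of the `i`-th coordinate. -/
def pd (i : Fin 2) (f : ℝ × ℝ → ℝ) (p : ℝ × ℝ) : ℝ := fderiv ℝ f p (coordVec i)

/-- The classical partial derivative `∂_x ^ α₁ ∂_y ^ α₂`. -/
def pdMulti (α : ℕ × ℕ) (f : ℝ × ℝ → ℝ) : ℝ × ℝ → ℝ := (pd 0)^[α.1] ((pd 1)^[α.2] f)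

/-- `φ ∈ C_c^∞(U)`. -/
def IsTest (U : Set (ℝ × ℝ)) (φ : ℝ × ℝ → ℝ) : Prop :=
  ContDiff ℝ ∞ φ ∧ HasCompactSupport φ ∧ tsupport φ ⊆ U

/-- `g` is the weak derivative `D^α f` on `U`. -/
def IsWeakDeriv (U : Set (ℝ × ℝ)) (α : ℕ × ℕ) (f g : ℝ × ℝ → ℝ) : Prop :=
  LocallyIntegrableOn f U ∧ LocallyIntegrableOn g U ∧
    ∀ φ, IsTest U φ →
      ∫ p in U, f p * pdMulti α φ p = (-1) ^ (α.1 + α.2) * ∫ p in U, g p * φ p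

open Classical in
/-- The weak derivative `D^α f` on `U` (unique almost everywhere on an open `U`); it is `0` when
there is none. -/
def weakDeriv (U : Set (ℝ × ℝ)) (α : ℕ × ℕ) (f : ℝ × ℝ → ℝ) : ℝ × ℝ → ℝ :=
  if h : ∃ g, IsWeakDeriv U α f g then h.choose else 0

/-- `f ∈ W^{m,p}(U)`: all weak derivatives of order at most `m` exist and lie in `L^p(U)`. -/
def MemSobolev (m : ℕ) (p : ENNReal) (U : Set (ℝ × ℝ)) (f : ℝ × ℝ → ℝ) : Prop :=
  ∀ α : ℕ × ℕ, α.1 + α.2 ≤ m → ∃ g, IsWeakDeriv U α f g ∧ MemLp g p (volume.restrict U)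

/-- The norm `‖f‖_{m,U}` of `H^m(U) = W^{m,2}(U)`: the square root of the sum of the
`∫_U |D^α f|²` over all `|α| ≤ m`. -/
def sobolevNorm (m : ℕ) (U : Set (ℝ × ℝ)) (f : ℝ × ℝ → ℝ) : ℝ :=
  Real.sqrt (∑ k ∈ Finset.range (m + 1), ∑ α ∈ Finset.HasAntidiagonal.antidiagonal k,
    ∫ p in U, (weakDeriv U α f p) ^ 2)

/-! ### The boundary value problem -/

/-- A nondegenerate rectangle with sides parallel to the axes. -/
structure Rect where
  (a b c d : ℝ)
  hab : a < b
  hcd : c < d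

/-- The open rectangle `Ω = (a, b) × (c, d)`. -/
def Rect.dom (Ω : Rect) : Set (ℝ × ℝ) := Set.Ioo Ω.a Ω.b ×ˢ Set.Ioo Ω.c Ω.d

/-- There are `C₁, C₂ > 0` with `C₁ ξᵀξ ≤ ξᵀA(p)ξ ≤ C₂ ξᵀξ` for all `ξ` and all `p ∈ U`. -/
def UniformlyElliptic (U : Set (ℝ × ℝ)) (A : ℝ × ℝ → Matrix (Fin 2) (Fin 2) ℝ) : Prop :=
  ∃ C₁ > 0, ∃ C₂ > 0, ∀ p ∈ U, ∀ ξ : Fin 2 → ℝ,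
    C₁ * (ξ ⬝ᵥ ξ) ≤ ξ ⬝ᵥ (A p *ᵥ ξ) ∧ ξ ⬝ᵥ (A p *ᵥ ξ) ≤ C₂ * (ξ ⬝ᵥ ξ)

/-- `u` solves `-div(A ∇u) + c u = f` in `Ω` (in the sense of distributions, `u ∈ H¹(Ω)`),
`u = 0` on `∂Ω`. As a function on the closed rectangle `u` is the continuous one in its class. -/
def IsSolution (Ω : Rect) (A : ℝ × ℝ → Matrix (Fin 2) (Fin 2) ℝ) (c f u : ℝ × ℝ → ℝ) : Prop :=
  MemSobolev 1 2 Ω.dom u ∧ ContinuousOn u (closure Ω.dom) ∧ (∀ p ∈ frontier Ω.dom, u p = 0) ∧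
    ∀ φ, IsTest Ω.dom φ →
      ∫ p in Ω.dom,
        ((A p *ᵥ ![weakDeriv Ω.dom (1, 0) u p, weakDeriv Ω.dom (0, 1) u p]) ⬝ᵥ
            ![pd 0 φ p, pd 1 φ p] + c p * u p * φ p)
        = ∫ p in Ω.dom, f p * φ p

/-! ### Rectangular meshes -/

/-- A (conforming) rectangular partition of `Ω`. It is given by the abscissas
`a = x 0 < ⋯ < x nx = b` and the ordinates `c = y 0 < ⋯ < y ny = d` of its grid lines;
the values `x i`, `i > nx`, and `y j`, `j > ny`, play no role. The nodes are the `(x i, y j)`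
with `i ≤ nx`, `j ≤ ny`. -/
structure RectMesh (Ω : Rect) where
  (nx ny : ℕ)
  (x y : ℕ → ℝ)
  x_zero : x 0 = Ω.a
  x_last : x nx = Ω.b
  x_lt : ∀ i < nx, x i < x (i + 1)
  y_zero : y 0 = Ω.c
  y_last : y ny = Ω.d
  y_lt : ∀ j < ny, y j < y (j + 1)

namespace RectMesh

variable {Ω : Rect}

theorem cells_nonempty (T : RectMesh Ω) :
    (Finset.range T.nx ×ˢ Finset.range T.ny).Nonempty := by
  rw [Finset.nonempty_product, Finset.nonempty_range_iff, Finset.nonempty_range_iff]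
  constructor
  · intro h
    have h1 := T.x_last
    rw [h, T.x_zero] at h1
    exact absurd h1 Ω.hab.ne
  · intro h
    have h1 := T.y_last
    rw [h, T.y_zero] at h1
    exact absurd h1 Ω.hcd.ne

/-- The closed element `K` with lower left vertex `(x i, y j)`, for `i < nx`, `j < ny`. -/
def elem (T : RectMesh Ω) (i j : ℕ) : Set (ℝ × ℝ) :=
  Set.Icc (T.x i) (T.x (i + 1)) ×ˢ Set.Icc (T.y j) (T.y (j + 1))

/-- The (Euclidean) diameter `h_K` of an element. -/
def elemDiam (T : RectMesh Ω) (i j : ℕ) : ℝ :=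
  Real.sqrt ((T.x (i + 1) - T.x i) ^ 2 + (T.y (j + 1) - T.y j) ^ 2)

/-- The diameter `ρ_K` of the biggest disc contained in an element. -/
def elemInDiam (T : RectMesh Ω) (i j : ℕ) : ℝ :=
  min (T.x (i + 1) - T.x i) (T.y (j + 1) - T.y j)

/-- The mesh size `h = max_K h_K`. -/
def meshSize (T : RectMesh Ω) : ℝ :=
  (Finset.range T.nx ×ˢ Finset.range T.ny).sup' T.cells_nonempty fun q => T.elemDiam q.1 q.2

/-- The regularity condition `h_K / ρ_K ≤ γ` for all elements `K`. -/
def IsRegular (T : RectMesh Ω) (γ : ℝ) : Prop :=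
  ∀ i < T.nx, ∀ j < T.ny, T.elemDiam i j / T.elemInDiam i j ≤ γ

/-- Left end of the dual element of a node with abscissa `x i`. -/
def dualL (T : RectMesh Ω) (i : ℕ) : ℝ := if i = 0 then T.x 0 else (T.x (i - 1) + T.x i) / 2

/-- Right end of the dual element of a node with abscissa `x i`. -/
def dualR (T : RectMesh Ω) (i : ℕ) : ℝ := if i = T.nx then T.x i else (T.x i + T.x (i + 1)) / 2

/-- Lower end of the dual element of a node with ordinate `y j`. -/
def dualB (T : RectMesh Ω) (j : ℕ) : ℝ := if j = 0 then T.y 0 else (T.y (j - 1) + T.y j) / 2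

/-- Upper end of the dual element of a node with ordinate `y j`. -/
def dualT (T : RectMesh Ω) (j : ℕ) : ℝ := if j = T.ny then T.y j else (T.y j + T.y (j + 1)) / 2

/-- The (closed) dual element `K_P^*` (control volume) of the node `P = (x i, y j)`: its sides
join the centres of the elements around `P` through the midpoints of the edges at `P`. -/
def dual (T : RectMesh Ω) (i j : ℕ) : Set (ℝ × ℝ) :=
  Set.Icc (T.dualL i) (T.dualR i) ×ˢ Set.Icc (T.dualB j) (T.dualT j)

/-- The trial space `U_h`: continuous on the closed rectangle, bilinear on each element, zero
on `∂Ω`. -/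
def IsTrial (T : RectMesh Ω) (w : ℝ × ℝ → ℝ) : Prop :=
  ContinuousOn w (closure Ω.dom) ∧
    (∀ i < T.nx, ∀ j < T.ny, ∃ k₀ k₁ k₂ k₃ : ℝ, ∀ p ∈ T.elem i j,
      w p = k₀ + k₁ * p.1 + k₂ * p.2 + k₃ * (p.1 * p.2)) ∧
    ∀ p ∈ frontier Ω.dom, w p = 0

/-- The projection `Π_h^* w = ∑_P w(P) χ_P` onto the functions that are constant on the dual
elements, `χ_P` being the characteristic function of `K_P^*`. -/
def dualProj (T : RectMesh Ω) (w : ℝ × ℝ → ℝ) (p : ℝ × ℝ) : ℝ :=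
  ∑ i ∈ Finset.range (T.nx + 1), ∑ j ∈ Finset.range (T.ny + 1),
    w (T.x i, T.y j) * (T.dual i j).indicator (fun _ => (1 : ℝ)) p

open Classical in
/-- The index of an interval `[z i, z (i + 1)]`, `i < n`, that contains `t ∈ [z 0, z n]`. -/
def cellIndex (z : ℕ → ℝ) (n : ℕ) (t : ℝ) : ℕ :=
  Nat.findGreatest (fun i => z i ≤ t) (n - 1)

/-- The bilinear interpolant `Π_h u`: on the element with vertices `P₁, P₂, P₃, P₄`
(counterclockwise from the lower left) and in the local coordinates `s, t ∈ [0, 1]` it is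
`u₁ + (u₂ - u₁) s + (u₄ - u₁) t + (u₃ + u₁ - u₂ - u₄) s t`, where `u_k = u(P_k)`. -/
def interp (T : RectMesh Ω) (u : ℝ × ℝ → ℝ) (p : ℝ × ℝ) : ℝ :=
  let i := cellIndex T.x T.nx p.1
  let j := cellIndex T.y T.ny p.2
  let s := (p.1 - T.x i) / (T.x (i + 1) - T.x i)
  let t := (p.2 - T.y j) / (T.y (j + 1) - T.y j)
  let u₁ := u (T.x i, T.y j)
  let u₂ := u (T.x (i + 1), T.y j)
  let u₃ := u (T.x (i + 1), T.y (j + 1))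
  let u₄ := u (T.x i, T.y (j + 1))
  u₁ + (u₂ - u₁) * s + (u₄ - u₁) * t + (u₃ + u₁ - u₂ - u₄) * (s * t)

end RectMesh

/-! ### The finite volume element scheme -/

/-- The vector `A ∇w`, with the classical gradient of `w`. -/
def flux (A : ℝ × ℝ → Matrix (Fin 2) (Fin 2) ℝ) (w : ℝ × ℝ → ℝ) (p : ℝ × ℝ) : Fin 2 → ℝ :=
  A p *ᵥ ![pd 0 w p, pd 1 w p]

/-- The line integral `∫ n · (A ∇w) ds` over the boundary of `[l, r] × [b, t]`, with the outward
unit normal `n`. -/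
def boundaryFlux (A : ℝ × ℝ → Matrix (Fin 2) (Fin 2) ℝ) (w : ℝ × ℝ → ℝ) (l r b t : ℝ) : ℝ :=
  (∫ y in b..t, flux A w (r, y) 0) - (∫ y in b..t, flux A w (l, y) 0) +
    (∫ x in l..r, flux A w (x, t) 1) - (∫ x in l..r, flux A w (x, b) 1)

/-- The form `a_h(w, v) = ∑_P ( - ∫_{∂K_P^*} n · (A ∇w) v ds + ∫_{K_P^*} c w v )` for trial
functions `w` and test functions `v`, the latter being constant on each dual element `K_P^*`, with
the value `v(P)`, and zero on those of the nodes on `∂Ω`. A trial function is smooth near all but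
finitely many points of the `∂K_P^*` of an interior node `P`, so its classical gradient serves. -/
def fveForm {Ω : Rect} (T : RectMesh Ω) (A : ℝ × ℝ → Matrix (Fin 2) (Fin 2) ℝ)
    (c w v : ℝ × ℝ → ℝ) : ℝ :=
  ∑ i ∈ Finset.range (T.nx + 1), ∑ j ∈ Finset.range (T.ny + 1),
    (-(boundaryFlux A w (T.dualL i) (T.dualR i) (T.dualB j) (T.dualT j) * v (T.x i, T.y j)) +
      ∫ p in T.dual i j, c p * w p * v p)

/-- `uh ∈ U_h` solves the scheme `a_h(uh, Π_h^* v) = (f, Π_h^* v)` for all `v ∈ U_h`. -/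
def IsFVESolution {Ω : Rect} (T : RectMesh Ω) (A : ℝ × ℝ → Matrix (Fin 2) (Fin 2) ℝ)
    (c f uh : ℝ × ℝ → ℝ) : Prop :=
  T.IsTrial uh ∧ ∀ v, T.IsTrial v →
    fveForm T A c uh (T.dualProj v) = ∫ p in Ω.dom, f p * T.dualProj v p

end

end FVE

open FVE

namespace FVE

/-! ### Functions of one variable -/

/-! Put `e = Π_h u - u_h`. This is a trial function, and the scheme is tested with `v = e` itself. A
trial function is determined by its nodal values, and its `H¹` norm is at most a constant times the
square root of `nodalEnergy`, the sum of the squared increments along the edges of the elements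
(`IsPiecewise.sobolevNorm_le`, which uses the discrete Poincaré inequality `sum_cornerSq_le`). It
therefore suffices to bound the energy of `e`, by coercivity and second order consistency.

Since `v` vanishes at the boundary nodes, summation by parts over the control volumes turns the flux
terms into fluxes through the halves of the element midlines, multiplied by the increments of `v`
across them. This is `vform`, used once for the vertical midlines and once, with the coordinates
exchanged, for the horizontal ones (`sum_sideDiff_zero`, `IsCoeff.fveForm_eq`).

Coercivity (`IsCoeff.discForm_self_ge`): with `A` frozen at the centre of an element, the
contribution of that element is an explicit quadratic form in its four edge increments. Ellipticity
at the mean gradient, together with two remaining squares, bounds it from below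
(`quadratic_form_cell_ge`). The Lipschitz variation of `A` costs `O(h)` times the energy. So does
the replacement of `Π_h^* v` by `v` in the zeroth order term, after which `c ≥ 0` gives the sign.
This is why `h` has to be small.

Consistency (`abs_vform_interp_error_le`): the solution satisfies the flux balance on every interior
control volume, so only the fluxes of the interpolation error matter. On a vertical midline the
`x`-derivative of that error is of third order, because the midline is the axis of symmetry of the
element. The `y`-derivative is not; only its integral over the whole midline is. Its two half
integrals differ by a second difference `D` of `u` along the midline, one order short. But `D` is
multiplied by the mixed difference of `v`, which is also the `x`-difference of the `y`-increments of
`v`. A second summation by parts, along a horizontal strip of elements, moves this difference onto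
the product of the coefficient with `D`: neighbouring values of `D` differ by a third order term,
and the coefficient is Lipschitz. There are no boundary terms, since the `y`-increments of `v`
vanish on the two vertical sides. The Cauchy-Schwarz inequality over the elements gives `h² ‖u‖₃`
times the square root of the energy.

These estimates are proved for smooth functions, with `L¹` norms of derivatives on the right.
Contraction towards the centre followed by mollification (`exists_smooth_approx`) yields smooth
functions that converge to `u` in `H³` and pointwise on the closed rectangle. Their nodal values
converge, and their balances over interior control volumes converge to the integrals of `f`
(`IsCoeff.tendsto_balance`), so that traces of `∇u` never have to be defined. -/

theorem exists_eq_mul_deriv {φ φ' : ℝ → ℝ} {a b : ℝ} (hab : a ≤ b)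
    (hd : ∀ t, HasDerivAt φ (φ' t) t) : ∃ ξ ∈ Set.Icc a b, φ b - φ a = (b - a) * φ' ξ := by
  rcases hab.eq_or_lt with rfl | hlt
  · exact ⟨a, by simp, by ring⟩
  · obtain ⟨ξ, hξ, h⟩ := exists_hasDerivAt_eq_slope φ φ' hlt
      (fun t _ => (hd t).continuousAt.continuousWithinAt) (fun t _ => hd t)
    refine ⟨ξ, Set.Ioo_subset_Icc_self hξ, ?_⟩
    rw [h, mul_div_cancel₀ _ (sub_ne_zero.mpr hlt.ne')]

/-- The one-variable error bounds combine mean values with this estimate. The points `s` and `t` are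
mean value points of unknown position, so the bound is by the `L¹` norm over the whole interval. -/
theorem abs_sub_le_integral_abs_deriv {φ φ' : ℝ → ℝ} {a b s t : ℝ}
    (hd : ∀ t, HasDerivAt φ (φ' t) t) (hc : Continuous φ')
    (hs : s ∈ Set.Icc a b) (ht : t ∈ Set.Icc a b) : |φ s - φ t| ≤ ∫ x in a..b, |φ' x| := by
  have hab : a ≤ b := hs.1.trans hs.2
  rw [← intervalIntegral.integral_eq_sub_of_hasDerivAt (fun x _ => hd x)
    (hc.intervalIntegrable t s)]
  refine (intervalIntegral.norm_integral_le_abs_integral_norm (f := φ')).trans ?_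
  have h := intervalIntegral.abs_integral_mono_interval (f := fun x => |φ' x|) (μ := volume)
    (a := t) (b := s) (c := a) (d := b)
    (by rw [Set.uIoc_of_le hab]
        exact Set.Ioc_subset_Ioc (le_min ht.1 hs.1) (max_le ht.2 hs.2))
    (Filter.Eventually.of_forall fun x => abs_nonneg _) (hc.abs.intervalIntegrable _ _)
  rwa [abs_of_nonneg (intervalIntegral.integral_nonneg hab fun x _ => abs_nonneg _)] at h

/-- The slope of `φ` over `[a, b]` and its slope over `[a, y]` are values of `φ'` at two points, and
the interpolation error is their difference times `(b - a) (y - a)`. Denominators are cleared, so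
that the degenerate interval is included. -/
theorem abs_linear_interp_sub_le {φ φ' φ'' : ℝ → ℝ} {a b y : ℝ}
    (hd : ∀ t, HasDerivAt φ (φ' t) t) (hd' : ∀ t, HasDerivAt φ' (φ'' t) t) (hc : Continuous φ'')
    (hy : y ∈ Set.Icc a b) :
    |(b - a) * φ y - ((b - y) * φ a + (y - a) * φ b)| ≤ (b - a) ^ 2 * ∫ x in a..b, |φ'' x| := by
  have hab : a ≤ b := hy.1.trans hy.2
  obtain ⟨ξ, hξ, h1⟩ := exists_eq_mul_deriv hab hd
  obtain ⟨ζ, hζ, h2⟩ := exists_eq_mul_deriv hy.1 hd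
  have h3 := abs_sub_le_integral_abs_deriv hd' hc (a := a) (b := b)
    ⟨hζ.1, hζ.2.trans hy.2⟩ hξ
  have h4 : (b - a) * φ y - ((b - y) * φ a + (y - a) * φ b)
      = (b - a) * (y - a) * (φ' ζ - φ' ξ) := by
    linear_combination (b - a) * h2 - (y - a) * h1
  rw [h4, abs_mul, abs_of_nonneg (mul_nonneg (sub_nonneg.mpr hab) (sub_nonneg.mpr hy.1)), sq]
  gcongr
  exact hy.2

/-- The second difference is half the length of the interval times the difference of the slopes over
the two halves, which are two values of `φ'`. -/
theorem abs_second_difference_le {φ φ' φ'' : ℝ → ℝ} {a b : ℝ} (hab : a ≤ b)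
    (hd : ∀ t, HasDerivAt φ (φ' t) t) (hd' : ∀ t, HasDerivAt φ' (φ'' t) t)
    (hc : Continuous φ'') :
    |φ b + φ a - 2 * φ ((a + b) / 2)| ≤ (b - a) * ∫ x in a..b, |φ'' x| := by
  obtain ⟨ξ, hξ, h1⟩ := exists_eq_mul_deriv (by linarith : a ≤ (a + b) / 2) hd
  obtain ⟨ζ, hζ, h2⟩ := exists_eq_mul_deriv (by linarith : (a + b) / 2 ≤ b) hd
  have h3 := abs_sub_le_integral_abs_deriv hd' hc (a := a) (b := b) (s := ζ) (t := ξ)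
    ⟨by linarith [hζ.1], hζ.2⟩ ⟨hξ.1, by linarith [hξ.2]⟩
  have h4 : φ b + φ a - 2 * φ ((a + b) / 2) = (b - a) / 2 * (φ' ζ - φ' ξ) := by
    linear_combination h2 - h1
  rw [h4, abs_mul, abs_of_nonneg (by linarith)]
  have : 0 ≤ ∫ x in a..b, |φ'' x| := intervalIntegral.integral_nonneg hab fun x _ => abs_nonneg _
  have h5 : (b - a) / 2 ≤ b - a := by linarith
  gcongr

theorem abs_midpoint_deriv_sub_le {φ φ' φ'' φ''' : ℝ → ℝ} {a b : ℝ} (hab : a ≤ b)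
    (hd : ∀ t, HasDerivAt φ (φ' t) t) (hd' : ∀ t, HasDerivAt φ' (φ'' t) t)
    (hd'' : ∀ t, HasDerivAt φ'' (φ''' t) t) (hc : Continuous φ''') :
    |(b - a) * φ' ((a + b) / 2) - (φ b - φ a)| ≤ (b - a) ^ 2 * ∫ x in a..b, |φ''' x| := by
  set m := (a + b) / 2 with hm
  -- The odd part of `φ` about the midpoint, minus its linear term. The second derivative cancels by
  -- symmetry, so after two applications of the mean value theorem only a difference of values of
  -- `φ''` is left.
  have hψ : ∀ s, HasDerivAt (fun s => φ (m + s) - φ (m - s) - 2 * s * φ' m)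
      (φ' (m + s) + φ' (m - s) - 2 * φ' m) s := fun s => by
    have h1 : HasDerivAt (fun s => φ (m + s)) (φ' (m + s)) s := by
      simpa using (hd (m + s)).comp_const_add m s
    have h2 : HasDerivAt (fun s => φ (m - s)) (-φ' (m - s)) s := by
      simpa using (hd (m - s)).comp_const_sub m s
    have h3 : HasDerivAt (fun s => 2 * s * φ' m) (2 * φ' m) s := by
      simpa using ((hasDerivAt_id s).const_mul 2).mul_const (φ' m)
    exact ((h1.sub h2).sub h3).congr_deriv (by ring)
  obtain ⟨σ, hσ, h1⟩ := exists_eq_mul_deriv (by linarith : 0 ≤ (b - a) / 2) hψ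
  obtain ⟨ξ, hξ, h2⟩ := exists_eq_mul_deriv (by linarith [hσ.1] : m ≤ m + σ) hd'
  obtain ⟨ζ, hζ, h3⟩ := exists_eq_mul_deriv (by linarith [hσ.1] : m - σ ≤ m) hd'
  have h4 := abs_sub_le_integral_abs_deriv hd'' hc (a := a) (b := b) (s := ζ) (t := ξ)
    ⟨by linarith [hζ.1, hσ.2], by linarith [hζ.2]⟩ ⟨by linarith [hξ.1], by linarith [hξ.2, hσ.2]⟩
  have e1 : m + (b - a) / 2 = b := by rw [hm]; ring
  have e2 : m - (b - a) / 2 = a := by rw [hm]; ring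
  rw [e1, e2] at h1
  have h5 : (b - a) * φ' m - (φ b - φ a) = (b - a) / 2 * σ * (φ' ζ * 0 + (φ'' ζ - φ'' ξ)) := by
    simp only [add_zero, sub_zero] at h1
    linear_combination -h1 - (b - a) / 2 * h2 + (b - a) / 2 * h3
  rw [h5, abs_mul, abs_of_nonneg (mul_nonneg (by linarith) hσ.1), mul_zero, zero_add]
  have h6 : (b - a) / 2 * σ ≤ (b - a) ^ 2 := by nlinarith [hσ.1, hσ.2]
  gcongr

/-- Average `|φ s| ≤ |φ t| + ∫ |φ'|` over `t`. Integrated in the other variable, this becomes a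
trace inequality on an element. -/
theorem mul_abs_le_integral_add {φ φ' : ℝ → ℝ} {a b s : ℝ}
    (hd : ∀ t, HasDerivAt φ (φ' t) t) (hc : Continuous φ') (hs : s ∈ Set.Icc a b) :
    (b - a) * |φ s| ≤ (∫ x in a..b, |φ x|) + (b - a) * ∫ x in a..b, |φ' x| := by
  have hab : a ≤ b := hs.1.trans hs.2
  have hφ : Continuous φ := continuous_iff_continuousAt.mpr fun t => (hd t).continuousAt
  have h := intervalIntegral.integral_mono_on (μ := volume) (f := fun _ => |φ s|)
    (g := fun t => |φ t| + ∫ x in a..b, |φ' x|) hab (by simp)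
    ((hφ.abs.add continuous_const).intervalIntegrable _ _) (fun t ht => by
      have h1 := abs_sub_le_integral_abs_deriv hd hc hs ht
      have h2 := abs_sub_abs_le_abs_sub (φ s) (φ t)
      linarith)
  rw [intervalIntegral.integral_add (hφ.abs.intervalIntegrable _ _) (by simp)] at h
  simpa using h

/-! ### Partial derivatives of smooth functions of two variables -/

theorem contDiff_pd {f : ℝ × ℝ → ℝ} (hf : ContDiff ℝ ∞ f) (i : Fin 2) : ContDiff ℝ ∞ (pd i f) := by
  have : ContDiff ℝ ∞ (fderiv ℝ f) := hf.fderiv_right (by simp)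
  exact this.clm_apply contDiff_const

theorem contDiff_pd_iterate {f : ℝ × ℝ → ℝ} (hf : ContDiff ℝ ∞ f) (i : Fin 2) (n : ℕ) :
    ContDiff ℝ ∞ ((pd i)^[n] f) := by
  induction n with
  | zero => exact hf
  | succ n ih => rw [Function.iterate_succ_apply']; exact contDiff_pd ih i

theorem contDiff_pdMulti {f : ℝ × ℝ → ℝ} (hf : ContDiff ℝ ∞ f) (α : ℕ × ℕ) :
    ContDiff ℝ ∞ (pdMulti α f) :=
  contDiff_pd_iterate (contDiff_pd_iterate hf 1 _) 0 _

theorem hasDerivAt_pd_zero {f : ℝ × ℝ → ℝ} (hf : Differentiable ℝ f) (x y : ℝ) :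
    HasDerivAt (fun s => f (s, y)) (pd 0 f (x, y)) x := by
  have h1 : HasDerivAt (fun s : ℝ => (s, y)) ((1 : ℝ), (0 : ℝ)) x :=
    (hasDerivAt_id x).prodMk (hasDerivAt_const x y)
  have := (hf (x, y)).hasFDerivAt.comp_hasDerivAt x h1
  exact HasDerivAt.congr_deriv (f := fun s => f (s, y)) this (by simp [pd, coordVec])

theorem hasDerivAt_pd_one {f : ℝ × ℝ → ℝ} (hf : Differentiable ℝ f) (x y : ℝ) :
    HasDerivAt (fun s => f (x, s)) (pd 1 f (x, y)) y := by
  have h1 : HasDerivAt (fun s : ℝ => (x, s)) ((0 : ℝ), (1 : ℝ)) y :=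
    (hasDerivAt_const y x).prodMk (hasDerivAt_id y)
  have := (hf (x, y)).hasFDerivAt.comp_hasDerivAt y h1
  exact HasDerivAt.congr_deriv (f := fun s => f (x, s)) this (by simp [pd, coordVec])

theorem pd_comm {f : ℝ × ℝ → ℝ} (hf : ContDiff ℝ ∞ f) (i j : Fin 2) :
    pd i (pd j f) = pd j (pd i f) := by
  funext p
  have hd : DifferentiableAt ℝ (fderiv ℝ f) p :=
    ((hf.fderiv_right (m := ∞) (by simp)).differentiable (by simp)) p
  have key : ∀ k l : Fin 2, pd k (pd l f) p = fderiv ℝ (fderiv ℝ f) p (coordVec k) (coordVec l) := by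
    intro k l
    have : HasFDerivAt (pd l f) ((fderiv ℝ (fderiv ℝ f) p).flip (coordVec l)) p := by
      have h := hd.hasFDerivAt.clm_apply (hasFDerivAt_const (coordVec l) p)
      exact HasFDerivAt.congr_fderiv (f := pd l f) h (by ext <;> simp)
    rw [pd, this.fderiv]; rfl
  rw [key, key]
  exact (hf.contDiffAt.isSymmSndFDerivAt (by simp; exact WithTop.coe_le_coe.2 le_top)).eq _ _

theorem pd_iterate_comm {f : ℝ × ℝ → ℝ} (hf : ContDiff ℝ ∞ f) (i j : Fin 2) (m n : ℕ) :
    (pd i)^[m] ((pd j)^[n] f) = (pd j)^[n] ((pd i)^[m] f) := by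
  have one : ∀ n, ∀ {g : ℝ × ℝ → ℝ}, ContDiff ℝ ∞ g → pd i ((pd j)^[n] g) = (pd j)^[n] (pd i g) := by
    intro n
    induction n with
    | zero => intro g _; rfl
    | succ n ih =>
      intro g hg
      rw [Function.iterate_succ_apply, ih (contDiff_pd hg j), pd_comm hg,
        Function.iterate_succ_apply]
  induction m with
  | zero => rfl
  | succ m ih =>
    rw [Function.iterate_succ_apply', ih, one n (contDiff_pd_iterate hf i m),
      Function.iterate_succ_apply']

/-- In `Fin 2`, `1 - i` is the other index. Exchanging the coordinates lets every estimate on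
vertical midlines serve for the horizontal ones. -/
theorem pd_comp_swap (f : ℝ × ℝ → ℝ) (i : Fin 2) :
    pd i (f ∘ Prod.swap) = pd (1 - i) f ∘ Prod.swap := by
  funext p
  have h := (ContinuousLinearEquiv.prodComm ℝ ℝ ℝ).comp_right_fderiv (f := f) (x := p)
  have h' : fderiv ℝ (f ∘ Prod.swap) p = _ := h
  simp only [pd, h', Function.comp]
  fin_cases i <;> simp [coordVec]

theorem pdMulti_comp_swap {f : ℝ × ℝ → ℝ} (hf : ContDiff ℝ ∞ f) (α : ℕ × ℕ) :
    pdMulti α (f ∘ Prod.swap) = pdMulti α.swap f ∘ Prod.swap := by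
  have it : ∀ (i : Fin 2) (n : ℕ) (g : ℝ × ℝ → ℝ),
      (pd i)^[n] (g ∘ Prod.swap) = (pd (1 - i))^[n] g ∘ Prod.swap := by
    intro i n
    induction n with
    | zero => intro g; rfl
    | succ n ih => intro g; rw [Function.iterate_succ_apply, pd_comp_swap, ih,
        Function.iterate_succ_apply]
  rw [pdMulti, it, it, pdMulti, pd_iterate_comm hf]
  rfl

end FVE

namespace FVE

/-! ### Integrals over rectangles -/

/-- The integral of `G` over the rectangle `[a, b] × [c, d]`. -/
noncomputable def boxInt (G : ℝ × ℝ → ℝ) (a b c d : ℝ) : ℝ :=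
  ∫ p in Set.Icc a b ×ˢ Set.Icc c d, G p

theorem integrableOn_box_of_continuous {G : ℝ × ℝ → ℝ} (hG : Continuous G) (a b c d : ℝ) :
    IntegrableOn G (Set.Icc a b ×ˢ Set.Icc c d) :=
  hG.continuousOn.integrableOn_compact (isCompact_Icc.prod isCompact_Icc)

theorem boxInt_eq_integral_integral {G : ℝ × ℝ → ℝ} {a b c d : ℝ} (hab : a ≤ b) (hcd : c ≤ d)
    (hG : IntegrableOn G (Set.Icc a b ×ˢ Set.Icc c d)) :
    boxInt G a b c d = ∫ x in a..b, ∫ y in c..d, G (x, y) := by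
  rw [boxInt, Measure.volume_eq_prod, setIntegral_prod _ (by rwa [← Measure.volume_eq_prod]),
    integral_Icc_eq_integral_Ioc, intervalIntegral.integral_of_le hab]
  simp_rw [integral_Icc_eq_integral_Ioc, intervalIntegral.integral_of_le hcd]

theorem boxInt_comp_swap (G : ℝ × ℝ → ℝ) (a b c d : ℝ) :
    boxInt (G ∘ Prod.swap) c d a b = boxInt G a b c d := by
  rw [boxInt, boxInt, Measure.volume_eq_prod]
  exact setIntegral_prod_swap _ _ G

theorem boxInt_eq_integral_integral' {G : ℝ × ℝ → ℝ} {a b c d : ℝ} (hab : a ≤ b) (hcd : c ≤ d)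
    (hG : IntegrableOn G (Set.Icc a b ×ˢ Set.Icc c d)) :
    boxInt G a b c d = ∫ y in c..d, ∫ x in a..b, G (x, y) := by
  rw [← boxInt_comp_swap, boxInt_eq_integral_integral hcd hab]
  · rfl
  · rw [Measure.volume_eq_prod] at hG ⊢
    exact hG.swap

theorem boxInt_nonneg {G : ℝ × ℝ → ℝ} (hG : ∀ p, 0 ≤ G p) (a b c d : ℝ) : 0 ≤ boxInt G a b c d :=
  integral_nonneg hG

theorem volume_box {a b c d : ℝ} (hab : a ≤ b) (hcd : c ≤ d) :
    volume.real (Set.Icc a b ×ˢ Set.Icc c d) = (b - a) * (d - c) := by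
  rw [Measure.volume_eq_prod, measureReal_prod_prod, Real.volume_real_Icc_of_le hab,
    Real.volume_real_Icc_of_le hcd]

/-- The Cauchy-Schwarz inequality against a constant. -/
theorem integral_abs_le_sqrt_mul_sqrt {μ : Measure (ℝ × ℝ)} [IsFiniteMeasure μ] {G : ℝ × ℝ → ℝ}
    (hG : MemLp G 2 μ) : ∫ p, |G p| ∂μ ≤ √(μ.real Set.univ) * √(∫ p, G p ^ 2 ∂μ) := by
  have i1 : Integrable (fun p => |G p|) μ := (hG.integrable (by norm_num)).abs
  have i2 : Integrable (fun p => G p ^ 2) μ := hG.integrable_sq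
  set I := ∫ p, |G p| ∂μ with hI
  set J := ∫ p, G p ^ 2 ∂μ with hJ
  have hV0 : 0 ≤ μ.real Set.univ := measureReal_nonneg
  -- The integral of `(t |G| - 1)²` is a nonnegative quadratic polynomial in `t`; its discriminant
  -- gives the inequality.
  have key : ∀ t : ℝ, 0 ≤ J * (t * t) + (-2 * I) * t + μ.real Set.univ := fun t => by
    have h : 0 ≤ ∫ p, (t * |G p| - 1) ^ 2 ∂μ := integral_nonneg fun _ => sq_nonneg _
    have e : ∀ p, (t * |G p| - 1) ^ 2 = t ^ 2 * G p ^ 2 - 2 * t * |G p| + 1 := fun p => by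
      rw [← sq_abs (G p)]; ring
    simp_rw [e] at h
    rw [integral_add (by exact (i2.const_mul _).sub (i1.const_mul _)) (integrable_const _),
      integral_sub (i2.const_mul _) (i1.const_mul _), integral_const_mul, integral_const_mul,
      integral_const] at h
    simp only [smul_eq_mul, mul_one] at h
    linarith
  have hd := discrim_le_zero key
  rw [discrim] at hd
  rw [← Real.sqrt_mul hV0]
  exact Real.le_sqrt_of_sq_le (by nlinarith)

theorem memLp_two_box_of_continuous {G : ℝ × ℝ → ℝ} (hG : Continuous G) (a b c d : ℝ) :
    MemLp G 2 (volume.restrict (Set.Icc a b ×ˢ Set.Icc c d)) :=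
  (memLp_two_iff_integrable_sq hG.aestronglyMeasurable).mpr
    (integrableOn_box_of_continuous (hG.pow 2) a b c d)

instance isFiniteMeasure_box (a b c d : ℝ) :
    IsFiniteMeasure ((volume : Measure (ℝ × ℝ)).restrict (Set.Icc a b ×ˢ Set.Icc c d)) :=
  isFiniteMeasure_restrict.mpr (isCompact_Icc.prod isCompact_Icc).measure_lt_top.ne

/-- The square root of the area of an element is at most `h`. Passing from `L¹` to `L²` norms of the
derivatives thus gains one of the two powers of `h`. -/
theorem boxInt_abs_le_sqrt {G : ℝ × ℝ → ℝ} {a b c d : ℝ} (hab : a ≤ b) (hcd : c ≤ d)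
    (hG : Continuous G) :
    boxInt (fun p => |G p|) a b c d
      ≤ √((b - a) * (d - c)) * √(boxInt (fun p => G p ^ 2) a b c d) := by
  have h := integral_abs_le_sqrt_mul_sqrt (memLp_two_box_of_continuous hG a b c d)
  rwa [measureReal_restrict_apply_univ, volume_box hab hcd] at h

theorem continuous_integral_fst {G : ℝ × ℝ → ℝ} (hG : Continuous G) (a b : ℝ) :
    Continuous fun y => ∫ x in a..b, G (x, y) :=
  intervalIntegral.continuous_parametric_intervalIntegral_of_continuous'
    (f := fun y x => G (x, y)) (hG.comp continuous_swap) a b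

theorem continuous_integral_snd {G : ℝ × ℝ → ℝ} (hG : Continuous G) (a b : ℝ) :
    Continuous fun x => ∫ y in a..b, G (x, y) :=
  intervalIntegral.continuous_parametric_intervalIntegral_of_continuous'
    (f := fun x y => G (x, y)) hG a b

/-! ### Interpolation errors on a single element -/

section Cell

variable {w : ℝ × ℝ → ℝ} {x₀ x₁ y₀ y₁ : ℝ}

theorem differentiable_of_contDiff {f : ℝ × ℝ → ℝ} (hf : ContDiff ℝ ∞ f) : Differentiable ℝ f :=
  hf.differentiable (by simp)

/-- The `x`-derivative of the interpolation error is of third order on the vertical midline. -/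
theorem integral_abs_pd_zero_interp_error_le (hw : ContDiff ℝ ∞ w) (hx : x₀ < x₁) (hy : y₀ < y₁) :
    ∫ y in y₀..y₁, |pd 0 w ((x₀ + x₁) / 2, y) -
        ((y₁ - y) * (w (x₁, y₀) - w (x₀, y₀)) + (y - y₀) * (w (x₁, y₁) - w (x₀, y₁))) /
          ((x₁ - x₀) * (y₁ - y₀))|
      ≤ (x₁ - x₀) * boxInt (fun p => |pd 0 (pd 0 (pd 0 w)) p|) x₀ x₁ y₀ y₁ +
        (y₁ - y₀) ^ 2 / (x₁ - x₀) * boxInt (fun p => |pd 0 (pd 1 (pd 1 w)) p|) x₀ x₁ y₀ y₁ := by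
  have hx' : 0 < x₁ - x₀ := sub_pos.mpr hx
  have hy' : 0 < y₁ - y₀ := sub_pos.mpr hy
  have s0 := contDiff_pd hw 0
  have s1 := contDiff_pd hw 1
  have s00 := contDiff_pd s0 0
  have s11 := contDiff_pd s1 1
  have c000 : Continuous fun p => |pd 0 (pd 0 (pd 0 w)) p| := (contDiff_pd s00 0).continuous.abs
  have c011 : Continuous fun p => |pd 0 (pd 1 (pd 1 w)) p| := (contDiff_pd s11 0).continuous.abs
  rw [boxInt_eq_integral_integral' hx.le hy.le (integrableOn_box_of_continuous c000 _ _ _ _),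
    boxInt_eq_integral_integral' hx.le hy.le (integrableOn_box_of_continuous c011 _ _ _ _)]
  set M := ∫ y in y₀..y₁, ∫ x in x₀..x₁, |pd 0 (pd 1 (pd 1 w)) (x, y)| with hM
  have pt : ∀ y ∈ Set.Icc y₀ y₁, |pd 0 w ((x₀ + x₁) / 2, y) -
        ((y₁ - y) * (w (x₁, y₀) - w (x₀, y₀)) + (y - y₀) * (w (x₁, y₁) - w (x₀, y₁))) /
          ((x₁ - x₀) * (y₁ - y₀))|
      ≤ (x₁ - x₀) * (∫ x in x₀..x₁, |pd 0 (pd 0 (pd 0 w)) (x, y)|) +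
        (y₁ - y₀) / (x₁ - x₀) * M := by
    intro y hyy
    have h1 := abs_midpoint_deriv_sub_le hx.le
      (fun t => hasDerivAt_pd_zero (differentiable_of_contDiff hw) t y)
      (fun t => hasDerivAt_pd_zero (differentiable_of_contDiff s0) t y)
      (fun t => hasDerivAt_pd_zero (differentiable_of_contDiff s00) t y)
      ((contDiff_pd s00 0).continuous.comp (by fun_prop))
    have h2 := abs_linear_interp_sub_le (φ := fun y => w (x₁, y) - w (x₀, y))
      (φ' := fun y => pd 1 w (x₁, y) - pd 1 w (x₀, y))
      (φ'' := fun y => pd 1 (pd 1 w) (x₁, y) - pd 1 (pd 1 w) (x₀, y)) (a := y₀) (b := y₁) (y := y)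
      (fun t => (hasDerivAt_pd_one (differentiable_of_contDiff hw) _ t).sub
        (hasDerivAt_pd_one (differentiable_of_contDiff hw) _ t))
      (fun t => (hasDerivAt_pd_one (differentiable_of_contDiff s1) _ t).sub
        (hasDerivAt_pd_one (differentiable_of_contDiff s1) _ t))
      ((s11.continuous.comp (by fun_prop)).sub (s11.continuous.comp (by fun_prop))) hyy
    -- The values of `∂_y² w` on the two vertical sides differ by an integral of a third derivative
    -- across the element.
    have h3 : ∫ y in y₀..y₁, |pd 1 (pd 1 w) (x₁, y) - pd 1 (pd 1 w) (x₀, y)| ≤ M := by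
      refine intervalIntegral.integral_mono_on hy.le ?_
        ((continuous_integral_fst c011 _ _).intervalIntegrable _ _) fun t _ => ?_
      · exact ((s11.continuous.comp (by fun_prop)).sub
          (s11.continuous.comp (by fun_prop))).abs.intervalIntegrable _ _
      · exact abs_sub_le_integral_abs_deriv
          (fun s => hasDerivAt_pd_zero (differentiable_of_contDiff s11) s t)
          ((contDiff_pd s11 0).continuous.comp (by fun_prop))
          (Set.right_mem_Icc.mpr hx.le) (Set.left_mem_Icc.mpr hx.le)
    set I := ∫ x in x₀..x₁, |pd 0 (pd 0 (pd 0 w)) (x, y)|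
    set L := (y₁ - y) * (w (x₁, y₀) - w (x₀, y₀)) + (y - y₀) * (w (x₁, y₁) - w (x₀, y₁)) with hL
    -- Two errors: the midpoint formula for the `x`-derivative at height `y`, and linear
    -- interpolation in `y` of the difference between the two vertical sides.
    have e : pd 0 w ((x₀ + x₁) / 2, y) - L / ((x₁ - x₀) * (y₁ - y₀))
        = ((x₁ - x₀) * pd 0 w ((x₀ + x₁) / 2, y) - (w (x₁, y) - w (x₀, y))) / (x₁ - x₀) +
          ((y₁ - y₀) * (w (x₁, y) - w (x₀, y)) - L) / ((x₁ - x₀) * (y₁ - y₀)) := by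
      field_simp; ring
    rw [e]
    refine (abs_add_le _ _).trans (add_le_add ?_ ?_)
    · rw [abs_div, abs_of_pos hx', div_le_iff₀ hx']
      refine h1.trans (le_of_eq (by ring))
    · rw [abs_div, abs_of_pos (mul_pos hx' hy'), div_le_iff₀ (mul_pos hx' hy')]
      refine h2.trans ((mul_le_mul_of_nonneg_left h3 (by positivity)).trans (le_of_eq ?_))
      field_simp
  refine (intervalIntegral.integral_mono_on hy.le ?_ ?_ pt).trans (le_of_eq ?_)
  · refine Continuous.intervalIntegrable ?_ _ _
    exact ((s0.continuous.comp (by fun_prop)).sub (by fun_prop)).abs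
  · exact (((continuous_integral_fst c000 _ _).const_smul (x₁ - x₀)).add
      continuous_const).intervalIntegrable _ _
  · rw [intervalIntegral.integral_add, intervalIntegral.integral_const_mul]
    · simp; ring
    · exact ((continuous_integral_fst c000 _ _).const_smul (x₁ - x₀)).intervalIntegrable _ _
    · simp

/-- On the vertical midline, the increments of `w` and of its interpolant differ by a term of third
order. -/
theorem abs_midline_increment_sub_le (hw : ContDiff ℝ ∞ w) (hx : x₀ < x₁) (hy : y₀ < y₁) :
    |(w ((x₀ + x₁) / 2, y₁) - w ((x₀ + x₁) / 2, y₀)) -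
        ((w (x₀, y₁) - w (x₀, y₀)) + (w (x₁, y₁) - w (x₁, y₀))) / 2|
      ≤ (x₁ - x₀) * boxInt (fun p => |pd 0 (pd 0 (pd 1 w)) p|) x₀ x₁ y₀ y₁ := by
  have s1 := contDiff_pd hw 1
  have s01 := contDiff_pd s1 0
  have c001 : Continuous fun p => |pd 0 (pd 0 (pd 1 w)) p| := (contDiff_pd s01 0).continuous.abs
  rw [boxInt_eq_integral_integral' hx.le hy.le (integrableOn_box_of_continuous c001 _ _ _ _)]
  set m := (x₀ + x₁) / 2 with hm
  have ftc : ∀ x, w (x, y₁) - w (x, y₀) = ∫ y in y₀..y₁, pd 1 w (x, y) := fun x =>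
    (intervalIntegral.integral_eq_sub_of_hasDerivAt
      (fun t _ => hasDerivAt_pd_one (differentiable_of_contDiff hw) x t)
      ((s1.continuous.comp (by fun_prop)).intervalIntegrable _ _)).symm
  have ii : ∀ x, IntervalIntegrable (fun y => pd 1 w (x, y)) volume y₀ y₁ := fun x =>
    (s1.continuous.comp (by fun_prop)).intervalIntegrable _ _
  -- Written as an integral over `y`, the quantity is minus one half of the second difference in `x`
  -- of `∂_y w`, which is of second order in the width of the element.
  have e : (w (m, y₁) - w (m, y₀)) - ((w (x₀, y₁) - w (x₀, y₀)) + (w (x₁, y₁) - w (x₁, y₀))) / 2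
      = ∫ y in y₀..y₁, -(1 / 2) * (pd 1 w (x₁, y) + pd 1 w (x₀, y) - 2 * pd 1 w (m, y)) := by
    rw [intervalIntegral.integral_const_mul, intervalIntegral.integral_sub ((ii _).add (ii _))
      ((ii _).const_mul _), intervalIntegral.integral_add (ii _) (ii _),
      intervalIntegral.integral_const_mul, ftc, ftc, ftc]
    ring
  rw [e, ← intervalIntegral.integral_const_mul]
  refine (intervalIntegral.abs_integral_le_integral_abs hy.le).trans
    (intervalIntegral.integral_mono_on hy.le ?_ ?_ fun y _ => ?_)
  · refine Continuous.intervalIntegrable ?_ _ _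
    have := s1.continuous
    fun_prop
  · exact ((continuous_integral_fst c001 _ _).const_smul (x₁ - x₀)).intervalIntegrable _ _
  · have h := abs_second_difference_le hx.le
      (fun t => hasDerivAt_pd_zero (differentiable_of_contDiff s1) t y)
      (fun t => hasDerivAt_pd_zero (differentiable_of_contDiff s01) t y)
      ((contDiff_pd s01 0).continuous.comp (by fun_prop))
    rw [abs_mul]
    have h0 := abs_nonneg (pd 1 w (x₁, y) + pd 1 w (x₀, y) - 2 * pd 1 w (m, y))
    norm_num
    linarith

/-- The second difference of `w` in `y` varies slowly with `x`. -/
theorem abs_second_difference_sub_le (hw : ContDiff ℝ ∞ w) (hy : y₀ < y₁) {s t : ℝ} (hst : s ≤ t) :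
    |(w (t, y₁) + w (t, y₀) - 2 * w (t, (y₀ + y₁) / 2)) -
        (w (s, y₁) + w (s, y₀) - 2 * w (s, (y₀ + y₁) / 2))|
      ≤ (y₁ - y₀) * boxInt (fun p => |pd 0 (pd 1 (pd 1 w)) p|) s t y₀ y₁ := by
  have s0 := contDiff_pd hw 0
  have s10 := contDiff_pd s0 1
  have s1 := contDiff_pd hw 1
  have s11 := contDiff_pd s1 1
  have c011 : Continuous fun p => |pd 0 (pd 1 (pd 1 w)) p| := (contDiff_pd s11 0).continuous.abs
  have e011 : pd 1 (pd 1 (pd 0 w)) = pd 0 (pd 1 (pd 1 w)) := by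
    rw [pd_comm hw 1 0, pd_comm s1 1 0]
  rw [boxInt_eq_integral_integral hst hy.le (integrableOn_box_of_continuous c011 _ _ _ _),
    ← intervalIntegral.integral_const_mul]
  set m := (y₀ + y₁) / 2 with hm
  have c0 := s0.continuous
  -- The variation in `x` is the integral of the second difference in `y` of `∂_x w`.
  rw [← intervalIntegral.integral_eq_sub_of_hasDerivAt
    (f := fun x => w (x, y₁) + w (x, y₀) - 2 * w (x, m))
    (f' := fun x => pd 0 w (x, y₁) + pd 0 w (x, y₀) - 2 * pd 0 w (x, m))
    (fun x _ => ((hasDerivAt_pd_zero (differentiable_of_contDiff hw) x _).add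
      (hasDerivAt_pd_zero (differentiable_of_contDiff hw) x _)).sub
      ((hasDerivAt_pd_zero (differentiable_of_contDiff hw) x _).const_mul 2))
    (Continuous.intervalIntegrable (by fun_prop) _ _)]
  refine (intervalIntegral.abs_integral_le_integral_abs hst).trans
    (intervalIntegral.integral_mono_on hst ?_ ?_ fun x _ => ?_)
  · exact Continuous.intervalIntegrable (by fun_prop) _ _
  · exact ((continuous_integral_snd c011 _ _).const_smul (y₁ - y₀)).intervalIntegrable _ _
  · have h := abs_second_difference_le hy.le
      (fun t => hasDerivAt_pd_one (differentiable_of_contDiff s0) x t)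
      (fun t => hasDerivAt_pd_one (differentiable_of_contDiff s10) x t)
      ((contDiff_pd s10 1).continuous.comp (by fun_prop))
    rwa [e011] at h

theorem abs_second_difference_midline_le (hw : ContDiff ℝ ∞ w) (hy : y₀ < y₁) (x : ℝ) :
    |w (x, y₁) + w (x, y₀) - 2 * w (x, (y₀ + y₁) / 2)|
      ≤ (y₁ - y₀) * ∫ y in y₀..y₁, |pd 1 (pd 1 w) (x, y)| :=
  abs_second_difference_le hy.le
    (fun t => hasDerivAt_pd_one (differentiable_of_contDiff hw) x t)
    (fun t => hasDerivAt_pd_one (differentiable_of_contDiff (contDiff_pd hw 1)) x t)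
    ((contDiff_pd (contDiff_pd hw 1) 1).continuous.comp (by fun_prop))

/-- A trace inequality. -/
theorem mul_integral_abs_le {g : ℝ × ℝ → ℝ} (hg : ContDiff ℝ ∞ g) (hy : y₀ ≤ y₁) {x : ℝ}
    (hx : x ∈ Set.Icc x₀ x₁) :
    (x₁ - x₀) * ∫ y in y₀..y₁, |g (x, y)| ≤
      boxInt (fun p => |g p|) x₀ x₁ y₀ y₁ + (x₁ - x₀) * boxInt (fun p => |pd 0 g p|) x₀ x₁ y₀ y₁ := by
  have hxx := hx.1.trans hx.2
  have c := hg.continuous.abs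
  have c0 := (contDiff_pd hg 0).continuous.abs
  rw [boxInt_eq_integral_integral' hxx hy (integrableOn_box_of_continuous c _ _ _ _),
    boxInt_eq_integral_integral' hxx hy (integrableOn_box_of_continuous c0 _ _ _ _),
    ← intervalIntegral.integral_const_mul, ← intervalIntegral.integral_const_mul,
    ← intervalIntegral.integral_add]
  · refine intervalIntegral.integral_mono_on hy ?_ ?_ fun y _ => ?_
    · exact Continuous.intervalIntegrable (by fun_prop) _ _
    · exact ((continuous_integral_fst c _ _).add
        ((continuous_integral_fst c0 _ _).const_smul (x₁ - x₀))).intervalIntegrable _ _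
    · exact mul_abs_le_integral_add
        (fun t => hasDerivAt_pd_zero (differentiable_of_contDiff hg) t y)
        ((contDiff_pd hg 0).continuous.comp (by fun_prop)) hx
  · exact (continuous_integral_fst c _ _).intervalIntegrable _ _
  · exact ((continuous_integral_fst c0 _ _).const_smul (x₁ - x₀)).intervalIntegrable _ _

/-- The `y`-derivative of the interpolation error on the vertical midline. -/
theorem integral_abs_pd_one_interp_error_le (hw : ContDiff ℝ ∞ w) (hx : x₀ < x₁) (hy : y₀ < y₁) :
    ∫ y in y₀..y₁, |pd 1 w ((x₀ + x₁) / 2, y) -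
        ((w (x₀, y₁) - w (x₀, y₀)) + (w (x₁, y₁) - w (x₁, y₀))) / (2 * (y₁ - y₀))|
      ≤ (y₁ - y₀) * (∫ y in y₀..y₁, |pd 1 (pd 1 w) ((x₀ + x₁) / 2, y)|) +
        (x₁ - x₀) * boxInt (fun p => |pd 0 (pd 0 (pd 1 w)) p|) x₀ x₁ y₀ y₁ := by
  have hy' : 0 < y₁ - y₀ := sub_pos.mpr hy
  have h1 := abs_midline_increment_sub_le hw hx hy
  set m := (x₀ + x₁) / 2 with hm
  set I := boxInt (fun p => |pd 0 (pd 0 (pd 1 w)) p|) x₀ x₁ y₀ y₁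
  set J := ∫ y in y₀..y₁, |pd 1 (pd 1 w) (m, y)|
  have s1 := contDiff_pd hw 1
  have c1 := s1.continuous
  have pt : ∀ y ∈ Set.Icc y₀ y₁, |pd 1 w (m, y) -
        ((w (x₀, y₁) - w (x₀, y₀)) + (w (x₁, y₁) - w (x₁, y₀))) / (2 * (y₁ - y₀))|
        ≤ J + (x₁ - x₀) * I / (y₁ - y₀) := fun y hyy => by
    -- At `ξ` the derivative equals the slope of `w` along the midline. Moving from `y` to `ξ` costs
    -- an integral of `∂_y² w`, and the slope of the interpolant differs from that of `w` by a third
    -- order term.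
    obtain ⟨ξ, hξ, h2⟩ := exists_eq_mul_deriv hy.le
      (fun t => hasDerivAt_pd_one (differentiable_of_contDiff hw) m t)
    have h3 := abs_sub_le_integral_abs_deriv
      (fun t => hasDerivAt_pd_one (differentiable_of_contDiff s1) m t)
      ((contDiff_pd s1 1).continuous.comp (by fun_prop)) hyy hξ
    rw [h2] at h1
    have e : pd 1 w (m, y) -
        ((w (x₀, y₁) - w (x₀, y₀)) + (w (x₁, y₁) - w (x₁, y₀))) / (2 * (y₁ - y₀))
        = (pd 1 w (m, y) - pd 1 w (m, ξ)) + ((y₁ - y₀) * pd 1 w (m, ξ) -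
          ((w (x₀, y₁) - w (x₀, y₀)) + (w (x₁, y₁) - w (x₁, y₀))) / 2) / (y₁ - y₀) := by
      field_simp; ring
    rw [e]
    refine (abs_add_le _ _).trans (add_le_add h3 ?_)
    rw [abs_div, abs_of_pos hy']
    gcongr
  refine (intervalIntegral.integral_mono_on hy.le
    (Continuous.intervalIntegrable (by fun_prop) _ _) (by simp) pt).trans (le_of_eq ?_)
  simp
  field_simp

/-- The interpolation error on an element is of second order in the mean. -/
theorem boxInt_abs_interp_error_le (hw : ContDiff ℝ ∞ w) (hx : x₀ < x₁) (hy : y₀ < y₁) :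
    boxInt (fun p => |(x₁ - x₀) * (y₁ - y₀) * w p -
        ((x₁ - p.1) * ((y₁ - p.2) * w (x₀, y₀) + (p.2 - y₀) * w (x₀, y₁)) +
          (p.1 - x₀) * ((y₁ - p.2) * w (x₁, y₀) + (p.2 - y₀) * w (x₁, y₁)))|) x₀ x₁ y₀ y₁
      ≤ (x₁ - x₀) * (y₁ - y₀) * ((x₁ - x₀) ^ 2 * boxInt (fun p => |pd 0 (pd 0 w) p|) x₀ x₁ y₀ y₁ +
        (y₁ - y₀) ^ 2 * (boxInt (fun p => |pd 1 (pd 1 w) p|) x₀ x₁ y₀ y₁ +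
          (x₁ - x₀) * boxInt (fun p => |pd 0 (pd 1 (pd 1 w)) p|) x₀ x₁ y₀ y₁)) := by
  have hx' : 0 < x₁ - x₀ := sub_pos.mpr hx
  have hy' : 0 < y₁ - y₀ := sub_pos.mpr hy
  have s0 := contDiff_pd hw 0
  have s1 := contDiff_pd hw 1
  have s00 := contDiff_pd s0 0
  have s11 := contDiff_pd s1 1
  have c00 : Continuous fun p => |pd 0 (pd 0 w) p| := s00.continuous.abs
  have t0 := mul_integral_abs_le s11 hy.le (Set.left_mem_Icc.mpr hx.le)
  have t1 := mul_integral_abs_le s11 hy.le (Set.right_mem_Icc.mpr hx.le)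
  rw [boxInt_eq_integral_integral' hx.le hy.le (integrableOn_box_of_continuous c00 _ _ _ _)]
  set N := boxInt (fun p => |pd 1 (pd 1 w) p|) x₀ x₁ y₀ y₁ +
          (x₁ - x₀) * boxInt (fun p => |pd 0 (pd 1 (pd 1 w)) p|) x₀ x₁ y₀ y₁
  have cw := hw.continuous
  rw [boxInt_eq_integral_integral' hx.le hy.le
    (integrableOn_box_of_continuous (by fun_prop) _ _ _ _)]
  have pt : ∀ y ∈ Set.Icc y₀ y₁, ∀ x ∈ Set.Icc x₀ x₁,
      |(x₁ - x₀) * (y₁ - y₀) * w (x, y) -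
        ((x₁ - x) * ((y₁ - y) * w (x₀, y₀) + (y - y₀) * w (x₀, y₁)) +
          (x - x₀) * ((y₁ - y) * w (x₁, y₀) + (y - y₀) * w (x₁, y₁)))| ≤
      (y₁ - y₀) * (x₁ - x₀) ^ 2 * (∫ x in x₀..x₁, |pd 0 (pd 0 w) (x, y)|) +
        (y₁ - y₀) ^ 2 * N := fun y hyy x hxx => by
    have h1 := abs_linear_interp_sub_le
      (fun t => hasDerivAt_pd_zero (differentiable_of_contDiff hw) t y)
      (fun t => hasDerivAt_pd_zero (differentiable_of_contDiff s0) t y)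
      (s00.continuous.comp (by fun_prop)) hxx
    have h2 : ∀ z, _ := fun z => abs_linear_interp_sub_le
      (fun t => hasDerivAt_pd_one (differentiable_of_contDiff hw) z t)
      (fun t => hasDerivAt_pd_one (differentiable_of_contDiff s1) z t)
      (s11.continuous.comp (by fun_prop)) hyy
    have h3 := h2 x₀
    have h4 := h2 x₁
    -- Interpolate first in `x` along the horizontal line through the point, then in `y` along the
    -- two vertical sides. The line integrals on the sides are controlled by the trace inequalities
    -- `t0` and `t1`.
    have e : (x₁ - x₀) * (y₁ - y₀) * w (x, y) -
        ((x₁ - x) * ((y₁ - y) * w (x₀, y₀) + (y - y₀) * w (x₀, y₁)) +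
          (x - x₀) * ((y₁ - y) * w (x₁, y₀) + (y - y₀) * w (x₁, y₁)))
        = (y₁ - y₀) * ((x₁ - x₀) * w (x, y) - ((x₁ - x) * w (x₀, y) + (x - x₀) * w (x₁, y))) +
          ((x₁ - x) * ((y₁ - y₀) * w (x₀, y) - ((y₁ - y) * w (x₀, y₀) + (y - y₀) * w (x₀, y₁))) +
          (x - x₀) * ((y₁ - y₀) * w (x₁, y) -
            ((y₁ - y) * w (x₁, y₀) + (y - y₀) * w (x₁, y₁)))) := by
      ring
    have hl : 0 ≤ x₁ - x := sub_nonneg.mpr hxx.2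
    have hr : 0 ≤ x - x₀ := sub_nonneg.mpr hxx.1
    rw [e]
    refine (abs_add_le _ _).trans (add_le_add ?_ ((abs_add_le _ _).trans ?_))
    · rw [abs_mul, abs_of_pos hy', mul_assoc]
      gcongr
    · rw [abs_mul, abs_mul, abs_of_nonneg hl, abs_of_nonneg hr]
      -- The weights `x₁ - x` and `x - x₀` of the two sides add up to the width.
      have hN : (y₁ - y₀) ^ 2 * N = ((x₁ - x) * ((y₁ - y₀) ^ 2 * (N / (x₁ - x₀)))) +
          (x - x₀) * ((y₁ - y₀) ^ 2 * (N / (x₁ - x₀))) := by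
        field_simp; ring
      rw [hN]
      gcongr
      · refine h3.trans ?_
        gcongr
        rw [le_div_iff₀ hx']; linarith
      · refine h4.trans ?_
        gcongr
        rw [le_div_iff₀ hx']; linarith
  have step : ∀ y ∈ Set.Icc y₀ y₁, (∫ x in x₀..x₁, |(x₁ - x₀) * (y₁ - y₀) * w (x, y) -
        ((x₁ - x) * ((y₁ - y) * w (x₀, y₀) + (y - y₀) * w (x₀, y₁)) +
          (x - x₀) * ((y₁ - y) * w (x₁, y₀) + (y - y₀) * w (x₁, y₁)))|) ≤
      (x₁ - x₀) * ((y₁ - y₀) * (x₁ - x₀) ^ 2 * (∫ x in x₀..x₁, |pd 0 (pd 0 w) (x, y)|) +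
        (y₁ - y₀) ^ 2 * N) := fun y hyy => by
    refine (intervalIntegral.integral_mono_on hx.le
      (Continuous.intervalIntegrable (by fun_prop) _ _) (by simp) (pt y hyy)).trans (le_of_eq ?_)
    simp
    ring
  refine (intervalIntegral.integral_mono_on hy.le ?_ ?_ step).trans (le_of_eq ?_)
  · exact (continuous_integral_fst (G := fun p => |(x₁ - x₀) * (y₁ - y₀) * w p -
        ((x₁ - p.1) * ((y₁ - p.2) * w (x₀, y₀) + (p.2 - y₀) * w (x₀, y₁)) +
          (p.1 - x₀) * ((y₁ - p.2) * w (x₁, y₀) + (p.2 - y₀) * w (x₁, y₁)))|)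
      (by fun_prop) _ _).intervalIntegrable _ _
  · have := continuous_integral_fst c00 x₀ x₁
    exact Continuous.intervalIntegrable (by fun_prop) _ _
  · have := continuous_integral_fst c00 x₀ x₁
    rw [intervalIntegral.integral_const_mul, intervalIntegral.integral_add
      (Continuous.intervalIntegrable (by fun_prop) _ _) (by simp),
      intervalIntegral.integral_const_mul]
    simp
    ring

end Cell

end FVE

namespace FVE

/-! ### Decomposition of rectangles -/

/-- The edges are null sets. Half-open boxes are the convenient form for tilings, since adjacent
ones are disjoint. -/
theorem boxInt_eq_Ioc (G : ℝ × ℝ → ℝ) (a b c d : ℝ) :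
    boxInt G a b c d = ∫ p in Set.Ioc a b ×ˢ Set.Ioc c d, G p := by
  refine setIntegral_congr_set ?_
  rw [Measure.volume_eq_prod]
  exact (Measure.set_prod_ae_eq Ioc_ae_eq_Icc Ioc_ae_eq_Icc).symm

theorem boxInt_eq_Ioo (G : ℝ × ℝ → ℝ) (a b c d : ℝ) :
    boxInt G a b c d = ∫ p in Set.Ioo a b ×ˢ Set.Ioo c d, G p := by
  refine setIntegral_congr_set ?_
  rw [Measure.volume_eq_prod]
  exact (Measure.set_prod_ae_eq Ioo_ae_eq_Icc Ioo_ae_eq_Icc).symm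

theorem boxInt_add_adjacent {G : ℝ × ℝ → ℝ} {a b e c d : ℝ} (hab : a ≤ b) (hbe : b ≤ e)
    (hG : IntegrableOn G (Set.Icc a e ×ˢ Set.Icc c d)) :
    boxInt G a b c d + boxInt G b e c d = boxInt G a e c d := by
  rw [boxInt_eq_Ioc, boxInt_eq_Ioc, boxInt_eq_Ioc, ← Set.Ioc_union_Ioc_eq_Ioc hab hbe,
    Set.union_prod, setIntegral_union]
  · exact Set.disjoint_prod.mpr (Or.inl (Set.Ioc_disjoint_Ioc_of_le le_rfl))
  · exact measurableSet_Ioc.prod measurableSet_Ioc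
  · exact hG.mono_set (Set.prod_mono (Set.Ioc_subset_Icc_self.trans (Set.Icc_subset_Icc_right hbe))
      Set.Ioc_subset_Icc_self)
  · exact hG.mono_set (Set.prod_mono (Set.Ioc_subset_Icc_self.trans (Set.Icc_subset_Icc_left hab))
      Set.Ioc_subset_Icc_self)

theorem le_of_forall_step {z : ℕ → ℝ} {n : ℕ} (hz : ∀ i < n, z i ≤ z (i + 1)) {i j : ℕ}
    (hij : i ≤ j) (hj : j ≤ n) : z i ≤ z j := by
  induction j, hij using Nat.le_induction with
  | base => exact le_rfl
  | succ k hk ih => exact (ih (by omega)).trans (hz k (by omega))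

theorem sum_boxInt_fst {G : ℝ × ℝ → ℝ} {z : ℕ → ℝ} {n : ℕ} {c d : ℝ}
    (hz : ∀ i < n, z i ≤ z (i + 1)) (hG : IntegrableOn G (Set.Icc (z 0) (z n) ×ˢ Set.Icc c d)) :
    ∑ i ∈ Finset.range n, boxInt G (z i) (z (i + 1)) c d = boxInt G (z 0) (z n) c d := by
  induction n with
  | zero => rw [boxInt_eq_Ioc]; simp
  | succ n ih =>
    have h1 : z 0 ≤ z n := le_of_forall_step hz (Nat.zero_le n) (by omega)
    have h2 : z n ≤ z (n + 1) := hz n (by omega)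
    rw [Finset.sum_range_succ, ih (fun i hi => hz i (by omega))
      (hG.mono_set (Set.prod_mono (Set.Icc_subset_Icc_right h2) subset_rfl)),
      boxInt_add_adjacent h1 h2 hG]

theorem integrableOn_comp_swap {G : ℝ × ℝ → ℝ} {s t : Set ℝ} (hG : IntegrableOn G (s ×ˢ t)) :
    IntegrableOn (G ∘ Prod.swap) (t ×ˢ s) := by
  rw [Measure.volume_eq_prod] at hG ⊢
  exact hG.swap

theorem sum_boxInt {G : ℝ × ℝ → ℝ} {z s : ℕ → ℝ} {n m : ℕ}
    (hz : ∀ i < n, z i ≤ z (i + 1)) (hs : ∀ j < m, s j ≤ s (j + 1))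
    (hG : IntegrableOn G (Set.Icc (z 0) (z n) ×ˢ Set.Icc (s 0) (s m))) :
    ∑ i ∈ Finset.range n, ∑ j ∈ Finset.range m, boxInt G (z i) (z (i + 1)) (s j) (s (j + 1))
      = boxInt G (z 0) (z n) (s 0) (s m) := by
  rw [← sum_boxInt_fst hz hG]
  refine Finset.sum_congr rfl fun i hi => ?_
  have hi := Finset.mem_range.mp hi
  rw [← boxInt_comp_swap G (z i), ← sum_boxInt_fst hs]
  · simp_rw [← boxInt_comp_swap G (z i)]
  · refine integrableOn_comp_swap (hG.mono_set (Set.prod_mono (Set.Icc_subset_Icc ?_ ?_) subset_rfl))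
    · exact le_of_forall_step hz (Nat.zero_le i) hi.le
    · exact le_of_forall_step hz hi le_rfl

theorem boxInt_mono_set {G : ℝ × ℝ → ℝ} {a b c d a' b' c' d' : ℝ} (hG0 : ∀ p, 0 ≤ G p)
    (hG : IntegrableOn G (Set.Icc a b ×ˢ Set.Icc c d)) (ha : a ≤ a') (hb : b' ≤ b) (hc : c ≤ c')
    (hd : d' ≤ d) : boxInt G a' b' c' d' ≤ boxInt G a b c d :=
  setIntegral_mono_set hG (Filter.Eventually.of_forall hG0)
    (Set.prod_mono (Set.Icc_subset_Icc ha hb) (Set.Icc_subset_Icc hc hd)).eventuallyLE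

/-! ### Nodal functions -/

/-- A family of grid lines that is regular with constant `γ` and of mesh size at most `h`. -/
structure IsGrid (n m : ℕ) (x y : ℕ → ℝ) (γ h : ℝ) : Prop where
  x_lt : ∀ i < n, x i < x (i + 1)
  y_lt : ∀ j < m, y j < y (j + 1)
  x_le : ∀ i < n, x (i + 1) - x i ≤ h
  y_le : ∀ j < m, y (j + 1) - y j ≤ h
  x_ratio : ∀ i < n, ∀ j < m, x (i + 1) - x i ≤ γ * (y (j + 1) - y j)
  y_ratio : ∀ i < n, ∀ j < m, y (j + 1) - y j ≤ γ * (x (i + 1) - x i)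

theorem IsGrid.swap {n m : ℕ} {x y : ℕ → ℝ} {γ h : ℝ} (H : IsGrid n m x y γ h) :
    IsGrid m n y x γ h :=
  ⟨H.y_lt, H.x_lt, H.y_le, H.x_le, fun i hi j hj => H.y_ratio j hj i hi,
    fun i hi j hj => H.x_ratio j hj i hi⟩

/-- The increment of a nodal function in the first direction. -/
def dX (V : ℕ → ℕ → ℝ) (i j : ℕ) : ℝ := V (i + 1) j - V i j

/-- The increment of a nodal function in the second direction. -/
def dY (V : ℕ → ℕ → ℝ) (i j : ℕ) : ℝ := V i (j + 1) - V i j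

/-- The sum of the squares of the increments along the edges of an element. -/
def cellSq (V : ℕ → ℕ → ℝ) (i j : ℕ) : ℝ :=
  dX V i j ^ 2 + dX V i (j + 1) ^ 2 + dY V i j ^ 2 + dY V (i + 1) j ^ 2

/-- The discrete energy of a nodal function. -/
noncomputable def nodalEnergy (n m : ℕ) (V : ℕ → ℕ → ℝ) : ℝ :=
  ∑ i ∈ Finset.range n, ∑ j ∈ Finset.range m, cellSq V i j

/-- The nodal function with exchanged coordinates. -/
def flipNodal (V : ℕ → ℕ → ℝ) (j i : ℕ) : ℝ := V i j

theorem cellSq_flip (V : ℕ → ℕ → ℝ) (i j : ℕ) : cellSq (flipNodal V) j i = cellSq V i j := by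
  simp only [cellSq, dX, dY, flipNodal]; ring

theorem nodalEnergy_flip (n m : ℕ) (V : ℕ → ℕ → ℝ) :
    nodalEnergy m n (flipNodal V) = nodalEnergy n m V := by
  rw [nodalEnergy, nodalEnergy, Finset.sum_comm]
  simp_rw [cellSq_flip]

theorem cellSq_nonneg (V : ℕ → ℕ → ℝ) (i j : ℕ) : 0 ≤ cellSq V i j := by
  unfold cellSq; positivity

theorem nodalEnergy_nonneg (n m : ℕ) (V : ℕ → ℕ → ℝ) : 0 ≤ nodalEnergy n m V :=
  Finset.sum_nonneg fun _ _ => Finset.sum_nonneg fun _ _ => cellSq_nonneg _ _ _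

theorem abs_dX_le (V : ℕ → ℕ → ℝ) (i j : ℕ) : |dX V i j| ≤ √(cellSq V i j) :=
  Real.abs_le_sqrt (by
    unfold cellSq
    linarith [sq_nonneg (dX V i (j + 1)), sq_nonneg (dY V i j),
      sq_nonneg (dY V (i + 1) j)])

theorem abs_dX_succ_le (V : ℕ → ℕ → ℝ) (i j : ℕ) : |dX V i (j + 1)| ≤ √(cellSq V i j) :=
  Real.abs_le_sqrt (by
    unfold cellSq
    linarith [sq_nonneg (dX V i j), sq_nonneg (dY V i j),
      sq_nonneg (dY V (i + 1) j)])

theorem abs_dY_le (V : ℕ → ℕ → ℝ) (i j : ℕ) : |dY V i j| ≤ √(cellSq V i j) :=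
  Real.abs_le_sqrt (by
    unfold cellSq
    linarith [sq_nonneg (dX V i j), sq_nonneg (dX V i (j + 1)),
      sq_nonneg (dY V (i + 1) j)])

theorem abs_dY_succ_le (V : ℕ → ℕ → ℝ) (i j : ℕ) : |dY V (i + 1) j| ≤ √(cellSq V i j) :=
  Real.abs_le_sqrt (by
    unfold cellSq
    linarith [sq_nonneg (dX V i j), sq_nonneg (dX V i (j + 1)),
      sq_nonneg (dY V i j)])

/-! ### The third order Sobolev energy of a smooth function -/

/-- The square of the `H³` norm of a smooth function over a rectangle. -/
noncomputable def sobEnergy (w : ℝ × ℝ → ℝ) (a b c d : ℝ) : ℝ :=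
  ∑ k ∈ Finset.range 4, ∑ α ∈ Finset.HasAntidiagonal.antidiagonal k,
    boxInt (fun p => pdMulti α w p ^ 2) a b c d

theorem sobEnergy_nonneg (w : ℝ × ℝ → ℝ) (a b c d : ℝ) : 0 ≤ sobEnergy w a b c d :=
  Finset.sum_nonneg fun _ _ => Finset.sum_nonneg fun _ _ =>
    boxInt_nonneg (fun _ => sq_nonneg _) _ _ _ _

theorem boxInt_sq_le_sobEnergy (w : ℝ × ℝ → ℝ) (a b c d : ℝ) {α : ℕ × ℕ} (hα : α.1 + α.2 ≤ 3) :
    boxInt (fun p => pdMulti α w p ^ 2) a b c d ≤ sobEnergy w a b c d := by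
  have h1 : ∑ β ∈ Finset.HasAntidiagonal.antidiagonal (α.1 + α.2),
      boxInt (fun p => pdMulti β w p ^ 2) a b c d ≤ sobEnergy w a b c d :=
    Finset.single_le_sum (f := fun k => ∑ β ∈ Finset.HasAntidiagonal.antidiagonal k,
      boxInt (fun p => pdMulti β w p ^ 2) a b c d) (fun _ _ => Finset.sum_nonneg fun _ _ =>
        boxInt_nonneg (fun _ => sq_nonneg _) _ _ _ _) (Finset.mem_range.mpr (by omega))
  refine le_trans ?_ h1
  exact Finset.single_le_sum (f := fun β : ℕ × ℕ => boxInt (fun p => pdMulti β w p ^ 2) a b c d)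
    (fun _ _ => boxInt_nonneg (fun _ => sq_nonneg _) _ _ _ _) (by simp)

theorem boxInt_abs_le_sobEnergy {w : ℝ × ℝ → ℝ} (hw : ContDiff ℝ ∞ w) {a b c d : ℝ} (hab : a ≤ b)
    (hcd : c ≤ d) (α : ℕ × ℕ) (hα : α.1 + α.2 ≤ 3) :
    boxInt (fun p => |pdMulti α w p|) a b c d
      ≤ √((b - a) * (d - c)) * √(sobEnergy w a b c d) := by
  refine (boxInt_abs_le_sqrt hab hcd (contDiff_pdMulti hw α).continuous).trans ?_
  gcongr
  exact boxInt_sq_le_sobEnergy w a b c d hα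

theorem sobEnergy_comp_swap {w : ℝ × ℝ → ℝ} (hw : ContDiff ℝ ∞ w) (a b c d : ℝ) :
    sobEnergy (w ∘ Prod.swap) c d a b = sobEnergy w a b c d := by
  unfold sobEnergy
  refine Finset.sum_congr rfl fun k _ => ?_
  rw [← Finset.Nat.sum_antidiagonal_swap]
  refine Finset.sum_congr rfl fun α _ => ?_
  rw [← boxInt_comp_swap]
  congr 1
  funext p
  rw [pdMulti_comp_swap hw]
  simp

theorem sum_sobEnergy {w : ℝ × ℝ → ℝ} (hw : ContDiff ℝ ∞ w) {x y : ℕ → ℝ} {n m : ℕ}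
    (hx : ∀ i < n, x i ≤ x (i + 1)) (hy : ∀ j < m, y j ≤ y (j + 1)) :
    ∑ i ∈ Finset.range n, ∑ j ∈ Finset.range m, sobEnergy w (x i) (x (i + 1)) (y j) (y (j + 1))
      = sobEnergy w (x 0) (x n) (y 0) (y m) := by
  unfold sobEnergy
  simp_rw [Finset.sum_comm (s := Finset.range m)]
  rw [Finset.sum_comm]
  refine Finset.sum_congr rfl fun k _ => ?_
  rw [Finset.sum_comm]
  refine Finset.sum_congr rfl fun α _ => ?_
  exact sum_boxInt hx hy (integrableOn_box_of_continuous
    ((contDiff_pdMulti hw α).continuous.pow 2) _ _ _ _)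

theorem sum_sqrt_mul_sqrt_le {n m : ℕ} {f g : ℕ → ℕ → ℝ} (hf : ∀ i j, 0 ≤ f i j)
    (hg : ∀ i j, 0 ≤ g i j) :
    ∑ i ∈ Finset.range n, ∑ j ∈ Finset.range m, √(f i j) * √(g i j)
      ≤ √(∑ i ∈ Finset.range n, ∑ j ∈ Finset.range m, f i j) *
        √(∑ i ∈ Finset.range n, ∑ j ∈ Finset.range m, g i j) := by
  simp_rw [← Finset.sum_product']
  exact Real.sum_sqrt_mul_sqrt_le _ (fun q => hf q.1 q.2) (fun q => hg q.1 q.2)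

end FVE

namespace FVE

/-! ### Fluxes through the vertical midlines of the elements -/

/-- The abscissa of the centre of an element. -/
noncomputable def midpt (x : ℕ → ℝ) (i : ℕ) : ℝ := (x i + x (i + 1)) / 2

/-- The `x`-derivative, on the vertical midline, of the bilinear function with nodal values `W`. -/
noncomputable def bilinX (x y : ℕ → ℝ) (W : ℕ → ℕ → ℝ) (i j : ℕ) (t : ℝ) : ℝ :=
  ((y (j + 1) - t) * dX W i j + (t - y j) * dX W i (j + 1)) /
    ((x (i + 1) - x i) * (y (j + 1) - y j))

/-- The `y`-derivative, on the vertical midline, of the bilinear function with nodal values `W`. -/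
noncomputable def bilinY (y : ℕ → ℝ) (W : ℕ → ℕ → ℝ) (i j : ℕ) : ℝ :=
  (dY W i j + dY W (i + 1) j) / (2 * (y (j + 1) - y j))

/-- The sum of the fluxes through the halves of the vertical midlines, tested with the increments
of `V` across them. -/
noncomputable def vform (n m : ℕ) (y : ℕ → ℝ) (F : ℕ → ℕ → ℝ → ℝ) (V : ℕ → ℕ → ℝ) : ℝ :=
  ∑ i ∈ Finset.range n, ∑ j ∈ Finset.range m,
    ((∫ t in y j..midpt y j, F i j t) * dX V i j +
      (∫ t in midpt y j..y (j + 1), F i j t) * dX V i (j + 1))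

theorem vform_sub {n m : ℕ} {y : ℕ → ℝ} {F G : ℕ → ℕ → ℝ → ℝ} {V : ℕ → ℕ → ℝ}
    (hF : ∀ i j, Continuous (F i j)) (hG : ∀ i j, Continuous (G i j)) :
    vform n m y F V - vform n m y G V = vform n m y (fun i j t => F i j t - G i j t) V := by
  unfold vform
  simp_rw [← Finset.sum_sub_distrib]
  refine Finset.sum_congr rfl fun i _ => Finset.sum_congr rfl fun j _ => ?_
  rw [intervalIntegral.integral_sub ((hF i j).intervalIntegrable _ _)
    ((hG i j).intervalIntegrable _ _), intervalIntegral.integral_sub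
    ((hF i j).intervalIntegrable _ _) ((hG i j).intervalIntegrable _ _)]
  ring

theorem left_mem_midpt {c d : ℝ} (h : c < d) : c ≤ (c + d) / 2 ∧ (c + d) / 2 ≤ d :=
  ⟨by linarith, by linarith⟩

theorem abs_integral_mul_le {α f : ℝ → ℝ} {c d c' d' K : ℝ} (hc : c ≤ c') (hcd : c' ≤ d')
    (hd : d' ≤ d) (hα : Continuous α) (hf : Continuous f) (hK : ∀ t ∈ Set.Icc c d, |α t| ≤ K) :
    |∫ t in c'..d', α t * f t| ≤ K * ∫ t in c..d, |f t| := by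
  have hK0 : 0 ≤ K := (abs_nonneg _).trans (hK c ⟨le_rfl, hc.trans (hcd.trans hd)⟩)
  have h1 : |∫ t in c'..d', α t * f t| ≤ K * ∫ t in c'..d', |f t| := by
    rw [← intervalIntegral.integral_const_mul]
    refine (intervalIntegral.abs_integral_le_integral_abs hcd).trans
      (intervalIntegral.integral_mono_on hcd ?_ ?_ fun t ht => ?_)
    · exact Continuous.intervalIntegrable (by fun_prop) _ _
    · exact Continuous.intervalIntegrable (by fun_prop) _ _
    · rw [abs_mul]
      exact mul_le_mul_of_nonneg_right (hK t ⟨hc.trans ht.1, ht.2.trans hd⟩) (abs_nonneg _)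
  refine h1.trans (mul_le_mul_of_nonneg_left ?_ hK0)
  exact intervalIntegral.integral_mono_interval hc hcd hd
    (Filter.Eventually.of_forall fun _ => abs_nonneg _) (hf.abs.intervalIntegrable _ _)

theorem abs_mul_add_mul_le {A B U p q : ℝ} (hA : |A| ≤ U) (hB : |B| ≤ U) :
    |A * p + B * q| ≤ U * (|p| + |q|) := by
  refine (abs_add_le _ _).trans ?_
  rw [abs_mul, abs_mul, mul_add]
  gcongr

/-- Freeze `β` at the centre. If `I` and `J` are the integrals of `ey` over the two halves, then `I
p + J q = (I + J) (p + q) / 2 + (J - I) (q - p) / 2`. The sum `I + J` is small by `hT`. The part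
with `J - I` is not small on a single element and is subtracted here, to be treated later by
summation by parts over neighbouring elements. -/
theorem abs_half_fluxes_sub_le {α β ex ey : ℝ → ℝ} {c d M K T p q : ℝ} (hcd : c < d)
    (hα : Continuous α) (hβ : Continuous β) (hex : Continuous ex) (hey : Continuous ey)
    (hαM : ∀ t ∈ Set.Icc c d, |α t| ≤ M) (hβM : |β ((c + d) / 2)| ≤ M)
    (hβK : ∀ t ∈ Set.Icc c d, |β t - β ((c + d) / 2)| ≤ K) (hT : |∫ t in c..d, ey t| ≤ T) :
    |(∫ t in c..(c + d) / 2, α t * ex t + β t * ey t) * p +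
        (∫ t in (c + d) / 2..d, α t * ex t + β t * ey t) * q -
        β ((c + d) / 2) * ((∫ t in (c + d) / 2..d, ey t) - ∫ t in c..(c + d) / 2, ey t) *
          (q - p) / 2|
      ≤ (M * (∫ t in c..d, |ex t|) + K * (∫ t in c..d, |ey t|) + M * T) * (|p| + |q|) := by
  obtain ⟨h1, h2⟩ := left_mem_midpt hcd
  set Y := (c + d) / 2
  have split : ∀ l r : ℝ, ∫ t in l..r, α t * ex t + β t * ey t =
      (∫ t in l..r, α t * ex t) + (∫ t in l..r, (β t - β Y) * ey t) +
        β Y * ∫ t in l..r, ey t := fun l r => by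
    rw [← intervalIntegral.integral_const_mul, ← intervalIntegral.integral_add,
      ← intervalIntegral.integral_add]
    · congr 1; funext t; ring
    all_goals exact Continuous.intervalIntegrable (by fun_prop) _ _
  have sum : (∫ t in c..Y, ey t) + (∫ t in Y..d, ey t) = ∫ t in c..d, ey t :=
    intervalIntegral.integral_add_adjacent_intervals (hey.intervalIntegrable _ _)
      (hey.intervalIntegrable _ _)
  have b1 := abs_mul_add_mul_le (p := p) (q := q)
    (abs_integral_mul_le le_rfl h1 h2 hα hex hαM) (abs_integral_mul_le h1 h2 le_rfl hα hex hαM)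
  have b2 := abs_mul_add_mul_le (p := p) (q := q)
    (abs_integral_mul_le (α := fun t => β t - β Y) le_rfl h1 h2 (hβ.sub continuous_const) hey hβK)
    (abs_integral_mul_le (α := fun t => β t - β Y) h1 h2 le_rfl (hβ.sub continuous_const) hey hβK)
  have b3 : |β Y * (∫ t in c..d, ey t) * ((p + q) / 2)| ≤ M * T * (|p| + |q|) := by
    rw [abs_mul, abs_mul]
    have hM : 0 ≤ M := (abs_nonneg _).trans hβM
    have hT0 : 0 ≤ T := (abs_nonneg _).trans hT
    have hpq : |(p + q) / 2| ≤ |p| + |q| := by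
      rw [abs_div, abs_two]
      linarith [abs_add_le p q, abs_nonneg (p + q)]
    gcongr
  rw [split, split, add_mul _ _ (|p| + |q|), add_mul _ _ (|p| + |q|)]
  refine le_trans (le_of_eq ?_) ((abs_add_three _ _ _).trans (add_le_add (add_le_add b1 b2) b3))
  congr 1
  rw [← sum]
  ring

theorem sum_mul_sub_eq (g δ : ℕ → ℝ) (n : ℕ) :
    ∑ i ∈ Finset.range (n + 1), g i * (δ (i + 1) - δ i) =
      g n * δ (n + 1) - g 0 * δ 0 + ∑ i ∈ Finset.range n, (g i - g (i + 1)) * δ (i + 1) := by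
  induction n with
  | zero => simp; ring
  | succ n ih => rw [Finset.sum_range_succ, ih, Finset.sum_range_succ]; ring

/-- Abel summation moves the difference from `δ` to `g`, the boundary terms being zero. Each `s i`
then occurs for at most two neighbouring pairs, whence the factor two. -/
theorem abs_sum_mul_sub_le {g δ s : ℕ → ℝ} {n : ℕ} (h0 : δ 0 = 0) (hn : δ n = 0)
    (hs : ∀ i < n, 0 ≤ s i)
    (hg : ∀ i, i + 1 < n → |(g i - g (i + 1)) * δ (i + 1)| ≤ s i + s (i + 1)) :
    |∑ i ∈ Finset.range n, g i * (δ (i + 1) - δ i)| ≤ 2 * ∑ i ∈ Finset.range n, s i := by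
  rcases n with _ | n
  · simp
  rw [sum_mul_sub_eq, h0, hn, mul_zero, mul_zero, sub_zero, zero_add]
  refine (Finset.abs_sum_le_sum_abs _ _).trans
    ((Finset.sum_le_sum fun i hi => hg i (by simpa using hi)).trans ?_)
  rw [Finset.sum_add_distrib, two_mul]
  refine add_le_add ?_ ?_
  · rw [Finset.sum_range_succ]
    linarith [hs n (by omega)]
  · rw [Finset.sum_range_succ']
    linarith [hs 0 (by omega)]

theorem sqrt_mul_le_of_le {p q h : ℝ} (hp : 0 ≤ p) (hq : 0 ≤ q) (hph : p ≤ h) (hqh : q ≤ h) :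
    √(p * q) ≤ h := by
  rw [Real.sqrt_le_left (hp.trans hph), sq]
  exact mul_le_mul hph hqh hq (hp.trans hph)

/-- The consistency error of the fluxes through the vertical midlines is of second order. -/
theorem abs_vform_interp_error_le {n m : ℕ} {x y : ℕ → ℝ} {γ h M L : ℝ} {w a b : ℝ × ℝ → ℝ}
    {V : ℕ → ℕ → ℝ} (H : IsGrid n m x y γ h) (hγ : 0 ≤ γ) (hh : 0 ≤ h) (hh1 : h ≤ 1)
    (hw : ContDiff ℝ ∞ w) (ha : Continuous a) (hb : Continuous b) (haM : ∀ p, |a p| ≤ M)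
    (hbM : ∀ p, |b p| ≤ M) (hL : 0 ≤ L) (hbL : ∀ p q, |b p - b q| ≤ L * dist p q)
    (hV0 : ∀ j < m, dY V 0 j = 0) (hVn : ∀ j < m, dY V n j = 0) :
    |vform n m y (fun i j t =>
        a (midpt x i, t) * (pd 0 w (midpt x i, t) - bilinX x y (fun i j => w (x i, y j)) i j t) +
        b (midpt x i, t) * (pd 1 w (midpt x i, t) - bilinY y (fun i j => w (x i, y j)) i j)) V|
      ≤ (2 * (M * (1 + γ) + L * (2 * γ + 1) + M) + (M + 2 * L * γ)) * h ^ 2 *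
        (√(sobEnergy w (x 0) (x n) (y 0) (y m)) * √(nodalEnergy n m V)) := by
  have hM : 0 ≤ M := (abs_nonneg _).trans (haM 0)
  have s0 := contDiff_pd hw 0
  have s1 := contDiff_pd hw 1
  have s11 := contDiff_pd s1 1
  have k0 := s0.continuous
  have k1 := s1.continuous
  set N : ℕ → ℕ → ℝ := fun i j => √(sobEnergy w (x i) (x (i + 1)) (y j) (y (j + 1))) with hN
  set d : ℕ → ℕ → ℝ := fun i j => √(cellSq V i j) with hd
  have hN0 : ∀ i j, 0 ≤ N i j := fun i j => Real.sqrt_nonneg _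
  have hd0 : ∀ i j, 0 ≤ d i j := fun i j => Real.sqrt_nonneg _
  have hI : ∀ i < n, ∀ j < m, ∀ α : ℕ × ℕ, α.1 + α.2 ≤ 3 →
      boxInt (fun p => |pdMulti α w p|) (x i) (x (i + 1)) (y j) (y (j + 1)) ≤ h * N i j :=
    fun i hi j hj α hα => by
      refine (boxInt_abs_le_sobEnergy hw (H.x_lt i hi).le (H.y_lt j hj).le α hα).trans ?_
      gcongr
      exact sqrt_mul_le_of_le (sub_nonneg.mpr (H.x_lt i hi).le) (sub_nonneg.mpr (H.y_lt j hj).le)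
        (H.x_le i hi) (H.y_le j hj)
  -- The trace inequality carries the width of the element as a factor on the left. The height in
  -- front of the integral is traded for this width by regularity, at the cost of `γ`.
  have hJ : ∀ i < n, ∀ j < m, (y (j + 1) - y j) *
      (∫ t in y j..y (j + 1), |pd 1 (pd 1 w) (midpt x i, t)|) ≤ 2 * γ * (h * N i j) :=
    fun i hi j hj => by
      have h1 := mul_integral_abs_le (x₀ := x i) (x₁ := x (i + 1)) s11 (H.y_lt j hj).le
        (x := midpt x i) (left_mem_midpt (H.x_lt i hi))
      have h2 := hI i hi j hj (0, 2) (by norm_num)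
      have h3 := hI i hi j hj (1, 2) (by norm_num)
      have h4 : 0 ≤ ∫ t in y j..y (j + 1), |pd 1 (pd 1 w) (midpt x i, t)| :=
        intervalIntegral.integral_nonneg (H.y_lt j hj).le fun _ _ => abs_nonneg _
      have h5 : (x (i + 1) - x i) * boxInt (fun p => |pdMulti (1, 2) w p|) (x i) (x (i + 1))
          (y j) (y (j + 1)) ≤ 1 * (h * N i j) :=
        mul_le_mul ((H.x_le i hi).trans hh1) h3 (boxInt_nonneg (fun _ => abs_nonneg _) _ _ _ _)
          zero_le_one
      calc _ ≤ γ * (x (i + 1) - x i) * ∫ t in y j..y (j + 1), |pd 1 (pd 1 w) (midpt x i, t)| := by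
            gcongr; exact H.y_ratio i hi j hj
        _ = γ * ((x (i + 1) - x i) * ∫ t in y j..y (j + 1), |pd 1 (pd 1 w) (midpt x i, t)|) := by
            ring
        _ ≤ γ * (2 * (h * N i j)) := by
            refine mul_le_mul_of_nonneg_left (h1.trans ?_) hγ
            have h2' : boxInt (fun p => |pd 1 (pd 1 w) p|) (x i) (x (i + 1)) (y j) (y (j + 1))
              ≤ h * N i j := h2
            have h5' : (x (i + 1) - x i) * boxInt (fun p => |pd 0 (pd 1 (pd 1 w)) p|)
              (x i) (x (i + 1)) (y j) (y (j + 1)) ≤ 1 * (h * N i j) := h5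
            linarith
        _ = _ := by ring
  -- The difference between the upper and the lower half integral of the `y`-derivative of the
  -- interpolation error. The interpolant drops out, since its `y`-derivative is constant along the
  -- midline.
  set D : ℕ → ℕ → ℝ := fun i j =>
    w (midpt x i, y (j + 1)) + w (midpt x i, y j) - 2 * w (midpt x i, midpt y j) with hD
  set C₁ := M * (1 + γ) + L * (2 * γ + 1) + M with hC₁
  have hC₁0 : 0 ≤ C₁ := by positivity
  set F : ℕ → ℕ → ℝ → ℝ := fun i j t =>
        a (midpt x i, t) * (pd 0 w (midpt x i, t) - bilinX x y (fun i j => w (x i, y j)) i j t) +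
        b (midpt x i, t) * (pd 1 w (midpt x i, t) - bilinY y (fun i j => w (x i, y j)) i j) with hF
  -- the contribution of a single element
  have cell : ∀ i < n, ∀ j < m, |(∫ t in y j..midpt y j, F i j t) * dX V i j +
      (∫ t in midpt y j..y (j + 1), F i j t) * dX V i (j + 1) -
      b (midpt x i, midpt y j) * D i j * (dX V i (j + 1) - dX V i j) / 2|
      ≤ C₁ * h ^ 2 * N i j * (2 * d i j) := fun i hi j hj => by
    have hx := H.x_lt i hi
    have hy := H.y_lt j hj
    have hx' : 0 < x (i + 1) - x i := sub_pos.mpr hx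
    have hy' : 0 < y (j + 1) - y j := sub_pos.mpr hy
    have ftc : ∀ l r : ℝ, ∫ t in l..r, (pd 1 w (midpt x i, t) -
        bilinY y (fun i j => w (x i, y j)) i j) = w (midpt x i, r) - w (midpt x i, l) -
          (r - l) * bilinY y (fun i j => w (x i, y j)) i j := fun l r => by
      rw [intervalIntegral.integral_sub (Continuous.intervalIntegrable (by fun_prop) _ _) (by simp),
        intervalIntegral.integral_eq_sub_of_hasDerivAt
          (fun t _ => hasDerivAt_pd_one (differentiable_of_contDiff hw) _ t)
          (Continuous.intervalIntegrable (by fun_prop) _ _)]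
      simp
    -- The gain here comes from integrating over the whole midline. The absolute value of the same
    -- error, bounded in `hEy`, is one order worse and is only used with the factor `L * h`.
    have hT : |∫ t in y j..y (j + 1), (pd 1 w (midpt x i, t) -
        bilinY y (fun i j => w (x i, y j)) i j)| ≤ h ^ 2 * N i j := by
      rw [ftc]
      have h1 := abs_midline_increment_sub_le hw hx hy
      have h2 := hI i hi j hj (2, 1) (by norm_num)
      have e : (y (j + 1) - y j) * bilinY y (fun i j => w (x i, y j)) i j =
          ((w (x i, y (j + 1)) - w (x i, y j)) +
            (w (x (i + 1), y (j + 1)) - w (x (i + 1), y j))) / 2 := by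
        simp only [bilinY, dY]; field_simp
      rw [e]
      refine h1.trans ?_
      calc _ ≤ h * (h * N i j) :=
            mul_le_mul (H.x_le i hi) h2 (boxInt_nonneg (fun _ => abs_nonneg _) _ _ _ _) hh
        _ = _ := by ring
    have hEx : ∫ t in y j..y (j + 1), |pd 0 w (midpt x i, t) -
        bilinX x y (fun i j => w (x i, y j)) i j t| ≤ (1 + γ) * (h ^ 2 * N i j) := by
      have h1 := integral_abs_pd_zero_interp_error_le hw hx hy
      have h2 : boxInt (fun p => |pd 0 (pd 0 (pd 0 w)) p|) (x i) (x (i + 1)) (y j) (y (j + 1))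
        ≤ h * N i j := hI i hi j hj (3, 0) (by norm_num)
      have h3 : boxInt (fun p => |pd 0 (pd 1 (pd 1 w)) p|) (x i) (x (i + 1)) (y j) (y (j + 1))
        ≤ h * N i j := hI i hi j hj (1, 2) (by norm_num)
      have h4 : (y (j + 1) - y j) ^ 2 / (x (i + 1) - x i) ≤ γ * h := by
        rw [div_le_iff₀ hx', sq]
        calc _ ≤ h * (γ * (x (i + 1) - x i)) :=
              mul_le_mul (H.y_le j hj) (H.y_ratio i hi j hj) hy'.le hh
          _ = _ := by ring
      refine h1.trans ?_
      calc _ ≤ h * (h * N i j) + γ * h * (h * N i j) :=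
            add_le_add
              (mul_le_mul (H.x_le i hi) h2 (boxInt_nonneg (fun _ => abs_nonneg _) _ _ _ _) hh)
              (mul_le_mul h4 h3 (boxInt_nonneg (fun _ => abs_nonneg _) _ _ _ _) (by positivity))
        _ = _ := by ring
    have hEy : ∫ t in y j..y (j + 1), |pd 1 w (midpt x i, t) -
        bilinY y (fun i j => w (x i, y j)) i j| ≤ (2 * γ + 1) * (h * N i j) := by
      have h1 := integral_abs_pd_one_interp_error_le hw hx hy
      have h2 : boxInt (fun p => |pd 0 (pd 0 (pd 1 w)) p|) (x i) (x (i + 1)) (y j) (y (j + 1))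
        ≤ h * N i j := hI i hi j hj (2, 1) (by norm_num)
      refine h1.trans ?_
      calc _ ≤ 2 * γ * (h * N i j) + 1 * (h * N i j) :=
            add_le_add (hJ i hi j hj)
              (mul_le_mul ((H.x_le i hi).trans hh1) h2
                (boxInt_nonneg (fun _ => abs_nonneg _) _ _ _ _) zero_le_one)
        _ = _ := by ring
    have hbil : Continuous fun t => bilinX x y (fun i j => w (x i, y j)) i j t := by
      unfold bilinX; fun_prop
    have main := abs_half_fluxes_sub_le (α := fun t => a (midpt x i, t))
      (β := fun t => b (midpt x i, t))
      (ex := fun t => pd 0 w (midpt x i, t) - bilinX x y (fun i j => w (x i, y j)) i j t)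
      (ey := fun t => pd 1 w (midpt x i, t) - bilinY y (fun i j => w (x i, y j)) i j)
      (p := dX V i j) (q := dX V i (j + 1)) (K := L * h) hy
      (by fun_prop) (by fun_prop) (by fun_prop) (by fun_prop)
      (fun t _ => haM _) (hbM _) (fun t ht => by
        refine (hbL _ _).trans (mul_le_mul_of_nonneg_left ?_ hL)
        rw [Prod.dist_eq, dist_self, Real.dist_eq]
        refine max_le hh (abs_le.mpr ⟨?_, ?_⟩) <;> linarith [ht.1, ht.2, H.y_le j hj]) hT
    rw [ftc, ftc] at main
    have e1 : w (midpt x i, y (j + 1)) - w (midpt x i, (y j + y (j + 1)) / 2) -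
        (y (j + 1) - (y j + y (j + 1)) / 2) * bilinY y (fun i j => w (x i, y j)) i j -
        (w (midpt x i, (y j + y (j + 1)) / 2) - w (midpt x i, y j) -
          ((y j + y (j + 1)) / 2 - y j) * bilinY y (fun i j => w (x i, y j)) i j) = D i j := by
      simp only [hD, midpt]; ring
    rw [e1] at main
    refine main.trans ?_
    have p1 := abs_dX_le V i j
    have p2 := abs_dX_succ_le V i j
    have hpq : |dX V i j| + |dX V i (j + 1)| ≤ 2 * d i j := by rw [two_mul]; exact add_le_add p1 p2
    refine mul_le_mul ?_ hpq (by positivity)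
      (mul_nonneg (mul_nonneg hC₁0 (sq_nonneg h)) (hN0 i j))
    calc _ ≤ M * ((1 + γ) * (h ^ 2 * N i j)) + L * h * ((2 * γ + 1) * (h * N i j)) +
          M * (h ^ 2 * N i j) := by gcongr
      _ = _ := by rw [hC₁]; ring
  -- summation by parts along the strips
  have strip : ∀ j < m, |∑ i ∈ Finset.range n, b (midpt x i, midpt y j) * D i j *
      (dY V (i + 1) j - dY V i j)| ≤
      2 * ∑ i ∈ Finset.range n, (M + 2 * L * γ) * h ^ 2 * (N i j * d i j) := fun j hj => by
    have hy := H.y_lt j hj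
    refine abs_sum_mul_sub_le (g := fun i => b (midpt x i, midpt y j) * D i j)
      (δ := fun i => dY V i j) (hV0 j hj) (hVn j hj)
      (fun i _ => mul_nonneg (by positivity) (mul_nonneg (hN0 i j) (hd0 i j))) fun i hi => ?_
    have hi0 : i < n := by omega
    have hx := H.x_lt i hi0
    have hx1 := H.x_lt (i + 1) hi
    have m1 := left_mem_midpt hx
    have m2 := left_mem_midpt hx1
    have hs1 := abs_second_difference_sub_le hw hy m1.2
    have hs2 := abs_second_difference_sub_le hw hy m2.1
    have hI1 : boxInt (fun p => |pd 0 (pd 1 (pd 1 w)) p|) ((x i + x (i + 1)) / 2) (x (i + 1))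
        (y j) (y (j + 1)) ≤ h * N i j :=
      (boxInt_mono_set (fun _ => abs_nonneg _) (integrableOn_box_of_continuous
        (contDiff_pd s11 0).continuous.abs _ _ _ _) m1.1 le_rfl le_rfl le_rfl).trans
        (hI i hi0 j hj (1, 2) (by norm_num))
    have hI2 : boxInt (fun p => |pd 0 (pd 1 (pd 1 w)) p|) (x (i + 1))
        ((x (i + 1) + x (i + 1 + 1)) / 2) (y j) (y (j + 1)) ≤ h * N (i + 1) j :=
      (boxInt_mono_set (fun _ => abs_nonneg _) (integrableOn_box_of_continuous
        (contDiff_pd s11 0).continuous.abs _ _ _ _) le_rfl m2.2 le_rfl le_rfl).trans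
        (hI (i + 1) hi j hj (1, 2) (by norm_num))
    have hy0 : 0 ≤ y (j + 1) - y j := (sub_pos.mpr hy).le
    -- Pass from one midline to the next through the common side `x (i + 1)`. Each half step stays
    -- inside one element and costs a third derivative there.
    have hDD : |D i j - D (i + 1) j| ≤ h ^ 2 * N i j + h ^ 2 * N (i + 1) j := by
      have e1 : (y (j + 1) - y j) * boxInt (fun p => |pd 0 (pd 1 (pd 1 w)) p|)
          ((x i + x (i + 1)) / 2) (x (i + 1)) (y j) (y (j + 1)) ≤ h * (h * N i j) :=
        mul_le_mul (H.y_le j hj) hI1 (boxInt_nonneg (fun _ => abs_nonneg _) _ _ _ _) hh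
      have e2 : (y (j + 1) - y j) * boxInt (fun p => |pd 0 (pd 1 (pd 1 w)) p|) (x (i + 1))
        ((x (i + 1) + x (i + 1 + 1)) / 2) (y j) (y (j + 1)) ≤ h * (h * N (i + 1) j) :=
        mul_le_mul (H.y_le j hj) hI2 (boxInt_nonneg (fun _ => abs_nonneg _) _ _ _ _) hh
      rw [abs_sub_comm]
      refine (abs_sub_le _ (w (x (i + 1), y (j + 1)) + w (x (i + 1), y j) -
        2 * w (x (i + 1), (y j + y (j + 1)) / 2)) _).trans ?_
      have := add_le_add (hs2.trans e2) (hs1.trans e1)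
      refine this.trans (le_of_eq (by ring))
    -- `D` alone is one order short; the missing power of `h` comes from the Lipschitz bound on `b`
    -- between the two centres.
    have hD1 : |D (i + 1) j| ≤ 2 * γ * (h * N (i + 1) j) :=
      (abs_second_difference_midline_le hw hy _).trans (hJ (i + 1) hi j hj)
    have hbb : |b (midpt x i, midpt y j) - b (midpt x (i + 1), midpt y j)| ≤ L * h := by
      refine (hbL _ _).trans (mul_le_mul_of_nonneg_left ?_ hL)
      rw [Prod.dist_eq, dist_self, Real.dist_eq]
      refine max_le (abs_le.mpr ⟨?_, ?_⟩) hh <;>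
        simp only [midpt] <;> linarith [H.x_le i hi0, H.x_le (i + 1) hi]
    have hgg : |b (midpt x i, midpt y j) * D i j - b (midpt x (i + 1), midpt y j) * D (i + 1) j| ≤
        (M + 2 * L * γ) * h ^ 2 * N i j + (M + 2 * L * γ) * h ^ 2 * N (i + 1) j := by
      have e : b (midpt x i, midpt y j) * D i j - b (midpt x (i + 1), midpt y j) * D (i + 1) j =
          b (midpt x i, midpt y j) * (D i j - D (i + 1) j) +
          (b (midpt x i, midpt y j) - b (midpt x (i + 1), midpt y j)) * D (i + 1) j := by ring
      rw [e]
      refine (abs_add_le _ _).trans ?_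
      rw [abs_mul, abs_mul]
      calc _ ≤ M * (h ^ 2 * N i j + h ^ 2 * N (i + 1) j) +
            L * h * (2 * γ * (h * N (i + 1) j)) := by
            gcongr
            exact hbM _
        _ ≤ _ := by
            have : 0 ≤ 2 * L * γ * h ^ 2 * N i j := mul_nonneg (by positivity) (hN0 _ _)
            linarith
    have hδ1 := abs_dY_succ_le V i j
    have hδ2 := abs_dY_le V (i + 1) j
    rw [abs_mul]
    refine (mul_le_mul_of_nonneg_right hgg (abs_nonneg _)).trans ?_
    rw [add_mul, mul_assoc _ (N i j), mul_assoc _ (N (i + 1) j)]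
    have := hN0 i j
    have := hN0 (i + 1) j
    gcongr
  -- the sum over all elements
  have hsum : ∑ i ∈ Finset.range n, ∑ j ∈ Finset.range m, N i j * d i j ≤
      √(sobEnergy w (x 0) (x n) (y 0) (y m)) * √(nodalEnergy n m V) := by
    rw [← sum_sobEnergy hw (fun i hi => (H.x_lt i hi).le) (fun j hj => (H.y_lt j hj).le)]
    exact sum_sqrt_mul_sqrt_le (fun _ _ => sobEnergy_nonneg _ _ _ _ _)
      (fun _ _ => cellSq_nonneg _ _ _)
  -- The difference of the `x`-increments on the top and bottom edges of an element equals the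
  -- difference of the `y`-increments on its right and left edges. The subtracted terms can
  -- therefore be summed along horizontal strips.
  have hsplit : vform n m y F V = (∑ i ∈ Finset.range n, ∑ j ∈ Finset.range m,
      ((∫ t in y j..midpt y j, F i j t) * dX V i j +
      (∫ t in midpt y j..y (j + 1), F i j t) * dX V i (j + 1) -
      b (midpt x i, midpt y j) * D i j * (dX V i (j + 1) - dX V i j) / 2)) +
      (1 / 2) * ∑ j ∈ Finset.range m, ∑ i ∈ Finset.range n, b (midpt x i, midpt y j) * D i j *
      (dY V (i + 1) j - dY V i j) := by
    rw [Finset.sum_comm (s := Finset.range m), Finset.mul_sum, ← Finset.sum_add_distrib]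
    refine Finset.sum_congr rfl fun i _ => ?_
    rw [Finset.mul_sum, ← Finset.sum_add_distrib]
    refine Finset.sum_congr rfl fun j _ => ?_
    simp only [dX, dY]
    ring
  rw [hsplit]
  refine (abs_add_le _ _).trans ?_
  have r1 : |∑ i ∈ Finset.range n, ∑ j ∈ Finset.range m,
      ((∫ t in y j..midpt y j, F i j t) * dX V i j +
      (∫ t in midpt y j..y (j + 1), F i j t) * dX V i (j + 1) -
      b (midpt x i, midpt y j) * D i j * (dX V i (j + 1) - dX V i j) / 2)| ≤
      2 * C₁ * h ^ 2 * ∑ i ∈ Finset.range n, ∑ j ∈ Finset.range m, N i j * d i j := by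
    rw [Finset.mul_sum]
    refine (Finset.abs_sum_le_sum_abs _ _).trans (Finset.sum_le_sum fun i hi => ?_)
    rw [Finset.mul_sum]
    refine (Finset.abs_sum_le_sum_abs _ _).trans (Finset.sum_le_sum fun j hj => ?_)
    refine (cell i (Finset.mem_range.mp hi) j (Finset.mem_range.mp hj)).trans (le_of_eq (by ring))
  have r2 : |(1 / 2) * ∑ j ∈ Finset.range m, ∑ i ∈ Finset.range n,
      b (midpt x i, midpt y j) * D i j * (dY V (i + 1) j - dY V i j)| ≤
      (M + 2 * L * γ) * h ^ 2 *
        ∑ i ∈ Finset.range n, ∑ j ∈ Finset.range m, N i j * d i j := by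
    rw [abs_mul, Finset.sum_comm (s := Finset.range n), Finset.mul_sum]
    have : |∑ j ∈ Finset.range m, ∑ i ∈ Finset.range n,
      b (midpt x i, midpt y j) * D i j * (dY V (i + 1) j - dY V i j)| ≤
      ∑ j ∈ Finset.range m, 2 * ((M + 2 * L * γ) * h ^ 2 * ∑ i ∈ Finset.range n, N i j * d i j) := by
      refine (Finset.abs_sum_le_sum_abs _ _).trans (Finset.sum_le_sum fun j hj => ?_)
      refine (strip j (Finset.mem_range.mp hj)).trans (le_of_eq ?_)
      rw [← Finset.mul_sum]
    rw [← Finset.mul_sum] at this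
    rw [abs_of_pos (by norm_num : (0 : ℝ) < 1 / 2)]
    linarith
  refine (add_le_add r1 r2).trans ?_
  rw [← add_mul, ← add_mul]
  gcongr

end FVE

namespace FVE

/-! ### Coercivity of the flux form -/

/-- The flux through the vertical midlines of the bilinear function with nodal values `W`. -/
noncomputable def discFlux (a b : ℝ × ℝ → ℝ) (x y : ℕ → ℝ) (W : ℕ → ℕ → ℝ) (i j : ℕ) (t : ℝ) : ℝ :=
  a (midpt x i, t) * bilinX x y W i j t + b (midpt x i, t) * bilinY y W i j

theorem continuous_bilinX (x y : ℕ → ℝ) (W : ℕ → ℕ → ℝ) (i j : ℕ) :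
    Continuous (bilinX x y W i j) := by
  unfold bilinX; fun_prop

theorem integral_affine (A B l r : ℝ) :
    ∫ t in l..r, (A + B * t) = A * (r - l) + B * ((r ^ 2 - l ^ 2) / 2) := by
  rw [intervalIntegral.integral_add (by simp) (Continuous.intervalIntegrable (by fun_prop) _ _),
    intervalIntegral.integral_const_mul, integral_id, intervalIntegral.integral_const, smul_eq_mul]
  ring

/-- With coefficients frozen at the centre the half integrals are explicit: `(d - c) (3 p + q) / (8
H)` and `(d - c) (p + 3 q) / (8 H)` for the first part of the flux, and `(r + s) / 4` on either half
for the second. The variation of the coefficients is at most `K` and multiplies the `L¹` norms of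
the derivatives. -/
theorem abs_half_fluxes_disc_sub_le {α β : ℝ → ℝ} {c d H K p q r s : ℝ} (hcd : c < d) (hH : 0 < H)
    (hα : Continuous α) (hβ : Continuous β)
    (hαK : ∀ t ∈ Set.Icc c d, |α t - α ((c + d) / 2)| ≤ K)
    (hβK : ∀ t ∈ Set.Icc c d, |β t - β ((c + d) / 2)| ≤ K) :
    |(∫ t in c..(c + d) / 2, α t * (((d - t) * p + (t - c) * q) / (H * (d - c))) +
          β t * ((r + s) / (2 * (d - c)))) * p +
        (∫ t in (c + d) / 2..d, α t * (((d - t) * p + (t - c) * q) / (H * (d - c))) +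
          β t * ((r + s) / (2 * (d - c)))) * q -
        (α ((c + d) / 2) * ((d - c) / (8 * H)) * (3 * p ^ 2 + 2 * p * q + 3 * q ^ 2) +
          β ((c + d) / 2) * ((p + q) * (r + s) / 4))|
      ≤ K * ((d - c) / H + 1) * (|p| + |q| + |r| + |s|) ^ 2 := by
  obtain ⟨h1, h2⟩ := left_mem_midpt hcd
  have hcd' : 0 < d - c := sub_pos.mpr hcd
  have hK : 0 ≤ K := (abs_nonneg _).trans (hαK c ⟨le_rfl, hcd.le⟩)
  set Y := (c + d) / 2 with hY
  set ex : ℝ → ℝ := fun t => ((d - t) * p + (t - c) * q) / (H * (d - c)) with hex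
  set ey : ℝ → ℝ := fun _ => (r + s) / (2 * (d - c)) with hey
  have cex : Continuous ex := by fun_prop
  have cey : Continuous ey := by fun_prop
  have split : ∀ l r' : ℝ, ∫ t in l..r', α t * ex t + β t * ey t =
      (∫ t in l..r', (α t - α Y) * ex t) + (∫ t in l..r', (β t - β Y) * ey t) +
        (α Y * (∫ t in l..r', ex t) + β Y * ∫ t in l..r', ey t) := fun l r' => by
    rw [← intervalIntegral.integral_const_mul, ← intervalIntegral.integral_const_mul,
      ← intervalIntegral.integral_add, ← intervalIntegral.integral_add,
      ← intervalIntegral.integral_add]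
    · congr 1; funext t; ring
    all_goals exact Continuous.intervalIntegrable (by fun_prop) _ _
  have iex : ∀ l r' : ℝ, ∫ t in l..r', ex t =
      ((d * p - c * q) * (r' - l) + (q - p) * ((r' ^ 2 - l ^ 2) / 2)) / (H * (d - c)) :=
    fun l r' => by
      rw [← integral_affine, ← intervalIntegral.integral_div]
      congr 1; funext t; rw [hex]; ring
  have iey : ∀ l r' : ℝ, ∫ t in l..r', ey t = (r' - l) * ((r + s) / (2 * (d - c))) := fun l r' => by
    simp [hey]
    ring
  have aex : ∫ t in c..d, |ex t| ≤ (d - c) / H * (|p| + |q|) := by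
    have : ∀ t ∈ Set.Icc c d, |ex t| ≤ (|p| + |q|) / H := fun t ht => by
      rw [hex, abs_div, abs_of_pos (mul_pos hH hcd'), div_le_div_iff₀ (mul_pos hH hcd') hH]
      have e1 : |(d - t) * p + (t - c) * q| ≤ (d - c) * |p| + (d - c) * |q| := by
        refine (abs_add_le _ _).trans ?_
        rw [abs_mul, abs_mul, abs_of_nonneg (sub_nonneg.mpr ht.2),
          abs_of_nonneg (sub_nonneg.mpr ht.1)]
        gcongr <;> linarith [ht.1, ht.2]
      calc _ ≤ ((d - c) * |p| + (d - c) * |q|) * H := by gcongr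
        _ = _ := by ring
    refine (intervalIntegral.integral_mono_on hcd.le (cex.abs.intervalIntegrable _ _) (by simp)
      this).trans (le_of_eq ?_)
    simp; ring
  have aey : ∫ t in c..d, |ey t| ≤ |r| + |s| := by
    simp only [hey, intervalIntegral.integral_const, smul_eq_mul]
    rw [abs_div, abs_of_pos (by linarith : 0 < 2 * (d - c))]
    have : (d - c) * (|r + s| / (2 * (d - c))) = |r + s| / 2 := by field_simp
    rw [this]
    linarith [abs_add_le r s, abs_nonneg (r + s)]
  have b1 := abs_mul_add_mul_le (p := p) (q := q)
    (abs_integral_mul_le (α := fun t => α t - α Y) le_rfl h1 h2 (hα.sub continuous_const) cex hαK)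
    (abs_integral_mul_le (α := fun t => α t - α Y) h1 h2 le_rfl (hα.sub continuous_const) cex hαK)
  have b2 := abs_mul_add_mul_le (p := p) (q := q)
    (abs_integral_mul_le (α := fun t => β t - β Y) le_rfl h1 h2 (hβ.sub continuous_const) cey hβK)
    (abs_integral_mul_le (α := fun t => β t - β Y) h1 h2 le_rfl (hβ.sub continuous_const) cey hβK)
  have e : (∫ t in c..Y, α t * ex t + β t * ey t) * p + (∫ t in Y..d, α t * ex t + β t * ey t) * q -
        (α Y * ((d - c) / (8 * H)) * (3 * p ^ 2 + 2 * p * q + 3 * q ^ 2) +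
          β Y * ((p + q) * (r + s) / 4)) =
      ((∫ t in c..Y, (α t - α Y) * ex t) * p + (∫ t in Y..d, (α t - α Y) * ex t) * q) +
      ((∫ t in c..Y, (β t - β Y) * ey t) * p + (∫ t in Y..d, (β t - β Y) * ey t) * q) := by
    rw [split, split, iex, iex, iey, iey]
    have k1 : ((d * p - c * q) * (Y - c) + (q - p) * ((Y ^ 2 - c ^ 2) / 2)) / (H * (d - c))
        = (d - c) * (3 * p + q) / (8 * H) := by
      rw [hY]; field_simp; ring
    have k2 : ((d * p - c * q) * (d - Y) + (q - p) * ((d ^ 2 - Y ^ 2) / 2)) / (H * (d - c))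
        = (d - c) * (p + 3 * q) / (8 * H) := by
      rw [hY]; field_simp; ring
    have k3 : (Y - c) * ((r + s) / (2 * (d - c))) = (r + s) / 4 := by
      rw [hY]; field_simp; ring
    have k4 : (d - Y) * ((r + s) / (2 * (d - c))) = (r + s) / 4 := by
      rw [hY]; field_simp; ring
    rw [k1, k2, k3, k4]
    field_simp
    ring
  rw [e]
  refine (abs_add_le _ _).trans ((add_le_add b1 b2).trans ?_)
  have hp := abs_nonneg p
  have hq := abs_nonneg q
  have hr := abs_nonneg r
  have hs := abs_nonneg s
  set S := |p| + |q| + |r| + |s| with hS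
  calc _ ≤ K * ((d - c) / H * S) * S + K * S * S := by
        gcongr
        · exact aex.trans (by gcongr; linarith)
        · linarith
        · exact aey.trans (by linarith)
        · linarith
    _ = _ := by ring

theorem sq_sum_abs_increments_le (V : ℕ → ℕ → ℝ) (i j : ℕ) :
    (|dX V i j| + |dX V i (j + 1)| + |dY V i j| + |dY V (i + 1) j|) ^ 2 ≤ 4 * cellSq V i j := by
  unfold cellSq
  rw [← sq_abs (dX V i j), ← sq_abs (dX V i (j + 1)), ← sq_abs (dY V i j),
    ← sq_abs (dY V (i + 1) j)]
  set p := |dX V i j|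
  set q := |dX V i (j + 1)|
  set r := |dY V i j|
  set s := |dY V (i + 1) j|
  nlinarith [sq_nonneg (p - q), sq_nonneg (p - r), sq_nonneg (p - s), sq_nonneg (q - r),
    sq_nonneg (q - s), sq_nonneg (r - s)]

/-- Since `(3 p² + 2 p q + 3 q²) / 8 = (p + q)² / 4 + (p - q)² / 8`, the form splits in two. One
part is the area times the value of the elliptic form at the mean gradient `((p + q) / (2 H), (r +
s) / (2 K))`; the other is a multiple of `(p - q)²` and `(r - s)²` with the positive weights `a₁₁`
and `a₂₂`. The mixed coefficients enter only the first part, where ellipticity applies. -/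
theorem quadratic_form_cell_ge {a₁₁ a₁₂ a₂₁ a₂₂ C₁ γ H K p q r s : ℝ} (hC : 0 ≤ C₁) (hγ : 0 < γ)
    (hH : 0 < H) (hK : 0 < K) (hHK : H ≤ γ * K) (hKH : K ≤ γ * H)
    (hell : ∀ s t : ℝ, C₁ * (s ^ 2 + t ^ 2) ≤ a₁₁ * s ^ 2 + (a₁₂ + a₂₁) * (s * t) + a₂₂ * t ^ 2) :
    C₁ / (4 * γ) * (p ^ 2 + q ^ 2 + r ^ 2 + s ^ 2) ≤
      (a₁₁ * (K / (8 * H)) * (3 * p ^ 2 + 2 * p * q + 3 * q ^ 2) + a₁₂ * ((p + q) * (r + s) / 4)) +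
      (a₂₂ * (H / (8 * K)) * (3 * r ^ 2 + 2 * r * s + 3 * s ^ 2) +
        a₂₁ * ((r + s) * (p + q) / 4)) := by
  have h11 : C₁ ≤ a₁₁ := by have := hell 1 0; norm_num at this; linarith
  have h22 : C₁ ≤ a₂₂ := by have := hell 0 1; norm_num at this; linarith
  have hξ := mul_le_mul_of_nonneg_left (hell ((p + q) / (2 * H)) ((r + s) / (2 * K)))
    (mul_pos hH hK).le
  have e1 : H * K * (C₁ * (((p + q) / (2 * H)) ^ 2 + ((r + s) / (2 * K)) ^ 2)) =
      C₁ * (K / H * ((p + q) ^ 2 / 4) + H / K * ((r + s) ^ 2 / 4)) := by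
    field_simp
    ring
  have e2 : H * K * (a₁₁ * ((p + q) / (2 * H)) ^ 2 +
      (a₁₂ + a₂₁) * ((p + q) / (2 * H) * ((r + s) / (2 * K))) + a₂₂ * ((r + s) / (2 * K)) ^ 2) =
      a₁₁ * (K / H) * ((p + q) ^ 2 / 4) + (a₁₂ + a₂₁) * ((p + q) * (r + s) / 4) +
        a₂₂ * (H / K) * ((r + s) ^ 2 / 4) := by
    field_simp
    ring
  rw [e1, e2] at hξ
  have e3 : (a₁₁ * (K / (8 * H)) * (3 * p ^ 2 + 2 * p * q + 3 * q ^ 2) +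
      a₁₂ * ((p + q) * (r + s) / 4)) + (a₂₂ * (H / (8 * K)) * (3 * r ^ 2 + 2 * r * s + 3 * s ^ 2) +
        a₂₁ * ((r + s) * (p + q) / 4)) = (a₁₁ * (K / H) * ((p + q) ^ 2 / 4) +
        (a₁₂ + a₂₁) * ((p + q) * (r + s) / 4) + a₂₂ * (H / K) * ((r + s) ^ 2 / 4)) +
        (a₁₁ * (K / H * ((p - q) ^ 2 / 8)) + a₂₂ * (H / K * ((r - s) ^ 2 / 8))) := by
    field_simp
    ring
  rw [e3]
  have hKH' : 1 / γ ≤ K / H := by rw [div_le_div_iff₀ hγ hH]; linarith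
  have hHK' : 1 / γ ≤ H / K := by rw [div_le_div_iff₀ hγ hK]; linarith
  have f1 : C₁ * (K / H * ((p - q) ^ 2 / 8)) ≤ a₁₁ * (K / H * ((p - q) ^ 2 / 8)) := by gcongr
  have f2 : C₁ * (H / K * ((r - s) ^ 2 / 8)) ≤ a₂₂ * (H / K * ((r - s) ^ 2 / 8)) := by gcongr
  have f3 : C₁ * (1 / γ * ((p + q) ^ 2 / 4 + (p - q) ^ 2 / 8) +
      1 / γ * ((r + s) ^ 2 / 4 + (r - s) ^ 2 / 8)) ≤
      C₁ * (K / H * ((p + q) ^ 2 / 4 + (p - q) ^ 2 / 8) +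
      H / K * ((r + s) ^ 2 / 4 + (r - s) ^ 2 / 8)) := by gcongr
  have f4 : C₁ / (4 * γ) * (p ^ 2 + q ^ 2 + r ^ 2 + s ^ 2) ≤
      C₁ * (1 / γ * ((p + q) ^ 2 / 4 + (p - q) ^ 2 / 8) +
      1 / γ * ((r + s) ^ 2 / 4 + (r - s) ^ 2 / 8)) := by
    have : C₁ * (1 / γ * ((p + q) ^ 2 / 4 + (p - q) ^ 2 / 8) +
      1 / γ * ((r + s) ^ 2 / 4 + (r - s) ^ 2 / 8)) =
      C₁ / (4 * γ) * (p ^ 2 + q ^ 2 + r ^ 2 + s ^ 2) +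
        C₁ * (1 / γ) * ((p + q) ^ 2 / 8 + (r + s) ^ 2 / 8) := by
      field_simp; ring
    rw [this]
    have : 0 ≤ C₁ * (1 / γ) * ((p + q) ^ 2 / 8 + (r + s) ^ 2 / 8) := by positivity
    linarith
  linarith

/-- The flux form is coercive on fine meshes. -/
theorem vform_add_vform_flip_ge {n m : ℕ} {x y : ℕ → ℝ} {γ h C₁ L : ℝ} {a₁₁ a₁₂ a₂₁ a₂₂ : ℝ × ℝ → ℝ}
    (H : IsGrid n m x y γ h) (hγ : 0 < γ) (hh : 0 ≤ h) (hC : 0 ≤ C₁)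
    (c₁₁ : Continuous a₁₁) (c₁₂ : Continuous a₁₂) (c₂₁ : Continuous a₂₁) (c₂₂ : Continuous a₂₂)
    (hL : 0 ≤ L) (l₁₁ : ∀ p q, |a₁₁ p - a₁₁ q| ≤ L * dist p q)
    (l₁₂ : ∀ p q, |a₁₂ p - a₁₂ q| ≤ L * dist p q) (l₂₁ : ∀ p q, |a₂₁ p - a₂₁ q| ≤ L * dist p q)
    (l₂₂ : ∀ p q, |a₂₂ p - a₂₂ q| ≤ L * dist p q)
    (hell : ∀ i < n, ∀ j < m, ∀ s t : ℝ, C₁ * (s ^ 2 + t ^ 2) ≤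
      a₁₁ (midpt x i, midpt y j) * s ^ 2 +
        (a₁₂ (midpt x i, midpt y j) + a₂₁ (midpt x i, midpt y j)) * (s * t) +
        a₂₂ (midpt x i, midpt y j) * t ^ 2)
    (W : ℕ → ℕ → ℝ) :
    (C₁ / (4 * γ) - 8 * L * (γ + 1) * h) * nodalEnergy n m W ≤
      vform n m y (discFlux a₁₁ a₁₂ x y W) W +
      vform m n x (discFlux (a₂₂ ∘ Prod.swap) (a₂₁ ∘ Prod.swap) y x (flipNodal W))
        (flipNodal W) := by
  unfold nodalEnergy vform
  rw [Finset.sum_comm (s := Finset.range m), ← Finset.sum_add_distrib, Finset.mul_sum]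
  refine Finset.sum_le_sum fun i hi => ?_
  rw [← Finset.sum_add_distrib, Finset.mul_sum]
  refine Finset.sum_le_sum fun j hj => ?_
  have hi := Finset.mem_range.mp hi
  have hj := Finset.mem_range.mp hj
  have hx := sub_pos.mpr (H.x_lt i hi)
  have hy := sub_pos.mpr (H.y_lt j hj)
  have d1 : ∀ z : ℝ, ∀ t ∈ Set.Icc (y j) (y (j + 1)),
      dist (z, t) (z, (y j + y (j + 1)) / 2) ≤ h := fun z t ht => by
    rw [Prod.dist_eq, dist_self, Real.dist_eq]
    refine max_le hh (abs_le.mpr ⟨?_, ?_⟩) <;> linarith [ht.1, ht.2, H.y_le j hj]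
  have d2 : ∀ z : ℝ, ∀ t ∈ Set.Icc (x i) (x (i + 1)),
      dist (t, z) ((x i + x (i + 1)) / 2, z) ≤ h := fun z t ht => by
    rw [Prod.dist_eq, dist_self, Real.dist_eq]
    refine max_le (abs_le.mpr ⟨?_, ?_⟩) hh <;> linarith [ht.1, ht.2, H.x_le i hi]
  have A := abs_half_fluxes_disc_sub_le (α := fun t => a₁₁ (midpt x i, t))
    (β := fun t => a₁₂ (midpt x i, t)) (K := L * h) (p := dX W i j) (q := dX W i (j + 1))
    (r := dY W i j) (s := dY W (i + 1) j) (H.y_lt j hj) hx (by fun_prop) (by fun_prop)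
    (fun t ht => (l₁₁ _ _).trans (mul_le_mul_of_nonneg_left (d1 _ t ht) hL))
    (fun t ht => (l₁₂ _ _).trans (mul_le_mul_of_nonneg_left (d1 _ t ht) hL))
  have B := abs_half_fluxes_disc_sub_le (α := fun t => a₂₂ (t, midpt y j))
    (β := fun t => a₂₁ (t, midpt y j)) (K := L * h) (p := dY W i j) (q := dY W (i + 1) j)
    (r := dX W i j) (s := dX W i (j + 1)) (H.x_lt i hi) hy (by fun_prop) (by fun_prop)
    (fun t ht => (l₂₂ _ _).trans (mul_le_mul_of_nonneg_left (d2 _ t ht) hL))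
    (fun t ht => (l₂₁ _ _).trans (mul_le_mul_of_nonneg_left (d2 _ t ht) hL))
  have Q := quadratic_form_cell_ge (p := dX W i j) (q := dX W i (j + 1)) (r := dY W i j)
    (s := dY W (i + 1) j) hC hγ hx hy (H.x_ratio i hi j hj) (H.y_ratio i hi j hj) (hell i hi j hj)
  have S := sq_sum_abs_increments_le W i j
  have rx : (x (i + 1) - x i) / (y (j + 1) - y j) ≤ γ := by
    rw [div_le_iff₀ hy]; exact H.x_ratio i hi j hj
  have ry : (y (j + 1) - y j) / (x (i + 1) - x i) ≤ γ := by
    rw [div_le_iff₀ hx]; exact H.y_ratio i hi j hj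
  -- Each of the two directions contributes `4 L h (γ + 1)` times the energy of the element, which
  -- together make the constant `8 L (γ + 1) h`.
  have SA : L * h * ((y (j + 1) - y j) / (x (i + 1) - x i) + 1) *
      (|dX W i j| + |dX W i (j + 1)| + |dY W i j| + |dY W (i + 1) j|) ^ 2 ≤
      L * h * (γ + 1) * (4 * cellSq W i j) := by gcongr
  have SB : L * h * ((x (i + 1) - x i) / (y (j + 1) - y j) + 1) *
      (|dY W i j| + |dY W (i + 1) j| + |dX W i j| + |dX W i (j + 1)|) ^ 2 ≤
      L * h * (γ + 1) * (4 * cellSq W i j) := by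
    have : |dY W i j| + |dY W (i + 1) j| + |dX W i j| + |dX W i (j + 1)| =
      |dX W i j| + |dX W i (j + 1)| + |dY W i j| + |dY W (i + 1) j| := by ring
    rw [this]; gcongr
  have A' := (abs_le.mp (A.trans SA)).1
  have B' := (abs_le.mp (B.trans SB)).1
  have Q' : C₁ / (4 * γ) * cellSq W i j ≤ _ := Q
  have goal := add_le_add Q' (add_le_add A' B')
  have eA : ∀ l r : ℝ, ∫ t in l..r, discFlux a₁₁ a₁₂ x y W i j t = ∫ t in l..r,
      a₁₁ (midpt x i, t) * (((y (j + 1) - t) * dX W i j + (t - y j) * dX W i (j + 1)) /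
        ((x (i + 1) - x i) * (y (j + 1) - y j))) +
      a₁₂ (midpt x i, t) * ((dY W i j + dY W (i + 1) j) / (2 * (y (j + 1) - y j))) :=
    fun l r => rfl
  have eB : ∀ l r : ℝ, ∫ t in l..r,
      discFlux (a₂₂ ∘ Prod.swap) (a₂₁ ∘ Prod.swap) y x (flipNodal W) j i t = ∫ t in l..r,
      a₂₂ (t, midpt y j) * (((x (i + 1) - t) * dY W i j + (t - x i) * dY W (i + 1) j) /
        ((y (j + 1) - y j) * (x (i + 1) - x i))) +
      a₂₁ (t, midpt y j) * ((dX W i j + dX W i (j + 1)) / (2 * (x (i + 1) - x i))) :=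
    fun l r => rfl
  have g1 : dX (flipNodal W) j i = dY W i j := rfl
  have g2 : dX (flipNodal W) j (i + 1) = dY W (i + 1) j := rfl
  rw [eA, eA, eB, eB, g1, g2]
  simp only [midpt] at goal ⊢
  linarith

end FVE

namespace FVE

/-! ### The bilinear function on an element and the discrete Poincaré inequality -/

/-- The bilinear function on the element `(i, j)` with nodal values `W`. -/
noncomputable def bil (x y : ℕ → ℝ) (W : ℕ → ℕ → ℝ) (i j : ℕ) (p : ℝ × ℝ) : ℝ :=
  ((x (i + 1) - p.1) * ((y (j + 1) - p.2) * W i j + (p.2 - y j) * W i (j + 1)) +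
    (p.1 - x i) * ((y (j + 1) - p.2) * W (i + 1) j + (p.2 - y j) * W (i + 1) (j + 1))) /
    ((x (i + 1) - x i) * (y (j + 1) - y j))

theorem continuous_bil (x y : ℕ → ℝ) (W : ℕ → ℕ → ℝ) (i j : ℕ) : Continuous (bil x y W i j) := by
  unfold bil; fun_prop

/-- The sum of the squares of the nodal values at the vertices of an element. -/
def cornerSq (W : ℕ → ℕ → ℝ) (i j : ℕ) : ℝ :=
  W i j ^ 2 + W (i + 1) j ^ 2 + W i (j + 1) ^ 2 + W (i + 1) (j + 1) ^ 2

theorem cornerSq_nonneg (V : ℕ → ℕ → ℝ) (i j : ℕ) : 0 ≤ cornerSq V i j := by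
  unfold cornerSq; positivity

theorem abs_corner_le (V : ℕ → ℕ → ℝ) {i j k l : ℕ} (hk : k = i ∨ k = i + 1)
    (hl : l = j ∨ l = j + 1) : |V k l| ≤ √(cornerSq V i j) := by
  refine Real.abs_le_sqrt ?_
  unfold cornerSq
  have h1 := sq_nonneg (V i j)
  have h2 := sq_nonneg (V (i + 1) j)
  have h3 := sq_nonneg (V i (j + 1))
  have h4 := sq_nonneg (V (i + 1) (j + 1))
  rcases hk with rfl | rfl <;> rcases hl with rfl | rfl <;> linarith

theorem abs_corner_sub_le (V : ℕ → ℕ → ℝ) {i j k l k' l' : ℕ} (hk : k = i ∨ k = i + 1)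
    (hl : l = j ∨ l = j + 1) (hk' : k' = i ∨ k' = i + 1) (hl' : l' = j ∨ l' = j + 1) :
    |V k' l' - V k l| ≤ 2 * √(cellSq V i j) := by
  have h1 := abs_le.mp (abs_dX_le V i j)
  have h2 := abs_le.mp (abs_dX_succ_le V i j)
  have h3 := abs_le.mp (abs_dY_le V i j)
  have h4 := abs_le.mp (abs_dY_succ_le V i j)
  simp only [dX, dY] at h1 h2 h3 h4
  rcases hk with rfl | rfl <;> rcases hl with rfl | rfl <;> rcases hk' with rfl | rfl <;>
    rcases hl' with rfl | rfl <;> refine abs_le.mpr ⟨?_, ?_⟩ <;> linarith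

/-- On the element, the bilinear function is a convex combination of its nodal values. -/
theorem abs_bil_sub_le {x y : ℕ → ℝ} {W : ℕ → ℕ → ℝ} {i j : ℕ} {p : ℝ × ℝ} {v B : ℝ}
    (hx : x i < x (i + 1)) (hy : y j < y (j + 1))
    (hp : p ∈ Set.Icc (x i) (x (i + 1)) ×ˢ Set.Icc (y j) (y (j + 1)))
    (hB : ∀ k l, (k = i ∨ k = i + 1) → (l = j ∨ l = j + 1) → |W k l - v| ≤ B) :
    |bil x y W i j p - v| ≤ B := by
  have hx' := sub_pos.mpr hx
  have hy' := sub_pos.mpr hy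
  have hp1 := hp.1
  have hp2 := hp.2
  have e : bil x y W i j p - v = ((x (i + 1) - p.1) * ((y (j + 1) - p.2) * (W i j - v) +
      (p.2 - y j) * (W i (j + 1) - v)) + (p.1 - x i) * ((y (j + 1) - p.2) * (W (i + 1) j - v) +
      (p.2 - y j) * (W (i + 1) (j + 1) - v))) / ((x (i + 1) - x i) * (y (j + 1) - y j)) := by
    unfold bil; field_simp; ring
  have b1 := hB i j (Or.inl rfl) (Or.inl rfl)
  have b2 := hB i (j + 1) (Or.inl rfl) (Or.inr rfl)
  have b3 := hB (i + 1) j (Or.inr rfl) (Or.inl rfl)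
  have b4 := hB (i + 1) (j + 1) (Or.inr rfl) (Or.inr rfl)
  have q1 := sub_nonneg.mpr hp1.1
  have q2 := sub_nonneg.mpr hp1.2
  have q3 := sub_nonneg.mpr hp2.1
  have q4 := sub_nonneg.mpr hp2.2
  rw [e, abs_div, abs_of_pos (mul_pos hx' hy'), div_le_iff₀ (mul_pos hx' hy')]
  have comb : ∀ {s t u v' : ℝ}, 0 ≤ s → 0 ≤ t → ∀ {U : ℝ}, |u| ≤ U → |v'| ≤ U →
      |s * u + t * v'| ≤ (s + t) * U := by
    intro s t u v' hs ht U hu hv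
    refine (abs_add_le _ _).trans ?_
    rw [abs_mul, abs_mul, abs_of_nonneg hs, abs_of_nonneg ht, add_mul]
    gcongr
  refine (comb q2 q1 (comb q4 q3 b1 b2) (comb q4 q3 b3 b4)).trans (le_of_eq (by ring))

theorem abs_bil_le {x y : ℕ → ℝ} {W : ℕ → ℕ → ℝ} {i j : ℕ} {p : ℝ × ℝ}
    (hx : x i < x (i + 1)) (hy : y j < y (j + 1))
    (hp : p ∈ Set.Icc (x i) (x (i + 1)) ×ˢ Set.Icc (y j) (y (j + 1))) :
    |bil x y W i j p| ≤ √(cornerSq W i j) := by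
  simpa using abs_bil_sub_le (v := 0) hx hy hp
    (fun k l hk hl => by simpa using abs_corner_le W hk hl)

theorem sum_increments_eq (z : ℕ → ℝ) (n : ℕ) :
    ∑ i ∈ Finset.range n, (z (i + 1) - z i) = z n - z 0 := Finset.sum_range_sub z n

/-- The discrete Poincaré inequality. -/
theorem sum_cornerSq_le {n m : ℕ} {x y : ℕ → ℝ} {γ h : ℝ} {W : ℕ → ℕ → ℝ}
    (H : IsGrid n m x y γ h) (hW : ∀ j ≤ m, W 0 j = 0) :
    ∑ i ∈ Finset.range n, ∑ j ∈ Finset.range m,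
        (x (i + 1) - x i) * (y (j + 1) - y j) * cornerSq W i j
      ≤ 2 * (x n - x 0) ^ 2 * γ * nodalEnergy n m W := by
  -- The one-dimensional Dirichlet energy along the `j`-th grid line. Starting from the zero value
  -- on the left side, every nodal value on this line is a sum of increments, and the weighted
  -- Cauchy-Schwarz inequality bounds its square by the length of the line times `R j`.
  set R : ℕ → ℝ := fun j => ∑ i ∈ Finset.range n, dX W i j ^ 2 / (x (i + 1) - x i) with hR
  have hx0 : 0 ≤ x n - x 0 :=
    sub_nonneg.mpr (le_of_forall_step (fun i hi => (H.x_lt i hi).le) (Nat.zero_le n) le_rfl)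
  have hWR : ∀ j ≤ m, ∀ k ≤ n, W k j ^ 2 ≤ (x n - x 0) * R j := fun j hj k hk => by
    have h1 : W k j = ∑ i ∈ Finset.range k, dX W i j := by
      have := Finset.sum_range_sub (fun i => W i j) k
      simp only [hW j hj, sub_zero] at this
      exact this.symm
    have h2 : |W k j| ≤ ∑ i ∈ Finset.range n, |dX W i j| := by
      rw [h1]
      refine (Finset.abs_sum_le_sum_abs _ _).trans ?_
      exact Finset.sum_le_sum_of_subset_of_nonneg (Finset.range_mono hk) fun _ _ _ => abs_nonneg _
    rw [← sq_abs, ← sum_increments_eq x n]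
    refine (pow_le_pow_left₀ (abs_nonneg _) h2 2).trans ?_
    refine Finset.sum_sq_le_sum_mul_sum_of_sq_le_mul _ (fun i hi => ?_) (fun i hi => ?_)
      (fun i hi => ?_)
    · exact (sub_pos.mpr (H.x_lt i (Finset.mem_range.mp hi))).le
    · exact div_nonneg (sq_nonneg _) (sub_pos.mpr (H.x_lt i (Finset.mem_range.mp hi))).le
    · rw [sq_abs, mul_div_cancel₀ _ (sub_pos.mpr (H.x_lt i (Finset.mem_range.mp hi))).ne']
  calc _ ≤ ∑ i ∈ Finset.range n, ∑ j ∈ Finset.range m,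
        (x (i + 1) - x i) * ((y (j + 1) - y j) * (2 * (x n - x 0) * (R j + R (j + 1)))) := by
        refine Finset.sum_le_sum fun i hi => Finset.sum_le_sum fun j hj => ?_
        have hi := Finset.mem_range.mp hi
        have hj := Finset.mem_range.mp hj
        rw [mul_assoc]
        have hx := (sub_pos.mpr (H.x_lt i hi)).le
        have hy := (sub_pos.mpr (H.y_lt j hj)).le
        refine mul_le_mul_of_nonneg_left (mul_le_mul_of_nonneg_left ?_ hy) hx
        unfold cornerSq
        linarith [hWR j hj.le i hi.le, hWR j hj.le (i + 1) hi, hWR (j + 1) hj i hi.le,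
          hWR (j + 1) hj (i + 1) hi]
    _ = (x n - x 0) * ∑ j ∈ Finset.range m,
        ((y (j + 1) - y j) * (2 * (x n - x 0) * (R j + R (j + 1)))) := by
        simp_rw [← Finset.mul_sum]
        rw [← Finset.sum_mul, sum_increments_eq]
    _ = 2 * (x n - x 0) ^ 2 * ∑ i ∈ Finset.range n, ∑ j ∈ Finset.range m,
        (y (j + 1) - y j) / (x (i + 1) - x i) * (dX W i j ^ 2 + dX W i (j + 1) ^ 2) := by
        rw [Finset.sum_comm, Finset.mul_sum, Finset.mul_sum]
        refine Finset.sum_congr rfl fun j _ => ?_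
        simp only [hR]
        rw [← Finset.sum_add_distrib, Finset.mul_sum, Finset.mul_sum, Finset.mul_sum,
          Finset.mul_sum]
        refine Finset.sum_congr rfl fun i _ => ?_
        ring
    _ ≤ 2 * (x n - x 0) ^ 2 * ∑ i ∈ Finset.range n, ∑ j ∈ Finset.range m, γ * cellSq W i j := by
        refine mul_le_mul_of_nonneg_left (Finset.sum_le_sum fun i hi =>
          Finset.sum_le_sum fun j hj => ?_) (by positivity)
        have hi := Finset.mem_range.mp hi
        have hj := Finset.mem_range.mp hj
        have hx := sub_pos.mpr (H.x_lt i hi)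
        have hy := sub_pos.mpr (H.y_lt j hj)
        have hr : (y (j + 1) - y j) / (x (i + 1) - x i) ≤ γ := by
          rw [div_le_iff₀ hx]; exact H.y_ratio i hi j hj
        have h0 : 0 ≤ (y (j + 1) - y j) / (x (i + 1) - x i) := (div_pos hy hx).le
        refine mul_le_mul hr ?_ (by positivity) (h0.trans hr)
        unfold cellSq
        linarith [sq_nonneg (dY W i j), sq_nonneg (dY W (i + 1) j)]
    _ = _ := by
        simp_rw [← Finset.mul_sum]
        rw [nodalEnergy]
        ring

/-! ### The zeroth order terms -/

/-- `P` takes almost everywhere on each element one of the values of `V` at the vertices. -/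
def IsStepOf (n m : ℕ) (x y : ℕ → ℝ) (V : ℕ → ℕ → ℝ) (P : ℝ × ℝ → ℝ) : Prop :=
  Measurable P ∧ ∀ i < n, ∀ j < m,
    ∀ᵐ p ∂(volume.restrict (Set.Icc (x i) (x (i + 1)) ×ˢ Set.Icc (y j) (y (j + 1)))),
      ∃ k l, (k = i ∨ k = i + 1) ∧ (l = j ∨ l = j + 1) ∧ P p = V k l

/-- The form `∫ c w P` for the piecewise bilinear function `w` with nodal values `W`. -/
noncomputable def cform (n m : ℕ) (x y : ℕ → ℝ) (c P : ℝ × ℝ → ℝ) (W : ℕ → ℕ → ℝ) : ℝ :=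
  ∑ i ∈ Finset.range n, ∑ j ∈ Finset.range m,
    boxInt (fun p => c p * bil x y W i j p * P p) (x i) (x (i + 1)) (y j) (y (j + 1))

theorem ae_mem_box (a b c d : ℝ) :
    ∀ᵐ p ∂(volume.restrict (Set.Icc a b ×ˢ Set.Icc c d)), p ∈ Set.Icc a b ×ˢ Set.Icc c d :=
  ae_restrict_mem (measurableSet_Icc.prod measurableSet_Icc)

theorem IsStepOf.ae_abs_le {n m : ℕ} {x y : ℕ → ℝ} {V : ℕ → ℕ → ℝ} {P : ℝ × ℝ → ℝ}
    (hP : IsStepOf n m x y V P) {i j : ℕ} (hi : i < n) (hj : j < m) :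
    ∀ᵐ p ∂(volume.restrict (Set.Icc (x i) (x (i + 1)) ×ˢ Set.Icc (y j) (y (j + 1)))),
      |P p| ≤ √(cornerSq V i j) := by
  filter_upwards [hP.2 i hi j hj] with p ⟨k, l, hk, hl, h⟩
  rw [h]
  exact abs_corner_le V hk hl

theorem integrableOn_mul_step {n m : ℕ} {x y : ℕ → ℝ} {V : ℕ → ℕ → ℝ} {c g P : ℝ × ℝ → ℝ} {M : ℝ}
    (hP : IsStepOf n m x y V P) {i j : ℕ} (hi : i < n) (hj : j < m) (hc : Measurable c)
    (hcM : ∀ p, |c p| ≤ M) (hg : Continuous g) :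
    IntegrableOn (fun p => c p * g p * P p)
      (Set.Icc (x i) (x (i + 1)) ×ˢ Set.Icc (y j) (y (j + 1))) := by
  have h1 : IntegrableOn (fun p => c p * g p) _ :=
    Integrable.bdd_mul (c := M) (integrableOn_box_of_continuous hg (x i) (x (i + 1)) (y j)
      (y (j + 1))) hc.aestronglyMeasurable (Filter.Eventually.of_forall hcM)
  exact Integrable.mul_bdd (c := √(cornerSq V i j)) h1 hP.1.aestronglyMeasurable
    (hP.ae_abs_le hi hj)

/-- The zeroth order term is nonnegative up to a small multiple of the energy. -/
theorem cform_self_ge {n m : ℕ} {x y : ℕ → ℝ} {γ h M : ℝ} {W : ℕ → ℕ → ℝ} {c P : ℝ × ℝ → ℝ}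
    (H : IsGrid n m x y γ h) (hh : 0 ≤ h) (hW : ∀ j ≤ m, W 0 j = 0)
    (hc : Measurable c) (hc0 : ∀ p, 0 ≤ c p) (hcM : ∀ p, c p ≤ M) (hP : IsStepOf n m x y W P) :
    -(2 * M * √(2 * (x n - x 0) ^ 2 * γ) * h) * nodalEnergy n m W ≤ cform n m x y c P W := by
  have hM : 0 ≤ M := (hc0 0).trans (hcM 0)
  have hcell : ∀ i < n, ∀ j < m, -(2 * M * h * (√((x (i + 1) - x i) * (y (j + 1) - y j) *
      cornerSq W i j) * √(cellSq W i j))) ≤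
      boxInt (fun p => c p * bil x y W i j p * P p) (x i) (x (i + 1)) (y j) (y (j + 1)) :=
    fun i hi j hj => by
      have hx := H.x_lt i hi
      have hy := H.y_lt j hj
      have hx' := sub_pos.mpr hx
      have hy' := sub_pos.mpr hy
      have hv := volume_box hx.le hy.le
      have low : -(M * √(cornerSq W i j) * (2 * √(cellSq W i j))) *
          ((x (i + 1) - x i) * (y (j + 1) - y j)) ≤
          boxInt (fun p => c p * bil x y W i j p * P p) (x i) (x (i + 1)) (y j) (y (j + 1)) := by
        have hconst : ∫ p in Set.Icc (x i) (x (i + 1)) ×ˢ Set.Icc (y j) (y (j + 1)),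
            -(M * √(cornerSq W i j) * (2 * √(cellSq W i j))) =
            -(M * √(cornerSq W i j) * (2 * √(cellSq W i j))) *
              ((x (i + 1) - x i) * (y (j + 1) - y j)) := by
          rw [setIntegral_const, hv, smul_eq_mul, mul_comm]
        rw [← hconst]
        refine integral_mono_ae (integrableOn_box_of_continuous continuous_const _ _ _ _)
          (integrableOn_mul_step hP hi hj hc (fun p => by rw [abs_of_nonneg (hc0 p)]; exact hcM p)
            (continuous_bil x y W i j)) ?_
        filter_upwards [hP.2 i hi j hj, ae_mem_box _ _ _ _] with p ⟨k, l, hk, hl, hkl⟩ hp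
        have h1 := abs_bil_le (W := W) hx hy hp
        have h2 : |bil x y W i j p - P p| ≤ 2 * √(cellSq W i j) := by
          rw [hkl]
          exact abs_bil_sub_le hx hy hp fun k' l' hk' hl' => abs_corner_sub_le W hk hl hk' hl'
        -- The square has the right sign because `c ≥ 0`. The remainder contains the deviation of
        -- the bilinear function from one of its own nodal values, which is bounded by the
        -- increments of the element.
        have e : c p * bil x y W i j p * P p = c p * bil x y W i j p ^ 2 -
            c p * bil x y W i j p * (bil x y W i j p - P p) := by ring
        have h3 : |c p * bil x y W i j p * (bil x y W i j p - P p)| ≤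
            M * √(cornerSq W i j) * (2 * √(cellSq W i j)) := by
          rw [abs_mul, abs_mul, abs_of_nonneg (hc0 p)]
          have := hcM p
          gcongr
        have h4 : 0 ≤ c p * bil x y W i j p ^ 2 := mul_nonneg (hc0 p) (sq_nonneg _)
        rw [e]
        linarith [(abs_le.mp h3).2]
      refine le_trans ?_ low
      -- Of the two factors `r` in the area `r * r`, one is bounded by `h`. The other stays with the
      -- nodal values, in the form needed for the discrete Poincaré inequality.
      rw [Real.sqrt_mul (mul_pos hx' hy').le]
      have hs := sqrt_mul_le_of_le hx'.le hy'.le (H.x_le i hi) (H.y_le j hj)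
      have hss := Real.mul_self_sqrt (mul_pos hx' hy').le
      set r := √((x (i + 1) - x i) * (y (j + 1) - y j))
      have hr0 : 0 ≤ r := Real.sqrt_nonneg _
      have : 2 * M * (√(cornerSq W i j) * √(cellSq W i j)) * (r * r) ≤
          2 * M * (√(cornerSq W i j) * √(cellSq W i j)) * (h * r) := by gcongr
      rw [← hss]
      linarith
  have hsum : ∑ i ∈ Finset.range n, ∑ j ∈ Finset.range m,
      √((x (i + 1) - x i) * (y (j + 1) - y j) * cornerSq W i j) * √(cellSq W i j) ≤
      √(2 * (x n - x 0) ^ 2 * γ) * nodalEnergy n m W := by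
    -- `sum_sqrt_mul_sqrt_le` asks for nonnegativity at all indices, and outside the grid the
    -- product of the mesh widths has no sign. Hence the absolute value, which changes nothing
    -- inside the grid.
    have h1 : ∑ i ∈ Finset.range n, ∑ j ∈ Finset.range m,
      √((x (i + 1) - x i) * (y (j + 1) - y j) * cornerSq W i j) * √(cellSq W i j) =
      ∑ i ∈ Finset.range n, ∑ j ∈ Finset.range m,
      √(|(x (i + 1) - x i) * (y (j + 1) - y j)| * cornerSq W i j) * √(cellSq W i j) := by
      refine Finset.sum_congr rfl fun i hi => Finset.sum_congr rfl fun j hj => ?_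
      rw [abs_of_pos (mul_pos (sub_pos.mpr (H.x_lt i (Finset.mem_range.mp hi)))
        (sub_pos.mpr (H.y_lt j (Finset.mem_range.mp hj))))]
    rw [h1]
    refine (sum_sqrt_mul_sqrt_le (fun i j => mul_nonneg (abs_nonneg _) (cornerSq_nonneg W i j))
      (fun i j => cellSq_nonneg W i j)).trans ?_
    have h2 : ∑ i ∈ Finset.range n, ∑ j ∈ Finset.range m,
        |(x (i + 1) - x i) * (y (j + 1) - y j)| * cornerSq W i j ≤
        2 * (x n - x 0) ^ 2 * γ * nodalEnergy n m W := by
      refine le_trans (le_of_eq ?_) (sum_cornerSq_le H hW)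
      refine Finset.sum_congr rfl fun i hi => Finset.sum_congr rfl fun j hj => ?_
      rw [abs_of_pos (mul_pos (sub_pos.mpr (H.x_lt i (Finset.mem_range.mp hi)))
        (sub_pos.mpr (H.y_lt j (Finset.mem_range.mp hj))))]
    have h3 := nodalEnergy_nonneg n m W
    calc _ ≤ √(2 * (x n - x 0) ^ 2 * γ * nodalEnergy n m W) * √(nodalEnergy n m W) := by
          gcongr
          exact le_rfl
      _ = _ := by rw [Real.sqrt_mul' _ h3, mul_assoc, Real.mul_self_sqrt h3]
  have hfin : -(2 * M * h * ∑ i ∈ Finset.range n, ∑ j ∈ Finset.range m,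
      √((x (i + 1) - x i) * (y (j + 1) - y j) * cornerSq W i j) * √(cellSq W i j)) ≤
      cform n m x y c P W := by
    unfold cform
    rw [Finset.mul_sum, ← Finset.sum_neg_distrib]
    refine Finset.sum_le_sum fun i hi => ?_
    rw [Finset.mul_sum, ← Finset.sum_neg_distrib]
    exact Finset.sum_le_sum fun j hj => hcell i (Finset.mem_range.mp hi) j (Finset.mem_range.mp hj)
  refine le_trans ?_ hfin
  have := mul_le_mul_of_nonneg_left hsum (by positivity : 0 ≤ 2 * M * h)
  linarith

/-- The consistency error of the zeroth order term is of second order. -/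
theorem abs_boxInt_sub_cform_le {n m : ℕ} {x y : ℕ → ℝ} {γ h M : ℝ} {w : ℝ × ℝ → ℝ}
    {V : ℕ → ℕ → ℝ} {c P : ℝ × ℝ → ℝ}
    (H : IsGrid n m x y γ h) (hh1 : h ≤ 1) (hw : ContDiff ℝ ∞ w)
    (hV : ∀ j ≤ m, V 0 j = 0) (hc : Measurable c) (hcM : ∀ p, |c p| ≤ M)
    (hP : IsStepOf n m x y V P) :
    |(∑ i ∈ Finset.range n, ∑ j ∈ Finset.range m,
        boxInt (fun p => c p * w p * P p) (x i) (x (i + 1)) (y j) (y (j + 1))) -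
        cform n m x y c P (fun i j => w (x i, y j))| ≤
      3 * M * √(2 * (x n - x 0) ^ 2 * γ) * h ^ 2 *
        (√(sobEnergy w (x 0) (x n) (y 0) (y m)) * √(nodalEnergy n m V)) := by
  have hM : 0 ≤ M := (abs_nonneg _).trans (hcM 0)
  set W : ℕ → ℕ → ℝ := fun i j => w (x i, y j) with hWdef
  have hcell : ∀ i < n, ∀ j < m,
      |boxInt (fun p => c p * w p * P p) (x i) (x (i + 1)) (y j) (y (j + 1)) -
        boxInt (fun p => c p * bil x y W i j p * P p) (x i) (x (i + 1)) (y j) (y (j + 1))| ≤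
      3 * M * h ^ 2 * (√(sobEnergy w (x i) (x (i + 1)) (y j) (y (j + 1))) *
        √((x (i + 1) - x i) * (y (j + 1) - y j) * cornerSq V i j)) := fun i hi j hj => by
    have hx := H.x_lt i hi
    have hy := H.y_lt j hj
    have hx' := sub_pos.mpr hx
    have hy' := sub_pos.mpr hy
    have cw := hw.continuous
    have cb := continuous_bil x y W i j
    have i1 := integrableOn_mul_step hP hi hj hc hcM cw
    have i2 := integrableOn_mul_step hP hi hj hc hcM cb
    have e1 := boxInt_abs_interp_error_le hw hx hy
    have n1 := boxInt_abs_le_sobEnergy hw hx.le hy.le (2, 0) (by norm_num)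
    have n2 := boxInt_abs_le_sobEnergy hw hx.le hy.le (0, 2) (by norm_num)
    have n3 := boxInt_abs_le_sobEnergy hw hx.le hy.le (1, 2) (by norm_num)
    have n1' : boxInt (fun p => |pd 0 (pd 0 w) p|) (x i) (x (i + 1)) (y j) (y (j + 1)) ≤ _ := n1
    have n2' : boxInt (fun p => |pd 1 (pd 1 w) p|) (x i) (x (i + 1)) (y j) (y (j + 1)) ≤ _ := n2
    have n3' : boxInt (fun p => |pd 0 (pd 1 (pd 1 w)) p|) (x i) (x (i + 1)) (y j) (y (j + 1)) ≤ _ :=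
      n3
    -- The factor `r` that arises from passing to `L²` norms on the element is exactly the weight of
    -- the nodal values of `V` in the discrete Poincaré inequality.
    rw [Real.sqrt_mul (mul_pos hx' hy').le]
    set r := √((x (i + 1) - x i) * (y (j + 1) - y j))
    set N := √(sobEnergy w (x i) (x (i + 1)) (y j) (y (j + 1)))
    have hrN : 0 ≤ r * N := mul_nonneg (Real.sqrt_nonneg _) (Real.sqrt_nonneg _)
    have e2 : boxInt (fun p => |w p - bil x y W i j p|) (x i) (x (i + 1)) (y j) (y (j + 1)) ≤
        3 * h ^ 2 * (r * N) := by
      have hpos := mul_pos hx' hy'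
      have e3 : boxInt (fun p => |(x (i + 1) - x i) * (y (j + 1) - y j) * w p -
        ((x (i + 1) - p.1) * ((y (j + 1) - p.2) * w (x i, y j) +
          (p.2 - y j) * w (x i, y (j + 1))) + (p.1 - x i) * ((y (j + 1) - p.2) *
          w (x (i + 1), y j) + (p.2 - y j) * w (x (i + 1), y (j + 1))))|)
          (x i) (x (i + 1)) (y j) (y (j + 1)) = (x (i + 1) - x i) * (y (j + 1) - y j) *
          boxInt (fun p => |w p - bil x y W i j p|) (x i) (x (i + 1)) (y j) (y (j + 1)) := by
        unfold boxInt
        rw [← integral_const_mul]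
        congr 1
        funext p
        rw [← abs_of_pos hpos, ← abs_mul, abs_of_pos hpos]
        unfold bil
        field_simp
        rfl
      rw [e3] at e1
      refine (le_of_mul_le_mul_left e1 hpos).trans ?_
      have hx2 : (x (i + 1) - x i) ^ 2 ≤ h ^ 2 := pow_le_pow_left₀ hx'.le (H.x_le i hi) 2
      have hy2 : (y (j + 1) - y j) ^ 2 ≤ h ^ 2 := pow_le_pow_left₀ hy'.le (H.y_le j hj) 2
      have hx1 : x (i + 1) - x i ≤ 1 := (H.x_le i hi).trans hh1
      have B0 : ∀ g : ℝ × ℝ → ℝ, 0 ≤ boxInt (fun p => |g p|) (x i) (x (i + 1)) (y j) (y (j + 1)) :=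
        fun g => boxInt_nonneg (fun _ => abs_nonneg _) _ _ _ _
      calc _ ≤ h ^ 2 * (r * N) + h ^ 2 * (r * N + 1 * (r * N)) := by
            have := B0 (pd 0 (pd 0 w))
            have := B0 (pd 1 (pd 1 w))
            have := B0 (pd 0 (pd 1 (pd 1 w)))
            gcongr
        _ = _ := by ring
    have e4 : |boxInt (fun p => c p * w p * P p) (x i) (x (i + 1)) (y j) (y (j + 1)) -
        boxInt (fun p => c p * bil x y W i j p * P p) (x i) (x (i + 1)) (y j) (y (j + 1))| ≤
        M * √(cornerSq V i j) *
        boxInt (fun p => |w p - bil x y W i j p|) (x i) (x (i + 1)) (y j) (y (j + 1)) := by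
      unfold boxInt
      rw [← integral_sub i1 i2, ← integral_const_mul]
      refine (abs_integral_le_integral_abs).trans (integral_mono_ae (i1.sub i2).abs
        ((integrableOn_box_of_continuous (cw.sub cb).abs _ _ _ _).const_mul _) ?_)
      filter_upwards [hP.ae_abs_le hi hj] with p hp
      have e : c p * w p * P p - c p * bil x y W i j p * P p =
        c p * P p * (w p - bil x y W i j p) := by ring
      simp only [e, abs_mul]
      have := hcM p
      gcongr
    refine e4.trans ((mul_le_mul_of_nonneg_left e2 (by positivity)).trans (le_of_eq (by ring)))
  unfold cform
  simp_rw [← Finset.sum_sub_distrib]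
  have hsum : ∑ i ∈ Finset.range n, ∑ j ∈ Finset.range m,
      √(sobEnergy w (x i) (x (i + 1)) (y j) (y (j + 1))) *
        √(|(x (i + 1) - x i) * (y (j + 1) - y j)| * cornerSq V i j) ≤
      √(2 * (x n - x 0) ^ 2 * γ) *
        (√(sobEnergy w (x 0) (x n) (y 0) (y m)) * √(nodalEnergy n m V)) := by
    refine (sum_sqrt_mul_sqrt_le (fun i j => sobEnergy_nonneg _ _ _ _ _)
      (fun i j => mul_nonneg (abs_nonneg _) (cornerSq_nonneg V i j))).trans ?_
    rw [sum_sobEnergy hw (fun i hi => (H.x_lt i hi).le) (fun j hj => (H.y_lt j hj).le)]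
    have h2 : ∑ i ∈ Finset.range n, ∑ j ∈ Finset.range m,
        |(x (i + 1) - x i) * (y (j + 1) - y j)| * cornerSq V i j ≤
        2 * (x n - x 0) ^ 2 * γ * nodalEnergy n m V := by
      refine le_trans (le_of_eq ?_) (sum_cornerSq_le H hV)
      refine Finset.sum_congr rfl fun i hi => Finset.sum_congr rfl fun j hj => ?_
      rw [abs_of_pos (mul_pos (sub_pos.mpr (H.x_lt i (Finset.mem_range.mp hi)))
        (sub_pos.mpr (H.y_lt j (Finset.mem_range.mp hj))))]
    have h3 := Real.sqrt_le_sqrt h2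
    rw [Real.sqrt_mul' _ (nodalEnergy_nonneg n m V)] at h3
    calc _ ≤ √(sobEnergy w (x 0) (x n) (y 0) (y m)) *
          (√(2 * (x n - x 0) ^ 2 * γ) * √(nodalEnergy n m V)) := by gcongr
      _ = _ := by ring
  calc _ ≤ 3 * M * h ^ 2 * ∑ i ∈ Finset.range n, ∑ j ∈ Finset.range m,
      √(sobEnergy w (x i) (x (i + 1)) (y j) (y (j + 1))) *
        √(|(x (i + 1) - x i) * (y (j + 1) - y j)| * cornerSq V i j) := by
        rw [Finset.mul_sum]
        refine (Finset.abs_sum_le_sum_abs _ _).trans (Finset.sum_le_sum fun i hi => ?_)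
        rw [Finset.mul_sum]
        refine (Finset.abs_sum_le_sum_abs _ _).trans (Finset.sum_le_sum fun j hj => ?_)
        have hi := Finset.mem_range.mp hi
        have hj := Finset.mem_range.mp hj
        rw [abs_of_pos (mul_pos (sub_pos.mpr (H.x_lt i hi)) (sub_pos.mpr (H.y_lt j hj)))]
        exact hcell i hi j hj
    _ ≤ 3 * M * h ^ 2 * (√(2 * (x n - x 0) ^ 2 * γ) *
        (√(sobEnergy w (x 0) (x n) (y 0) (y m)) * √(nodalEnergy n m V))) := by gcongr
    _ = _ := by ring

end FVE

namespace FVE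

/-! ### Weak derivatives -/

theorem pd_const_mul {f : ℝ × ℝ → ℝ} (hf : ContDiff ℝ ∞ f) (k : ℝ) (i : Fin 2) :
    pd i (fun p => k * f p) = fun p => k * pd i f p := by
  funext p
  have h := ((differentiable_of_contDiff hf p).hasFDerivAt.const_mul k).fderiv
  simp only [pd, h]
  rfl

theorem pd_comp_affine {f : ℝ × ℝ → ℝ} (hf : ContDiff ℝ ∞ f) (z : ℝ × ℝ) (k : ℝ) (i : Fin 2) :
    pd i (fun p => f (z + k • p)) = fun p => k * pd i f (z + k • p) := by
  funext p
  have h1 : HasFDerivAt (fun p : ℝ × ℝ => z + k • p) (k • ContinuousLinearMap.id ℝ (ℝ × ℝ)) p :=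
    ((hasFDerivAt_id p).const_smul k).const_add z
  have h := ((differentiable_of_contDiff hf (z + k • p)).hasFDerivAt.comp p h1).fderiv
  have h' : fderiv ℝ (fun p => f (z + k • p)) p = _ := h
  simp only [pd, h']
  simp

theorem contDiff_comp_affine {f : ℝ × ℝ → ℝ} (hf : ContDiff ℝ ∞ f) (z : ℝ × ℝ) (k : ℝ) :
    ContDiff ℝ ∞ (fun p => f (z + k • p)) :=
  hf.comp (contDiff_const.add (contDiff_id.const_smul k))

theorem pdMulti_comp_affine {f : ℝ × ℝ → ℝ} (hf : ContDiff ℝ ∞ f) (z : ℝ × ℝ) (k : ℝ)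
    (α : ℕ × ℕ) :
    pdMulti α (fun p => f (z + k • p)) = fun p => k ^ (α.1 + α.2) * pdMulti α f (z + k • p) := by
  have it : ∀ (i : Fin 2) (n : ℕ) (e : ℝ) {g : ℝ × ℝ → ℝ}, ContDiff ℝ ∞ g →
      (pd i)^[n] (fun p => e * g (z + k • p)) =
        fun p => e * k ^ n * ((pd i)^[n] g) (z + k • p) := by
    intro i n
    induction n with
    | zero => intro e g _; simp
    | succ n ih =>
      intro e g hg
      rw [Function.iterate_succ_apply, pd_const_mul (contDiff_comp_affine hg z k),
        pd_comp_affine hg]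
      simp_rw [← mul_assoc]
      rw [ih (e * k) (contDiff_pd hg i), Function.iterate_succ_apply]
      funext p
      ring
  have h1 := it 1 α.2 1 hf
  simp only [one_mul] at h1
  rw [pdMulti, h1, it 0 α.1 _ (contDiff_pd_iterate hf 1 _)]
  funext p
  rw [pdMulti, pow_add]
  ring

theorem IsTest.integrableOn_mul {U : Set (ℝ × ℝ)} {φ g : ℝ × ℝ → ℝ} (hφ : IsTest U φ)
    (hg : LocallyIntegrableOn g U) : IntegrableOn (fun p => g p * φ p) U := by
  have h1 : IntegrableOn g (tsupport φ) := hg.integrableOn_compact_subset hφ.2.2 hφ.2.1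
  obtain ⟨B, hB⟩ := hφ.1.continuous.bounded_above_of_compact_support hφ.2.1
  have h2 : IntegrableOn (fun p => g p * φ p) (tsupport φ) :=
    Integrable.mul_bdd (c := B) h1 hφ.1.continuous.aestronglyMeasurable
      (Filter.Eventually.of_forall hB)
  refine (IntegrableOn.integrable_of_forall_notMem_eq_zero h2 fun p hp => ?_).integrableOn
  rw [image_eq_zero_of_notMem_tsupport hp, mul_zero]

theorem pd_tsupport_subset (φ : ℝ × ℝ → ℝ) (i : Fin 2) : tsupport (pd i φ) ⊆ tsupport φ := by
  refine closure_minimal (fun p hp => ?_) (isClosed_tsupport φ)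
  by_contra h
  refine hp ?_
  have : fderiv ℝ φ p = 0 := by
    by_contra h'
    exact h (support_fderiv_subset ℝ h')
  simp [pd, this]

theorem IsTest.pd {U : Set (ℝ × ℝ)} {φ : ℝ × ℝ → ℝ} (hφ : IsTest U φ) (i : Fin 2) :
    IsTest U (pd i φ) :=
  ⟨contDiff_pd hφ.1 i, hφ.2.1.of_isClosed_subset (isClosed_tsupport _) (pd_tsupport_subset φ i), (pd_tsupport_subset φ i).trans hφ.2.2⟩

end FVE

namespace FVE

theorem IsTest.pd_iterate {U : Set (ℝ × ℝ)} {φ : ℝ × ℝ → ℝ} (hφ : IsTest U φ) (i : Fin 2) (n : ℕ) :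
    IsTest U ((FVE.pd i)^[n] φ) := by
  induction n with
  | zero => exact hφ
  | succ n ih => rw [Function.iterate_succ_apply']; exact ih.pd i

/-- The fundamental lemma of the calculus of variations. It is what makes `weakDeriv`, a choice,
interchangeable with any concrete weak derivative under an integral. -/
theorem IsWeakDeriv.ae_eq {U : Set (ℝ × ℝ)} (hU : IsOpen U) {α : ℕ × ℕ} {f g g' : ℝ × ℝ → ℝ}
    (h : IsWeakDeriv U α f g) (h' : IsWeakDeriv U α f g') : g =ᵐ[volume.restrict U] g' := by
  have hz : ∀ᵐ p ∂volume, p ∈ U → (g - g') p = 0 := by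
    refine IsOpen.ae_eq_zero_of_integral_contDiff_smul_eq_zero hU (h.2.1.sub h'.2.1)
      fun φ hφ hc hs => ?_
    have hφ' : IsTest U φ := ⟨hφ, hc, hs⟩
    have e1 := h.2.2 φ hφ'
    have e2 := h'.2.2 φ hφ'
    rw [e1] at e2
    have e3 : ∫ p in U, g p * φ p = ∫ p in U, g' p * φ p :=
      mul_left_cancel₀ (pow_ne_zero _ (by norm_num)) e2
    have e4 : ∫ p in U, (g p * φ p - g' p * φ p) = 0 := by
      rw [integral_sub (hφ'.integrableOn_mul h.2.1) (hφ'.integrableOn_mul h'.2.1), e3, sub_self]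
    rw [← e4, ← setIntegral_eq_integral_of_forall_compl_eq_zero (s := U) fun p hp => ?_]
    · refine integral_congr_ae (Filter.Eventually.of_forall fun p => ?_)
      simp only [smul_eq_mul, Pi.sub_apply]; ring
    · rw [image_eq_zero_of_notMem_tsupport fun hq => hp (hs hq), zero_smul]
  rw [Filter.EventuallyEq, ae_restrict_iff' hU.measurableSet]
  filter_upwards [hz] with p hp hpU
  exact sub_eq_zero.mp (hp hpU)

theorem isWeakDeriv_weakDeriv {U : Set (ℝ × ℝ)} {α : ℕ × ℕ} {f g : ℝ × ℝ → ℝ}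
    (h : IsWeakDeriv U α f g) : IsWeakDeriv U α f (weakDeriv U α f) := by
  have : ∃ g, IsWeakDeriv U α f g := ⟨g, h⟩
  rw [weakDeriv, dif_pos this]
  exact this.choose_spec

theorem weakDeriv_ae_eq {U : Set (ℝ × ℝ)} (hU : IsOpen U) {α : ℕ × ℕ} {f g : ℝ × ℝ → ℝ}
    (h : IsWeakDeriv U α f g) : weakDeriv U α f =ᵐ[volume.restrict U] g :=
  (isWeakDeriv_weakDeriv h).ae_eq hU h

theorem isWeakDeriv_zero {U : Set (ℝ × ℝ)} {f : ℝ × ℝ → ℝ} (hf : LocallyIntegrableOn f U) :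
    IsWeakDeriv U (0, 0) f f :=
  ⟨hf, hf, fun φ _ => by simp [pdMulti]⟩

theorem MemSobolev.weakDeriv_spec {U : Set (ℝ × ℝ)} (hU : IsOpen U) {m : ℕ} {q : ENNReal}
    {f : ℝ × ℝ → ℝ} (hf : MemSobolev m q U f) {α : ℕ × ℕ} (hα : α.1 + α.2 ≤ m) :
    IsWeakDeriv U α f (weakDeriv U α f) ∧ MemLp (weakDeriv U α f) q (volume.restrict U) := by
  obtain ⟨g, hg, hgp⟩ := hf α hα
  exact ⟨isWeakDeriv_weakDeriv hg, hgp.ae_eq (weakDeriv_ae_eq hU hg).symm⟩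

theorem MemSobolev.memLp {U : Set (ℝ × ℝ)} (hU : IsOpen U) {m : ℕ} {q : ENNReal}
    {f : ℝ × ℝ → ℝ} (hf : MemSobolev m q U f) : MemLp f q (volume.restrict U) := by
  obtain ⟨g, hg, hgp⟩ := hf (0, 0) (by simp)
  exact hgp.ae_eq (hg.ae_eq hU (isWeakDeriv_zero hg.1))

/-! ### Mollification -/

/-- The convolution of `g` with the kernel `φ`. -/
noncomputable def moll (φ g : ℝ × ℝ → ℝ) (p : ℝ × ℝ) : ℝ := ∫ q, g q * φ (p - q)

open Convolution in
theorem moll_eq_convolution (φ g : ℝ × ℝ → ℝ) :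
    moll φ g = g ⋆[ContinuousLinearMap.mul ℝ ℝ, volume] φ := rfl

theorem contDiff_moll {φ g : ℝ × ℝ → ℝ} (hφ : ContDiff ℝ ∞ φ) (hc : HasCompactSupport φ)
    (hg : LocallyIntegrable g) : ContDiff ℝ ∞ (moll φ g) :=
  hc.contDiff_convolution_right (ContinuousLinearMap.mul ℝ ℝ) hg hφ

theorem pd_moll {φ g : ℝ × ℝ → ℝ} (hφ : ContDiff ℝ ∞ φ) (hc : HasCompactSupport φ)
    (hg : LocallyIntegrable g) (i : Fin 2) : pd i (moll φ g) = moll (pd i φ) g := by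
  funext p
  have h := (hc.hasFDerivAt_convolution_right (ContinuousLinearMap.mul ℝ ℝ) hg
    (hφ.of_le (by simp)) p).fderiv
  rw [pd, moll_eq_convolution, h, convolution_precompR_apply _ hg (hc.fderiv ℝ)
    (hφ.continuous_fderiv (by simp))]
  rfl

theorem pdMulti_moll {φ g : ℝ × ℝ → ℝ} (hφ : ContDiff ℝ ∞ φ) (hc : HasCompactSupport φ)
    (hg : LocallyIntegrable g) (α : ℕ × ℕ) : pdMulti α (moll φ g) = moll (pdMulti α φ) g := by
  have ht : IsTest Set.univ φ := ⟨hφ, hc, Set.subset_univ _⟩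
  have it : ∀ (i : Fin 2) (n : ℕ) {ψ : ℝ × ℝ → ℝ}, IsTest Set.univ ψ →
      (pd i)^[n] (moll ψ g) = moll ((pd i)^[n] ψ) g := by
    intro i n
    induction n with
    | zero => intro ψ _; rfl
    | succ n ih => intro ψ hψ; rw [Function.iterate_succ_apply, pd_moll hψ.1 hψ.2.1 hg,
        ih (hψ.pd i), Function.iterate_succ_apply]
  rw [pdMulti, it 1 _ ht, it 0 _ (ht.pd_iterate 1 _), pdMulti]

/-- Mollification commutes with weak differentiation away from the boundary. -/
theorem moll_pdMulti_eq {U : Set (ℝ × ℝ)} (hU : IsOpen U) {α : ℕ × ℕ} {f g φ : ℝ × ℝ → ℝ}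
    (h : IsWeakDeriv U α f g) (hφ : ContDiff ℝ ∞ φ) (hc : HasCompactSupport φ) {p : ℝ × ℝ}
    (hp : ∀ q ∈ tsupport φ, p - q ∈ U) :
    moll (pdMulti α φ) (U.indicator f) p = moll φ (U.indicator g) p := by
  have e1 : (fun q => φ (p - q)) = fun q => φ (p + (-1 : ℝ) • q) := by
    funext q; simp [sub_eq_add_neg]
  -- The reflected and translated kernel is an admissible test function precisely because `p` minus
  -- the support of `φ` lies in `U`. The sign from the reflection cancels the sign in the definition
  -- of the weak derivative.
  have hη : IsTest U (fun q => φ (p - q)) := by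
    refine ⟨by rw [e1]; exact contDiff_comp_affine hφ p _, ?_, ?_⟩
    · exact hc.comp_homeomorph (Homeomorph.subLeft p)
    · refine (tsupport_comp_subset_preimage φ (f := fun q => p - q) (by fun_prop)).trans
        fun q hq => ?_
      simpa using hp _ hq
  have e2 := h.2.2 _ hη
  rw [e1, pdMulti_comp_affine hφ] at e2
  have e3 : ∀ k : ℝ × ℝ → ℝ, ∀ ψ : ℝ × ℝ → ℝ,
      moll ψ (U.indicator k) p = ∫ q in U, k q * ψ (p + (-1 : ℝ) • q) := fun k ψ => by
    rw [moll, ← integral_indicator hU.measurableSet]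
    congr 1
    funext q
    by_cases hq : q ∈ U
    · simp [hq, sub_eq_add_neg]
    · simp [hq]
  rw [e3, e3]
  have e4 : ∫ q in U, f q * ((-1) ^ (α.1 + α.2) * pdMulti α φ (p + (-1 : ℝ) • q)) =
      (-1) ^ (α.1 + α.2) * ∫ q in U, f q * pdMulti α φ (p + (-1 : ℝ) • q) := by
    rw [← integral_const_mul]; congr 1; funext q; ring
  rw [e4] at e2
  have e5 : ∀ q : ℝ × ℝ, p + (-1 : ℝ) • q = p - q := fun q => by simp [sub_eq_add_neg]
  simp_rw [e5] at e2 ⊢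
  exact mul_left_cancel₀ (pow_ne_zero (α.1 + α.2) (by norm_num : (-1 : ℝ) ≠ 0)) e2

/-- A smooth bump function supported in a small ball. -/
noncomputable def smallBump (s : ℝ) (hs : 0 < s) : ContDiffBump (0 : ℝ × ℝ) :=
  ⟨s / 2, s, half_pos hs, half_lt_self hs⟩

/-- A smooth nonnegative kernel of mass one supported in the ball of radius `s`. -/
noncomputable def kernel (s : ℝ) (hs : 0 < s) : ℝ × ℝ → ℝ := (smallBump s hs).normed volume

section Kernel

variable {s : ℝ} (hs : 0 < s)

theorem contDiff_kernel : ContDiff ℝ ∞ (kernel s hs) := (smallBump s hs).contDiff_normed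

theorem hasCompactSupport_kernel : HasCompactSupport (kernel s hs) :=
  (smallBump s hs).hasCompactSupport_normed

theorem tsupport_kernel : tsupport (kernel s hs) = Metric.closedBall 0 s :=
  (smallBump s hs).tsupport_normed_eq

theorem kernel_nonneg (p : ℝ × ℝ) : 0 ≤ kernel s hs p := (smallBump s hs).nonneg_normed p

theorem integral_kernel : ∫ p, kernel s hs p = 1 := (smallBump s hs).integral_normed

theorem integrable_kernel : Integrable (kernel s hs) := (smallBump s hs).integrable_normed

theorem integral_kernel_sub (p : ℝ × ℝ) : ∫ q, kernel s hs (p - q) = 1 := by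
  rw [integral_sub_left_eq_self (kernel s hs) volume p, integral_kernel]

theorem integrable_kernel_sub (p : ℝ × ℝ) : Integrable fun q => kernel s hs (p - q) :=
  (integrable_kernel hs).comp_sub_left p

theorem abs_moll_kernel_sub_le {g : ℝ × ℝ → ℝ} (hg : AEStronglyMeasurable g volume) {p : ℝ × ℝ}
    {ε : ℝ} (h : ∀ q ∈ Metric.ball p s, |g q - g p| ≤ ε) : |moll (kernel s hs) g p - g p| ≤ ε := by
  have h1 := (smallBump s hs).dist_normed_convolution_le (μ := volume) hg (x₀ := p) (ε := ε) h
  rw [convolution_lsmul_swap, Real.dist_eq] at h1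
  refine le_trans (le_of_eq ?_) h1
  congr 2
  rw [moll]
  congr 1
  funext q
  rw [smul_eq_mul, mul_comm]
  rfl

theorem integrable_mul_kernel {g : ℝ × ℝ → ℝ} (hg : LocallyIntegrable g) (p : ℝ × ℝ) :
    Integrable fun q => g q * kernel s hs (p - q) := by
  have := (hasCompactSupport_kernel hs).convolutionExists_right (ContinuousLinearMap.mul ℝ ℝ) hg
    (contDiff_kernel hs).continuous p
  exact this

theorem moll_kernel_sub {f g : ℝ × ℝ → ℝ} (hf : LocallyIntegrable f) (hg : LocallyIntegrable g)
    (p : ℝ × ℝ) : moll (kernel s hs) (fun q => f q - g q) p =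
      moll (kernel s hs) f p - moll (kernel s hs) g p := by
  unfold moll
  rw [← integral_sub (integrable_mul_kernel hs hf p) (integrable_mul_kernel hs hg p)]
  congr 1; funext q; ring

theorem abs_moll_kernel_le {g : ℝ × ℝ → ℝ} (hg : LocallyIntegrable g) {M : ℝ}
    (hM : ∀ᵐ q, |g q| ≤ M) (p : ℝ × ℝ) : |moll (kernel s hs) g p| ≤ M := by
  have h1 : ∫ q, |g q * kernel s hs (p - q)| ≤ ∫ q, M * kernel s hs (p - q) := by
    refine integral_mono_ae (integrable_mul_kernel hs hg p).abs
      ((integrable_kernel_sub hs p).const_mul M) ?_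
    filter_upwards [hM] with q hq
    rw [abs_mul, abs_of_nonneg (kernel_nonneg hs _)]
    exact mul_le_mul_of_nonneg_right hq (kernel_nonneg hs _)
  rw [integral_const_mul, integral_kernel_sub, mul_one] at h1
  exact abs_integral_le_integral_abs.trans h1

/-- Jensen's inequality, in the form that the variance of `g` under the probability density `q ↦
kernel s hs (p - q)` is nonnegative. -/
theorem moll_kernel_sq_le {g : ℝ × ℝ → ℝ} (hg : MemLp g 2) (p : ℝ × ℝ) :
    moll (kernel s hs) g p ^ 2 ≤ moll (kernel s hs) (fun q => g q ^ 2) p := by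
  have hg1 : LocallyIntegrable g := hg.locallyIntegrable (by norm_num)
  have hg2 : LocallyIntegrable fun q => g q ^ 2 := hg.integrable_sq.locallyIntegrable
  have i1 := integrable_mul_kernel hs hg1 p
  have i2 := integrable_mul_kernel hs hg2 p
  have i3 := integrable_kernel_sub hs p
  set m := moll (kernel s hs) g p with hm
  have h : 0 ≤ ∫ q, (g q - m) ^ 2 * kernel s hs (p - q) :=
    integral_nonneg fun q => mul_nonneg (sq_nonneg _) (kernel_nonneg hs _)
  have e : (fun q => (g q - m) ^ 2 * kernel s hs (p - q)) = fun q =>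
      g q ^ 2 * kernel s hs (p - q) - 2 * m * (g q * kernel s hs (p - q)) +
        m ^ 2 * kernel s hs (p - q) := by
    funext q; ring
  rw [e, integral_add (by exact i2.sub (i1.const_mul _)) (i3.const_mul _), integral_sub i2 (i1.const_mul _),
    integral_const_mul, integral_const_mul, integral_kernel_sub] at h
  have e1 : ∫ q, g q * kernel s hs (p - q) = m := rfl
  have e2 : ∫ q, g q ^ 2 * kernel s hs (p - q) = moll (kernel s hs) (fun q => g q ^ 2) p := rfl
  rw [e1, e2] at h
  nlinarith

theorem continuous_moll_kernel {g : ℝ × ℝ → ℝ} (hg : LocallyIntegrable g) :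
    Continuous (moll (kernel s hs) g) :=
  (contDiff_moll (contDiff_kernel hs) (hasCompactSupport_kernel hs) hg).continuous

/-- Integrating Jensen's inequality over `p`, with a kernel of mass one, shows that mollification
does not increase the `L²` norm. -/
theorem integrable_moll_kernel_sq {g : ℝ × ℝ → ℝ} (hg : MemLp g 2) :
    Integrable (fun p => moll (kernel s hs) g p ^ 2) ∧
      ∫ p, moll (kernel s hs) g p ^ 2 ≤ ∫ p, g p ^ 2 := by
  have hg1 : LocallyIntegrable g := hg.locallyIntegrable (by norm_num)
  have i1 : Integrable (moll (kernel s hs) fun q => g q ^ 2) :=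
    hg.integrable_sq.integrable_convolution (ContinuousLinearMap.mul ℝ ℝ) (integrable_kernel hs)
  have i2 : Integrable (fun p => moll (kernel s hs) g p ^ 2) := by
    refine i1.mono' ((continuous_moll_kernel hs hg1).pow 2).aestronglyMeasurable
      (Filter.Eventually.of_forall fun p => ?_)
    rw [Real.norm_of_nonneg (sq_nonneg _)]
    exact moll_kernel_sq_le hs hg p
  refine ⟨i2, (integral_mono i2 i1 (moll_kernel_sq_le hs hg)).trans (le_of_eq ?_)⟩
  rw [moll_eq_convolution, integral_convolution _ hg.integrable_sq (integrable_kernel hs),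
    integral_kernel]
  simp

end Kernel

end FVE

namespace FVE

/-! ### Density of smooth functions in the Sobolev spaces of a rectangle -/

open Filter Topology

theorem integral_comp_affine (f : ℝ × ℝ → ℝ) (z : ℝ × ℝ) {k : ℝ} :
    ∫ p, f (z + k • p) = (k ^ 2)⁻¹ * ∫ p, f p := by
  rw [Measure.integral_comp_smul volume (fun p => f (z + p)) k, integral_add_left_eq_self f z]
  simp

theorem integrable_comp_affine {f : ℝ × ℝ → ℝ} (hf : Integrable f) (z : ℝ × ℝ) {k : ℝ}
    (hk : k ≠ 0) : Integrable fun p => f (z + k • p) :=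
  (hf.comp_add_left z).comp_smul hk

theorem memLp_moll_kernel_comp_affine {s : ℝ} (hs : 0 < s) {g : ℝ × ℝ → ℝ} (hg : MemLp g 2)
    (z : ℝ × ℝ) {k : ℝ} (hk : k ≠ 0) :
    MemLp (fun p => moll (kernel s hs) g (z + k • p)) 2 := by
  have hc := continuous_moll_kernel hs (hg.locallyIntegrable (by norm_num))
  rw [memLp_two_iff_integrable_sq (Continuous.aestronglyMeasurable (by fun_prop))]
  exact integrable_comp_affine (integrable_moll_kernel_sq hs hg).1 z hk

/-- The dilation has Jacobian `k²`, and the bound `1 / 2 ≤ k` keeps its inverse below four. -/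
theorem integral_moll_kernel_comp_affine_sq_le {s : ℝ} (hs : 0 < s) {g : ℝ × ℝ → ℝ}
    (hg : MemLp g 2) (z : ℝ × ℝ) {k : ℝ} (hk : 1 / 2 ≤ k) :
    ∫ p, moll (kernel s hs) g (z + k • p) ^ 2 ≤ 4 * ∫ p, g p ^ 2 := by
  rw [integral_comp_affine (fun p => moll (kernel s hs) g p ^ 2)]
  have h0 : 0 ≤ ∫ p, moll (kernel s hs) g p ^ 2 := integral_nonneg fun _ => sq_nonneg _
  have h1 : (k ^ 2)⁻¹ ≤ 4 := by
    rw [inv_le_comm₀ (by positivity) (by norm_num)]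
    nlinarith
  exact mul_le_mul h1 (integrable_moll_kernel_sq hs hg).2 h0 (by norm_num)

/-- Mollification combined with a dilation converges in the mean square. -/
theorem tendsto_integral_moll_kernel_sub_sq {g : ℝ × ℝ → ℝ} (hg : MemLp g 2) {U : Set (ℝ × ℝ)}
    (hU : MeasurableSet U) (hUb : Bornology.IsBounded U) (z : ℝ × ℝ) {s k : ℕ → ℝ}
    (hs : ∀ n, 0 < s n) (hs0 : Tendsto s atTop (𝓝 0)) (hk : ∀ n, 1 / 2 ≤ k n)
    (hk1 : Tendsto k atTop (𝓝 1)) :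
    Tendsto (fun n => ∫ p in U,
      (moll (kernel (s n) (hs n)) g ((1 - k n) • z + k n • p) - g p) ^ 2) atTop (𝓝 0) := by
  rw [Metric.tendsto_atTop]
  intro ε hε
  -- The three contributions in the end add up to `12 δ + 12 δ + 3 δ`, below `36 δ = ε`.
  set δ := ε / 36 with hδ
  have hδ0 : 0 < δ := by positivity
  -- For a continuous function of compact support the convergence is uniform on the bounded set `U`.
  -- The difference `g - h` is small in `L²` and stays so under mollification and dilation.
  obtain ⟨h, hhc, hhg, hhcont, hhL⟩ := MemLp.exists_hasCompactSupport_integral_rpow_sub_le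
    (p := 2) (by norm_num) (by simpa using hg) hδ0
  have hhL : MemLp h 2 := by simpa using hhL
  have hhg : ∫ p, (g p - h p) ^ 2 ≤ δ := by simpa using hhg
  obtain ⟨R, hR⟩ := hUb.exists_norm_le
  have hfin : volume U ≠ ⊤ := hUb.measure_lt_top.ne
  set V := volume.real U with hV
  have hV0 : 0 ≤ V := measureReal_nonneg
  -- The tolerance whose square, integrated over `U`, is at most `δ`; the added one admits a null
  -- set `U`.
  set η := √(δ / (V + 1)) with hη
  have hη0 : 0 < η := Real.sqrt_pos.mpr (by positivity)
  have hηV : η ^ 2 * V ≤ δ := by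
    rw [hη, Real.sq_sqrt (by positivity), div_mul_eq_mul_div, div_le_iff₀ (by positivity)]
    nlinarith
  have huc := hhc.uniformContinuous_of_continuous hhcont
  obtain ⟨d, hd, hdh⟩ := Metric.uniformContinuous_iff.mp huc η hη0
  have ev1 : ∀ᶠ n in atTop, s n < d := hs0.eventually (gt_mem_nhds hd)
  have ev2 : ∀ᶠ n in atTop, |1 - k n| * (‖z‖ + |R|) < d := by
    have : Tendsto (fun n => |1 - k n| * (‖z‖ + |R|)) atTop (𝓝 (|1 - 1| * (‖z‖ + |R|))) :=
      ((tendsto_const_nhds.sub hk1).abs).mul_const _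
    simp only [sub_self, abs_zero, zero_mul] at this
    exact this.eventually (gt_mem_nhds hd)
  obtain ⟨N, hN⟩ := (ev1.and ev2).exists_forall_of_atTop
  refine ⟨N, fun n hn => ?_⟩
  obtain ⟨h1, h2⟩ := hN n hn
  rw [Real.dist_eq, sub_zero, abs_of_nonneg (integral_nonneg fun _ => sq_nonneg _)]
  set τ : ℝ × ℝ → ℝ × ℝ := fun p => (1 - k n) • z + k n • p with hτ
  have hgl : LocallyIntegrable g := hg.locallyIntegrable (by norm_num)
  have hhl : LocallyIntegrable h := hhL.locallyIntegrable (by norm_num)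
  have hdiff : MemLp (fun p => g p - h p) 2 := hg.sub hhL
  have hk0 : k n ≠ 0 := by have := hk n; intro h0; rw [h0] at this; norm_num at this
  have i1 : Integrable fun p => moll (kernel (s n) (hs n)) (fun p => g p - h p) (τ p) ^ 2 :=
    (memLp_moll_kernel_comp_affine (hs n) hdiff _ hk0).integrable_sq
  have i2 : Integrable fun p => (g p - h p) ^ 2 := hdiff.integrable_sq
  have pt : ∀ p ∈ U, (moll (kernel (s n) (hs n)) g (τ p) - g p) ^ 2 ≤
      3 * (moll (kernel (s n) (hs n)) (fun p => g p - h p) (τ p) ^ 2) + 12 * η ^ 2 +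
        3 * (g p - h p) ^ 2 := fun p hp => by
    rw [moll_kernel_sub (hs n) hgl hhl]
    have b1 : |moll (kernel (s n) (hs n)) h (τ p) - h (τ p)| ≤ η :=
      abs_moll_kernel_sub_le (hs n) hhcont.aestronglyMeasurable fun q hq =>
        (hdh ((Metric.mem_ball.mp hq).trans h1)).le
    have b2 : |h (τ p) - h p| ≤ η := by
      refine (hdh ?_).le
      have e : τ p - p = (1 - k n) • (z - p) := by
        simp only [hτ, smul_sub, sub_smul, one_smul]; abel
      rw [dist_eq_norm, e, norm_smul, Real.norm_eq_abs]
      refine lt_of_le_of_lt ?_ h2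
      gcongr
      exact (norm_sub_le _ _).trans (add_le_add le_rfl ((hR p hp).trans (le_abs_self R)))
    have b3 := abs_le.mp b1
    have b4 := abs_le.mp b2
    set A := moll (kernel (s n) (hs n)) g (τ p)
    set B := moll (kernel (s n) (hs n)) h (τ p)
    have b5 : (B - h p) ^ 2 ≤ 4 * η ^ 2 := by nlinarith
    nlinarith [sq_nonneg ((A - B) - (B - h p)), sq_nonneg ((A - B) - (h p - g p)),
      sq_nonneg ((B - h p) - (h p - g p))]
  have i3 : IntegrableOn (fun _ : ℝ × ℝ => 12 * η ^ 2) U := integrableOn_const hfin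
  have i4 : IntegrableOn (fun p => 3 * moll (kernel (s n) (hs n)) (fun p => g p - h p) (τ p) ^ 2 +
      12 * η ^ 2 + 3 * (g p - h p) ^ 2) U :=
    Integrable.add (Integrable.add (i1.const_mul 3).integrableOn i3) (i2.const_mul 3).integrableOn
  calc _ ≤ ∫ p in U, (3 * (moll (kernel (s n) (hs n)) (fun p => g p - h p) (τ p) ^ 2) +
        12 * η ^ 2 + 3 * (g p - h p) ^ 2) :=
        integral_mono_of_nonneg (Eventually.of_forall fun _ => sq_nonneg _)
          i4 ((ae_restrict_iff' hU).mpr (Eventually.of_forall pt))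
    _ = 3 * (∫ p in U, moll (kernel (s n) (hs n)) (fun p => g p - h p) (τ p) ^ 2) +
        12 * (η ^ 2 * V) + 3 * ∫ p in U, (g p - h p) ^ 2 := by
        rw [integral_add (by exact (i1.const_mul 3).integrableOn.add i3)
          (i2.const_mul 3).integrableOn, integral_add (i1.const_mul 3).integrableOn i3,
          setIntegral_const, integral_const_mul, integral_const_mul, smul_eq_mul]
        ring
    _ ≤ 3 * (4 * δ) + 12 * δ + 3 * δ := by
        gcongr
        · refine (setIntegral_le_integral i1 (Eventually.of_forall fun _ => sq_nonneg _)).trans ?_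
          refine (integral_moll_kernel_comp_affine_sq_le (hs n) hdiff _ (hk n)).trans ?_
          gcongr
        · exact (setIntegral_le_integral i2 (Eventually.of_forall fun _ => sq_nonneg _)).trans hhg
    _ < ε := by rw [hδ]; linarith

theorem Rect.isOpen_dom (Ω : Rect) : IsOpen Ω.dom := isOpen_Ioo.prod isOpen_Ioo

theorem Rect.closure_dom (Ω : Rect) :
    closure Ω.dom = Set.Icc Ω.a Ω.b ×ˢ Set.Icc Ω.c Ω.d := by
  rw [Rect.dom, closure_prod_eq, closure_Ioo Ω.hab.ne, closure_Ioo Ω.hcd.ne]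

theorem Rect.isBounded_dom (Ω : Rect) : Bornology.IsBounded Ω.dom :=
  (Metric.isBounded_Ioo _ _).prod (Metric.isBounded_Ioo _ _)

/-- Contraction towards the centre keeps the closed rectangle away from its boundary. -/
theorem Rect.contraction_mem_dom (Ω : Rect) {ε s : ℝ} (hε1 : ε ≤ 1)
    (hs1 : s < ε * ((Ω.b - Ω.a) / 2)) (hs2 : s < ε * ((Ω.d - Ω.c) / 2))
    {p q : ℝ × ℝ} (hp : p ∈ closure Ω.dom) (hq : ‖q‖ ≤ s) :
    ε • (((Ω.a + Ω.b) / 2, (Ω.c + Ω.d) / 2) : ℝ × ℝ) + (1 - ε) • p - q ∈ Ω.dom := by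
  rw [Rect.closure_dom] at hp
  obtain ⟨⟨h1, h2⟩, h3, h4⟩ := hp
  obtain ⟨q1, q2⟩ := abs_le.mp ((norm_fst_le q).trans hq)
  obtain ⟨q3, q4⟩ := abs_le.mp ((norm_snd_le q).trans hq)
  have hε' : 0 ≤ 1 - ε := by linarith
  refine ⟨⟨?_, ?_⟩, ?_, ?_⟩ <;>
    simp only [Prod.fst_sub, Prod.snd_sub, Prod.fst_add, Prod.snd_add, Prod.smul_fst, Prod.smul_snd,
      smul_eq_mul]
  · nlinarith [mul_nonneg hε' (sub_nonneg.mpr h1)]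
  · nlinarith [mul_nonneg hε' (sub_nonneg.mpr h2)]
  · nlinarith [mul_nonneg hε' (sub_nonneg.mpr h3)]
  · nlinarith [mul_nonneg hε' (sub_nonneg.mpr h4)]

theorem MemSobolev.memLp_indicator {U : Set (ℝ × ℝ)} (hU : IsOpen U) {g : ℝ × ℝ → ℝ}
    {q : ENNReal} (hg : MemLp g q (volume.restrict U)) : MemLp (U.indicator g) q :=
  (memLp_indicator_iff_restrict hU.measurableSet).mpr hg

/-- Smooth functions are dense in `H^m` of a rectangle, with pointwise convergence on the closed
rectangle for continuous functions. -/
theorem exists_smooth_approx {Ω : Rect} {m : ℕ} {u : ℝ × ℝ → ℝ} (hu : MemSobolev m 2 Ω.dom u)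
    (huc : ContinuousOn u (closure Ω.dom)) :
    ∃ w : ℕ → ℝ × ℝ → ℝ, (∀ n, ContDiff ℝ ∞ (w n)) ∧
      (∀ p ∈ closure Ω.dom, Tendsto (fun n => w n p) atTop (𝓝 (u p))) ∧
      ∀ α : ℕ × ℕ, α.1 + α.2 ≤ m → Tendsto (fun n => ∫ p in Ω.dom,
        (pdMulti α (w n) p - weakDeriv Ω.dom α u p) ^ 2) atTop (𝓝 0) := by
  have hU := Ω.isOpen_dom
  set z : ℝ × ℝ := ((Ω.a + Ω.b) / 2, (Ω.c + Ω.d) / 2) with hz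
  set H := min ((Ω.b - Ω.a) / 2) ((Ω.d - Ω.c) / 2) with hH
  have hH0 : 0 < H := lt_min (by linarith [Ω.hab]) (by linarith [Ω.hcd])
  -- The amount of contraction towards the centre; the shift by two makes the dilation factor `1 - e
  -- n` at least one half from `n = 0` on.
  set e : ℕ → ℝ := fun n => 1 / ((n : ℝ) + 2) with he
  have he0 : ∀ n, 0 < e n := fun n => by positivity
  have he2 : ∀ n, e n ≤ 1 / 2 := fun n => by
    have : (0 : ℝ) ≤ n := Nat.cast_nonneg n
    exact one_div_le_one_div_of_le (by norm_num) (by linarith)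
  have het : Tendsto e atTop (𝓝 0) := by
    have h := (tendsto_one_div_add_atTop_nhds_zero_nat (𝕜 := ℝ)).comp (tendsto_add_atTop_nat 1)
    refine h.congr fun n => ?_
    simp only [he, Function.comp, Nat.cast_add, Nat.cast_one]
    ring
  -- Contraction by `e n` moves the closed rectangle at least `e n * H` away from the boundary. Half
  -- of this is a radius at which mollification on the contracted rectangle sees only values inside
  -- the domain.
  set s : ℕ → ℝ := fun n => e n * H / 2 with hsdef
  have hs : ∀ n, 0 < s n := fun n => by have := he0 n; positivity
  have hs0 : Tendsto s atTop (𝓝 0) := by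
    have := (het.mul_const H).div_const 2
    simpa using this
  set k : ℕ → ℝ := fun n => 1 - e n with hk
  have hk2 : ∀ n, 1 / 2 ≤ k n := fun n => by have := he2 n; simp only [hk]; linarith
  have hkle : ∀ n, k n ≤ 1 := fun n => by have := he0 n; simp only [hk]; linarith
  have hk1 : Tendsto k atTop (𝓝 1) := by
    have := (tendsto_const_nhds (x := (1 : ℝ))).sub het
    simpa using this
  have hke : ∀ n, 1 - k n = e n := fun n => by simp [hk]
  have hmem : ∀ n, ∀ p ∈ closure Ω.dom, ∀ q : ℝ × ℝ, ‖q‖ ≤ s n →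
      (1 - k n) • z + k n • p - q ∈ Ω.dom := fun n p hp q hq => by
    rw [hke]
    have h1 : s n < e n * H := by have := mul_pos (he0 n) hH0; simp only [hsdef]; linarith
    exact Ω.contraction_mem_dom ((he2 n).trans (by norm_num))
      (h1.trans_le (mul_le_mul_of_nonneg_left (min_le_left _ _) (he0 n).le))
      (h1.trans_le (mul_le_mul_of_nonneg_left (min_le_right _ _) (he0 n).le)) hp hq
  have huL : MemLp (Ω.dom.indicator u) 2 := MemSobolev.memLp_indicator hU (hu.memLp hU)
  have hul : LocallyIntegrable (Ω.dom.indicator u) := huL.locallyIntegrable (by norm_num)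
  have hsm : ∀ n, ContDiff ℝ ∞ (moll (kernel (s n) (hs n)) (Ω.dom.indicator u)) := fun n =>
    contDiff_moll (contDiff_kernel (hs n)) (hasCompactSupport_kernel (hs n)) hul
  refine ⟨fun n p => moll (kernel (s n) (hs n)) (Ω.dom.indicator u) ((1 - k n) • z + k n • p),
    fun n => contDiff_comp_affine (hsm n) _ _, fun p hp => ?_, fun α hα => ?_⟩
  · rw [Metric.tendsto_atTop]
    intro ε hε
    obtain ⟨d, hd, hdu⟩ := Metric.continuousWithinAt_iff.mp (huc p hp) (ε / 4) (by positivity)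
    have hlim : Tendsto (fun n => s n + e n * ‖z - p‖) atTop (𝓝 0) := by
      have := hs0.add (het.mul_const ‖z - p‖)
      simpa using this
    obtain ⟨N, hN⟩ := (hlim.eventually (gt_mem_nhds hd)).exists_forall_of_atTop
    refine ⟨N, fun n hn => ?_⟩
    have hn' := hN n hn
    set t := (1 - k n) • z + k n • p with ht
    have htp : t - p = e n • (z - p) := by
      rw [ht, hke]; simp only [hk, smul_sub, sub_smul, one_smul]; abel
    have htp' : ‖t - p‖ = e n * ‖z - p‖ := by
      rw [htp, norm_smul, Real.norm_of_nonneg (he0 n).le]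
    have hnear : ∀ q ∈ Metric.ball t (s n), q ∈ Ω.dom ∧ |u q - u p| < ε / 4 := fun q hq => by
      rw [mem_ball_iff_norm'] at hq
      have h1 : q ∈ Ω.dom := by
        have := hmem n p hp (t - q) hq.le
        simpa [ht] using this
      refine ⟨h1, hdu (subset_closure h1) ?_⟩
      rw [dist_eq_norm]
      have : q - p = (t - p) - (t - q) := by abel
      rw [this]
      refine (norm_sub_le _ _).trans_lt ?_
      rw [htp']
      linarith
    obtain ⟨ht1, ht2⟩ := hnear t (Metric.mem_ball_self (hs n))
    have hb := abs_moll_kernel_sub_le (hs n) huL.aestronglyMeasurable (p := t) (ε := ε / 2)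
      fun q hq => by
        obtain ⟨hq1, hq2⟩ := hnear q hq
        rw [Set.indicator_of_mem hq1, Set.indicator_of_mem ht1]
        rw [abs_lt] at hq2 ht2
        exact abs_le.mpr ⟨by linarith, by linarith⟩
    rw [Set.indicator_of_mem ht1] at hb
    rw [Real.dist_eq]
    rw [abs_lt] at ht2 ⊢
    rw [abs_le] at hb
    exact ⟨by linarith, by linarith⟩
  · obtain ⟨hw, hL⟩ := hu.weakDeriv_spec hU hα
    set g := weakDeriv Ω.dom α u
    have hgL : MemLp (Ω.dom.indicator g) 2 := MemSobolev.memLp_indicator hU hL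
    have hlim := tendsto_integral_moll_kernel_sub_sq hgL hU.measurableSet Ω.isBounded_dom z hs hs0
      hk2 hk1
    have hlim2 : Tendsto (fun n => 2 * (∫ p in Ω.dom, (moll (kernel (s n) (hs n))
        (Ω.dom.indicator g) ((1 - k n) • z + k n • p) - Ω.dom.indicator g p) ^ 2) +
        2 * (1 - k n ^ (α.1 + α.2)) ^ 2 * ∫ p in Ω.dom, g p ^ 2) atTop (𝓝 0) := by
      have h1 := hlim.const_mul 2
      have h2 : Tendsto (fun n => 2 * (1 - k n ^ (α.1 + α.2)) ^ 2 * ∫ p in Ω.dom, g p ^ 2) atTop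
          (𝓝 (2 * (1 - 1 ^ (α.1 + α.2)) ^ 2 * ∫ p in Ω.dom, g p ^ 2)) :=
        (((tendsto_const_nhds.sub (hk1.pow _)).pow 2).const_mul 2).mul_const _
      simpa using h1.add h2
    refine squeeze_zero (fun n => integral_nonneg fun _ => sq_nonneg _) (fun n => ?_) hlim2
    have hk0 : k n ≠ 0 := by have := hk2 n; intro h0; rw [h0] at this; norm_num at this
    have i1 : IntegrableOn (fun p => (moll (kernel (s n) (hs n)) (Ω.dom.indicator g)
        ((1 - k n) • z + k n • p) - Ω.dom.indicator g p) ^ 2) Ω.dom :=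
      ((memLp_moll_kernel_comp_affine (hs n) hgL _ hk0).sub hgL).integrable_sq.integrableOn
    have i2 : IntegrableOn (fun p => g p ^ 2) Ω.dom := hL.integrable_sq
    rw [← integral_const_mul, ← integral_const_mul, ← integral_add (i1.const_mul _)
      (i2.const_mul _)]
    refine integral_mono_of_nonneg (Eventually.of_forall fun _ => sq_nonneg _)
      ((i1.const_mul _).add (i2.const_mul _))
      ((ae_restrict_iff' hU.measurableSet).mpr (Eventually.of_forall fun p hp => ?_))
    have e1 : pdMulti α (fun p => moll (kernel (s n) (hs n)) (Ω.dom.indicator u)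
        ((1 - k n) • z + k n • p)) p = k n ^ (α.1 + α.2) * moll (kernel (s n) (hs n))
        (Ω.dom.indicator g) ((1 - k n) • z + k n • p) := by
      rw [pdMulti_comp_affine (hsm n), pdMulti_moll (contDiff_kernel (hs n))
        (hasCompactSupport_kernel (hs n)) hul]
      beta_reduce
      congr 1
      refine moll_pdMulti_eq hU hw (contDiff_kernel (hs n)) (hasCompactSupport_kernel (hs n))
        fun q hq => hmem n p (subset_closure hp) q ?_
      rw [tsupport_kernel] at hq
      simpa using hq
    simp only [e1]
    rw [Set.indicator_of_mem hp]
    set S := moll (kernel (s n) (hs n)) (Ω.dom.indicator g) ((1 - k n) • z + k n • p)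
    have hkn0 : 0 ≤ k n ^ (α.1 + α.2) := pow_nonneg (le_trans (by norm_num) (hk2 n)) _
    have hkn1 : k n ^ (α.1 + α.2) ≤ 1 := pow_le_one₀ (le_trans (by norm_num) (hk2 n)) (hkle n)
    set κ := k n ^ (α.1 + α.2)
    -- The factor `κ` comes from the chain rule for the dilation and tends to one. The first term is
    -- controlled by the convergence of the mollified derivative, the second by the norm of `g`.
    have e2 : κ * S - g p = κ * (S - g p) - (1 - κ) * g p := by ring
    rw [e2]
    have e3 : (κ * (S - g p)) ^ 2 ≤ (S - g p) ^ 2 := by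
      rw [mul_pow]
      have : κ ^ 2 ≤ 1 := pow_le_one₀ hkn0 hkn1
      nlinarith [sq_nonneg (S - g p)]
    nlinarith [sq_nonneg (κ * (S - g p) + (1 - κ) * g p)]

end FVE

namespace FVE

/-! ### Lipschitz continuity of continuous `W^{1,∞}` functions -/

open Filter Topology

/-- The multi-index of the `k`-th first partial derivative. -/
def unitIdx (k : Fin 2) : ℕ × ℕ := if k = 0 then (1, 0) else (0, 1)

theorem pdMulti_unitIdx (k : Fin 2) (f : ℝ × ℝ → ℝ) : pdMulti (unitIdx k) f = pd k f := by
  fin_cases k <;> rfl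

theorem unitIdx_sum (k : Fin 2) : (unitIdx k).1 + (unitIdx k).2 = 1 := by
  fin_cases k <;> rfl

theorem pdMulti_unitIdx_add {f : ℝ × ℝ → ℝ} (hf : ContDiff ℝ ∞ f) (k j : Fin 2) :
    pdMulti (unitIdx k + unitIdx j) f = pd k (pd j f) := by
  fin_cases k <;> fin_cases j
  · rfl
  · rfl
  · exact (pd_comm hf 0 1)
  · rfl

theorem exists_radius_of_isCompact {U K : Set (ℝ × ℝ)} (hU : IsOpen U) (hK : IsCompact K)
    (hKU : K ⊆ U) : ∃ δ > 0, ∀ p ∈ K, ∀ q : ℝ × ℝ, ‖q‖ ≤ δ → p - q ∈ U := by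
  obtain ⟨δ, hδ, h⟩ := hK.exists_cthickening_subset_open hU hKU
  refine ⟨δ, hδ, fun p hp q hq => h (Metric.mem_cthickening_of_dist_le _ p δ K hp ?_)⟩
  simpa [dist_eq_norm] using hq

/-- Away from the boundary the mollified function is smooth with mollified derivatives. -/
theorem pd_moll_kernel_eq {U : Set (ℝ × ℝ)} (hU : IsOpen U) {F g : ℝ × ℝ → ℝ} {k : Fin 2}
    (hF : LocallyIntegrable (U.indicator F)) (h : IsWeakDeriv U (unitIdx k) F g) {s : ℝ}
    (hs : 0 < s) {p : ℝ × ℝ} (hp : ∀ q : ℝ × ℝ, ‖q‖ ≤ s → p - q ∈ U) :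
    pd k (moll (kernel s hs) (U.indicator F)) p = moll (kernel s hs) (U.indicator g) p := by
  rw [← pdMulti_unitIdx, pdMulti_moll (contDiff_kernel hs) (hasCompactSupport_kernel hs) hF]
  refine moll_pdMulti_eq hU h (contDiff_kernel hs) (hasCompactSupport_kernel hs) fun q hq => hp q ?_
  rw [tsupport_kernel] at hq
  simpa using hq

theorem exists_ae_bound {μ : Measure (ℝ × ℝ)} {g : ℝ × ℝ → ℝ} (hg : MemLp g ⊤ μ) :
    ∃ M, 0 ≤ M ∧ ∀ᵐ p ∂μ, |g p| ≤ M := by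
  refine ⟨(eLpNormEssSup g μ).toReal, ENNReal.toReal_nonneg, ?_⟩
  have hfin : eLpNormEssSup g μ ≠ ⊤ := by
    have := hg.2.ne
    rwa [eLpNorm_exponent_top] at this
  filter_upwards [enorm_ae_le_eLpNormEssSup g μ] with p hp
  rw [← Real.norm_eq_abs, ← toReal_enorm]
  exact ENNReal.toReal_mono hfin hp

/-- A continuous function in `W^{1,∞}` of a rectangle is Lipschitz continuous. -/
theorem exists_lipschitz_of_memSobolev {Ω : Rect} {F : ℝ × ℝ → ℝ} (hF : MemSobolev 1 ⊤ Ω.dom F)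
    (hFc : ContinuousOn F Ω.dom) :
    ∃ L, 0 ≤ L ∧ ∀ p ∈ Ω.dom, ∀ q ∈ Ω.dom, |F p - F q| ≤ L * dist p q := by
  have hU := Ω.isOpen_dom
  have hspec : ∀ k : Fin 2, ∃ g, IsWeakDeriv Ω.dom (unitIdx k) F g ∧
      MemLp g ⊤ (volume.restrict Ω.dom) := fun k => hF _ (unitIdx_sum k).le
  choose g hg hgL using hspec
  have hb : ∀ k, ∃ M, 0 ≤ M ∧ ∀ᵐ p ∂(volume.restrict Ω.dom), |g k p| ≤ M :=
    fun k => exists_ae_bound (hgL k)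
  choose M hM0 hM using hb
  have hgi : ∀ k, LocallyIntegrable (Ω.dom.indicator (g k)) := fun k =>
    (MemSobolev.memLp_indicator hU (hgL k)).locallyIntegrable le_top
  have hFi : LocallyIntegrable (Ω.dom.indicator F) :=
    (MemSobolev.memLp_indicator hU (hF.memLp hU)).locallyIntegrable le_top
  have hMi : ∀ k, ∀ᵐ p, |Ω.dom.indicator (g k) p| ≤ M k := fun k => by
    filter_upwards [(ae_restrict_iff' hU.measurableSet).mp (hM k)] with p hp
    by_cases h : p ∈ Ω.dom
    · rw [Set.indicator_of_mem h]; exact hp h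
    · rw [Set.indicator_of_notMem h, abs_zero]; exact hM0 k
  refine ⟨M 0 + M 1, add_nonneg (hM0 0) (hM0 1), fun p hp q hq => ?_⟩
  -- The rectangle spanned by `p` and `q` lies in the domain. Its mollified function has partial
  -- derivatives bounded by `M 0` and `M 1`, independently of the radius, and the path from `p` to
  -- `q` along a horizontal and a vertical side stays in it.
  set K := Set.uIcc p.1 q.1 ×ˢ Set.uIcc p.2 q.2 with hK
  have hKc : IsCompact K := isCompact_uIcc.prod isCompact_uIcc
  have hKU : K ⊆ Ω.dom := by
    refine Set.prod_mono ?_ ?_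
    · exact Set.OrdConnected.uIcc_subset Set.ordConnected_Ioo hp.1 hq.1
    · exact Set.OrdConnected.uIcc_subset Set.ordConnected_Ioo hp.2 hq.2
  obtain ⟨δ, hδ, hδU⟩ := exists_radius_of_isCompact hU hKc hKU
  refine le_of_forall_pos_le_add fun ε hε => ?_
  obtain ⟨d₁, hd₁, h₁⟩ := Metric.continuousOn_iff.mp hFc p hp (ε / 2) (half_pos hε)
  obtain ⟨d₂, hd₂, h₂⟩ := Metric.continuousOn_iff.mp hFc q hq (ε / 2) (half_pos hε)
  set s := min δ (min d₁ d₂) with hsdef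
  have hs : 0 < s := lt_min hδ (lt_min hd₁ hd₂)
  have hsδ : s ≤ δ := min_le_left _ _
  set G := moll (kernel s hs) (Ω.dom.indicator F) with hG
  have hGs : ContDiff ℝ ∞ G := contDiff_moll (contDiff_kernel hs) (hasCompactSupport_kernel hs) hFi
  have hGb : ∀ k, ∀ z ∈ K, ‖pd k G z‖ ≤ M k := fun k z hz => by
    rw [hG, pd_moll_kernel_eq hU hFi (hg k) hs fun t ht => hδU z hz t (ht.trans hsδ)]
    exact abs_moll_kernel_le hs (hgi k) (hMi k) z
  have hclose : ∀ z ∈ Ω.dom, (∀ t ∈ Metric.ball z s, t ∈ Ω.dom) →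
      (∀ t ∈ Ω.dom, dist t z < s → dist (F t) (F z) < ε / 2) → |G z - F z| ≤ ε / 2 :=
    fun z hz hball hcl => by
      have := abs_moll_kernel_sub_le hs hFi.aestronglyMeasurable (p := z) (ε := ε / 2) fun t ht => by
        rw [Set.indicator_of_mem hz, Set.indicator_of_mem (hball t ht)]
        exact (hcl t (hball t ht) ht).le
      rwa [Set.indicator_of_mem hz] at this
  have hball : ∀ z ∈ K, ∀ t ∈ Metric.ball z s, t ∈ Ω.dom := fun z hz t ht => by
    have := hδU z hz (z - t) ?_
    · simpa using this
    · rw [mem_ball_iff_norm'] at ht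
      exact ht.le.trans hsδ
  have hpK : p ∈ K := ⟨Set.left_mem_uIcc, Set.left_mem_uIcc⟩
  have hqK : q ∈ K := ⟨Set.right_mem_uIcc, Set.right_mem_uIcc⟩
  have c1 := hclose p hp (hball p hpK) fun t ht htd => h₁ t ht
    (htd.trans_le ((min_le_right _ _).trans (min_le_left _ _)))
  have c2 := hclose q hq (hball q hqK) fun t ht htd => h₂ t ht
    (htd.trans_le ((min_le_right _ _).trans (min_le_right _ _)))
  have v1 : ‖G (q.1, p.2) - G (p.1, p.2)‖ ≤ M 0 * ‖q.1 - p.1‖ :=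
    (convex_uIcc p.1 q.1).norm_image_sub_le_of_norm_hasDerivWithin_le
      (f := fun t => G (t, p.2)) (f' := fun t => pd 0 G (t, p.2))
      (fun t _ => (hasDerivAt_pd_zero (differentiable_of_contDiff hGs) t p.2).hasDerivWithinAt)
      (fun t ht => hGb 0 (t, p.2) ⟨ht, Set.left_mem_uIcc⟩) Set.left_mem_uIcc Set.right_mem_uIcc
  have v2 : ‖G (q.1, q.2) - G (q.1, p.2)‖ ≤ M 1 * ‖q.2 - p.2‖ :=
    (convex_uIcc p.2 q.2).norm_image_sub_le_of_norm_hasDerivWithin_le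
      (f := fun t => G (q.1, t)) (f' := fun t => pd 1 G (q.1, t))
      (fun t _ => (hasDerivAt_pd_one (differentiable_of_contDiff hGs) q.1 t).hasDerivWithinAt)
      (fun t ht => hGb 1 (q.1, t) ⟨Set.right_mem_uIcc, ht⟩) Set.left_mem_uIcc Set.right_mem_uIcc
  have d1 : ‖q.1 - p.1‖ ≤ dist p q := by
    rw [dist_comm, dist_eq_norm]; exact norm_fst_le (q - p)
  have d2 : ‖q.2 - p.2‖ ≤ dist p q := by
    rw [dist_comm, dist_eq_norm]; exact norm_snd_le (q - p)
  have v1' := v1.trans (mul_le_mul_of_nonneg_left d1 (hM0 0))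
  have v2' := v2.trans (mul_le_mul_of_nonneg_left d2 (hM0 1))
  rw [Real.norm_eq_abs, abs_le] at v1' v2'
  rw [abs_le] at c1 c2 ⊢
  have e1 : G (p.1, p.2) = G p := rfl
  have e2 : G (q.1, q.2) = G q := rfl
  rw [e1] at v1'
  rw [e2] at v2'
  constructor <;> nlinarith

/-! ### The divergence theorem on rectangles for weak derivatives -/

/-- The difference of the line integrals of `F` over opposite sides, normal to the `k`-th coordinate
direction, of a rectangle. -/
noncomputable def sideDiff (k : Fin 2) (F : ℝ × ℝ → ℝ) (l r b t : ℝ) : ℝ :=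
  if k = 0 then (∫ y in b..t, F (r, y)) - ∫ y in b..t, F (l, y)
  else (∫ x in l..r, F (x, t)) - ∫ x in l..r, F (x, b)

theorem sideDiff_eq_boxInt_pd {F : ℝ × ℝ → ℝ} (hF : ContDiff ℝ ∞ F) (k : Fin 2) {l r b t : ℝ}
    (hlr : l ≤ r) (hbt : b ≤ t) : sideDiff k F l r b t = boxInt (pd k F) l r b t := by
  have cF := hF.continuous
  have ck := (contDiff_pd hF k).continuous
  rcases (show k = 0 ∨ k = 1 by omega) with rfl | rfl
  · rw [boxInt_eq_integral_integral' hlr hbt (integrableOn_box_of_continuous ck _ _ _ _), sideDiff,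
      if_pos rfl, ← intervalIntegral.integral_sub (Continuous.intervalIntegrable (by fun_prop) _ _)
      (Continuous.intervalIntegrable (by fun_prop) _ _)]
    congr 1
    funext y
    exact (intervalIntegral.integral_eq_sub_of_hasDerivAt
      (fun x _ => hasDerivAt_pd_zero (differentiable_of_contDiff hF) x y)
      ((ck.comp (by fun_prop)).intervalIntegrable _ _)).symm
  · rw [boxInt_eq_integral_integral hlr hbt (integrableOn_box_of_continuous ck _ _ _ _), sideDiff,
      if_neg (by decide), ← intervalIntegral.integral_sub
      (Continuous.intervalIntegrable (by fun_prop) _ _)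
      (Continuous.intervalIntegrable (by fun_prop) _ _)]
    congr 1
    funext x
    exact (intervalIntegral.integral_eq_sub_of_hasDerivAt
      (fun y _ => hasDerivAt_pd_one (differentiable_of_contDiff hF) x y)
      ((ck.comp (by fun_prop)).intervalIntegrable _ _)).symm

theorem abs_sideDiff_sub_le {F G : ℝ × ℝ → ℝ} (hF : Continuous F) (hG : Continuous G) (k : Fin 2)
    {l r b t ε : ℝ} (hlr : l ≤ r) (hbt : b ≤ t)
    (h : ∀ p ∈ Set.Icc l r ×ˢ Set.Icc b t, |F p - G p| ≤ ε) :
    |sideDiff k F l r b t - sideDiff k G l r b t| ≤ 2 * ε * ((t - b) + (r - l)) := by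
  have hε : 0 ≤ ε := (abs_nonneg _).trans (h (l, b) ⟨⟨le_rfl, hlr⟩, le_rfl, hbt⟩)
  have line : ∀ {f g : ℝ → ℝ}, Continuous f → Continuous g → ∀ {u v : ℝ}, u ≤ v →
      (∀ z ∈ Set.Icc u v, |f z - g z| ≤ ε) →
      |(∫ z in u..v, f z) - ∫ z in u..v, g z| ≤ ε * (v - u) := by
    intro f g hf hg u v huv hfg
    rw [← intervalIntegral.integral_sub (hf.intervalIntegrable _ _) (hg.intervalIntegrable _ _)]
    have := intervalIntegral.norm_integral_le_of_norm_le_const (a := u) (b := v) (C := ε)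
      (f := fun z => f z - g z) fun z hz => hfg z (by
        rw [Set.uIoc_of_le huv] at hz; exact Set.Ioc_subset_Icc_self hz)
    rwa [abs_of_nonneg (sub_nonneg.mpr huv)] at this
  have hpos1 : 0 ≤ ε * (r - l) := mul_nonneg hε (sub_nonneg.mpr hlr)
  have hpos2 : 0 ≤ ε * (t - b) := mul_nonneg hε (sub_nonneg.mpr hbt)
  unfold sideDiff
  split_ifs
  · have e1 := abs_le.mp (line (f := fun y => F (r, y)) (g := fun y => G (r, y)) (by fun_prop)
      (by fun_prop) hbt fun z hz => h (r, z) ⟨⟨hlr, le_rfl⟩, hz⟩)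
    have e2 := abs_le.mp (line (f := fun y => F (l, y)) (g := fun y => G (l, y)) (by fun_prop)
      (by fun_prop) hbt fun z hz => h (l, z) ⟨⟨le_rfl, hlr⟩, hz⟩)
    exact abs_le.mpr ⟨by linarith, by linarith⟩
  · have e1 := abs_le.mp (line (f := fun x => F (x, t)) (g := fun x => G (x, t)) (by fun_prop)
      (by fun_prop) hlr fun z hz => h (z, t) ⟨hz, hbt, le_rfl⟩)
    have e2 := abs_le.mp (line (f := fun x => F (x, b)) (g := fun x => G (x, b)) (by fun_prop)
      (by fun_prop) hlr fun z hz => h (z, b) ⟨hz, le_rfl, hbt⟩)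
    exact abs_le.mpr ⟨by linarith, by linarith⟩

/-- The divergence theorem on a rectangle, one coordinate at a time, for a continuous function with a
square integrable weak derivative. -/
theorem sideDiff_eq_boxInt {U : Set (ℝ × ℝ)} (hU : IsOpen U) {F g : ℝ × ℝ → ℝ} {k : Fin 2}
    (hF : Continuous F) (h : IsWeakDeriv U (unitIdx k) F g)
    (hg : MemLp g 2 (volume.restrict U)) {l r b t : ℝ} (hlr : l ≤ r) (hbt : b ≤ t)
    (hsub : Set.Icc l r ×ˢ Set.Icc b t ⊆ U) : sideDiff k F l r b t = boxInt g l r b t := by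
  set K := Set.Icc l r ×ˢ Set.Icc b t with hK
  have hKc : IsCompact K := isCompact_Icc.prod isCompact_Icc
  have hKm : MeasurableSet K := measurableSet_Icc.prod measurableSet_Icc
  obtain ⟨δ, hδ, hδU⟩ := exists_radius_of_isCompact hU hKc hsub
  set s : ℕ → ℝ := fun n => δ * (1 / ((n : ℝ) + 1)) with hsdef
  have hs : ∀ n, 0 < s n := fun n => by positivity
  have hs0 : Tendsto s atTop (𝓝 0) := by
    have := (tendsto_one_div_add_atTop_nhds_zero_nat (𝕜 := ℝ)).const_mul δ
    rw [mul_zero] at this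
    exact this
  have hsδ : ∀ n, s n ≤ δ := fun n => by
    have h1 : 1 / ((n : ℝ) + 1) ≤ 1 := by
      rw [div_le_one (by positivity)]; linarith [(Nat.cast_nonneg n : (0 : ℝ) ≤ n)]
    simp only [hsdef]; nlinarith
  have hFi : LocallyIntegrable (U.indicator F) := hF.locallyIntegrable.indicator hU.measurableSet
  have hgL : MemLp (U.indicator g) 2 := MemSobolev.memLp_indicator hU hg
  set G : ℕ → ℝ × ℝ → ℝ := fun n => moll (kernel (s n) (hs n)) (U.indicator F) with hG
  have hGs : ∀ n, ContDiff ℝ ∞ (G n) := fun n =>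
    contDiff_moll (contDiff_kernel (hs n)) (hasCompactSupport_kernel (hs n)) hFi
  -- `F` is uniformly continuous on a compact neighbourhood of the box, so its mollifications
  -- converge uniformly on the box and the line integrals pass to the limit.
  have lim1 : Tendsto (fun n => sideDiff k (G n) l r b t) atTop (𝓝 (sideDiff k F l r b t)) := by
    rw [Metric.tendsto_atTop]
    intro ε hε
    set η := ε / (2 * ((t - b) + (r - l)) + 1) with hη
    have hden : 0 < 2 * ((t - b) + (r - l)) + 1 := by linarith
    have hη0 : 0 < η := div_pos hε hden
    have huc := (hKc.cthickening (r := δ)).uniformContinuousOn_of_continuous hF.continuousOn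
    obtain ⟨d, hd, hdF⟩ := Metric.uniformContinuousOn_iff.mp huc η hη0
    obtain ⟨N, hN⟩ := (hs0.eventually (gt_mem_nhds hd)).exists_forall_of_atTop
    refine ⟨N, fun n hn => ?_⟩
    have hcl : ∀ p ∈ K, |G n p - F p| ≤ η := fun p hp => by
      have := abs_moll_kernel_sub_le (hs n) hFi.aestronglyMeasurable (p := p) (ε := η)
        fun q hq => by
          have hqU : q ∈ U := by
            have := hδU p hp (p - q) ((mem_ball_iff_norm'.mp hq).le.trans (hsδ n))
            simpa using this
          rw [Set.indicator_of_mem (hsub hp), Set.indicator_of_mem hqU]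
          exact (hdF q (Metric.mem_cthickening_of_dist_le q p δ K hp (hq.le.trans (hsδ n)))
            p (Metric.self_subset_cthickening K hp) (hq.trans (hN n hn))).le
      rwa [Set.indicator_of_mem (hsub hp)] at this
    rw [Real.dist_eq]
    refine (abs_sideDiff_sub_le (hGs n).continuous hF k hlr hbt hcl).trans_lt ?_
    have : η * (2 * ((t - b) + (r - l)) + 1) = ε := div_mul_cancel₀ _ hden.ne'
    nlinarith
  have lim2 : Tendsto (fun n => sideDiff k (G n) l r b t) atTop (𝓝 (boxInt g l r b t)) := by
    -- No dilation is needed here (factor one), because the closed box has a positive distance from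
    -- the complement of `U`.
    have hL2 := tendsto_integral_moll_kernel_sub_sq hgL hKm hKc.isBounded 0 hs hs0
      (k := fun _ => 1) (fun _ => by norm_num) tendsto_const_nhds
    have hbound : ∀ n, |sideDiff k (G n) l r b t - boxInt g l r b t| ≤
        √(volume.real K) * √(∫ p in K, (moll (kernel (s n) (hs n)) (U.indicator g)
          ((1 - (1 : ℝ)) • 0 + (1 : ℝ) • p) - U.indicator g p) ^ 2) := fun n => by
      have hm : MemLp (fun p => moll (kernel (s n) (hs n)) (U.indicator g)
          ((1 - (1 : ℝ)) • 0 + (1 : ℝ) • p) - U.indicator g p) 2 (volume.restrict K) :=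
        ((memLp_moll_kernel_comp_affine (hs n) hgL _ one_ne_zero).sub hgL).restrict K
      have h1 := integral_abs_le_sqrt_mul_sqrt hm
      rw [measureReal_restrict_apply_univ] at h1
      refine le_trans ?_ h1
      rw [sideDiff_eq_boxInt_pd (hGs n) k hlr hbt]
      have e1 : boxInt (pd k (G n)) l r b t - boxInt g l r b t = ∫ p in K,
          (moll (kernel (s n) (hs n)) (U.indicator g)
          ((1 - (1 : ℝ)) • 0 + (1 : ℝ) • p) - U.indicator g p) := by
        rw [integral_sub, boxInt, boxInt]
        · congr 1
          · refine setIntegral_congr_fun hKm fun p hp => ?_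
            simp only [sub_self, zero_smul, one_smul, zero_add]
            exact pd_moll_kernel_eq hU hFi h (hs n) fun q hq => hδU p hp q (hq.trans (hsδ n))
          · refine setIntegral_congr_fun hKm fun p hp => ?_
            rw [Set.indicator_of_mem (hsub hp)]
        · exact ((memLp_moll_kernel_comp_affine (hs n) hgL _ one_ne_zero).restrict K).integrable
            (by norm_num)
        · exact (hgL.restrict K).integrable (by norm_num)
      rw [e1]
      exact abs_integral_le_integral_abs
    rw [tendsto_iff_dist_tendsto_zero]
    refine squeeze_zero (fun _ => dist_nonneg) (fun n => hbound n) ?_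
    have := (hL2.sqrt).const_mul √(volume.real K)
    simpa using this
  exact tendsto_nhds_unique lim1 lim2

theorem pd_mul {f g : ℝ × ℝ → ℝ} (hf : ContDiff ℝ ∞ f) (hg : ContDiff ℝ ∞ g) (k : Fin 2) :
    pd k (fun p => f p * g p) = fun p => f p * pd k g p + pd k f p * g p := by
  funext p
  have := ((differentiable_of_contDiff hf p).hasFDerivAt.mul
    (differentiable_of_contDiff hg p).hasFDerivAt).fderiv
  have h' : fderiv ℝ (fun p => f p * g p) p = _ := this
  simp only [pd, h']
  simp [mul_comm]

/-- The product rule for a weak derivative and a smooth function. -/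
theorem IsWeakDeriv.mul_smooth {U : Set (ℝ × ℝ)} (hU : IsOpen U) {a g φ : ℝ × ℝ → ℝ} {k : Fin 2}
    (h : IsWeakDeriv U (unitIdx k) a g) (hφ : ContDiff ℝ ∞ φ) :
    IsWeakDeriv U (unitIdx k) (fun p => a p * φ p) (fun p => g p * φ p + a p * pd k φ p) := by
  have hlc := hU.isLocallyClosed
  have l1 : LocallyIntegrableOn (fun p => a p * φ p) U :=
    h.1.mul_continuousOn hφ.continuous.continuousOn hlc
  have l2 : LocallyIntegrableOn (fun p => g p * φ p) U :=
    h.2.1.mul_continuousOn hφ.continuous.continuousOn hlc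
  have l3 : LocallyIntegrableOn (fun p => a p * pd k φ p) U :=
    h.1.mul_continuousOn (contDiff_pd hφ k).continuous.continuousOn hlc
  refine ⟨l1, l2.add l3, fun ψ hψ => ?_⟩
  -- Testing the weak derivative of `a` with `φ ψ` moves the smooth factor from the test function to
  -- `a`.
  have ht : IsTest U (fun p => φ p * ψ p) :=
    ⟨hφ.mul hψ.1, hψ.2.1.mul_left, (tsupport_mul_subset_right (f := φ)).trans hψ.2.2⟩
  have e := h.2.2 _ ht
  rw [pdMulti_unitIdx, pd_mul hφ hψ.1, unitIdx_sum, pow_one] at e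
  rw [pdMulti_unitIdx, unitIdx_sum, pow_one]
  have i1 := (hψ.pd k).integrableOn_mul l1
  have i2 := hψ.integrableOn_mul l3
  have i3 := hψ.integrableOn_mul l2
  have e1 : ∫ p in U, a p * (φ p * pd k ψ p + pd k φ p * ψ p) =
      (∫ p in U, a p * φ p * pd k ψ p) + ∫ p in U, a p * pd k φ p * ψ p := by
    rw [← integral_add i1 i2]; congr 1; funext p; ring
  have e2 : ∫ p in U, (g p * φ p + a p * pd k φ p) * ψ p =
      (∫ p in U, g p * φ p * ψ p) + ∫ p in U, a p * pd k φ p * ψ p := by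
    rw [← integral_add i3 i2]; congr 1; funext p; ring
  have e3 : ∫ p in U, g p * (φ p * ψ p) = ∫ p in U, g p * φ p * ψ p := by
    congr 1; funext p; ring
  rw [e1, e3] at e
  rw [e2]
  linarith

end FVE

namespace FVE

open Filter Topology

/-! ### The coefficients of the differential operator -/

/-- Globally defined regular representatives `a`, `c'` of the coefficients `A`, `c`, with the weak
derivatives `g k j = ∂_k a_kj`, and their bounds. -/
structure IsCoeff (Ω : Rect) (A : ℝ × ℝ → Matrix (Fin 2) (Fin 2) ℝ) (c : ℝ × ℝ → ℝ)
    (a g : Fin 2 → Fin 2 → ℝ × ℝ → ℝ) (c' : ℝ × ℝ → ℝ) (M L C₁ : ℝ) : Prop where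
  a_eq : ∀ k j, ∀ p ∈ Ω.dom, a k j p = A p k j
  a_cont : ∀ k j, Continuous (a k j)
  a_lip : ∀ k j p q, |a k j p - a k j q| ≤ L * dist p q
  a_le : ∀ k j p, |a k j p| ≤ M
  weak : ∀ k j, IsWeakDeriv Ω.dom (unitIdx k) (a k j) (g k j)
  g_le : ∀ k j, ∀ᵐ p ∂(volume.restrict Ω.dom), |g k j p| ≤ M
  c_meas : Measurable c'
  c_nonneg : ∀ p, 0 ≤ c' p
  c_le : ∀ p, c' p ≤ M
  c_ae : c =ᵐ[volume.restrict Ω.dom] c'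
  L_nonneg : 0 ≤ L
  C_pos : 0 < C₁
  ell : ∀ p ∈ Ω.dom, ∀ s t : ℝ, C₁ * (s ^ 2 + t ^ 2) ≤
    a 0 0 p * s ^ 2 + (a 0 1 p + a 1 0 p) * (s * t) + a 1 1 p * t ^ 2

theorem Rect.nonempty_dom (Ω : Rect) : Ω.dom.Nonempty :=
  (Set.nonempty_Ioo.mpr Ω.hab).prod (Set.nonempty_Ioo.mpr Ω.hcd)

/-- A continuous function in `W^{1,∞}` of a rectangle extends to a bounded Lipschitz function. -/
theorem exists_lipschitz_extension {Ω : Rect} {F : ℝ × ℝ → ℝ} (hF : MemSobolev 1 ⊤ Ω.dom F)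
    (hFc : ContinuousOn F Ω.dom) :
    ∃ e : ℝ × ℝ → ℝ, ∃ L M, 0 ≤ L ∧ Continuous e ∧ (∀ p ∈ Ω.dom, e p = F p) ∧
      (∀ p q, |e p - e q| ≤ L * dist p q) ∧ ∀ p, |e p| ≤ M := by
  obtain ⟨L, hL, h⟩ := exists_lipschitz_of_memSobolev hF hFc
  have hlip : LipschitzOnWith L.toNNReal F Ω.dom :=
    LipschitzOnWith.of_dist_le_mul fun p hp q hq => by
      rw [Real.coe_toNNReal L hL, Real.dist_eq]; exact h p hp q hq
  obtain ⟨e, he, heq⟩ := hlip.extend_real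
  obtain ⟨p₀, hp₀⟩ := Ω.nonempty_dom
  set M := |F p₀| + L * Metric.diam Ω.dom with hM
  have hM0 : 0 ≤ M := by have := Metric.diam_nonneg (s := Ω.dom); positivity
  have hFM : ∀ p ∈ Ω.dom, |F p| ≤ M := fun p hp => by
    have h1 := h p hp p₀ hp₀
    have h2 := mul_le_mul_of_nonneg_left (Metric.dist_le_diam_of_mem Ω.isBounded_dom hp hp₀) hL
    have h3 := abs_sub_abs_le_abs_sub (F p) (F p₀)
    linarith
  -- Truncation at the levels `-M` and `M` keeps the Lipschitz constant and changes nothing on the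
  -- domain, where `|F| ≤ M`.
  have hl : LipschitzWith L.toNNReal fun p => max (-M) (min M (e p)) :=
    (he.const_min M).const_max (-M)
  refine ⟨fun p => max (-M) (min M (e p)), L, M, hL, hl.continuous, fun p hp => ?_, fun p q => ?_,
    fun p => abs_le.mpr ⟨le_max_left _ _, max_le (by linarith) (min_le_left _ _)⟩⟩
  · have h1 := abs_le.mp (hFM p hp)
    simp only [← heq hp, min_eq_right h1.2, max_eq_right h1.1]
  · have := hl.dist_le_mul p q
    rwa [Real.coe_toNNReal L hL, Real.dist_eq] at this

theorem IsWeakDeriv.congr_on {U : Set (ℝ × ℝ)} (hU : IsOpen U) {α : ℕ × ℕ} {f f' g : ℝ × ℝ → ℝ}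
    (h : IsWeakDeriv U α f g) (hff : ∀ p ∈ U, f' p = f p) (hf' : Continuous f') :
    IsWeakDeriv U α f' g := by
  refine ⟨(hf'.locallyIntegrable).locallyIntegrableOn U, h.2.1, fun φ hφ => ?_⟩
  rw [← h.2.2 φ hφ]
  exact setIntegral_congr_fun hU.measurableSet fun p hp => by simp only [hff p hp]

/-- Continuous coefficients on the whole plane make line integrals of fluxes along the midlines
unproblematic. The entries of `A` are extended as bounded Lipschitz functions, and `c` is replaced
by a truncated measurable version. One `M`, the sum of all the bounds, serves for all of them. -/
theorem exists_isCoeff {Ω : Rect} {A : ℝ × ℝ → Matrix (Fin 2) (Fin 2) ℝ} {c : ℝ × ℝ → ℝ}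
    (hA : ∀ i j, MemSobolev 1 ⊤ Ω.dom (fun p => A p i j))
    (hAcont : ∀ i j, ContinuousOn (fun p => A p i j) Ω.dom)
    (hAell : UniformlyElliptic Ω.dom A)
    (hc : MemLp c ⊤ (volume.restrict Ω.dom))
    (hc0 : ∀ᵐ p ∂(volume.restrict Ω.dom), 0 ≤ c p) :
    ∃ a g c' M L C₁, IsCoeff Ω A c a g c' M L C₁ := by
  choose e L M hL hec heq hel heM using fun k j => exists_lipschitz_extension (hA k j) (hAcont k j)
  have hg : ∀ k j, ∃ g, IsWeakDeriv Ω.dom (unitIdx k) (fun p => A p k j) g ∧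
      MemLp g ⊤ (volume.restrict Ω.dom) := fun k j => hA k j _ (unitIdx_sum k).le
  choose g hg hgL using hg
  choose N hN0 hN using fun k j => exists_ae_bound (hgL k j)
  obtain ⟨R, hR0, hR⟩ := exists_ae_bound hc
  obtain ⟨C₁, hC₁, C₂, -, hell⟩ := hAell
  have hM0 : ∀ k j, 0 ≤ M k j := fun k j => (abs_nonneg _).trans (heM k j 0)
  have sum_le : ∀ f : Fin 2 → Fin 2 → ℝ, (∀ k j, 0 ≤ f k j) → ∀ k j, f k j ≤ ∑ k, ∑ j, f k j :=
    fun f hf k j => (Finset.single_le_sum (f := fun j => f k j) (fun j _ => hf k j)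
      (Finset.mem_univ j)).trans (Finset.single_le_sum (f := fun k => ∑ j, f k j)
      (fun k _ => Finset.sum_nonneg fun j _ => hf k j) (Finset.mem_univ k))
  have sM := sum_le M hM0
  have sN := sum_le N hN0
  have sL := sum_le L hL
  have pM : 0 ≤ ∑ k, ∑ j, M k j := Finset.sum_nonneg fun _ _ => Finset.sum_nonneg fun _ _ => hM0 _ _
  have pN : 0 ≤ ∑ k, ∑ j, N k j := Finset.sum_nonneg fun _ _ => Finset.sum_nonneg fun _ _ => hN0 _ _
  refine ⟨e, g, fun p => max 0 (min R (hc.1.mk c p)), (∑ k, ∑ j, M k j) + (∑ k, ∑ j, N k j) + R,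
    ∑ k, ∑ j, L k j, C₁, ?_⟩
  refine
  { a_eq := heq
    a_cont := hec
    a_lip := fun k j p q => (hel k j p q).trans (mul_le_mul_of_nonneg_right (sL k j) dist_nonneg)
    a_le := fun k j p => (heM k j p).trans (by linarith [sM k j])
    weak := fun k j => (hg k j).congr_on Ω.isOpen_dom (heq k j) (hec k j)
    g_le := fun k j => by
      filter_upwards [hN k j] with p hp
      linarith [sN k j]
    c_meas := measurable_const.max (measurable_const.min hc.1.stronglyMeasurable_mk.measurable)
    c_nonneg := fun p => le_max_left _ _
    c_le := fun p => max_le (by linarith) ((min_le_left _ _).trans (by linarith))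
    c_ae := by
      filter_upwards [hc.1.ae_eq_mk, hR, hc0] with p h1 h2 h3
      rw [← h1, min_eq_right ((le_abs_self _).trans h2), max_eq_right h3]
    L_nonneg := Finset.sum_nonneg fun _ _ => Finset.sum_nonneg fun _ _ => hL _ _
    C_pos := hC₁
    ell := fun p hp s t => ?_ }
  have h := (hell p hp ![s, t]).1
  simp only [Matrix.mulVec, dotProduct, Fin.sum_univ_two, Matrix.cons_val_zero,
    Matrix.cons_val_one] at h
  rw [heq 0 0 p hp, heq 0 1 p hp, heq 1 0 p hp, heq 1 1 p hp]
  linarith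

/-! ### The balance of fluxes -/

instance isFiniteMeasure_dom (Ω : Rect) : IsFiniteMeasure ((volume : Measure (ℝ × ℝ)).restrict Ω.dom) :=
  isFiniteMeasure_restrict.mpr Ω.isBounded_dom.measure_lt_top.ne

theorem memLp_two_dom_of_continuous {Ω : Rect} {v : ℝ × ℝ → ℝ} (hv : Continuous v) :
    MemLp v 2 (volume.restrict Ω.dom) :=
  (memLp_two_box_of_continuous hv Ω.a Ω.b Ω.c Ω.d).mono_measure (Measure.restrict_mono
    (Set.prod_mono Set.Ioo_subset_Icc_self Set.Ioo_subset_Icc_self) le_rfl)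

/-- A bounded measurable function on the rectangle. -/
def IsBdd (Ω : Rect) (q : ℝ × ℝ → ℝ) : Prop :=
  AEStronglyMeasurable q (volume.restrict Ω.dom) ∧ ∃ B, ∀ᵐ p ∂(volume.restrict Ω.dom), |q p| ≤ B

theorem IsBdd.mul {Ω : Rect} {q r : ℝ × ℝ → ℝ} (hq : IsBdd Ω q) (hr : IsBdd Ω r) :
    IsBdd Ω fun p => q p * r p := by
  obtain ⟨hq1, B, hB⟩ := hq
  obtain ⟨hr1, C, hC⟩ := hr
  refine ⟨hq1.mul hr1, B * C, ?_⟩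
  filter_upwards [hB, hC] with p h1 h2
  rw [abs_mul]
  exact mul_le_mul h1 h2 (abs_nonneg _) ((abs_nonneg _).trans h1)

theorem IsBdd.of_continuous {Ω : Rect} {q : ℝ × ℝ → ℝ} (hq : Continuous q) : IsBdd Ω q := by
  obtain ⟨B, hB⟩ := (isCompact_Icc.prod isCompact_Icc :
    IsCompact (Set.Icc Ω.a Ω.b ×ˢ Set.Icc Ω.c Ω.d)).exists_bound_of_continuousOn hq.continuousOn
  refine ⟨hq.aestronglyMeasurable, B, ?_⟩
  filter_upwards [ae_restrict_mem Ω.isOpen_dom.measurableSet] with p hp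
  exact hB p (Set.prod_mono Set.Ioo_subset_Icc_self Set.Ioo_subset_Icc_self hp)

theorem IsBdd.memLp_mul {Ω : Rect} {q v : ℝ × ℝ → ℝ} (hq : IsBdd Ω q)
    (hv : MemLp v 2 (volume.restrict Ω.dom)) :
    MemLp (fun p => q p * v p) 2 (volume.restrict Ω.dom) := by
  obtain ⟨hq1, B, hB⟩ := hq
  refine hv.of_le_mul (c := B) (hq1.mul hv.1) ?_
  filter_upwards [hB] with p h
  rw [norm_mul]
  exact mul_le_mul_of_nonneg_right h (norm_nonneg _)

theorem IsBdd.integrableOn_mul {Ω : Rect} {q v : ℝ × ℝ → ℝ} (hq : IsBdd Ω q)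
    (hv : MemLp v 2 (volume.restrict Ω.dom)) {S : Set (ℝ × ℝ)} (hS : S ⊆ Ω.dom) :
    IntegrableOn (fun p => q p * v p) S :=
  IntegrableOn.mono_set (t := Ω.dom) ((hq.memLp_mul hv).integrable (by norm_num)) hS

/-- On a domain of finite measure `L²` convergence implies `L¹` convergence, and the factor `q` is
bounded. This is the only limit passage used for integrals that contain the coefficients. -/
theorem IsBdd.tendsto_setIntegral_mul {Ω : Rect} {q v : ℝ × ℝ → ℝ} {V : ℕ → ℝ × ℝ → ℝ}
    (hq : IsBdd Ω q) (hv : MemLp v 2 (volume.restrict Ω.dom)) (hV : ∀ n, Continuous (V n))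
    (hlim : Tendsto (fun n => ∫ p in Ω.dom, (V n p - v p) ^ 2) atTop (𝓝 0))
    {S : Set (ℝ × ℝ)} (hS : S ⊆ Ω.dom) :
    Tendsto (fun n => ∫ p in S, q p * V n p) atTop (𝓝 (∫ p in S, q p * v p)) := by
  have hq' := hq
  obtain ⟨hq1, B, hB⟩ := hq
  rw [tendsto_iff_dist_tendsto_zero]
  have hb : ∀ n, dist (∫ p in S, q p * V n p) (∫ p in S, q p * v p) ≤
      |B| * (√((volume.restrict Ω.dom).real Set.univ) * √(∫ p in Ω.dom, (V n p - v p) ^ 2)) :=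
    fun n => by
      have hd : MemLp (fun p => V n p - v p) 2 (volume.restrict Ω.dom) :=
        (memLp_two_dom_of_continuous (hV n)).sub hv
      have hi : Integrable (fun p => V n p - v p) (volume.restrict Ω.dom) :=
        hd.integrable (by norm_num)
      rw [Real.dist_eq, ← integral_sub (hq'.integrableOn_mul (memLp_two_dom_of_continuous (hV n)) hS)
        (hq'.integrableOn_mul hv hS)]
      refine abs_integral_le_integral_abs.trans ?_
      refine le_trans ?_ (mul_le_mul_of_nonneg_left (integral_abs_le_sqrt_mul_sqrt hd) (abs_nonneg B))
      rw [← integral_const_mul]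
      have hI : IntegrableOn (fun p => |B| * |V n p - v p|) Ω.dom := hi.abs.const_mul _
      refine le_trans ?_ (setIntegral_mono_set (s := S) hI
        (Eventually.of_forall fun p => by positivity) hS.eventuallyLE)
      refine integral_mono_ae ?_ (hI.mono_set hS) ?_
      · exact ((hq'.integrableOn_mul (memLp_two_dom_of_continuous (hV n)) hS).sub
          (hq'.integrableOn_mul hv hS)).abs
      · filter_upwards [ae_restrict_of_ae_restrict_of_subset hS hB] with p hp
        rw [← mul_sub, abs_mul]
        exact mul_le_mul_of_nonneg_right (hp.trans (le_abs_self _)) (abs_nonneg _)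
  refine squeeze_zero (fun _ => dist_nonneg) hb ?_
  simpa using ((hlim.sqrt).const_mul √((volume.restrict Ω.dom).real Set.univ)).const_mul |B|

/-- The integral of `b L v` over `S`, for the nondivergence form `L` of the differential operator,
`v` being given by its derivatives. -/
noncomputable def opInt (a g : Fin 2 → Fin 2 → ℝ × ℝ → ℝ) (c b : ℝ × ℝ → ℝ) (S : Set (ℝ × ℝ))
    (v : ℕ × ℕ → ℝ × ℝ → ℝ) : ℝ :=
  -(∑ k, ∑ j, ((∫ p in S, (b p * g k j p) * v (unitIdx j) p) +
    ∫ p in S, (b p * a k j p) * v (unitIdx k + unitIdx j) p)) +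
    ∫ p in S, (b p * c p) * v (0, 0) p

/-- The nondivergence form of the differential operator. -/
noncomputable def opFun (a g : Fin 2 → Fin 2 → ℝ × ℝ → ℝ) (c : ℝ × ℝ → ℝ)
    (v : ℕ × ℕ → ℝ × ℝ → ℝ) (p : ℝ × ℝ) : ℝ :=
  -(∑ k, ∑ j, (g k j p * v (unitIdx j) p + a k j p * v (unitIdx k + unitIdx j) p)) +
    c p * v (0, 0) p

/-- The `k`-th component of the flux `a ∇w`. -/
noncomputable def fluxComp (a : Fin 2 → Fin 2 → ℝ × ℝ → ℝ) (k : Fin 2) (w : ℝ × ℝ → ℝ) (p : ℝ × ℝ) :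
    ℝ := a k 0 p * pd 0 w p + a k 1 p * pd 1 w p

section Balance

variable {Ω : Rect} {A : ℝ × ℝ → Matrix (Fin 2) (Fin 2) ℝ} {c c' f u : ℝ × ℝ → ℝ}
  {a g : Fin 2 → Fin 2 → ℝ × ℝ → ℝ} {M L C₁ : ℝ}

theorem IsCoeff.isBdd_a (H : IsCoeff Ω A c a g c' M L C₁) (k j : Fin 2) : IsBdd Ω (a k j) :=
  .of_continuous (H.a_cont k j)

theorem IsCoeff.isBdd_g (H : IsCoeff Ω A c a g c' M L C₁) (k j : Fin 2) : IsBdd Ω (g k j) :=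
  ⟨(H.weak k j).2.1.aestronglyMeasurable, M, H.g_le k j⟩

theorem IsCoeff.isBdd_c (H : IsCoeff Ω A c a g c' M L C₁) : IsBdd Ω c' :=
  ⟨H.c_meas.aestronglyMeasurable, M, Eventually.of_forall fun p => by
    rw [abs_of_nonneg (H.c_nonneg p)]; exact H.c_le p⟩

theorem unitIdx_add_sum_le (k j : Fin 2) :
    (unitIdx k + unitIdx j).1 + (unitIdx k + unitIdx j).2 ≤ 2 := by
  have h1 := unitIdx_sum k
  have h2 := unitIdx_sum j
  simp only [Prod.fst_add, Prod.snd_add]; omega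

/-- The termwise form suits passing to the limit, the single integral suits the differential
equation. The weight `b` is a test function when the strong form is derived, and constant one for
the balance on a control volume. -/
theorem IsCoeff.opInt_eq (H : IsCoeff Ω A c a g c' M L C₁) {b : ℝ × ℝ → ℝ} (hb : IsBdd Ω b)
    {S : Set (ℝ × ℝ)} (hS : S ⊆ Ω.dom) {v : ℕ × ℕ → ℝ × ℝ → ℝ}
    (hv : ∀ α : ℕ × ℕ, α.1 + α.2 ≤ 2 → MemLp (v α) 2 (volume.restrict Ω.dom)) :
    opInt a g c' b S v = ∫ p in S, b p * opFun a g c' v p := by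
  have i1 : ∀ k j, IntegrableOn (fun p => (b p * g k j p) * v (unitIdx j) p) S := fun k j =>
    (hb.mul (H.isBdd_g k j)).integrableOn_mul (hv _ (by rw [unitIdx_sum]; norm_num)) hS
  have i2 : ∀ k j, IntegrableOn (fun p => (b p * a k j p) * v (unitIdx k + unitIdx j) p) S :=
    fun k j => (hb.mul (H.isBdd_a k j)).integrableOn_mul (hv _ (unitIdx_add_sum_le k j)) hS
  have i3 : IntegrableOn (fun p => (b p * c' p) * v (0, 0) p) S :=
    (hb.mul H.isBdd_c).integrableOn_mul (hv _ (by norm_num)) hS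
  have i4 : ∀ k, IntegrableOn (fun p => ∑ j, ((b p * g k j p) * v (unitIdx j) p +
      (b p * a k j p) * v (unitIdx k + unitIdx j) p)) S := fun k =>
    integrable_finsetSum _ fun j _ => (i1 k j).add (i2 k j)
  have i5 : IntegrableOn (fun p => ∑ k, ∑ j, ((b p * g k j p) * v (unitIdx j) p +
      (b p * a k j p) * v (unitIdx k + unitIdx j) p)) S :=
    integrable_finsetSum _ fun k _ => i4 k
  have e : (fun p => b p * opFun a g c' v p) = fun p =>
      -(∑ k, ∑ j, ((b p * g k j p) * v (unitIdx j) p +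
        (b p * a k j p) * v (unitIdx k + unitIdx j) p)) + (b p * c' p) * v (0, 0) p := by
    funext p
    simp only [opFun, Fin.sum_univ_two]; ring
  rw [e, integral_add i5.fun_neg i3, integral_neg, integral_finsetSum _ fun k _ => i4 k, opInt]
  congr 2
  refine Finset.sum_congr rfl fun k _ => ?_
  refine Eq.trans ?_ (integral_finsetSum _ fun j _ => (i1 k j).add (i2 k j)).symm
  exact Finset.sum_congr rfl fun j _ => (integral_add (i1 k j) (i2 k j)).symm

theorem IsCoeff.tendsto_opInt (H : IsCoeff Ω A c a g c' M L C₁) {b : ℝ × ℝ → ℝ} (hb : IsBdd Ω b)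
    {S : Set (ℝ × ℝ)} (hS : S ⊆ Ω.dom) {v : ℕ × ℕ → ℝ × ℝ → ℝ} {w : ℕ → ℝ × ℝ → ℝ}
    (hv : ∀ α : ℕ × ℕ, α.1 + α.2 ≤ 2 → MemLp (v α) 2 (volume.restrict Ω.dom))
    (hw : ∀ n, ContDiff ℝ ∞ (w n))
    (hlim : ∀ α : ℕ × ℕ, α.1 + α.2 ≤ 2 →
      Tendsto (fun n => ∫ p in Ω.dom, (pdMulti α (w n) p - v α p) ^ 2) atTop (𝓝 0)) :
    Tendsto (fun n => opInt a g c' b S fun α => pdMulti α (w n)) atTop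
      (𝓝 (opInt a g c' b S v)) := by
  have key : ∀ {q : ℝ × ℝ → ℝ}, IsBdd Ω q → ∀ α : ℕ × ℕ, α.1 + α.2 ≤ 2 →
      Tendsto (fun n => ∫ p in S, (b p * q p) * pdMulti α (w n) p) atTop
        (𝓝 (∫ p in S, (b p * q p) * v α p)) := fun hq α hα =>
    (hb.mul hq).tendsto_setIntegral_mul (hv α hα)
      (fun n => (contDiff_pdMulti (hw n) α).continuous) (hlim α hα) hS
  unfold opInt
  refine ((tendsto_finsetSum _ fun k _ => tendsto_finsetSum _ fun j _ => ?_).neg).add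
    (key H.isBdd_c _ (by norm_num))
  exact (key (H.isBdd_g k j) _ (by rw [unitIdx_sum]; norm_num)).add
    (key (H.isBdd_a k j) _ (unitIdx_add_sum_le k j))

/-- The weak form of the operator agrees with its nondivergence form. -/
theorem IsCoeff.weak_form_eq (H : IsCoeff Ω A c a g c' M L C₁) {w φ : ℝ × ℝ → ℝ}
    (hw : ContDiff ℝ ∞ w) (hφ : IsTest Ω.dom φ) :
    (∑ k, ∑ j, ∫ p in Ω.dom, (a k j p * pd k φ p) * pd j w p) +
      ∫ p in Ω.dom, (φ p * c' p) * w p = opInt a g c' φ Ω.dom fun α => pdMulti α w := by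
  have hb : IsBdd Ω φ := .of_continuous hφ.1.continuous
  rw [opInt, ← Finset.sum_neg_distrib]
  congr 1
  refine Finset.sum_congr rfl fun k _ => ?_
  rw [← Finset.sum_neg_distrib]
  refine Finset.sum_congr rfl fun j _ => ?_
  -- Integration by parts with the product rule for the Lipschitz coefficient and the smooth
  -- function `∂_j w`; this is where the derivatives `g k j` of the coefficients appear.
  have h := ((H.weak k j).mul_smooth Ω.isOpen_dom (contDiff_pd hw j)).2.2 φ hφ
  rw [pdMulti_unitIdx, unitIdx_sum, pow_one] at h
  have h1 : ∫ p in Ω.dom, (a k j p * pd k φ p) * pd j w p =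
      ∫ p in Ω.dom, a k j p * pd j w p * pd k φ p := by congr 1; funext p; ring
  rw [h1, h, neg_one_mul, neg_inj, ← integral_add]
  · congr 1; funext p
    rw [pdMulti_unitIdx, pdMulti_unitIdx_add hw]; ring
  · refine (hb.mul (H.isBdd_g k j)).integrableOn_mul ?_ subset_rfl
    exact memLp_two_dom_of_continuous (contDiff_pdMulti hw _).continuous
  · refine (hb.mul (H.isBdd_a k j)).integrableOn_mul ?_ subset_rfl
    exact memLp_two_dom_of_continuous (contDiff_pdMulti hw _).continuous

/-- The divergence theorem for the operator on a rectangle. -/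
theorem IsCoeff.sideDiff_flux_eq (H : IsCoeff Ω A c a g c' M L C₁) {w : ℝ × ℝ → ℝ}
    (hw : ContDiff ℝ ∞ w) {l r b t : ℝ} (hlr : l ≤ r) (hbt : b ≤ t)
    (hsub : Set.Icc l r ×ˢ Set.Icc b t ⊆ Ω.dom) :
    -(∑ k, sideDiff k (fluxComp a k w) l r b t) + boxInt (fun p => c' p * w p) l r b t =
      opInt a g c' (fun _ => 1) (Set.Icc l r ×ˢ Set.Icc b t) fun α => pdMulti α w := by
  have hadd : ∀ (k : Fin 2) {F G : ℝ × ℝ → ℝ}, Continuous F → Continuous G →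
      sideDiff k (fun p => F p + G p) l r b t = sideDiff k F l r b t + sideDiff k G l r b t := by
    intro k F G hF hG
    unfold sideDiff
    split_ifs <;>
    · rw [intervalIntegral.integral_add, intervalIntegral.integral_add]
      · ring
      all_goals exact Continuous.intervalIntegrable (by fun_prop) _ _
  have cont : ∀ k j, Continuous fun p => a k j p * pd j w p := fun k j =>
    (H.a_cont k j).mul (contDiff_pd hw j).continuous
  have hsum : ∀ k, sideDiff k (fluxComp a k w) l r b t =
      ∑ j, sideDiff k (fun p => a k j p * pd j w p) l r b t := fun k => by
    rw [Fin.sum_univ_two, ← hadd k (cont k 0) (cont k 1)]; rfl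
  rw [opInt]
  congr 1
  · congr 1
    refine Finset.sum_congr rfl fun k _ => ?_
    rw [hsum]
    refine Finset.sum_congr rfl fun j _ => ?_
    have m1 : MemLp (pd j w) 2 (volume.restrict Ω.dom) :=
      memLp_two_dom_of_continuous (contDiff_pd hw j).continuous
    have m2 : MemLp (pd k (pd j w)) 2 (volume.restrict Ω.dom) :=
      memLp_two_dom_of_continuous (contDiff_pd (contDiff_pd hw j) k).continuous
    rw [sideDiff_eq_boxInt Ω.isOpen_dom (cont k j)
      ((H.weak k j).mul_smooth Ω.isOpen_dom (contDiff_pd hw j))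
      (((H.isBdd_g k j).memLp_mul m1).add ((H.isBdd_a k j).memLp_mul m2)) hlr hbt hsub, boxInt,
      integral_add ((H.isBdd_g k j).integrableOn_mul m1 hsub)
      ((H.isBdd_a k j).integrableOn_mul m2 hsub)]
    simp only [one_mul, pdMulti_unitIdx, pdMulti_unitIdx_add hw]
  · simp only [one_mul]; rfl

theorem IsCoeff.memLp_opFun (H : IsCoeff Ω A c a g c' M L C₁) {v : ℕ × ℕ → ℝ × ℝ → ℝ}
    (hv : ∀ α : ℕ × ℕ, α.1 + α.2 ≤ 2 → MemLp (v α) 2 (volume.restrict Ω.dom)) :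
    MemLp (opFun a g c' v) 2 (volume.restrict Ω.dom) := by
  have h1 : ∀ k j, MemLp (fun p => g k j p * v (unitIdx j) p +
      a k j p * v (unitIdx k + unitIdx j) p) 2 (volume.restrict Ω.dom) := fun k j =>
    ((H.isBdd_g k j).memLp_mul (hv _ (by rw [unitIdx_sum]; norm_num))).add
      ((H.isBdd_a k j).memLp_mul (hv _ (unitIdx_add_sum_le k j)))
  have h2 : ∀ k, MemLp (fun p => ∑ j, (g k j p * v (unitIdx j) p +
      a k j p * v (unitIdx k + unitIdx j) p)) 2 (volume.restrict Ω.dom) := fun k =>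
    memLp_finsetSum _ fun j _ => h1 k j
  have h3 : MemLp (fun p => ∑ k, ∑ j, (g k j p * v (unitIdx j) p +
      a k j p * v (unitIdx k + unitIdx j) p)) 2 (volume.restrict Ω.dom) :=
    memLp_finsetSum _ fun k _ => h2 k
  exact h3.neg.add (H.isBdd_c.memLp_mul (hv _ (by norm_num)))

/-- A strong form of the differential equation, tested with smooth functions. -/
theorem IsCoeff.integral_mul_opFun (H : IsCoeff Ω A c a g c' M L C₁)
    (hsol : IsSolution Ω A c f u) (hu : MemSobolev 3 2 Ω.dom u) {w : ℕ → ℝ × ℝ → ℝ}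
    (hw : ∀ n, ContDiff ℝ ∞ (w n))
    (hlim : ∀ α : ℕ × ℕ, α.1 + α.2 ≤ 2 → Tendsto (fun n => ∫ p in Ω.dom,
        (pdMulti α (w n) p - weakDeriv Ω.dom α u p) ^ 2) atTop (𝓝 0))
    {φ : ℝ × ℝ → ℝ} (hφ : IsTest Ω.dom φ) :
    ∫ p in Ω.dom, φ p * opFun a g c' (fun α => weakDeriv Ω.dom α u) p =
      ∫ p in Ω.dom, f p * φ p := by
  have hU := Ω.isOpen_dom
  set v : ℕ × ℕ → ℝ × ℝ → ℝ := fun α => weakDeriv Ω.dom α u with hv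
  have hvL : ∀ α : ℕ × ℕ, α.1 + α.2 ≤ 2 → MemLp (v α) 2 (volume.restrict Ω.dom) := fun α hα =>
    (hu.weakDeriv_spec hU (hα.trans (by norm_num))).2
  have hu0 : v (0, 0) =ᵐ[volume.restrict Ω.dom] u :=
    weakDeriv_ae_eq hU (isWeakDeriv_zero (hu.weakDeriv_spec hU (α := (0, 0)) (by norm_num)).1.1)
  have hb : IsBdd Ω φ := .of_continuous hφ.1.continuous
  have hbk : ∀ k, IsBdd Ω (pd k φ) := fun k => .of_continuous (contDiff_pd hφ.1 k).continuous
  rw [← H.opInt_eq hb subset_rfl hvL]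
  -- For smooth functions the weak and the nondivergence form agree. Along the approximating
  -- sequence both converge, the weak one to the left side of the equation satisfied by `u`.
  refine tendsto_nhds_unique (H.tendsto_opInt hb subset_rfl hvL hw hlim) ?_
  simp_rw [← H.weak_form_eq (hw _) hφ]
  have hd : ∀ j : Fin 2, (unitIdx j).1 + (unitIdx j).2 ≤ 2 := fun j => by
    rw [unitIdx_sum]; norm_num
  have t1 : ∀ k j, Tendsto (fun n => ∫ p in Ω.dom, (a k j p * pd k φ p) * pd j (w n) p) atTop
      (𝓝 (∫ p in Ω.dom, (a k j p * pd k φ p) * v (unitIdx j) p)) := fun k j => by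
    have := ((H.isBdd_a k j).mul (hbk k)).tendsto_setIntegral_mul (hvL _ (hd j))
      (fun n => (contDiff_pdMulti (hw n) _).continuous) (hlim _ (hd j)) subset_rfl
    simpa only [pdMulti_unitIdx] using this
  have t2 : Tendsto (fun n => ∫ p in Ω.dom, (φ p * c' p) * w n p) atTop
      (𝓝 (∫ p in Ω.dom, (φ p * c' p) * v (0, 0) p)) :=
    (hb.mul H.isBdd_c).tendsto_setIntegral_mul (hvL _ (by norm_num))
      (fun n => (hw n).continuous) (hlim (0, 0) (by norm_num)) subset_rfl
  have t3 := (tendsto_finsetSum Finset.univ fun k _ => tendsto_finsetSum Finset.univ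
    fun j _ => t1 k j).add t2
  convert t3 using 2
  rw [← hsol.2.2.2 φ hφ]
  have i1 : ∀ k j, IntegrableOn (fun p => (a k j p * pd k φ p) * v (unitIdx j) p) Ω.dom :=
    fun k j => ((H.isBdd_a k j).mul (hbk k)).integrableOn_mul (hvL _ (hd j)) subset_rfl
  have i2 : IntegrableOn (fun p => (φ p * c' p) * v (0, 0) p) Ω.dom :=
    (hb.mul H.isBdd_c).integrableOn_mul (hvL _ (by norm_num)) subset_rfl
  have i3 : ∀ k, IntegrableOn (fun p => ∑ j, (a k j p * pd k φ p) * v (unitIdx j) p) Ω.dom :=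
    fun k => integrable_finsetSum _ fun j _ => i1 k j
  have e1 : (∑ k, ∑ j, ∫ p in Ω.dom, (a k j p * pd k φ p) * v (unitIdx j) p) =
      ∫ p in Ω.dom, ∑ k, ∑ j, (a k j p * pd k φ p) * v (unitIdx j) p := by
    rw [integral_finsetSum _ fun k _ => i3 k]
    exact Finset.sum_congr rfl fun k _ => (integral_finsetSum _ fun j _ => i1 k j).symm
  rw [e1, ← integral_add (integrable_finsetSum _ fun k _ => i3 k) i2]
  refine integral_congr_ae ?_
  filter_upwards [hu0, H.c_ae, ae_restrict_mem hU.measurableSet] with p h1 h2 hp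
  rw [h1, h2]
  simp only [Matrix.mulVec, dotProduct, Fin.sum_univ_two, Matrix.cons_val_zero,
    Matrix.cons_val_one, H.a_eq _ _ p hp, unitIdx, v]
  simp only [if_true, if_neg (one_ne_zero : (1 : Fin 2) ≠ 0)]
  ring

/-- The strong form of the differential equation. -/
theorem IsCoeff.ae_opFun_eq (H : IsCoeff Ω A c a g c' M L C₁) (hf : MemLp f 2 (volume.restrict Ω.dom))
    (hsol : IsSolution Ω A c f u) (hu : MemSobolev 3 2 Ω.dom u) {w : ℕ → ℝ × ℝ → ℝ}
    (hw : ∀ n, ContDiff ℝ ∞ (w n))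
    (hlim : ∀ α : ℕ × ℕ, α.1 + α.2 ≤ 2 → Tendsto (fun n => ∫ p in Ω.dom,
        (pdMulti α (w n) p - weakDeriv Ω.dom α u p) ^ 2) atTop (𝓝 0)) :
    ∀ᵐ p, p ∈ Ω.dom → opFun a g c' (fun α => weakDeriv Ω.dom α u) p - f p = 0 := by
  have hU := Ω.isOpen_dom
  set v : ℕ × ℕ → ℝ × ℝ → ℝ := fun α => weakDeriv Ω.dom α u with hv
  have hop : MemLp (opFun a g c' v) 2 (volume.restrict Ω.dom) := H.memLp_opFun fun α hα =>
    (hu.weakDeriv_spec hU (hα.trans (by norm_num))).2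
  have hL : MemLp (fun p => opFun a g c' v p - f p) 2 (volume.restrict Ω.dom) := hop.sub hf
  have hli : LocallyIntegrableOn (fun p => opFun a g c' v p - f p) Ω.dom :=
    IntegrableOn.locallyIntegrableOn (hL.integrable (by norm_num))
  refine IsOpen.ae_eq_zero_of_integral_contDiff_smul_eq_zero hU hli fun φ hφ hc hs => ?_
  have hφ' : IsTest Ω.dom φ := ⟨hφ, hc, hs⟩
  have hb : IsBdd Ω φ := .of_continuous hφ.continuous
  have e := H.integral_mul_opFun hsol hu hw hlim hφ'
  have e2 : ∫ p, φ p • (opFun a g c' v p - f p) = ∫ p in Ω.dom, φ p * (opFun a g c' v p - f p) := by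
    rw [setIntegral_eq_integral_of_forall_compl_eq_zero]
    · rfl
    · intro p hp
      rw [image_eq_zero_of_notMem_tsupport fun h => hp (hs h), zero_mul]
  rw [e2]
  simp_rw [mul_sub]
  rw [integral_sub (hb.integrableOn_mul hop subset_rfl) (hb.integrableOn_mul hf subset_rfl), e]
  simp_rw [mul_comm (f _)]
  exact sub_self _

/-- For smooth functions the divergence theorem expresses the balance as the integral of the
nondivergence operator over the box. That integral converges, because it involves derivatives up to
order two only, and its limit is the integral of `f` by the strong form of the equation. The fluxes
of `u` itself never occur. -/
theorem IsCoeff.tendsto_balance (H : IsCoeff Ω A c a g c' M L C₁) (hf : MemLp f 2 (volume.restrict Ω.dom))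
    (hsol : IsSolution Ω A c f u) (hu : MemSobolev 3 2 Ω.dom u) {w : ℕ → ℝ × ℝ → ℝ}
    (hw : ∀ n, ContDiff ℝ ∞ (w n))
    (hlim : ∀ α : ℕ × ℕ, α.1 + α.2 ≤ 3 → Tendsto (fun n => ∫ p in Ω.dom,
        (pdMulti α (w n) p - weakDeriv Ω.dom α u p) ^ 2) atTop (𝓝 0))
    {l r b t : ℝ} (hlr : l ≤ r) (hbt : b ≤ t) (hsub : Set.Icc l r ×ˢ Set.Icc b t ⊆ Ω.dom) :
    Tendsto (fun n => -(∑ k, sideDiff k (fluxComp a k (w n)) l r b t) +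
      boxInt (fun p => c' p * w n p) l r b t) atTop (𝓝 (boxInt f l r b t)) := by
  have hU := Ω.isOpen_dom
  set v : ℕ × ℕ → ℝ × ℝ → ℝ := fun α => weakDeriv Ω.dom α u with hv
  have hvL : ∀ α : ℕ × ℕ, α.1 + α.2 ≤ 2 → MemLp (v α) 2 (volume.restrict Ω.dom) := fun α hα =>
    (hu.weakDeriv_spec hU (hα.trans (by norm_num))).2
  have hlim' : ∀ α : ℕ × ℕ, α.1 + α.2 ≤ 2 → Tendsto (fun n => ∫ p in Ω.dom,
      (pdMulti α (w n) p - v α p) ^ 2) atTop (𝓝 0) := fun α hα => hlim α (hα.trans (by norm_num))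
  have hae := H.ae_opFun_eq hf hsol hu hw hlim'
  have h1 : IsBdd Ω fun _ => (1 : ℝ) := .of_continuous continuous_const
  simp_rw [H.sideDiff_flux_eq (hw _) hlr hbt hsub]
  have := H.tendsto_opInt h1 hsub hvL hw hlim'
  rw [H.opInt_eq h1 hsub hvL] at this
  convert this using 2
  rw [boxInt]
  refine setIntegral_congr_ae (measurableSet_Icc.prod measurableSet_Icc) ?_
  filter_upwards [hae] with p hp hpS
  have := hp (hsub hpS)
  linarith

end Balance

end FVE

namespace FVE

/-! ### The dual partition -/

/-- The left end of the dual interval of the `i`-th grid point. -/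
noncomputable def cutL (z : ℕ → ℝ) (i : ℕ) : ℝ := if i = 0 then z 0 else (z (i - 1) + z i) / 2

/-- The right end of the dual interval of the `i`-th grid point. -/
noncomputable def cutR (z : ℕ → ℝ) (n i : ℕ) : ℝ := if i = n then z i else (z i + z (i + 1)) / 2

theorem cutL_succ (z : ℕ → ℝ) (i : ℕ) : cutL z (i + 1) = midpt z i := by
  rw [cutL, if_neg (Nat.succ_ne_zero i)]; rfl

theorem cutR_of_lt (z : ℕ → ℝ) {n i : ℕ} (hi : i < n) : cutR z n i = midpt z i := by
  rw [cutR, if_neg hi.ne]; rfl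

theorem midpt_mem_Ioo {z : ℕ → ℝ} {i : ℕ} (h : z i < z (i + 1)) :
    midpt z i ∈ Set.Ioo (z i) (z (i + 1)) := by
  constructor <;> unfold midpt <;> linarith

theorem cutL_le {z : ℕ → ℝ} {n : ℕ} (hz : ∀ i < n, z i < z (i + 1)) {i : ℕ} (hi : i ≤ n) :
    cutL z i ≤ z i := by
  rcases i with _ | i
  · exact le_rfl
  · rw [cutL_succ]; exact (midpt_mem_Ioo (hz i hi)).2.le

theorem le_cutR {z : ℕ → ℝ} {n : ℕ} (hz : ∀ i < n, z i < z (i + 1)) {i : ℕ} (hi : i ≤ n) :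
    z i ≤ cutR z n i := by
  rcases hi.eq_or_lt with rfl | hi
  · simp [cutR]
  · rw [cutR_of_lt z hi]; exact (midpt_mem_Ioo (hz i hi)).1.le

theorem lt_of_lt_index {z : ℕ → ℝ} {n : ℕ} (hz : ∀ i < n, z i < z (i + 1)) {i j : ℕ}
    (hij : i < j) (hj : j ≤ n) : z i < z j :=
  (hz i (by omega)).trans_le (le_of_forall_step (fun i hi => (hz i hi).le) hij hj)

theorem cutR_le_cutL {z : ℕ → ℝ} {n : ℕ} (hz : ∀ i < n, z i < z (i + 1)) {i k : ℕ} (hik : i < k)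
    (hk : k ≤ n) : cutR z n i ≤ cutL z k := by
  obtain ⟨k, rfl⟩ : ∃ l, k = l + 1 := ⟨k - 1, by omega⟩
  rw [cutR_of_lt z (by omega), cutL_succ]
  rcases (Nat.lt_succ_iff.mp hik).eq_or_lt with rfl | h
  · exact le_rfl
  · exact (midpt_mem_Ioo (hz i (by omega))).2.le.trans ((le_of_forall_step
      (fun i hi => (hz i hi).le) h (by omega)).trans (midpt_mem_Ioo (hz k (by omega))).1.le)

/-- A point that is not an inner end point belongs to a single dual interval. -/
theorem mem_cut_iff {z : ℕ → ℝ} {n : ℕ} (hz : ∀ i < n, z i < z (i + 1)) {i k : ℕ} {t : ℝ}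
    (hk : k ≤ n) (hi : i ≤ n) (h : t ∈ Set.Icc (cutL z k) (cutR z n k))
    (hL : k = 0 ∨ cutL z k < t) (hR : k = n ∨ t < cutR z n k) :
    t ∈ Set.Icc (cutL z i) (cutR z n i) ↔ i = k := by
  refine ⟨fun hti => ?_, fun e => e ▸ h⟩
  rcases lt_trichotomy i k with hik | hik | hik
  · have := cutR_le_cutL hz hik hk
    rcases hL with rfl | hL
    · omega
    · linarith [hti.2]
  · exact hik
  · have := cutR_le_cutL hz hik hi
    rcases hR with rfl | hR
    · omega
    · linarith [hti.1]

theorem node_mem_cut_iff {z : ℕ → ℝ} {n : ℕ} (hz : ∀ i < n, z i < z (i + 1)) {i k : ℕ}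
    (hk : k ≤ n) (hi : i ≤ n) : z k ∈ Set.Icc (cutL z i) (cutR z n i) ↔ i = k := by
  refine mem_cut_iff hz hk hi ⟨cutL_le hz hk, le_cutR hz hk⟩ ?_ ?_
  · rcases k with _ | k
    · exact Or.inl rfl
    · rw [cutL_succ]; exact Or.inr (midpt_mem_Ioo (hz k hk)).2
  · rcases hk.eq_or_lt with h | h
    · exact Or.inl h
    · rw [cutR_of_lt z h]; exact Or.inr (midpt_mem_Ioo (hz k h)).1

/-- The midpoint is excluded because it lies in two closed dual intervals. Away from it, a point of
a cell lies in the dual interval of the nearer end point and in no other. -/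
theorem exists_cut {z : ℕ → ℝ} {n : ℕ} (hz : ∀ i < n, z i < z (i + 1)) {i : ℕ} {t : ℝ}
    (hi : i < n) (ht : t ∈ Set.Icc (z i) (z (i + 1))) (hm : t ≠ midpt z i) :
    ∃ k, (k = i ∨ k = i + 1) ∧ k ≤ n ∧ ∀ i' ≤ n, t ∈ Set.Icc (cutL z i') (cutR z n i') ↔ i' = k := by
  rcases hm.lt_or_gt with h | h
  · refine ⟨i, Or.inl rfl, hi.le, fun i' hi' => mem_cut_iff hz hi.le hi' ?_ ?_ ?_⟩
    · rw [cutR_of_lt z hi]; exact ⟨(cutL_le hz hi.le).trans ht.1, h.le⟩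
    · rcases i with _ | i
      · exact Or.inl rfl
      · right
        rw [cutL_succ]; exact (midpt_mem_Ioo (hz i (by omega))).2.trans_le ht.1
    · rw [cutR_of_lt z hi]; exact Or.inr h
  · refine ⟨i + 1, Or.inr rfl, hi, fun i' hi' => mem_cut_iff hz hi hi' ?_ ?_ ?_⟩
    · rw [cutL_succ]; exact ⟨h.le, ht.2.trans (le_cutR hz hi)⟩
    · rw [cutL_succ]; exact Or.inr h
    · rcases (Nat.succ_le_of_lt hi).eq_or_lt with h' | h'
      · exact Or.inl h'
      · right
        rw [cutR_of_lt z h']; exact ht.2.trans_lt (midpt_mem_Ioo (hz _ h')).1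

theorem sum_boxInt_dual {G : ℝ × ℝ → ℝ} {x y : ℕ → ℝ} {n m : ℕ}
    (hx : ∀ i < n, x i < x (i + 1)) (hy : ∀ j < m, y j < y (j + 1))
    (hG : IntegrableOn G (Set.Icc (x 0) (x n) ×ˢ Set.Icc (y 0) (y m))) :
    ∑ i ∈ Finset.range (n + 1), ∑ j ∈ Finset.range (m + 1),
      boxInt G (cutL x i) (cutR x n i) (cutL y j) (cutR y m j) = boxInt G (x 0) (x n) (y 0) (y m) := by
  -- The dual intervals are the `n + 1` cells of a grid whose points are the two ends and the
  -- midpoints. Its last point has to be set by hand, since `cutL z (n + 1)` would involve the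
  -- meaningless `z (n + 1)`.
  have key : ∀ {z : ℕ → ℝ} {n : ℕ}, (∀ i < n, z i < z (i + 1)) → ∃ s : ℕ → ℝ,
      (∀ i < n + 1, s i ≤ s (i + 1)) ∧ s 0 = z 0 ∧ s (n + 1) = z n ∧
        ∀ i < n + 1, s i = cutL z i ∧ s (i + 1) = cutR z n i := by
    intro z n hz
    have hs : ∀ i < n + 1, (if i = n + 1 then z n else cutL z i) = cutL z i ∧
        (if i + 1 = n + 1 then z n else cutL z (i + 1)) = cutR z n i := fun i hi => by
      refine ⟨if_neg (by omega), ?_⟩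
      split_ifs with h
      · obtain rfl : i = n := by omega
        simp [cutR]
      · rw [cutL_succ, cutR_of_lt z (by omega)]
    refine ⟨fun i => if i = n + 1 then z n else cutL z i, fun i hi => ?_, by simp [cutL], by simp, hs⟩
    simp only [hs i hi]
    exact (cutL_le hz (by omega)).trans (le_cutR hz (by omega))
  obtain ⟨s, s1, s2, s3, s4⟩ := key hx
  obtain ⟨r, r1, r2, r3, r4⟩ := key hy
  rw [← s2, ← s3, ← r2, ← r3] at hG ⊢
  rw [← sum_boxInt s1 r1 hG]
  refine Finset.sum_congr rfl fun i hi => Finset.sum_congr rfl fun j hj => ?_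
  rw [(s4 i (Finset.mem_range.mp hi)).1, (s4 i (Finset.mem_range.mp hi)).2,
    (r4 j (Finset.mem_range.mp hj)).1, (r4 j (Finset.mem_range.mp hj)).2]

/-! ### Summation by parts -/

/-- Here `g i` is the flux through the midline of cell `i` and `e i` the net flux out of the dual
interval `i`. The relation between them is only required at inner indices, since `v` vanishes at
both ends. -/
theorem sum_mul_eq_neg_sum_mul_sub {e g v : ℕ → ℝ} {n : ℕ} (h0 : v 0 = 0) (hn : v n = 0)
    (he : ∀ i, i + 1 < n → e (i + 1) = g (i + 1) - g i) :
    ∑ i ∈ Finset.range (n + 1), e i * v i = -∑ i ∈ Finset.range n, g i * (v (i + 1) - v i) := by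
  rcases n with _ | n
  · simp [h0]
  rw [sum_mul_sub_eq, h0, hn, Finset.sum_range_succ, hn, Finset.sum_range_succ', h0]
  simp only [mul_zero, add_zero, sub_zero, zero_add]
  rw [← Finset.sum_neg_distrib]
  refine Finset.sum_congr rfl fun i hi => ?_
  rw [he i (by simpa using hi)]
  ring

/-- A dual edge runs from the centre of one cell to the centre of the next. It is cut at the grid
line into `U j`, the upper half of cell `j`, and `D (j + 1)`, the lower half of the following cell;
the sum is regrouped by cells. -/
theorem sum_mul_eq_sum_halves {e U D v : ℕ → ℝ} {m : ℕ} (h0 : v 0 = 0) (hm : v m = 0)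
    (he : ∀ j, j + 1 < m → e (j + 1) = U j + D (j + 1)) :
    ∑ j ∈ Finset.range (m + 1), e j * v j =
      ∑ j ∈ Finset.range m, (D j * v j + U j * v (j + 1)) := by
  rcases m with _ | m
  · simp [h0]
  rw [Finset.sum_add_distrib, Finset.sum_range_succ, hm, Finset.sum_range_succ', h0,
    Finset.sum_range_succ' (fun j => D j * v j), h0, Finset.sum_range_succ (fun j => U j * v (j + 1)),
    hm, mul_zero, mul_zero, mul_zero, mul_zero, add_zero, add_zero, add_zero, add_zero,
    ← Finset.sum_add_distrib]
  refine Finset.sum_congr rfl fun j hj => ?_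
  rw [he j (by simpa using hj)]
  ring

/-- A piece of midline is shared by two control volumes, with opposite normals, so its flux meets
the increment of `V` across it. Regrouping by elements turns each dual edge into two halves
belonging to different elements. The outer sides of the boundary control volumes do not contribute,
as `V` vanishes there. -/
theorem sum_sideDiff_zero {n m : ℕ} {x y : ℕ → ℝ} {G : ℝ × ℝ → ℝ} {V : ℕ → ℕ → ℝ}
    (hy : ∀ j < m, y j < y (j + 1))
    (hG : ∀ i < n, ∀ j < m,
      IntervalIntegrable (fun t => G (midpt x i, t)) volume (y j) (y (j + 1)))
    (hV0 : ∀ j ≤ m, V 0 j = 0) (hVn : ∀ j ≤ m, V n j = 0) (hV0' : ∀ i ≤ n, V i 0 = 0)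
    (hVm : ∀ i ≤ n, V i m = 0) :
    ∑ i ∈ Finset.range (n + 1), ∑ j ∈ Finset.range (m + 1),
      sideDiff 0 G (cutL x i) (cutR x n i) (cutL y j) (cutR y m j) * V i j =
      -vform n m y (fun i _ t => G (midpt x i, t)) V := by
  set X : ℕ → ℕ → ℝ := fun i j => ∫ t in cutL y j..cutR y m j, G (midpt x i, t) with hX
  have h1 : ∀ j ∈ Finset.range (m + 1), ∑ i ∈ Finset.range (n + 1),
      sideDiff 0 G (cutL x i) (cutR x n i) (cutL y j) (cutR y m j) * V i j =
      -∑ i ∈ Finset.range n, X i j * dX V i j := fun j hj => by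
    have hj := Nat.lt_succ_iff.mp (Finset.mem_range.mp hj)
    refine sum_mul_eq_neg_sum_mul_sub (e := fun i => _) (g := fun i => X i j) (v := fun i => V i j)
      (hV0 j hj) (hVn j hj) fun i hi => ?_
    simp only [sideDiff, if_true, hX, cutL_succ, cutR_of_lt x hi]
  rw [Finset.sum_comm, Finset.sum_congr rfl h1, Finset.sum_neg_distrib, Finset.sum_comm, vform]
  congr 1
  refine Finset.sum_congr rfl fun i hi => ?_
  have hi := Finset.mem_range.mp hi
  refine sum_mul_eq_sum_halves (e := fun j => X i j)
    (D := fun j => ∫ t in y j..midpt y j, G (midpt x i, t))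
    (U := fun j => ∫ t in midpt y j..y (j + 1), G (midpt x i, t)) (v := fun j => dX V i j)
    ?_ ?_ fun j hj => ?_
  · simp only [dX, hV0' i hi.le, hV0' (i + 1) hi, sub_self]
  · simp only [dX, hVm i hi.le, hVm (i + 1) hi, sub_self]
  · simp only [hX, cutL_succ, cutR_of_lt y hj]
    have m1 := midpt_mem_Ioo (hy j (by omega))
    have m2 := midpt_mem_Ioo (hy (j + 1) hj)
    refine (intervalIntegral.integral_add_adjacent_intervals
      ((hG i hi j (by omega)).mono_set ?_) ((hG i hi (j + 1) hj).mono_set ?_)).symm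
    · rw [Set.uIcc_of_le m1.2.le, Set.uIcc_of_le (hy j (by omega)).le]
      exact Set.Icc_subset_Icc_left m1.1.le
    · rw [Set.uIcc_of_le m2.1.le, Set.uIcc_of_le (hy (j + 1) hj).le]
      exact Set.Icc_subset_Icc_right m2.2.le

theorem sideDiff_one_eq (G : ℝ × ℝ → ℝ) (l r b t : ℝ) :
    sideDiff 1 G l r b t = sideDiff 0 (G ∘ Prod.swap) b t l r := by
  rw [sideDiff, sideDiff, if_neg (by decide), if_pos rfl]
  rfl

theorem sum_sideDiff_one {n m : ℕ} {x y : ℕ → ℝ} {G : ℝ × ℝ → ℝ} {V : ℕ → ℕ → ℝ}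
    (hx : ∀ i < n, x i < x (i + 1))
    (hG : ∀ i < n, ∀ j < m,
      IntervalIntegrable (fun s => G (s, midpt y j)) volume (x i) (x (i + 1)))
    (hV0 : ∀ j ≤ m, V 0 j = 0) (hVn : ∀ j ≤ m, V n j = 0) (hV0' : ∀ i ≤ n, V i 0 = 0)
    (hVm : ∀ i ≤ n, V i m = 0) :
    ∑ i ∈ Finset.range (n + 1), ∑ j ∈ Finset.range (m + 1),
      sideDiff 1 G (cutL x i) (cutR x n i) (cutL y j) (cutR y m j) * V i j =
      -vform m n x (fun j _ s => G (s, midpt y j)) (flipNodal V) := by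
  rw [Finset.sum_comm]
  have h := sum_sideDiff_zero (x := y) (y := x) (G := G ∘ Prod.swap) (V := flipNodal V) hx
    (fun j hj i hi => hG i hi j hj) hV0' hVm hV0 hVn
  simp_rw [sideDiff_one_eq]
  exact h

/-- Only the open segments matter. At the ends of a midline, on the edges of the element, the
gradient of a trial function need not exist. -/
theorem vform_congr {n m : ℕ} {y : ℕ → ℝ} {F G : ℕ → ℕ → ℝ → ℝ} {V : ℕ → ℕ → ℝ}
    (hy : ∀ j < m, y j < y (j + 1))
    (h : ∀ i < n, ∀ j < m, ∀ t ∈ Set.Ioo (y j) (y (j + 1)), F i j t = G i j t) :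
    vform n m y F V = vform n m y G V := by
  unfold vform
  refine Finset.sum_congr rfl fun i hi => Finset.sum_congr rfl fun j hj => ?_
  have hi := Finset.mem_range.mp hi
  have hj := Finset.mem_range.mp hj
  have hm := midpt_mem_Ioo (hy j hj)
  rw [intervalIntegral.integral_congr_Ioo_of_le hm.1.le fun t ht => h i hi j hj t
      ⟨ht.1, ht.2.trans hm.2⟩,
    intervalIntegral.integral_congr_Ioo_of_le hm.2.le fun t ht => h i hi j hj t
      ⟨hm.1.trans ht.1, ht.2⟩]

/-! ### Meshes -/

namespace RectMesh

variable {Ω : Rect}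

theorem x_le_succ (T : RectMesh Ω) : ∀ i < T.nx, T.x i ≤ T.x (i + 1) := fun i hi => (T.x_lt i hi).le

theorem y_le_succ (T : RectMesh Ω) : ∀ j < T.ny, T.y j ≤ T.y (j + 1) := fun j hj => (T.y_lt j hj).le

theorem nx_pos (T : RectMesh Ω) : 0 < T.nx := by
  have := T.cells_nonempty
  rw [Finset.nonempty_product, Finset.nonempty_range_iff] at this
  omega

theorem ny_pos (T : RectMesh Ω) : 0 < T.ny := by
  have := T.cells_nonempty
  rw [Finset.nonempty_product, Finset.nonempty_range_iff, Finset.nonempty_range_iff] at this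
  omega

theorem elemDiam_le_meshSize (T : RectMesh Ω) {i j : ℕ} (hi : i < T.nx) (hj : j < T.ny) :
    T.elemDiam i j ≤ T.meshSize :=
  Finset.le_sup' (fun q : ℕ × ℕ => T.elemDiam q.1 q.2)
    (Finset.mk_mem_product (Finset.mem_range.mpr hi) (Finset.mem_range.mpr hj))

theorem fst_le_elemDiam (T : RectMesh Ω) (i j : ℕ) : T.x (i + 1) - T.x i ≤ T.elemDiam i j :=
  Real.le_sqrt_of_sq_le (by linarith [sq_nonneg (T.y (j + 1) - T.y j)])

theorem snd_le_elemDiam (T : RectMesh Ω) (i j : ℕ) : T.y (j + 1) - T.y j ≤ T.elemDiam i j :=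
  Real.le_sqrt_of_sq_le (by linarith [sq_nonneg (T.x (i + 1) - T.x i)])

theorem meshSize_pos (T : RectMesh Ω) : 0 < T.meshSize :=
  (sub_pos.mpr (T.x_lt 0 T.nx_pos)).trans_le
    ((T.fst_le_elemDiam 0 0).trans (T.elemDiam_le_meshSize T.nx_pos T.ny_pos))

/-- The diameter of an element dominates each side, and the diameter of its biggest disc is the
shorter side; the ratio bound therefore compares the two sides in both directions. -/
theorem IsRegular.isGrid {T : RectMesh Ω} {γ : ℝ} (h : T.IsRegular γ) (hγ : 0 ≤ γ) :
    IsGrid T.nx T.ny T.x T.y γ T.meshSize := by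
  have key : ∀ i < T.nx, ∀ j < T.ny, T.elemDiam i j ≤ γ * T.elemInDiam i j := fun i hi j hj => by
    have hpos : 0 < T.elemInDiam i j :=
      lt_min (sub_pos.mpr (T.x_lt i hi)) (sub_pos.mpr (T.y_lt j hj))
    exact (div_le_iff₀ hpos).mp (h i hi j hj)
  refine ⟨T.x_lt, T.y_lt, fun i hi => (T.fst_le_elemDiam i 0).trans (T.elemDiam_le_meshSize hi T.ny_pos),
    fun j hj => (T.snd_le_elemDiam 0 j).trans (T.elemDiam_le_meshSize T.nx_pos hj),
    fun i hi j hj => ?_, fun i hi j hj => ?_⟩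
  · exact (T.fst_le_elemDiam i j).trans ((key i hi j hj).trans
      (mul_le_mul_of_nonneg_left (min_le_right _ _) hγ))
  · exact (T.snd_le_elemDiam i j).trans ((key i hi j hj).trans
      (mul_le_mul_of_nonneg_left (min_le_left _ _) hγ))

theorem closure_eq (T : RectMesh Ω) :
    closure Ω.dom = Set.Icc (T.x 0) (T.x T.nx) ×ˢ Set.Icc (T.y 0) (T.y T.ny) := by
  rw [Ω.closure_dom, T.x_zero, T.x_last, T.y_zero, T.y_last]

theorem dom_eq (T : RectMesh Ω) :
    Ω.dom = Set.Ioo (T.x 0) (T.x T.nx) ×ˢ Set.Ioo (T.y 0) (T.y T.ny) := by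
  rw [Rect.dom, T.x_zero, T.x_last, T.y_zero, T.y_last]

theorem elem_subset_closure (T : RectMesh Ω) {i j : ℕ} (hi : i < T.nx) (hj : j < T.ny) :
    T.elem i j ⊆ closure Ω.dom := by
  rw [T.closure_eq]
  refine Set.prod_mono (Set.Icc_subset_Icc ?_ ?_) (Set.Icc_subset_Icc ?_ ?_)
  · exact le_of_forall_step T.x_le_succ (Nat.zero_le i) hi.le
  · exact le_of_forall_step T.x_le_succ hi le_rfl
  · exact le_of_forall_step T.y_le_succ (Nat.zero_le j) hj.le
  · exact le_of_forall_step T.y_le_succ hj le_rfl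

theorem interior_elem_subset (T : RectMesh Ω) {i j : ℕ} (hi : i < T.nx) (hj : j < T.ny) :
    Set.Ioo (T.x i) (T.x (i + 1)) ×ˢ Set.Ioo (T.y j) (T.y (j + 1)) ⊆ Ω.dom := by
  rw [T.dom_eq]
  refine Set.prod_mono (Set.Ioo_subset_Ioo ?_ ?_) (Set.Ioo_subset_Ioo ?_ ?_)
  · exact le_of_forall_step T.x_le_succ (Nat.zero_le i) hi.le
  · exact le_of_forall_step T.x_le_succ hi le_rfl
  · exact le_of_forall_step T.y_le_succ (Nat.zero_le j) hj.le
  · exact le_of_forall_step T.y_le_succ hj le_rfl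

theorem _root_.FVE.exists_index {z : ℕ → ℝ} {n : ℕ} (hn : 0 < n) {t : ℝ}
    (ht : t ∈ Set.Icc (z 0) (z n)) : ∃ i < n, t ∈ Set.Icc (z i) (z (i + 1)) := by
  induction n with
  | zero => omega
  | succ n ih =>
    by_cases h : z n ≤ t
    · exact ⟨n, by omega, h, ht.2⟩
    · rcases Nat.eq_zero_or_pos n with rfl | hn'
      · exact absurd ht.1 h
      · obtain ⟨i, hi, h'⟩ := ih hn' ⟨ht.1, (not_le.mp h).le⟩
        exact ⟨i, by omega, h'⟩

theorem exists_elem (T : RectMesh Ω) {p : ℝ × ℝ} (hp : p ∈ closure Ω.dom) :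
    ∃ i < T.nx, ∃ j < T.ny, p ∈ T.elem i j := by
  rw [T.closure_eq] at hp
  obtain ⟨i, hi, h1⟩ := exists_index T.nx_pos hp.1
  obtain ⟨j, hj, h2⟩ := exists_index T.ny_pos hp.2
  exact ⟨i, hi, j, hj, h1, h2⟩

theorem node_mem_closure (T : RectMesh Ω) {i j : ℕ} (hi : i ≤ T.nx) (hj : j ≤ T.ny) :
    (T.x i, T.y j) ∈ closure Ω.dom := by
  rw [T.closure_eq]
  exact ⟨⟨le_of_forall_step T.x_le_succ (Nat.zero_le i) hi, le_of_forall_step T.x_le_succ hi le_rfl⟩,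
    le_of_forall_step T.y_le_succ (Nat.zero_le j) hj, le_of_forall_step T.y_le_succ hj le_rfl⟩

theorem mem_frontier (T : RectMesh Ω) {p : ℝ × ℝ} (hp : p ∈ closure Ω.dom)
    (h : p.1 = T.x 0 ∨ p.1 = T.x T.nx ∨ p.2 = T.y 0 ∨ p.2 = T.y T.ny) : p ∈ frontier Ω.dom := by
  rw [Ω.isOpen_dom.frontier_eq]
  refine ⟨hp, fun hd => ?_⟩
  rw [T.dom_eq] at hd
  obtain ⟨⟨h1, h2⟩, h3, h4⟩ := hd
  rcases h with h | h | h | h <;> linarith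

/-- A function on the closed rectangle that is, on each element, the bilinear function with the
nodal values `V`. -/
def IsPiecewise (T : RectMesh Ω) (w : ℝ × ℝ → ℝ) (V : ℕ → ℕ → ℝ) : Prop :=
  ∀ i < T.nx, ∀ j < T.ny, ∀ p ∈ T.elem i j, w p = bil T.x T.y V i j p

/-- The nodal values of a function. -/
def nodal (T : RectMesh Ω) (w : ℝ × ℝ → ℝ) (i j : ℕ) : ℝ := w (T.x i, T.y j)

theorem IsTrial.isPiecewise {T : RectMesh Ω} {w : ℝ × ℝ → ℝ} (hw : T.IsTrial w) :
    T.IsPiecewise w (T.nodal w) := by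
  intro i hi j hj p hp
  obtain ⟨k₀, k₁, k₂, k₃, h⟩ := hw.2.1 i hi j hj
  have hx := T.x_le_succ i hi
  have hy := T.y_le_succ j hj
  have hx' := (sub_pos.mpr (T.x_lt i hi)).ne'
  have hy' := (sub_pos.mpr (T.y_lt j hj)).ne'
  rw [h p hp]
  simp only [bil, nodal]
  rw [h (T.x i, T.y j) ⟨⟨le_rfl, hx⟩, le_rfl, hy⟩, h (T.x (i + 1), T.y j) ⟨⟨hx, le_rfl⟩, le_rfl, hy⟩,
    h (T.x i, T.y (j + 1)) ⟨⟨le_rfl, hx⟩, hy, le_rfl⟩,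
    h (T.x (i + 1), T.y (j + 1)) ⟨⟨hx, le_rfl⟩, hy, le_rfl⟩]
  field_simp
  ring

/-- On a grid line shared by two cells the greatest index selects the right cell, so a point of cell
`i` may also be assigned to cell `i + 1`, but only at its right end point. -/
theorem _root_.FVE.cellIndex_spec {z : ℕ → ℝ} {n : ℕ} (hz : ∀ i < n, z i < z (i + 1)) {i : ℕ} {t : ℝ}
    (hi : i < n) (ht : t ∈ Set.Icc (z i) (z (i + 1))) :
    cellIndex z n t < n ∧ (cellIndex z n t = i ∨ (cellIndex z n t = i + 1 ∧ t = z (i + 1))) := by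
  classical
  have hle : i ≤ cellIndex z n t := by
    unfold cellIndex
    exact Nat.le_findGreatest (by omega) ht.1
  have hub : cellIndex z n t ≤ n - 1 := by
    unfold cellIndex
    exact Nat.findGreatest_le _
  have hsp : z (cellIndex z n t) ≤ t := by
    unfold cellIndex
    exact Nat.findGreatest_spec (P := fun i => z i ≤ t) (m := i) (by omega) ht.1
  refine ⟨by omega, ?_⟩
  rcases hle.eq_or_lt with h | h
  · exact Or.inl h.symm
  rcases (Nat.succ_le_of_lt h).eq_or_lt with h' | h'
  · exact Or.inr ⟨h'.symm, le_antisymm ht.2 (by rw [← h'] at hsp; exact hsp)⟩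
  · have := lt_of_lt_index hz h' (by omega)
    exact absurd (ht.2.trans_lt this) (not_lt.mpr hsp)

/-- At a shared grid point both cells give the nodal value there. The interpolant is thus
independent of the cell that `cellIndex` selects. -/
theorem _root_.FVE.linear_interp_eq {z : ℕ → ℝ} {n i k : ℕ} (hz : ∀ i < n, z i < z (i + 1)) {t : ℝ}
    (hi : i < n) (hk : k < n) (h : k = i ∨ (k = i + 1 ∧ t = z (i + 1))) (f : ℕ → ℝ) :
    f k + (f (k + 1) - f k) * ((t - z k) / (z (k + 1) - z k)) =
      f i + (f (i + 1) - f i) * ((t - z i) / (z (i + 1) - z i)) := by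
  rcases h with rfl | ⟨rfl, rfl⟩
  · rfl
  · have h1 := (sub_pos.mpr (hz i hi)).ne'
    rw [sub_self, zero_div, mul_zero, div_self h1]
    ring

theorem isPiecewise_interp (T : RectMesh Ω) (u : ℝ × ℝ → ℝ) :
    T.IsPiecewise (T.interp u) (T.nodal u) := by
  intro i hi j hj p hp
  obtain ⟨ki, hki⟩ := cellIndex_spec T.x_lt hi hp.1
  obtain ⟨kj, hkj⟩ := cellIndex_spec T.y_lt hj hp.2
  set k := cellIndex T.x T.nx p.1
  set l := cellIndex T.y T.ny p.2
  have hx' := (sub_pos.mpr (T.x_lt i hi)).ne'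
  have hy' := (sub_pos.mpr (T.y_lt j hj)).ne'
  set F : ℕ → ℝ := fun i => T.nodal u i l + (T.nodal u i (l + 1) - T.nodal u i l) *
    ((p.2 - T.y l) / (T.y (l + 1) - T.y l)) with hF
  have e1 : T.interp u p = F k + (F (k + 1) - F k) * ((p.1 - T.x k) / (T.x (k + 1) - T.x k)) := by
    simp only [interp, nodal, hF]; ring
  rw [e1, linear_interp_eq T.x_lt hi ki hki F]
  simp only [hF]
  rw [linear_interp_eq T.y_lt hj kj hkj (T.nodal u i),
    linear_interp_eq T.y_lt hj kj hkj (T.nodal u (i + 1)), bil]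
  field_simp
  ring

theorem _root_.FVE.bil_sub (x y : ℕ → ℝ) (V W : ℕ → ℕ → ℝ) (i j : ℕ) (p : ℝ × ℝ) :
    bil x y V i j p - bil x y W i j p = bil x y (fun i j => V i j - W i j) i j p := by
  simp only [bil]; ring

theorem IsPiecewise.sub {T : RectMesh Ω} {w v : ℝ × ℝ → ℝ} {W V : ℕ → ℕ → ℝ}
    (hw : T.IsPiecewise w W) (hv : T.IsPiecewise v V) :
    T.IsPiecewise (fun p => w p - v p) fun i j => W i j - V i j := fun i hi j hj p hp => by
  simp only [hw i hi j hj p hp, hv i hi j hj p hp, bil_sub]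

theorem IsPiecewise.nodal_eq {T : RectMesh Ω} {w : ℝ × ℝ → ℝ} {W : ℕ → ℕ → ℝ}
    (hw : T.IsPiecewise w W) {i j : ℕ} (hi : i ≤ T.nx) (hj : j ≤ T.ny) : T.nodal w i j = W i j := by
  obtain ⟨k, hk, hki⟩ : ∃ k < T.nx, i = k ∨ i = k + 1 := by
    have := T.nx_pos
    rcases i with _ | i
    · exact ⟨0, this, Or.inl rfl⟩
    · exact ⟨i, hi, Or.inr rfl⟩
  obtain ⟨l, hl, hlj⟩ : ∃ l < T.ny, j = l ∨ j = l + 1 := by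
    have := T.ny_pos
    rcases j with _ | j
    · exact ⟨0, this, Or.inl rfl⟩
    · exact ⟨j, hj, Or.inr rfl⟩
  have hx := T.x_le_succ k hk
  have hy := T.y_le_succ l hl
  have hx' := (sub_pos.mpr (T.x_lt k hk)).ne'
  have hy' := (sub_pos.mpr (T.y_lt l hl)).ne'
  have hmem : (T.x i, T.y j) ∈ T.elem k l := by
    rcases hki with rfl | rfl <;> rcases hlj with rfl | rfl <;> simp [elem, hx, hy]
  rw [nodal, hw k hk l hl _ hmem, bil]
  rcases hki with rfl | rfl <;> rcases hlj with rfl | rfl <;> field_simp <;> ring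

/-- The closed elements form a finite closed cover, on each member of which the function is a
polynomial. The nodal values are shared, so no matching condition on the edges has to be checked. -/
theorem IsPiecewise.continuousOn {T : RectMesh Ω} {w : ℝ × ℝ → ℝ} {W : ℕ → ℕ → ℝ}
    (hw : T.IsPiecewise w W) : ContinuousOn w (closure Ω.dom) := by
  have hun : closure Ω.dom ⊆ ⋃ q : Fin T.nx × Fin T.ny, T.elem q.1 q.2 := fun p hp => by
    obtain ⟨i, hi, j, hj, h⟩ := T.exists_elem hp
    exact Set.mem_iUnion.mpr ⟨(⟨i, hi⟩, ⟨j, hj⟩), h⟩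
  refine ContinuousOn.mono ?_ hun
  refine (locallyFinite_of_finite _).continuousOn_iUnion (fun q => isClosed_Icc.prod isClosed_Icc)
    fun q => ?_
  exact (continuous_bil T.x T.y W q.1 q.2).continuousOn.congr
    fun p hp => hw q.1 q.1.2 q.2 q.2.2 p hp

theorem IsPiecewise.eq_zero_of_mem_frontier {T : RectMesh Ω} {w : ℝ × ℝ → ℝ} {W : ℕ → ℕ → ℝ}
    (hw : T.IsPiecewise w W) (h0 : ∀ j ≤ T.ny, W 0 j = 0) (hn : ∀ j ≤ T.ny, W T.nx j = 0)
    (h0' : ∀ i ≤ T.nx, W i 0 = 0) (hm : ∀ i ≤ T.nx, W i T.ny = 0) {p : ℝ × ℝ}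
    (hp : p ∈ frontier Ω.dom) : w p = 0 := by
  have hcl := frontier_subset_closure hp
  obtain ⟨i, hi, j, hj, h⟩ := T.exists_elem hcl
  rw [Ω.isOpen_dom.frontier_eq, T.dom_eq] at hp
  have hcl' := hcl
  rw [T.closure_eq] at hcl
  obtain ⟨⟨a1, a2⟩, a3, a4⟩ := hcl
  have hor : p.1 = T.x 0 ∨ p.1 = T.x T.nx ∨ p.2 = T.y 0 ∨ p.2 = T.y T.ny := by
    by_contra! hne
    exact hp.2 ⟨⟨lt_of_le_of_ne a1 hne.1.symm, lt_of_le_of_ne a2 hne.2.1⟩,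
      lt_of_le_of_ne a3 hne.2.2.1.symm, lt_of_le_of_ne a4 hne.2.2.2⟩
  have px := T.nx_pos
  have py := T.ny_pos
  rcases hor with e | e | e | e
  · have hm : p ∈ T.elem 0 j := ⟨⟨e.ge, e.le.trans (T.x_le_succ 0 px)⟩, h.2⟩
    rw [hw 0 px j hj p hm, bil, e, h0 j hj.le, h0 (j + 1) hj]
    simp
  · obtain ⟨k, hk⟩ : ∃ k, T.nx = k + 1 := ⟨T.nx - 1, by omega⟩
    rw [hk] at e
    have hm : p ∈ T.elem k j := ⟨⟨(T.x_le_succ k (by omega)).trans e.ge, e.le⟩, h.2⟩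
    rw [hw k (by omega) j hj p hm, bil, e, ← hk, hn j hj.le, hn (j + 1) hj, hk]
    simp
  · have hm : p ∈ T.elem i 0 := ⟨h.1, e.ge, e.le.trans (T.y_le_succ 0 py)⟩
    rw [hw i hi 0 py p hm, bil, e, h0' i hi.le, h0' (i + 1) hi]
    simp
  · obtain ⟨k, hk⟩ : ∃ k, T.ny = k + 1 := ⟨T.ny - 1, by omega⟩
    rw [hk] at e
    have hm' : p ∈ T.elem i k := ⟨h.1, (T.y_le_succ k (by omega)).trans e.ge, e.le⟩
    rw [hw i hi k (by omega) p hm', bil, e, ← hk, hm i hi.le, hm (i + 1) hi, hk]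
    simp

theorem _root_.FVE.bil_eq_coeffs (x y : ℕ → ℝ) (W : ℕ → ℕ → ℝ) (i j : ℕ) :
    ∃ k₀ k₁ k₂ k₃ : ℝ, ∀ p : ℝ × ℝ,
      bil x y W i j p = k₀ + k₁ * p.1 + k₂ * p.2 + k₃ * (p.1 * p.2) := by
  set D := (x (i + 1) - x i) * (y (j + 1) - y j)
  refine ⟨(x (i + 1) * y (j + 1) * W i j - x (i + 1) * y j * W i (j + 1) -
      x i * y (j + 1) * W (i + 1) j + x i * y j * W (i + 1) (j + 1)) / D,
    (-(y (j + 1) * W i j) + y j * W i (j + 1) + y (j + 1) * W (i + 1) j -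
      y j * W (i + 1) (j + 1)) / D,
    (-(x (i + 1) * W i j) + x (i + 1) * W i (j + 1) + x i * W (i + 1) j -
      x i * W (i + 1) (j + 1)) / D,
    (W i j - W i (j + 1) - W (i + 1) j + W (i + 1) (j + 1)) / D, fun p => ?_⟩
  simp only [bil]; ring

theorem IsPiecewise.isTrial {T : RectMesh Ω} {w : ℝ × ℝ → ℝ} {W : ℕ → ℕ → ℝ}
    (hw : T.IsPiecewise w W) (h0 : ∀ j ≤ T.ny, W 0 j = 0) (hn : ∀ j ≤ T.ny, W T.nx j = 0)
    (h0' : ∀ i ≤ T.nx, W i 0 = 0) (hm : ∀ i ≤ T.nx, W i T.ny = 0) : T.IsTrial w := by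
  refine ⟨hw.continuousOn, fun i hi j hj => ?_, fun p hp => hw.eq_zero_of_mem_frontier h0 hn h0' hm hp⟩
  obtain ⟨k₀, k₁, k₂, k₃, h⟩ := bil_eq_coeffs T.x T.y W i j
  exact ⟨k₀, k₁, k₂, k₃, fun p hp => by rw [hw i hi j hj p hp, h]⟩

/-! ### The projection onto the dual elements -/

theorem dual_eq (T : RectMesh Ω) (i j : ℕ) : T.dual i j =
    Set.Icc (cutL T.x i) (cutR T.x T.nx i) ×ˢ Set.Icc (cutL T.y j) (cutR T.y T.ny j) := rfl

theorem measurable_dualProj (T : RectMesh Ω) (w : ℝ × ℝ → ℝ) : Measurable (T.dualProj w) := by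
  unfold dualProj
  exact Finset.measurable_fun_sum _ fun i _ => Finset.measurable_fun_sum _ fun j _ =>
    (measurable_const.indicator (measurableSet_Icc.prod measurableSet_Icc)).const_mul _

/-- The dual elements are closed and overlap on their edges, where `dualProj` adds several nodal
values. The hypotheses `hx` and `hy` say that only one dual element contains the point. -/
theorem dualProj_eq (T : RectMesh Ω) (w : ℝ × ℝ → ℝ) {p : ℝ × ℝ} {k l : ℕ} (hk : k ≤ T.nx)
    (hl : l ≤ T.ny)
    (hx : ∀ i ≤ T.nx, p.1 ∈ Set.Icc (cutL T.x i) (cutR T.x T.nx i) ↔ i = k)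
    (hy : ∀ j ≤ T.ny, p.2 ∈ Set.Icc (cutL T.y j) (cutR T.y T.ny j) ↔ j = l) :
    T.dualProj w p = T.nodal w k l := by
  unfold dualProj
  rw [Finset.sum_eq_single_of_mem k (Finset.mem_range.mpr (by omega)),
    Finset.sum_eq_single_of_mem l (Finset.mem_range.mpr (by omega))]
  · rw [Set.indicator_of_mem (show p ∈ T.dual k l from ⟨(hx k hk).mpr rfl, (hy l hl).mpr rfl⟩), mul_one]
    rfl
  · intro j hj hjl
    rw [Set.indicator_of_notMem, mul_zero]
    exact fun hp => hjl ((hy j (by simpa [Nat.lt_succ_iff] using hj)).mp hp.2)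
  · intro i hi hik
    refine Finset.sum_eq_zero fun j _ => ?_
    rw [Set.indicator_of_notMem, mul_zero]
    exact fun hp => hik ((hx i (by simpa [Nat.lt_succ_iff] using hi)).mp hp.1)

theorem dualProj_node (T : RectMesh Ω) (w : ℝ × ℝ → ℝ) {i j : ℕ} (hi : i ≤ T.nx) (hj : j ≤ T.ny) :
    T.dualProj w (T.x i, T.y j) = T.nodal w i j :=
  T.dualProj_eq w hi hj (fun _ hi' => node_mem_cut_iff T.x_lt hi hi')
    fun _ hj' => node_mem_cut_iff T.y_lt hj hj'

theorem _root_.FVE.ae_fst_ne (r : ℝ) : ∀ᵐ p : ℝ × ℝ, p.1 ≠ r := by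
  rw [ae_iff]
  have : {p : ℝ × ℝ | ¬p.1 ≠ r} = {r} ×ˢ Set.univ := by ext p; simp
  rw [this, Measure.volume_eq_prod, Measure.prod_prod]
  simp

theorem _root_.FVE.ae_snd_ne (r : ℝ) : ∀ᵐ p : ℝ × ℝ, p.2 ≠ r := by
  rw [ae_iff]
  have : {p : ℝ × ℝ | ¬p.2 ≠ r} = Set.univ ×ˢ {r} := by ext p; simp
  rw [this, Measure.volume_eq_prod, Measure.prod_prod]
  simp

/-- Off its two midlines, a null set, a point of an element belongs to the dual element of exactly
one vertex of that element. -/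
theorem isStepOf_dualProj (T : RectMesh Ω) (w : ℝ × ℝ → ℝ) :
    IsStepOf T.nx T.ny T.x T.y (T.nodal w) (T.dualProj w) := by
  refine ⟨T.measurable_dualProj w, fun i hi j hj => ?_⟩
  filter_upwards [ae_mem_box (T.x i) (T.x (i + 1)) (T.y j) (T.y (j + 1)),
    ae_restrict_of_ae (ae_fst_ne (midpt T.x i)), ae_restrict_of_ae (ae_snd_ne (midpt T.y j))]
    with p hp h1 h2
  obtain ⟨k, hk, hkn, hk'⟩ := exists_cut T.x_lt hi hp.1 h1
  obtain ⟨l, hl, hln, hl'⟩ := exists_cut T.y_lt hj hp.2 h2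
  exact ⟨k, l, hk, hl, T.dualProj_eq w hkn hln hk' hl'⟩

end RectMesh

end FVE

namespace FVE

/-! ### Derivatives of piecewise bilinear functions -/

theorem contDiff_bil (x y : ℕ → ℝ) (W : ℕ → ℕ → ℝ) (i j : ℕ) : ContDiff ℝ ∞ (bil x y W i j) := by
  unfold bil; fun_prop

theorem pd_zero_bil (x y : ℕ → ℝ) (W : ℕ → ℕ → ℝ) (i j : ℕ) (s t : ℝ) :
    pd 0 (bil x y W i j) (s, t) = bilinX x y W i j t := by
  have h1 := hasDerivAt_pd_zero (differentiable_of_contDiff (contDiff_bil x y W i j)) s t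
  have h2 : HasDerivAt (fun s => bil x y W i j (s, t)) (bilinX x y W i j t) s := by
    have := (((((hasDerivAt_id s).const_sub (x (i + 1))).mul_const
      ((y (j + 1) - t) * W i j + (t - y j) * W i (j + 1))).add
      (((hasDerivAt_id s).sub_const (x i)).mul_const
      ((y (j + 1) - t) * W (i + 1) j + (t - y j) * W (i + 1) (j + 1)))).div_const
      ((x (i + 1) - x i) * (y (j + 1) - y j)))
    refine HasDerivAt.congr_deriv (f := fun s => bil x y W i j (s, t)) this ?_
    simp only [bilinX, dX]; ring
  exact h1.unique h2

theorem bil_comp_swap (x y : ℕ → ℝ) (W : ℕ → ℕ → ℝ) (i j : ℕ) :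
    bil x y W i j ∘ Prod.swap = bil y x (flipNodal W) j i := by
  funext p
  simp only [bil, Function.comp, flipNodal, Prod.fst_swap, Prod.snd_swap]
  ring

theorem pd_one_bil (x y : ℕ → ℝ) (W : ℕ → ℕ → ℝ) (i j : ℕ) (s t : ℝ) :
    pd 1 (bil x y W i j) (s, t) = bilinX y x (flipNodal W) j i s := by
  rw [← pd_zero_bil y x (flipNodal W) j i t s, ← bil_comp_swap, pd_comp_swap]
  rfl

/-- The `y`-derivative of a bilinear function is affine in `x`, so at the midline it is the mean of
the slopes on the two vertical sides. -/
theorem bilinX_flip_midpt {x : ℕ → ℝ} {i : ℕ} (hx : x i < x (i + 1)) (y : ℕ → ℝ) (W : ℕ → ℕ → ℝ)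
    (j : ℕ) : bilinX y x (flipNodal W) j i (midpt x i) = bilinY y W i j := by
  have h := (sub_pos.mpr hx).ne'
  -- For zero height both sides are zero by the convention for division by zero, so `y` needs no
  -- hypothesis.
  rcases eq_or_ne (y (j + 1) - y j) 0 with h0 | h0
  · simp [bilinX, bilinY, h0]
  · simp only [bilinX, bilinY, midpt, dX, dY, flipNodal]
    field_simp
    ring

namespace RectMesh

variable {Ω : Rect}

theorem IsPiecewise.pd_eq {T : RectMesh Ω} {w : ℝ × ℝ → ℝ} {W : ℕ → ℕ → ℝ}
    (hw : T.IsPiecewise w W) {i j : ℕ} (hi : i < T.nx) (hj : j < T.ny) {p : ℝ × ℝ}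
    (hp : p ∈ Set.Ioo (T.x i) (T.x (i + 1)) ×ˢ Set.Ioo (T.y j) (T.y (j + 1))) (k : Fin 2) :
    pd k w p = pd k (bil T.x T.y W i j) p := by
  have : w =ᶠ[nhds p] bil T.x T.y W i j :=
    Filter.eventuallyEq_of_mem ((isOpen_Ioo.prod isOpen_Ioo).mem_nhds hp) fun q hq =>
      hw i hi j hj q (Set.prod_mono Set.Ioo_subset_Icc_self Set.Ioo_subset_Icc_self hq)
  rw [pd, pd, this.fderiv_eq]

theorem integrableOn_closure (T : RectMesh Ω) {G : ℝ × ℝ → ℝ}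
    (h : ∀ i < T.nx, ∀ j < T.ny, IntegrableOn G (T.elem i j)) : IntegrableOn G (closure Ω.dom) := by
  have hun : closure Ω.dom ⊆ ⋃ q : Fin T.nx × Fin T.ny, T.elem q.1 q.2 := fun p hp => by
    obtain ⟨i, hi, j, hj, h⟩ := T.exists_elem hp
    exact Set.mem_iUnion.mpr ⟨((⟨i, hi⟩ : Fin T.nx), (⟨j, hj⟩ : Fin T.ny)), h⟩
  have hi : IntegrableOn G (⋃ q : Fin T.nx × Fin T.ny, T.elem q.1 q.2) := by
    rw [integrableOn_finite_iUnion]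
    exact fun q => h q.1 q.1.2 q.2 q.2.2
  exact hi.mono_set hun

theorem _root_.FVE.Rect.restrict_closure (Ω : Rect) :
    (volume : Measure (ℝ × ℝ)).restrict (closure Ω.dom) = volume.restrict Ω.dom := by
  refine Measure.restrict_congr_set ?_
  rw [Ω.closure_dom, Rect.dom, Measure.volume_eq_prod]
  exact (Measure.set_prod_ae_eq Ioo_ae_eq_Icc Ioo_ae_eq_Icc).symm

theorem boxInt_whole (T : RectMesh Ω) (G : ℝ × ℝ → ℝ) :
    boxInt G (T.x 0) (T.x T.nx) (T.y 0) (T.y T.ny) = ∫ p in Ω.dom, G p := by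
  rw [boxInt_eq_Ioo, T.dom_eq]

theorem sum_boxInt_elem (T : RectMesh Ω) {G : ℝ × ℝ → ℝ} (hG : IntegrableOn G (closure Ω.dom)) :
    ∑ i ∈ Finset.range T.nx, ∑ j ∈ Finset.range T.ny,
      boxInt G (T.x i) (T.x (i + 1)) (T.y j) (T.y (j + 1)) = ∫ p in Ω.dom, G p := by
  rw [T.closure_eq] at hG
  rw [sum_boxInt T.x_le_succ T.y_le_succ hG, T.boxInt_whole]

theorem ae_elem {T : RectMesh Ω} {Q : ℝ × ℝ → Prop} (h : ∀ᵐ p ∂(volume.restrict Ω.dom), Q p)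
    {i j : ℕ} (hi : i < T.nx) (hj : j < T.ny) : ∀ᵐ p ∂(volume.restrict (T.elem i j)), Q p := by
  rw [← Ω.restrict_closure] at h
  exact ae_restrict_of_ae_restrict_of_subset (T.elem_subset_closure hi hj) h

theorem abs_dualProj_le (T : RectMesh Ω) (w : ℝ × ℝ → ℝ) (p : ℝ × ℝ) :
    |T.dualProj w p| ≤ ∑ i ∈ Finset.range (T.nx + 1), ∑ j ∈ Finset.range (T.ny + 1),
      |T.nodal w i j| := by
  unfold dualProj
  refine (Finset.abs_sum_le_sum_abs _ _).trans (Finset.sum_le_sum fun i _ =>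
    (Finset.abs_sum_le_sum_abs _ _).trans (Finset.sum_le_sum fun j _ => ?_))
  rw [abs_mul]
  refine mul_le_of_le_one_right (abs_nonneg _) ?_
  by_cases h : p ∈ T.dual i j
  · rw [Set.indicator_of_mem h, abs_one]
  · rw [Set.indicator_of_notMem h, abs_zero]; exact zero_le_one

theorem integrableOn_mul_dualProj (T : RectMesh Ω) (w : ℝ × ℝ → ℝ) {G : ℝ × ℝ → ℝ}
    {S : Set (ℝ × ℝ)} (hG : IntegrableOn G S) : IntegrableOn (fun p => G p * T.dualProj w p) S :=
  Integrable.mul_bdd hG (T.measurable_dualProj w).aestronglyMeasurable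
    (Filter.Eventually.of_forall (T.abs_dualProj_le w))

/-- On the interior of each dual element the projection is constant, and the dual elements tile the
domain up to null sets. -/
theorem sum_boxInt_dual_mul (T : RectMesh Ω) (w : ℝ × ℝ → ℝ) {G : ℝ × ℝ → ℝ}
    (hG : IntegrableOn G (closure Ω.dom)) :
    ∑ i ∈ Finset.range (T.nx + 1), ∑ j ∈ Finset.range (T.ny + 1),
      boxInt G (cutL T.x i) (cutR T.x T.nx i) (cutL T.y j) (cutR T.y T.ny j) * T.nodal w i j =
      ∫ p in Ω.dom, G p * T.dualProj w p := by
  have hGP := T.integrableOn_mul_dualProj w hG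
  rw [T.closure_eq] at hGP
  rw [← T.boxInt_whole, ← sum_boxInt_dual T.x_lt T.y_lt hGP]
  refine Finset.sum_congr rfl fun i hi => Finset.sum_congr rfl fun j hj => ?_
  have hi : i ≤ T.nx := Nat.lt_succ_iff.mp (Finset.mem_range.mp hi)
  have hj : j ≤ T.ny := Nat.lt_succ_iff.mp (Finset.mem_range.mp hj)
  rw [boxInt_eq_Ioo, boxInt_eq_Ioo, ← integral_mul_const]
  refine setIntegral_congr_fun (measurableSet_Ioo.prod measurableSet_Ioo) fun p hp => ?_
  rw [T.dualProj_eq w hi hj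
    (fun i' hi' => mem_cut_iff T.x_lt hi hi' (Set.Ioo_subset_Icc_self hp.1) (Or.inr hp.1.1)
      (Or.inr hp.1.2))
    (fun j' hj' => mem_cut_iff T.y_lt hj hj' (Set.Ioo_subset_Icc_self hp.2) (Or.inr hp.2.1)
      (Or.inr hp.2.2))]

end RectMesh

/-! ### The discrete form -/

/-- The bilinear form of the scheme, in terms of nodal values. -/
noncomputable def discForm (n m : ℕ) (x y : ℕ → ℝ) (a : Fin 2 → Fin 2 → ℝ × ℝ → ℝ)
    (c P : ℝ × ℝ → ℝ) (W V : ℕ → ℕ → ℝ) : ℝ :=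
  vform n m y (discFlux (a 0 0) (a 0 1) x y W) V +
    vform m n x (discFlux (a 1 1 ∘ Prod.swap) (a 1 0 ∘ Prod.swap) y x (flipNodal W)) (flipNodal V) +
    cform n m x y c P W

theorem boundaryFlux_eq (A : ℝ × ℝ → Matrix (Fin 2) (Fin 2) ℝ) (w : ℝ × ℝ → ℝ) (l r b t : ℝ) :
    boundaryFlux A w l r b t =
      sideDiff 0 (fun p => flux A w p 0) l r b t + sideDiff 1 (fun p => flux A w p 1) l r b t := by
  rw [boundaryFlux, sideDiff, sideDiff, if_pos rfl, if_neg (by decide)]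
  ring

theorem flux_apply (A : ℝ × ℝ → Matrix (Fin 2) (Fin 2) ℝ) (w : ℝ × ℝ → ℝ) (p : ℝ × ℝ) (k : Fin 2) :
    flux A w p k = A p k 0 * pd 0 w p + A p k 1 * pd 1 w p := by
  simp [flux, Matrix.mulVec, dotProduct, Fin.sum_univ_two]

theorem continuous_discFlux {a b : ℝ × ℝ → ℝ} (ha : Continuous a) (hb : Continuous b)
    (x y : ℕ → ℝ) (W : ℕ → ℕ → ℝ) (i j : ℕ) : Continuous (discFlux a b x y W i j) := by
  have := continuous_bilinX x y W i j
  unfold discFlux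
  fun_prop

section

variable {Ω : Rect} {A : ℝ × ℝ → Matrix (Fin 2) (Fin 2) ℝ} {c c' : ℝ × ℝ → ℝ}
  {a g : Fin 2 → Fin 2 → ℝ × ℝ → ℝ} {M L C₁ : ℝ}

open RectMesh

theorem RectMesh.IsTrial.nodal_eq_zero {T : RectMesh Ω} {v : ℝ × ℝ → ℝ} (hv : T.IsTrial v) :
    (∀ j ≤ T.ny, T.nodal v 0 j = 0) ∧ (∀ j ≤ T.ny, T.nodal v T.nx j = 0) ∧
      (∀ i ≤ T.nx, T.nodal v i 0 = 0) ∧ ∀ i ≤ T.nx, T.nodal v i T.ny = 0 :=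
  ⟨fun _ hj => hv.2.2 _ (T.mem_frontier (T.node_mem_closure (Nat.zero_le _) hj) (by simp)),
    fun _ hj => hv.2.2 _ (T.mem_frontier (T.node_mem_closure le_rfl hj) (by simp)),
    fun _ hi => hv.2.2 _ (T.mem_frontier (T.node_mem_closure hi (Nat.zero_le _)) (by simp)),
    fun _ hi => hv.2.2 _ (T.mem_frontier (T.node_mem_closure hi le_rfl) (by simp))⟩

/-- Away from its end points the midline runs inside one open element, where the trial function
coincides with a single bilinear function and its classical gradient is available. -/
theorem IsCoeff.flux_vertical_eq (H : IsCoeff Ω A c a g c' M L C₁) {T : RectMesh Ω} {w : ℝ × ℝ → ℝ}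
    {W : ℕ → ℕ → ℝ} (hw : T.IsPiecewise w W) {i j : ℕ} (hi : i < T.nx) (hj : j < T.ny) {t : ℝ}
    (ht : t ∈ Set.Ioo (T.y j) (T.y (j + 1))) :
    flux A w (midpt T.x i, t) 0 = discFlux (a 0 0) (a 0 1) T.x T.y W i j t := by
  have hp : (midpt T.x i, t) ∈ Set.Ioo (T.x i) (T.x (i + 1)) ×ˢ Set.Ioo (T.y j) (T.y (j + 1)) :=
    ⟨midpt_mem_Ioo (T.x_lt i hi), ht⟩
  rw [flux_apply, hw.pd_eq hi hj hp, hw.pd_eq hi hj hp, pd_zero_bil, pd_one_bil,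
    bilinX_flip_midpt (T.x_lt i hi), ← H.a_eq _ _ _ (T.interior_elem_subset hi hj hp),
    ← H.a_eq _ _ _ (T.interior_elem_subset hi hj hp)]
  rfl

theorem IsCoeff.flux_horizontal_eq (H : IsCoeff Ω A c a g c' M L C₁) {T : RectMesh Ω}
    {w : ℝ × ℝ → ℝ} {W : ℕ → ℕ → ℝ} (hw : T.IsPiecewise w W) {i j : ℕ} (hi : i < T.nx)
    (hj : j < T.ny) {s : ℝ} (hs : s ∈ Set.Ioo (T.x i) (T.x (i + 1))) :
    flux A w (s, midpt T.y j) 1 =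
      discFlux (a 1 1 ∘ Prod.swap) (a 1 0 ∘ Prod.swap) T.y T.x (flipNodal W) j i s := by
  have hp : (s, midpt T.y j) ∈ Set.Ioo (T.x i) (T.x (i + 1)) ×ˢ Set.Ioo (T.y j) (T.y (j + 1)) :=
    ⟨hs, midpt_mem_Ioo (T.y_lt j hj)⟩
  have e : bilinX T.x T.y W i j (midpt T.y j) = bilinY T.x (flipNodal W) j i :=
    bilinX_flip_midpt (T.y_lt j hj) T.x (flipNodal W) i
  rw [flux_apply, hw.pd_eq hi hj hp, hw.pd_eq hi hj hp, pd_zero_bil, pd_one_bil, e,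
    ← H.a_eq _ _ _ (T.interior_elem_subset hi hj hp),
    ← H.a_eq _ _ _ (T.interior_elem_subset hi hj hp), add_comm]
  rfl

/-- The flux terms are summed by parts, which uses that the nodal values of `v` vanish on the
boundary. The zeroth order term is merely regrouped: the dual elements and the elements are two
tilings of the same rectangle. Afterwards the scheme is a form in nodal values and makes sense for
any nodal function. -/
theorem IsCoeff.fveForm_eq (H : IsCoeff Ω A c a g c' M L C₁) {T : RectMesh Ω} {w v : ℝ × ℝ → ℝ}
    (hw : T.IsTrial w) (hv : T.IsTrial v) :
    fveForm T A c w (T.dualProj v) =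
      discForm T.nx T.ny T.x T.y a c' (T.dualProj v) (T.nodal w) (T.nodal v) := by
  obtain ⟨z1, z2, z3, z4⟩ := hv.nodal_eq_zero
  have hP := T.isStepOf_dualProj v
  have hpw := hw.isPiecewise
  have hcell : ∀ i < T.nx, ∀ j < T.ny, (fun p => c p * w p * T.dualProj v p)
      =ᵐ[volume.restrict (T.elem i j)] fun p => c' p * bil T.x T.y (T.nodal w) i j p * T.dualProj v p :=
    fun i hi j hj => by
      filter_upwards [ae_elem H.c_ae hi hj, ae_mem_box (T.x i) (T.x (i + 1)) (T.y j) (T.y (j + 1))]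
        with p h1 h2
      rw [h1, hpw i hi j hj p h2]
  have hint : IntegrableOn (fun p => c p * w p * T.dualProj v p) (closure Ω.dom) :=
    T.integrableOn_closure fun i hi j hj =>
      (integrableOn_mul_step (M := M) hP hi hj H.c_meas (fun p => by
        rw [abs_of_nonneg (H.c_nonneg p)]; exact H.c_le p)
        (continuous_bil _ _ _ _ _)).congr (hcell i hi j hj).symm
  have e1 : fveForm T A c w (T.dualProj v) =
      -(∑ i ∈ Finset.range (T.nx + 1), ∑ j ∈ Finset.range (T.ny + 1),
        sideDiff 0 (fun p => flux A w p 0) (cutL T.x i) (cutR T.x T.nx i) (cutL T.y j)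
          (cutR T.y T.ny j) * T.nodal v i j) -
      (∑ i ∈ Finset.range (T.nx + 1), ∑ j ∈ Finset.range (T.ny + 1),
        sideDiff 1 (fun p => flux A w p 1) (cutL T.x i) (cutR T.x T.nx i) (cutL T.y j)
          (cutR T.y T.ny j) * T.nodal v i j) +
      ∑ i ∈ Finset.range (T.nx + 1), ∑ j ∈ Finset.range (T.ny + 1),
        boxInt (fun p => c p * w p * T.dualProj v p) (cutL T.x i) (cutR T.x T.nx i) (cutL T.y j)
          (cutR T.y T.ny j) := by
    rw [fveForm, ← Finset.sum_neg_distrib, ← Finset.sum_sub_distrib, ← Finset.sum_add_distrib]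
    refine Finset.sum_congr rfl fun i hi => ?_
    rw [← Finset.sum_neg_distrib, ← Finset.sum_sub_distrib, ← Finset.sum_add_distrib]
    refine Finset.sum_congr rfl fun j hj => ?_
    -- A node lies in its own dual element only, so the pointwise value of the projection there is
    -- the nodal value.
    rw [T.dualProj_node v (Nat.lt_succ_iff.mp (Finset.mem_range.mp hi))
      (Nat.lt_succ_iff.mp (Finset.mem_range.mp hj)), boundaryFlux_eq, add_mul, neg_add, ← sub_eq_add_neg]
    rfl
  have f1 : ∀ i < T.nx, ∀ j < T.ny, IntervalIntegrable (fun t => flux A w (midpt T.x i, t) 0) volume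
      (T.y j) (T.y (j + 1)) := fun i hi j hj => by
    refine ((continuous_discFlux (H.a_cont 0 0) (H.a_cont 0 1) T.x T.y (T.nodal w) i
      j).intervalIntegrable _ _).congr_uIoo fun t ht => ?_
    rw [Set.uIoo_of_le (T.y_le_succ j hj)] at ht
    exact (H.flux_vertical_eq hpw hi hj ht).symm
  have f2 : ∀ i < T.nx, ∀ j < T.ny, IntervalIntegrable (fun s => flux A w (s, midpt T.y j) 1) volume
      (T.x i) (T.x (i + 1)) := fun i hi j hj => by
    refine ((continuous_discFlux ((H.a_cont 1 1).comp continuous_swap)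
      ((H.a_cont 1 0).comp continuous_swap) T.y T.x (flipNodal (T.nodal w)) j
      i).intervalIntegrable _ _).congr_uIoo fun s hs => ?_
    rw [Set.uIoo_of_le (T.x_le_succ i hi)] at hs
    exact (H.flux_horizontal_eq hpw hi hj hs).symm
  rw [e1, sum_sideDiff_zero T.y_lt f1 z1 z2 z3 z4, sum_sideDiff_one T.x_lt f2 z1 z2 z3 z4,
    sum_boxInt_dual T.x_lt T.y_lt (by rwa [T.closure_eq] at hint), T.boxInt_whole,
    ← T.sum_boxInt_elem hint, discForm, neg_neg, sub_neg_eq_add]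
  congr 1
  · congr 1
    · exact vform_congr T.y_lt fun i hi j hj t ht => H.flux_vertical_eq hpw hi hj ht
    · exact vform_congr T.x_lt fun j hj i hi s hs => H.flux_horizontal_eq hpw hi hj hs
  · refine Finset.sum_congr rfl fun i hi => Finset.sum_congr rfl fun j hj => ?_
    exact integral_congr_ae (hcell i (Finset.mem_range.mp hi) j (Finset.mem_range.mp hj))

/-- The form of the scheme for a smooth function, in terms of the fluxes through the midlines. -/
theorem IsCoeff.sum_balance_eq (H : IsCoeff Ω A c a g c' M L C₁) {T : RectMesh Ω} {w v : ℝ × ℝ → ℝ}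
    (hw : ContDiff ℝ ∞ w) (hv : T.IsTrial v) :
    ∑ i ∈ Finset.range (T.nx + 1), ∑ j ∈ Finset.range (T.ny + 1),
      (-(∑ k, sideDiff k (fluxComp a k w) (cutL T.x i) (cutR T.x T.nx i) (cutL T.y j)
        (cutR T.y T.ny j)) + boxInt (fun p => c' p * w p) (cutL T.x i) (cutR T.x T.nx i)
        (cutL T.y j) (cutR T.y T.ny j)) * T.nodal v i j =
    vform T.nx T.ny T.y (fun i _ t => fluxComp a 0 w (midpt T.x i, t)) (T.nodal v) +
      vform T.ny T.nx T.x (fun j _ s => fluxComp a 1 w (s, midpt T.y j)) (flipNodal (T.nodal v)) +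
      ∑ i ∈ Finset.range T.nx, ∑ j ∈ Finset.range T.ny,
        boxInt (fun p => c' p * w p * T.dualProj v p) (T.x i) (T.x (i + 1)) (T.y j) (T.y (j + 1)) := by
  obtain ⟨z1, z2, z3, z4⟩ := hv.nodal_eq_zero
  have hcont : ∀ k, Continuous (fluxComp a k w) := fun k =>
    ((H.a_cont k 0).mul (contDiff_pd hw 0).continuous).add
      ((H.a_cont k 1).mul (contDiff_pd hw 1).continuous)
  have c0 := hcont 0
  have c1 := hcont 1
  have hG : IntegrableOn (fun p => c' p * w p) (closure Ω.dom) := by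
    rw [T.closure_eq]
    exact Integrable.bdd_mul (c := M) (integrableOn_box_of_continuous hw.continuous _ _ _ _)
      H.c_meas.aestronglyMeasurable (Filter.Eventually.of_forall fun p => by
        rw [Real.norm_eq_abs, abs_of_nonneg (H.c_nonneg p)]; exact H.c_le p)
  rw [T.sum_boxInt_elem (T.integrableOn_mul_dualProj v hG), ← T.sum_boxInt_dual_mul v hG]
  have s0 := sum_sideDiff_zero (x := T.x) (G := fluxComp a 0 w) T.y_lt
    (fun i _ j _ => Continuous.intervalIntegrable (by fun_prop) _ _) z1 z2 z3 z4
  have s1 := sum_sideDiff_one (y := T.y) (G := fluxComp a 1 w) T.x_lt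
    (fun i _ j _ => Continuous.intervalIntegrable (by fun_prop) _ _) z1 z2 z3 z4
  rw [← neg_eq_iff_eq_neg] at s0 s1
  rw [← s0, ← s1, ← Finset.sum_neg_distrib, ← Finset.sum_neg_distrib, ← Finset.sum_add_distrib,
    ← Finset.sum_add_distrib]
  refine Finset.sum_congr rfl fun i _ => ?_
  rw [← Finset.sum_neg_distrib, ← Finset.sum_neg_distrib, ← Finset.sum_add_distrib,
    ← Finset.sum_add_distrib]
  refine Finset.sum_congr rfl fun j _ => ?_
  rw [Fin.sum_univ_two]
  ring

end

end FVE

namespace FVE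

open Filter Topology

/-! ### Linearity, continuity and coercivity of the discrete form -/

theorem discFlux_sub (a b : ℝ × ℝ → ℝ) (x y : ℕ → ℝ) (W W' : ℕ → ℕ → ℝ) (i j : ℕ) (t : ℝ) :
    discFlux a b x y W i j t - discFlux a b x y W' i j t =
      discFlux a b x y (fun i j => W i j - W' i j) i j t := by
  simp only [discFlux, bilinX, bilinY, dX, dY]; ring

theorem vform_discFlux_sub {n m : ℕ} {x y : ℕ → ℝ} {a b : ℝ × ℝ → ℝ} {V : ℕ → ℕ → ℝ}
    (ha : Continuous a) (hb : Continuous b) (W W' : ℕ → ℕ → ℝ) :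
    vform n m y (discFlux a b x y W) V - vform n m y (discFlux a b x y W') V =
      vform n m y (discFlux a b x y fun i j => W i j - W' i j) V := by
  rw [vform_sub (continuous_discFlux ha hb x y W) (continuous_discFlux ha hb x y W')]
  simp_rw [discFlux_sub]

theorem cform_sub {n m : ℕ} {x y : ℕ → ℝ} {V : ℕ → ℕ → ℝ} {c P : ℝ × ℝ → ℝ} {M : ℝ}
    (hc : Measurable c) (hcM : ∀ p, |c p| ≤ M) (hP : IsStepOf n m x y V P) (W W' : ℕ → ℕ → ℝ) :
    cform n m x y c P W - cform n m x y c P W' = cform n m x y c P fun i j => W i j - W' i j := by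
  simp only [cform, ← Finset.sum_sub_distrib]
  refine Finset.sum_congr rfl fun i hi => Finset.sum_congr rfl fun j hj => ?_
  have hi := Finset.mem_range.mp hi
  have hj := Finset.mem_range.mp hj
  rw [boxInt, boxInt, boxInt, ← integral_sub
    (integrableOn_mul_step hP hi hj hc hcM (continuous_bil _ _ _ _ _))
    (integrableOn_mul_step hP hi hj hc hcM (continuous_bil _ _ _ _ _))]
  congr 1
  funext p
  rw [← bil_sub]
  ring

/-- The integral depends continuously on the four increments `p`, `q`, `r`, `s`, which enter the
integrand as parameters. -/
theorem tendsto_integral_bilinear {α β : ℝ → ℝ} (hα : Continuous α) (hβ : Continuous β)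
    {p q r s : ℕ → ℝ} {p' q' r' s' c d D E u v : ℝ} (hp : Tendsto p atTop (𝓝 p'))
    (hq : Tendsto q atTop (𝓝 q')) (hr : Tendsto r atTop (𝓝 r')) (hs : Tendsto s atTop (𝓝 s')) :
    Tendsto (fun k => ∫ t in u..v, (α t * (((d - t) * p k + (t - c) * q k) / D) +
      β t * ((r k + s k) / E))) atTop
      (𝓝 (∫ t in u..v, (α t * (((d - t) * p' + (t - c) * q') / D) + β t * ((r' + s') / E)))) := by
  have hc : Continuous fun z : ℝ × ℝ × ℝ × ℝ => ∫ t in u..v,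
      (α t * (((d - t) * z.1 + (t - c) * z.2.1) / D) + β t * ((z.2.2.1 + z.2.2.2) / E)) := by
    refine intervalIntegral.continuous_parametric_intervalIntegral_of_continuous' ?_ u v
    unfold Function.uncurry
    fun_prop
  have ht : Tendsto (fun k => (p k, q k, r k, s k)) atTop (𝓝 (p', q', r', s')) :=
    hp.prodMk_nhds (hq.prodMk_nhds (hr.prodMk_nhds hs))
  have := (hc.tendsto (p', q', r', s')).comp ht
  exact this

theorem tendsto_vform_discFlux {n m : ℕ} {x y : ℕ → ℝ} {a b : ℝ × ℝ → ℝ} {V W : ℕ → ℕ → ℝ}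
    {Z : ℕ → ℕ → ℕ → ℝ} (ha : Continuous a) (hb : Continuous b)
    (hZ : ∀ i ≤ n, ∀ j ≤ m, Tendsto (fun k => Z k i j) atTop (𝓝 (W i j))) :
    Tendsto (fun k => vform n m y (discFlux a b x y (Z k)) V) atTop
      (𝓝 (vform n m y (discFlux a b x y W) V)) := by
  have key : ∀ i < n, ∀ j < m, ∀ l r : ℝ, Tendsto (fun k => ∫ t in l..r, discFlux a b x y (Z k) i j t)
      atTop (𝓝 (∫ t in l..r, discFlux a b x y W i j t)) := fun i hi j hj l r => by
    have z1 := hZ i hi.le j hj.le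
    have z2 := hZ (i + 1) hi j hj.le
    have z3 := hZ i hi.le (j + 1) hj
    have z4 := hZ (i + 1) hi (j + 1) hj
    unfold discFlux bilinX bilinY
    exact tendsto_integral_bilinear (α := fun t => a (midpt x i, t)) (β := fun t => b (midpt x i, t))
      (by fun_prop) (by fun_prop) (z2.sub z1) (z4.sub z3) (z3.sub z1) (z4.sub z2)
  unfold vform
  refine tendsto_finsetSum _ fun i hi => tendsto_finsetSum _ fun j hj => ?_
  have hi := Finset.mem_range.mp hi
  have hj := Finset.mem_range.mp hj
  exact ((key i hi j hj _ _).mul_const _).add ((key i hi j hj _ _).mul_const _)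

theorem tendsto_cform {n m : ℕ} {x y : ℕ → ℝ} {V W : ℕ → ℕ → ℝ} {Z : ℕ → ℕ → ℕ → ℝ}
    {c P : ℝ × ℝ → ℝ} {M : ℝ} (hx : ∀ i < n, x i < x (i + 1)) (hy : ∀ j < m, y j < y (j + 1))
    (hc : Measurable c) (hcM : ∀ p, |c p| ≤ M) (hP : IsStepOf n m x y V P)
    (hZ : ∀ i ≤ n, ∀ j ≤ m, Tendsto (fun k => Z k i j) atTop (𝓝 (W i j))) :
    Tendsto (fun k => cform n m x y c P (Z k)) atTop (𝓝 (cform n m x y c P W)) := by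
  unfold cform
  refine tendsto_finsetSum _ fun i hi => tendsto_finsetSum _ fun j hj => ?_
  have hi := Finset.mem_range.mp hi
  have hj := Finset.mem_range.mp hj
  have z1 := hZ i hi.le j hj.le
  have z2 := hZ (i + 1) hi j hj.le
  have z3 := hZ i hi.le (j + 1) hj
  have z4 := hZ (i + 1) hi (j + 1) hj
  have hS : Tendsto (fun k => √(cornerSq (Z k) i j)) atTop (𝓝 √(cornerSq W i j)) :=
    ((((z1.pow 2).add (z2.pow 2)).add (z3.pow 2)).add (z4.pow 2)).sqrt
  have hev := hS.eventually (ge_mem_nhds (lt_add_one √(cornerSq W i j)))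
  -- The bilinear functions are bounded on the element by their nodal values, which are eventually
  -- below the limiting bound plus one; this gives a constant majorant.
  refine tendsto_integral_filter_of_dominated_convergence
    (fun _ => M * (√(cornerSq W i j) + 1) * √(cornerSq V i j)) ?_ ?_ ?_ ?_
  · exact Eventually.of_forall fun k =>
      ((hc.mul (continuous_bil _ _ _ _ _).measurable).mul hP.1).aestronglyMeasurable
  · filter_upwards [hev] with k hk
    filter_upwards [hP.ae_abs_le hi hj, ae_mem_box (x i) (x (i + 1)) (y j) (y (j + 1))] with p h1 h2
    rw [Real.norm_eq_abs, abs_mul, abs_mul]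
    have h3 := abs_bil_le (W := Z k) (hx i hi) (hy j hj) h2
    have hM : 0 ≤ M := (abs_nonneg _).trans (hcM p)
    have h4 := Real.sqrt_nonneg (cornerSq W i j)
    gcongr
    · exact hcM p
    · exact h3.trans hk
  · exact integrable_const _
  · refine Eventually.of_forall fun p => (Tendsto.const_mul _ ?_).mul_const _
    exact (((((z1.const_mul _).add (z3.const_mul _)).const_mul _).add
      (((z2.const_mul _).add (z4.const_mul _)).const_mul _))).div_const _

theorem dist_swap (p q : ℝ × ℝ) : dist p.swap q.swap = dist p q := by
  simp only [Prod.dist_eq, Prod.fst_swap, Prod.snd_swap, max_comm]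

section

variable {Ω : Rect} {A : ℝ × ℝ → Matrix (Fin 2) (Fin 2) ℝ} {c c' : ℝ × ℝ → ℝ}
  {a g : Fin 2 → Fin 2 → ℝ × ℝ → ℝ} {M L C₁ γ h : ℝ} {n m : ℕ} {x y : ℕ → ℝ} {P : ℝ × ℝ → ℝ}
  {V : ℕ → ℕ → ℝ}

theorem IsCoeff.abs_c_le (H : IsCoeff Ω A c a g c' M L C₁) (p : ℝ × ℝ) : |c' p| ≤ M := by
  rw [abs_of_nonneg (H.c_nonneg p)]; exact H.c_le p

theorem IsCoeff.M_nonneg (H : IsCoeff Ω A c a g c' M L C₁) : 0 ≤ M :=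
  (H.c_nonneg 0).trans (H.c_le 0)

theorem IsCoeff.discForm_sub (H : IsCoeff Ω A c a g c' M L C₁) (hP : IsStepOf n m x y V P)
    (W W' U : ℕ → ℕ → ℝ) :
    discForm n m x y a c' P W U - discForm n m x y a c' P W' U =
      discForm n m x y a c' P (fun i j => W i j - W' i j) U := by
  have s1 := vform_discFlux_sub (n := n) (m := m) (x := x) (y := y) (V := U) (H.a_cont 0 0)
    (H.a_cont 0 1) W W'
  have s2 := vform_discFlux_sub (n := m) (m := n) (x := y) (y := x) (V := flipNodal U)
    ((H.a_cont 1 1).comp continuous_swap) ((H.a_cont 1 0).comp continuous_swap)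
    (flipNodal W) (flipNodal W')
  have s3 := cform_sub H.c_meas H.abs_c_le hP W W'
  unfold discForm
  rw [← s1, ← s3]
  have s2' : vform m n x (discFlux (a 1 1 ∘ Prod.swap) (a 1 0 ∘ Prod.swap) y x
      (flipNodal fun i j => W i j - W' i j)) (flipNodal U) = _ := s2.symm
  rw [s2']
  ring

/-- The form depends on the values at the grid indices only, and continuously so. Pointwise
convergence of the smooth approximations at the nodes is therefore enough. -/
theorem IsCoeff.tendsto_discForm (H : IsCoeff Ω A c a g c' M L C₁) (hP : IsStepOf n m x y V P)
    (hx : ∀ i < n, x i < x (i + 1)) (hy : ∀ j < m, y j < y (j + 1)) {W : ℕ → ℕ → ℝ}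
    {Z : ℕ → ℕ → ℕ → ℝ} (hZ : ∀ i ≤ n, ∀ j ≤ m, Tendsto (fun k => Z k i j) atTop (𝓝 (W i j)))
    (U : ℕ → ℕ → ℝ) :
    Tendsto (fun k => discForm n m x y a c' P (Z k) U) atTop
      (𝓝 (discForm n m x y a c' P W U)) :=
  ((tendsto_vform_discFlux (H.a_cont 0 0) (H.a_cont 0 1) hZ).add
    (tendsto_vform_discFlux ((H.a_cont 1 1).comp continuous_swap)
      ((H.a_cont 1 0).comp continuous_swap) fun j hj i hi => hZ i hi j hj)).add
    (tendsto_cform hx hy H.c_meas H.abs_c_le hP hZ)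

/-- Both losses, from the variation of `A` and from the replacement of `Π_h^* v` by `v` in the
zeroth order term, are multiples of `h` times the energy. -/
theorem IsCoeff.discForm_self_ge (H : IsCoeff Ω A c a g c' M L C₁) (hP : IsStepOf n m x y V P)
    (G : IsGrid n m x y γ h) (hγ : 0 < γ) (hh : 0 ≤ h)
    (hmem : ∀ i < n, ∀ j < m, (midpt x i, midpt y j) ∈ Ω.dom) (hV : ∀ j ≤ m, V 0 j = 0) :
    (C₁ / (4 * γ) - (8 * L * (γ + 1) + 2 * M * √(2 * (x n - x 0) ^ 2 * γ)) * h) *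
      nodalEnergy n m V ≤ discForm n m x y a c' P V V := by
  have h1 := vform_add_vform_flip_ge (W := V) G hγ hh H.C_pos.le (H.a_cont 0 0) (H.a_cont 0 1)
    (H.a_cont 1 0) (H.a_cont 1 1) H.L_nonneg (H.a_lip 0 0) (H.a_lip 0 1) (H.a_lip 1 0) (H.a_lip 1 1)
    fun i hi j hj => H.ell _ (hmem i hi j hj)
  have h2 := cform_self_ge G hh hV H.c_meas H.c_nonneg H.c_le hP
  unfold discForm
  nlinarith

/-- The consistency error of the scheme for smooth functions. -/
theorem IsCoeff.abs_sub_discForm_le (H : IsCoeff Ω A c a g c' M L C₁) (hP : IsStepOf n m x y V P)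
    (G : IsGrid n m x y γ h) (hγ : 0 ≤ γ) (hh : 0 ≤ h) (hh1 : h ≤ 1) {w : ℝ × ℝ → ℝ}
    (hw : ContDiff ℝ ∞ w)
    (hV0 : ∀ j ≤ m, V 0 j = 0) (hVn : ∀ j ≤ m, V n j = 0) (hV0' : ∀ i ≤ n, V i 0 = 0)
    (hVm : ∀ i ≤ n, V i m = 0) :
    |vform n m y (fun i _ t => fluxComp a 0 w (midpt x i, t)) V +
      vform m n x (fun j _ s => fluxComp a 1 w (s, midpt y j)) (flipNodal V) +
      (∑ i ∈ Finset.range n, ∑ j ∈ Finset.range m,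
        boxInt (fun p => c' p * w p * P p) (x i) (x (i + 1)) (y j) (y (j + 1))) -
      discForm n m x y a c' P (fun i j => w (x i, y j)) V| ≤
    (2 * (2 * (M * (1 + γ) + L * (2 * γ + 1) + M) + (M + 2 * L * γ)) +
      3 * M * √(2 * (x n - x 0) ^ 2 * γ)) * h ^ 2 *
      (√(sobEnergy w (x 0) (x n) (y 0) (y m)) * √(nodalEnergy n m V)) := by
  have cfl : ∀ k, Continuous (fluxComp a k w) := fun k =>
    ((H.a_cont k 0).mul (contDiff_pd hw 0).continuous).add
      ((H.a_cont k 1).mul (contDiff_pd hw 1).continuous)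
  have cf0 := cfl 0
  have cf1 := cfl 1
  have hws : ContDiff ℝ ∞ (w ∘ Prod.swap) := hw.comp (contDiff_snd.prodMk contDiff_fst)
  have s1 : vform n m y (fun i _ t => fluxComp a 0 w (midpt x i, t)) V -
      vform n m y (discFlux (a 0 0) (a 0 1) x y fun i j => w (x i, y j)) V = vform n m y (fun i j t =>
        a 0 0 (midpt x i, t) * (pd 0 w (midpt x i, t) - bilinX x y (fun i j => w (x i, y j)) i j t) +
        a 0 1 (midpt x i, t) * (pd 1 w (midpt x i, t) - bilinY y (fun i j => w (x i, y j)) i j)) V := by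
    rw [vform_sub (fun i j => by fun_prop) (continuous_discFlux (H.a_cont 0 0) (H.a_cont 0 1) _ _ _)]
    congr 1
    funext i j t
    simp only [fluxComp, discFlux]; ring
  -- The horizontal midlines are the vertical ones of the reflected problem, for `w ∘ Prod.swap`,
  -- with the diagonal coefficient `a 1 1` in the role of `a` and `a 1 0` in that of `b`.
  have s2 : vform m n x (fun j _ s => fluxComp a 1 w (s, midpt y j)) (flipNodal V) -
      vform m n x (discFlux (a 1 1 ∘ Prod.swap) (a 1 0 ∘ Prod.swap) y x
        (flipNodal fun i j => w (x i, y j))) (flipNodal V) = vform m n x (fun j i s =>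
        (a 1 1 ∘ Prod.swap) (midpt y j, s) * (pd 0 (w ∘ Prod.swap) (midpt y j, s) -
          bilinX y x (fun j i => (w ∘ Prod.swap) (y j, x i)) j i s) +
        (a 1 0 ∘ Prod.swap) (midpt y j, s) * (pd 1 (w ∘ Prod.swap) (midpt y j, s) -
          bilinY x (fun j i => (w ∘ Prod.swap) (y j, x i)) j i)) (flipNodal V) := by
    rw [vform_sub (fun i j => by fun_prop) (continuous_discFlux ((H.a_cont 1 1).comp continuous_swap)
      ((H.a_cont 1 0).comp continuous_swap) _ _ _)]
    congr 1
    funext j i s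
    rw [pd_comp_swap, pd_comp_swap]
    have e : (flipNodal fun i j => w (x i, y j)) = fun j i => (w ∘ Prod.swap) (y j, x i) := rfl
    rw [e]
    simp only [fluxComp, discFlux, Function.comp, Prod.swap_prod_mk, sub_zero, sub_self]
    ring
  have b1 := abs_vform_interp_error_le (V := V) G hγ hh hh1 hw (H.a_cont 0 0) (H.a_cont 0 1)
    (H.a_le 0 0) (H.a_le 0 1) H.L_nonneg (H.a_lip 0 1)
    (fun j hj => by rw [dY, hV0 _ hj.le, hV0 _ hj, sub_self])
    (fun j hj => by rw [dY, hVn _ hj.le, hVn _ hj, sub_self])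
  have b2 := abs_vform_interp_error_le (V := flipNodal V) G.swap hγ hh hh1 hws
    ((H.a_cont 1 1).comp continuous_swap) ((H.a_cont 1 0).comp continuous_swap)
    (fun p => H.a_le 1 1 p.swap) (fun p => H.a_le 1 0 p.swap) H.L_nonneg
    (fun p q => by rw [← dist_swap p q]; exact H.a_lip 1 0 p.swap q.swap)
    (fun i hi => by rw [dY, flipNodal, flipNodal, hV0' _ hi.le, hV0' _ hi, sub_self])
    (fun i hi => by rw [dY, flipNodal, flipNodal, hVm _ hi.le, hVm _ hi, sub_self])
  have b3 := abs_boxInt_sub_cform_le G hh1 hw hV0 H.c_meas H.abs_c_le hP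
  rw [← s1] at b1
  rw [← s2, sobEnergy_comp_swap hw, nodalEnergy_flip] at b2
  rw [abs_le] at b1 b2 b3 ⊢
  unfold discForm
  constructor <;> linarith

end

end FVE

namespace FVE

open Filter Topology

/-! ### Piecewise bilinear functions in `H¹` -/

theorem ae_mem_open_box (a b c d : ℝ) :
    ∀ᵐ p ∂(volume.restrict (Set.Icc a b ×ˢ Set.Icc c d)), p ∈ Set.Ioo a b ×ˢ Set.Ioo c d := by
  have h : (volume : Measure (ℝ × ℝ)).restrict (Set.Icc a b ×ˢ Set.Icc c d) =
      volume.restrict (Set.Ioo a b ×ˢ Set.Ioo c d) := by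
    refine Measure.restrict_congr_set ?_
    rw [Measure.volume_eq_prod]
    exact (Measure.set_prod_ae_eq Ioo_ae_eq_Icc Ioo_ae_eq_Icc).symm
  rw [h]
  exact ae_restrict_mem (measurableSet_Ioo.prod measurableSet_Ioo)

theorem abs_bilinX_le {x y : ℕ → ℝ} {V : ℕ → ℕ → ℝ} {i j : ℕ} {t : ℝ} (hx : x i < x (i + 1))
    (hy : y j < y (j + 1)) (ht : t ∈ Set.Ioo (y j) (y (j + 1))) :
    |bilinX x y V i j t| ≤ √(cellSq V i j) / (x (i + 1) - x i) := by
  have hx' := sub_pos.mpr hx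
  have hy' := sub_pos.mpr hy
  have h1 := abs_dX_le V i j
  have h2 := abs_dX_succ_le V i j
  have t1 := sub_pos.mpr ht.1
  have t2 := sub_pos.mpr ht.2
  rw [bilinX, abs_div, abs_of_pos (mul_pos hx' hy'), div_le_div_iff₀ (mul_pos hx' hy') hx']
  have h3 : |(y (j + 1) - t) * dX V i j + (t - y j) * dX V i (j + 1)| ≤
      (y (j + 1) - y j) * √(cellSq V i j) := by
    refine (abs_add_le _ _).trans ?_
    rw [abs_mul, abs_mul, abs_of_pos t1, abs_of_pos t2]
    nlinarith
  nlinarith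

theorem sideDiff_congr {F G : ℝ × ℝ → ℝ} (k : Fin 2) {l r b t : ℝ} (hlr : l ≤ r) (hbt : b ≤ t)
    (h : ∀ p ∈ Set.Icc l r ×ˢ Set.Icc b t, F p = G p) : sideDiff k F l r b t = sideDiff k G l r b t := by
  have h0 : |sideDiff k F l r b t - sideDiff k G l r b t| = 0 := by
    have e1 : ∀ s ∈ Set.Icc l r, ∫ y in b..t, F (s, y) = ∫ y in b..t, G (s, y) := fun s hs =>
      intervalIntegral.integral_congr fun y hy => h (s, y) ⟨hs, by rwa [Set.uIcc_of_le hbt] at hy⟩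
    have e2 : ∀ s ∈ Set.Icc b t, ∫ x in l..r, F (x, s) = ∫ x in l..r, G (x, s) := fun s hs =>
      intervalIntegral.integral_congr fun x hx => h (x, s) ⟨by rwa [Set.uIcc_of_le hlr] at hx, hs⟩
    unfold sideDiff
    rw [e1 l ⟨le_rfl, hlr⟩, e1 r ⟨hlr, le_rfl⟩, e2 b ⟨le_rfl, hbt⟩, e2 t ⟨hbt, le_rfl⟩, sub_self,
      abs_zero]
  exact sub_eq_zero.mp (abs_eq_zero.mp h0)

/-- Line integrals over edges shared by two elements telescope, and `F` vanishes on the outer grid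
lines. -/
theorem sum_sideDiff_cells_eq_zero {n m : ℕ} {x y : ℕ → ℝ} {F : ℝ × ℝ → ℝ} (k : Fin 2)
    (h0 : ∀ t, F (x 0, t) = 0) (hn : ∀ t, F (x n, t) = 0) (h0' : ∀ s, F (s, y 0) = 0)
    (hm : ∀ s, F (s, y m) = 0) :
    ∑ i ∈ Finset.range n, ∑ j ∈ Finset.range m,
      sideDiff k F (x i) (x (i + 1)) (y j) (y (j + 1)) = 0 := by
  unfold sideDiff
  split_ifs
  · rw [Finset.sum_comm]
    refine Finset.sum_eq_zero fun j _ => ?_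
    rw [Finset.sum_range_sub fun i => ∫ t in y j..y (j + 1), F (x i, t)]
    simp [h0, hn]
  · refine Finset.sum_eq_zero fun i _ => ?_
    rw [Finset.sum_range_sub fun j => ∫ s in x i..x (i + 1), F (s, y j)]
    simp [h0', hm]

namespace RectMesh

variable {Ω : Rect} {T : RectMesh Ω} {w : ℝ × ℝ → ℝ} {V : ℕ → ℕ → ℝ}

theorem IsPiecewise.pd_ae_eq (hw : T.IsPiecewise w V) (k : Fin 2) {i j : ℕ} (hi : i < T.nx)
    (hj : j < T.ny) : pd k w =ᵐ[volume.restrict (T.elem i j)] pd k (bil T.x T.y V i j) := by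
  filter_upwards [ae_mem_open_box (T.x i) (T.x (i + 1)) (T.y j) (T.y (j + 1))] with p hp
  exact hw.pd_eq hi hj hp k

theorem IsPiecewise.ae_eq (hw : T.IsPiecewise w V) {i j : ℕ} (hi : i < T.nx)
    (hj : j < T.ny) : w =ᵐ[volume.restrict (T.elem i j)] bil T.x T.y V i j := by
  filter_upwards [ae_mem_box (T.x i) (T.x (i + 1)) (T.y j) (T.y (j + 1))] with p hp
  exact hw i hi j hj p hp

theorem IsPiecewise.integrableOn_elem {Φ : ℝ → ℝ} (hΦ : Continuous Φ) {G H : ℝ × ℝ → ℝ} {i j : ℕ}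
    (h : G =ᵐ[volume.restrict (T.elem i j)] H) (hH : Continuous H) :
    IntegrableOn (fun p => Φ (G p)) (T.elem i j) := by
  refine (integrableOn_box_of_continuous (hΦ.comp hH) (T.x i) (T.x (i + 1)) (T.y j)
    (T.y (j + 1))).congr ?_
  filter_upwards [h] with p hp
  rw [hp]; rfl

theorem IsPiecewise.integrableOn_pd (hw : T.IsPiecewise w V) (k : Fin 2) {Φ : ℝ → ℝ}
    (hΦ : Continuous Φ) : IntegrableOn (fun p => Φ (pd k w p)) (closure Ω.dom) :=
  T.integrableOn_closure fun _ hi _ hj => integrableOn_elem hΦ (hw.pd_ae_eq k hi hj)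
    (contDiff_pd (contDiff_bil _ _ _ _ _) k).continuous

theorem IsPiecewise.integrableOn (hw : T.IsPiecewise w V) {Φ : ℝ → ℝ}
    (hΦ : Continuous Φ) : IntegrableOn (fun p => Φ (w p)) (closure Ω.dom) :=
  T.integrableOn_closure fun _ hi _ hj => integrableOn_elem hΦ (hw.ae_eq hi hj)
    (continuous_bil _ _ _ _ _)

theorem measurable_pd (w : ℝ × ℝ → ℝ) (k : Fin 2) : Measurable (pd k w) :=
  measurable_fderiv_apply_const ℝ w (coordVec k)

/-- The classical derivatives of a piecewise bilinear function, which exist almost everywhere, are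
its weak derivatives. -/
theorem IsPiecewise.isWeakDeriv (hw : T.IsPiecewise w V) (k : Fin 2) :
    IsWeakDeriv Ω.dom (unitIdx k) w (pd k w) := by
  have i1 := (hw.integrableOn continuous_id).mono_set subset_closure
  have i2 := (hw.integrableOn_pd k continuous_id).mono_set subset_closure
  refine ⟨IntegrableOn.locallyIntegrableOn i1, IntegrableOn.locallyIntegrableOn i2, fun φ hφ => ?_⟩
  rw [pdMulti_unitIdx, unitIdx_sum, pow_one, neg_one_mul, eq_neg_iff_add_eq_zero]
  have j1 : IntegrableOn (fun p => w p * pd k φ p) (closure Ω.dom) := by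
    obtain ⟨B, hB⟩ := (hφ.pd k).2.1.exists_bound_of_continuous (hφ.pd k).1.continuous
    exact Integrable.mul_bdd (c := B) (hw.integrableOn continuous_id)
      (hφ.pd k).1.continuous.aestronglyMeasurable (Eventually.of_forall hB)
  have j2 : IntegrableOn (fun p => pd k w p * φ p) (closure Ω.dom) := by
    obtain ⟨B, hB⟩ := hφ.2.1.exists_bound_of_continuous hφ.1.continuous
    exact Integrable.mul_bdd (c := B) (hw.integrableOn_pd k continuous_id)
      hφ.1.continuous.aestronglyMeasurable (Eventually.of_forall hB)
  have j3 : IntegrableOn (fun p => w p * pd k φ p + pd k w p * φ p) (closure Ω.dom) := j1.add j2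
  rw [← integral_add (j1.mono_set subset_closure) (j2.mono_set subset_closure),
    ← T.sum_boxInt_elem j3]
  have hz : ∀ p ∉ Ω.dom, w p * φ p = 0 := fun p hp => by
    rw [image_eq_zero_of_notMem_tsupport fun h => hp (hφ.2.2 h), mul_zero]
  -- The boundary terms vanish because of the test function; nothing is assumed about `w` on the
  -- boundary.
  have hout : ∀ p : ℝ × ℝ, (p.1 = T.x 0 ∨ p.1 = T.x T.nx ∨ p.2 = T.y 0 ∨ p.2 = T.y T.ny) →
      w p * φ p = 0 := fun p h => hz p fun hd => by
    rw [T.dom_eq] at hd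
    obtain ⟨⟨h1, h2⟩, h3, h4⟩ := hd
    rcases h with h | h | h | h <;> linarith
  rw [← sum_sideDiff_cells_eq_zero (n := T.nx) (m := T.ny) (x := T.x) (y := T.y)
    (F := fun p => w p * φ p) k (fun t => hout _ (by simp)) (fun t => hout _ (by simp))
    (fun t => hout _ (by simp)) (fun t => hout _ (by simp))]
  refine Finset.sum_congr rfl fun i hi => Finset.sum_congr rfl fun j hj => ?_
  have hi := Finset.mem_range.mp hi
  have hj := Finset.mem_range.mp hj
  have hb := contDiff_bil T.x T.y V i j
  rw [sideDiff_congr (G := fun p => bil T.x T.y V i j p * φ p) k (T.x_le_succ i hi) (T.y_le_succ j hj)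
    fun p hp => by rw [hw i hi j hj p hp], sideDiff_eq_boxInt_pd (hb.mul hφ.1) k (T.x_le_succ i hi)
    (T.y_le_succ j hj), pd_mul hb hφ.1]
  refine integral_congr_ae ?_
  filter_upwards [hw.pd_ae_eq k hi hj, hw.ae_eq hi hj] with p h1 h2
  rw [h1, h2]

/-- The `x`-derivative is at most an edge increment divided by the width. Its square times the area
carries the factor height over width, at most `γ`; in the other direction the roles are exchanged.
-/
theorem IsPiecewise.boxInt_pd_sq_le (hw : T.IsPiecewise w V) {γ h : ℝ}
    (G : IsGrid T.nx T.ny T.x T.y γ h) (k : Fin 2) {i j : ℕ} (hi : i < T.nx) (hj : j < T.ny) :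
    boxInt (fun p => pd k w p ^ 2) (T.x i) (T.x (i + 1)) (T.y j) (T.y (j + 1)) ≤
      γ * cellSq V i j := by
  have hx := sub_pos.mpr (T.x_lt i hi)
  have hy := sub_pos.mpr (T.y_lt j hj)
  have hS := cellSq_nonneg V i j
  have key : ∀ D : ℝ, (∀ p ∈ Set.Ioo (T.x i) (T.x (i + 1)) ×ˢ Set.Ioo (T.y j) (T.y (j + 1)),
      |pd k w p| ≤ √(cellSq V i j) / D) →
      boxInt (fun p => pd k w p ^ 2) (T.x i) (T.x (i + 1)) (T.y j) (T.y (j + 1)) ≤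
        (T.x (i + 1) - T.x i) * (T.y (j + 1) - T.y j) * (cellSq V i j / D ^ 2) := fun D hD => by
    have hint : IntegrableOn (fun p => pd k w p ^ 2) (T.elem i j) :=
      integrableOn_elem (Φ := fun s => s ^ 2) (by fun_prop) (hw.pd_ae_eq k hi hj)
        (contDiff_pd (contDiff_bil _ _ _ _ _) k).continuous
    have h1 : boxInt (fun p => pd k w p ^ 2) (T.x i) (T.x (i + 1)) (T.y j) (T.y (j + 1)) ≤
        ∫ _ in Set.Icc (T.x i) (T.x (i + 1)) ×ˢ Set.Icc (T.y j) (T.y (j + 1)), cellSq V i j / D ^ 2 := by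
      refine integral_mono_ae hint (integrable_const _) ?_
      filter_upwards [ae_mem_open_box (T.x i) (T.x (i + 1)) (T.y j) (T.y (j + 1))] with p hp
      have := sq_le_sq' (by linarith [abs_nonneg (pd k w p), hD p hp]) (hD p hp)
      rwa [sq_abs, div_pow, Real.sq_sqrt hS] at this
    rwa [setIntegral_const, volume_box (T.x_le_succ i hi) (T.y_le_succ j hj), smul_eq_mul] at h1
  rcases (show k = 0 ∨ k = 1 by omega) with rfl | rfl
  · refine (key (T.x (i + 1) - T.x i) fun p hp => ?_).trans ?_
    · rw [hw.pd_eq hi hj hp, pd_zero_bil]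
      exact abs_bilinX_le (T.x_lt i hi) (T.y_lt j hj) hp.2
    · have e : (T.x (i + 1) - T.x i) * (T.y (j + 1) - T.y j) *
          (cellSq V i j / (T.x (i + 1) - T.x i) ^ 2) =
          (T.y (j + 1) - T.y j) / (T.x (i + 1) - T.x i) * cellSq V i j := by
        field_simp
      rw [e]
      exact mul_le_mul_of_nonneg_right ((div_le_iff₀ hx).mpr (G.y_ratio i hi j hj)) hS
  · refine (key (T.y (j + 1) - T.y j) fun p hp => ?_).trans ?_
    · rw [hw.pd_eq hi hj hp, pd_one_bil, ← cellSq_flip]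
      exact abs_bilinX_le (T.y_lt j hj) (T.x_lt i hi) hp.1
    · have e : (T.x (i + 1) - T.x i) * (T.y (j + 1) - T.y j) *
          (cellSq V i j / (T.y (j + 1) - T.y j) ^ 2) =
          (T.x (i + 1) - T.x i) / (T.y (j + 1) - T.y j) * cellSq V i j := by
        field_simp
      rw [e]
      exact mul_le_mul_of_nonneg_right ((div_le_iff₀ hy).mpr (G.x_ratio i hi j hj)) hS

theorem IsPiecewise.integral_pd_sq_le (hw : T.IsPiecewise w V) {γ h : ℝ}
    (G : IsGrid T.nx T.ny T.x T.y γ h) (k : Fin 2) :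
    ∫ p in Ω.dom, pd k w p ^ 2 ≤ γ * nodalEnergy T.nx T.ny V := by
  rw [← T.sum_boxInt_elem (hw.integrableOn_pd k (Φ := fun s => s ^ 2) (by fun_prop)), nodalEnergy,
    Finset.mul_sum]
  refine Finset.sum_le_sum fun i hi => ?_
  rw [Finset.mul_sum]
  exact Finset.sum_le_sum fun j hj =>
    hw.boxInt_pd_sq_le G k (Finset.mem_range.mp hi) (Finset.mem_range.mp hj)

theorem IsPiecewise.integral_sq_le (hw : T.IsPiecewise w V) {γ h : ℝ}
    (G : IsGrid T.nx T.ny T.x T.y γ h) (h0 : ∀ j ≤ T.ny, V 0 j = 0) :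
    ∫ p in Ω.dom, w p ^ 2 ≤ 2 * (Ω.b - Ω.a) ^ 2 * γ * nodalEnergy T.nx T.ny V := by
  have h1 := sum_cornerSq_le G h0
  rw [T.x_zero, T.x_last] at h1
  refine le_trans ?_ h1
  have hint := hw.integrableOn (Φ := fun s => s ^ 2) (by fun_prop)
  rw [← T.sum_boxInt_elem hint]
  refine Finset.sum_le_sum fun i hi => Finset.sum_le_sum fun j hj => ?_
  have hi := Finset.mem_range.mp hi
  have hj := Finset.mem_range.mp hj
  have h2 : boxInt (fun p => w p ^ 2) (T.x i) (T.x (i + 1)) (T.y j) (T.y (j + 1)) ≤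
      ∫ _ in Set.Icc (T.x i) (T.x (i + 1)) ×ˢ Set.Icc (T.y j) (T.y (j + 1)), cornerSq V i j := by
    refine integral_mono_ae (hint.mono_set (T.elem_subset_closure hi hj)) (integrable_const _) ?_
    filter_upwards [ae_mem_box (T.x i) (T.x (i + 1)) (T.y j) (T.y (j + 1))] with p hp
    rw [hw i hi j hj p hp]
    have h3 := abs_bil_le (W := V) (T.x_lt i hi) (T.y_lt j hj) hp
    rw [← sq_abs, ← Real.sq_sqrt (cornerSq_nonneg V i j)]
    exact pow_le_pow_left₀ (abs_nonneg _) h3 2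
  rwa [setIntegral_const, volume_box (T.x_le_succ i hi) (T.y_le_succ j hj), smul_eq_mul] at h2

theorem IsPiecewise.memSobolev (hw : T.IsPiecewise w V) : MemSobolev 1 2 Ω.dom w := by
  have h1 : ∀ k, ∃ g, IsWeakDeriv Ω.dom (unitIdx k) w g ∧ MemLp g 2 (volume.restrict Ω.dom) :=
    fun k => ⟨pd k w, hw.isWeakDeriv k,
      (memLp_two_iff_integrable_sq (measurable_pd w k).aestronglyMeasurable).mpr
        ((hw.integrableOn_pd k (Φ := fun s => s ^ 2) (by fun_prop)).mono_set subset_closure)⟩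
  have i1 : IntegrableOn w Ω.dom := (hw.integrableOn continuous_id).mono_set subset_closure
  rintro ⟨α, β⟩ hα
  obtain ⟨rfl, rfl⟩ | ⟨rfl, rfl⟩ | ⟨rfl, rfl⟩ :
      (α = 0 ∧ β = 0) ∨ (α = 1 ∧ β = 0) ∨ (α = 0 ∧ β = 1) := by
    simp only at hα; omega
  · exact ⟨w, isWeakDeriv_zero (IntegrableOn.locallyIntegrableOn i1),
      (memLp_two_iff_integrable_sq i1.aestronglyMeasurable).mpr
        ((hw.integrableOn (Φ := fun s => s ^ 2) (by fun_prop)).mono_set subset_closure)⟩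
  · exact h1 0
  · exact h1 1

/-- The term `2 * (Ω.b - Ω.a) ^ 2 * γ` comes from the discrete Poincaré inequality for the function
itself, and each of its two derivatives adds `γ`. -/
theorem IsPiecewise.sobolevNorm_le (hw : T.IsPiecewise w V) {γ h : ℝ}
    (G : IsGrid T.nx T.ny T.x T.y γ h) (h0 : ∀ j ≤ T.ny, V 0 j = 0) :
    sobolevNorm 1 Ω.dom w ≤
      √(2 * (Ω.b - Ω.a) ^ 2 * γ + 2 * γ) * √(nodalEnergy T.nx T.ny V) := by
  have hU := Ω.isOpen_dom
  have i1 : IntegrableOn w Ω.dom := (hw.integrableOn continuous_id).mono_set subset_closure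
  have sq_congr : ∀ {f g : ℝ × ℝ → ℝ}, f =ᵐ[volume.restrict Ω.dom] g →
      ∫ p in Ω.dom, f p ^ 2 = ∫ p in Ω.dom, g p ^ 2 := fun h =>
    integral_congr_ae (h.fun_comp (· ^ 2))
  have e0 := sq_congr (weakDeriv_ae_eq hU (isWeakDeriv_zero (IntegrableOn.locallyIntegrableOn i1)))
  have e1 : ∫ p in Ω.dom, weakDeriv Ω.dom (1, 0) w p ^ 2 = _ :=
    sq_congr (weakDeriv_ae_eq hU (hw.isWeakDeriv 0))
  have e2 : ∫ p in Ω.dom, weakDeriv Ω.dom (0, 1) w p ^ 2 = _ :=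
    sq_congr (weakDeriv_ae_eq hU (hw.isWeakDeriv 1))
  have h1 := hw.integral_pd_sq_le G 0
  have h2 := hw.integral_pd_sq_le G 1
  have h3 := hw.integral_sq_le G h0
  have hE := nodalEnergy_nonneg T.nx T.ny V
  rw [sobolevNorm, ← Real.sqrt_mul' _ hE]
  refine Real.sqrt_le_sqrt ?_
  simp only [Finset.sum_range_succ, Finset.sum_range_zero, Finset.Nat.antidiagonal_succ,
    Finset.Nat.antidiagonal_zero, Finset.map_singleton, Finset.sum_cons, Finset.sum_singleton]
  simp only [Function.Embedding.prodMap, Function.Embedding.coeFn_mk, Prod.map,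
    Function.Embedding.refl_apply, Nat.succ_eq_add_one, zero_add]
  rw [e0, e1, e2]
  linarith

end RectMesh

end FVE

namespace FVE

open Filter Topology RectMesh

/-! ### The error of the scheme -/

theorem integral_sq_le_two_mul {Ω : Rect} {v w : ℝ × ℝ → ℝ} (hv : MemLp v 2 (volume.restrict Ω.dom))
    (hw : MemLp w 2 (volume.restrict Ω.dom)) :
    ∫ p in Ω.dom, w p ^ 2 ≤ 2 * (∫ p in Ω.dom, v p ^ 2) + 2 * ∫ p in Ω.dom, (w p - v p) ^ 2 := by
  have i1 : Integrable (fun p => v p ^ 2) (volume.restrict Ω.dom) := hv.integrable_sq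
  have i2 : Integrable (fun p => (w p - v p) ^ 2) (volume.restrict Ω.dom) := (hw.sub hv).integrable_sq
  rw [← integral_const_mul, ← integral_const_mul, ← integral_add (i1.const_mul 2) (i2.const_mul 2)]
  refine integral_mono hw.integrable_sq ((i1.const_mul 2).add (i2.const_mul 2)) fun p => ?_
  simp only
  nlinarith [sq_nonneg (w p - 2 * v p)]

section

variable {Ω : Rect} {A : ℝ × ℝ → Matrix (Fin 2) (Fin 2) ℝ} {c c' f u uh : ℝ × ℝ → ℝ}
  {a g : Fin 2 → Fin 2 → ℝ × ℝ → ℝ} {M L C₁ γ : ℝ} {T : RectMesh Ω}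

theorem RectMesh.isTrial_interp_sub (hu : ∀ p ∈ frontier Ω.dom, u p = 0) (huh : T.IsTrial uh) :
    T.IsTrial fun p => T.interp u p - uh p := by
  obtain ⟨z1, z2, z3, z4⟩ := huh.nodal_eq_zero
  have hz : ∀ {i j : ℕ}, i ≤ T.nx → j ≤ T.ny →
      (T.x i = T.x 0 ∨ T.x i = T.x T.nx ∨ T.y j = T.y 0 ∨ T.y j = T.y T.ny) → T.nodal u i j = 0 :=
    fun hi hj h => hu _ (T.mem_frontier (T.node_mem_closure hi hj) h)
  refine ((T.isPiecewise_interp u).sub huh.isPiecewise).isTrial ?_ ?_ ?_ ?_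
  · exact fun j hj => by rw [z1 j hj, hz (Nat.zero_le _) hj (by simp), sub_zero]
  · exact fun j hj => by rw [z2 j hj, hz le_rfl hj (by simp), sub_zero]
  · exact fun i hi => by rw [z3 i hi, hz hi (Nat.zero_le _) (by simp), sub_zero]
  · exact fun i hi => by rw [z4 i hi, hz hi le_rfl (by simp), sub_zero]

/-- Only at interior nodes does the dual element stay away from the boundary, which is what the
balance of fluxes requires. -/
theorem RectMesh.dual_subset (T : RectMesh Ω) {i j : ℕ} (hi0 : 0 < i) (hi : i < T.nx) (hj0 : 0 < j)
    (hj : j < T.ny) : T.dual i j ⊆ Ω.dom := by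
  have key : ∀ {z : ℕ → ℝ} {n i : ℕ}, (∀ i < n, z i < z (i + 1)) → 0 < i → i < n →
      Set.Icc (cutL z i) (cutR z n i) ⊆ Set.Ioo (z 0) (z n) := by
    intro z n i hz hi0 hi t ht
    obtain ⟨k, rfl⟩ : ∃ k, i = k + 1 := ⟨i - 1, by omega⟩
    rw [cutL_succ, cutR_of_lt z hi] at ht
    constructor
    · exact ((le_of_forall_step (fun i hi => (hz i hi).le) (Nat.zero_le k) (by omega)).trans_lt
        (midpt_mem_Ioo (hz k (by omega))).1).trans_le ht.1
    · exact ht.2.trans_lt ((midpt_mem_Ioo (hz (k + 1) hi)).2.trans_le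
        (le_of_forall_step (fun i hi => (hz i hi).le) hi le_rfl))
  rw [T.dual_eq, T.dom_eq]
  exact Set.prod_mono (key T.x_lt hi0 hi) (key T.y_lt hj0 hj)

/-- At interior nodes the balance holds in the limit. The control volumes of boundary nodes reach
the boundary of the domain, but there the nodal value of `v` removes the term. -/
theorem IsCoeff.tendsto_sum_balance (H : IsCoeff Ω A c a g c' M L C₁)
    (hf : MemLp f 2 (volume.restrict Ω.dom)) (hsol : IsSolution Ω A c f u)
    (hu : MemSobolev 3 2 Ω.dom u) {w : ℕ → ℝ × ℝ → ℝ} (hw : ∀ n, ContDiff ℝ ∞ (w n))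
    (hlim : ∀ α : ℕ × ℕ, α.1 + α.2 ≤ 3 → Tendsto (fun n => ∫ p in Ω.dom,
        (pdMulti α (w n) p - weakDeriv Ω.dom α u p) ^ 2) atTop (𝓝 0))
    {v : ℝ × ℝ → ℝ} (hv : T.IsTrial v) :
    Tendsto (fun n => ∑ i ∈ Finset.range (T.nx + 1), ∑ j ∈ Finset.range (T.ny + 1),
      (-(∑ k, sideDiff k (fluxComp a k (w n)) (cutL T.x i) (cutR T.x T.nx i) (cutL T.y j)
        (cutR T.y T.ny j)) + boxInt (fun p => c' p * w n p) (cutL T.x i) (cutR T.x T.nx i)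
        (cutL T.y j) (cutR T.y T.ny j)) * T.nodal v i j) atTop
      (𝓝 (∫ p in Ω.dom, f p * T.dualProj v p)) := by
  obtain ⟨z1, z2, z3, z4⟩ := hv.nodal_eq_zero
  have hfi : IntegrableOn f (closure Ω.dom) := by
    rw [IntegrableOn, Ω.restrict_closure]
    exact hf.integrable (by norm_num)
  rw [← T.sum_boxInt_dual_mul v hfi]
  refine tendsto_finsetSum _ fun i hi => tendsto_finsetSum _ fun j hj => ?_
  have hi : i ≤ T.nx := Nat.lt_succ_iff.mp (Finset.mem_range.mp hi)
  have hj : j ≤ T.ny := Nat.lt_succ_iff.mp (Finset.mem_range.mp hj)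
  by_cases hint : 0 < i ∧ i < T.nx ∧ 0 < j ∧ j < T.ny
  · obtain ⟨hi0, hin, hj0, hjn⟩ := hint
    exact (H.tendsto_balance hf hsol hu hw hlim ((cutL_le T.x_lt hi).trans (le_cutR T.x_lt hi))
      ((cutL_le T.y_lt hj).trans (le_cutR T.y_lt hj))
      (T.dual_subset hi0 hin hj0 hjn)).mul_const _
  · have h0 : T.nodal v i j = 0 := by
      rcases Nat.eq_zero_or_pos i with rfl | hi0
      · exact z1 j hj
      rcases hi.eq_or_lt with rfl | hin
      · exact z2 j hj
      rcases Nat.eq_zero_or_pos j with rfl | hj0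
      · exact z3 i hi
      rcases hj.eq_or_lt with rfl | hjn
      · exact z4 i hi
      exact absurd ⟨hi0, hin, hj0, hjn⟩ hint
    simp only [h0, mul_zero]
    exact tendsto_const_nhds

theorem sobolevNorm_nonneg (m : ℕ) (U : Set (ℝ × ℝ)) (v : ℝ × ℝ → ℝ) : 0 ≤ sobolevNorm m U v :=
  Real.sqrt_nonneg _

/-- From `w² ≤ 2 v² + 2 (w - v)²`, derivative by derivative. The second sum disappears along the
approximating sequence, and the factor two only affects the constant. -/
theorem sobEnergy_le {w : ℝ × ℝ → ℝ} (hu : MemSobolev 3 2 Ω.dom u) (hw : ContDiff ℝ ∞ w) :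
    sobEnergy w Ω.a Ω.b Ω.c Ω.d ≤ 2 * sobolevNorm 3 Ω.dom u ^ 2 +
      2 * ∑ k ∈ Finset.range 4, ∑ α ∈ Finset.HasAntidiagonal.antidiagonal k,
        ∫ p in Ω.dom, (pdMulti α w p - weakDeriv Ω.dom α u p) ^ 2 := by
  rw [sobolevNorm, Real.sq_sqrt (Finset.sum_nonneg fun _ _ => Finset.sum_nonneg fun _ _ =>
    integral_nonneg fun _ => sq_nonneg _), sobEnergy]
  simp_rw [Finset.mul_sum, ← Finset.sum_add_distrib]
  refine Finset.sum_le_sum fun k hk => Finset.sum_le_sum fun α hα => ?_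
  have hα' : α.1 + α.2 ≤ 3 := by
    have h1 := Finset.HasAntidiagonal.mem_antidiagonal.mp hα
    have h2 := Finset.mem_range.mp hk
    omega
  rw [boxInt_eq_Ioo]
  exact integral_sq_le_two_mul (hu.weakDeriv_spec Ω.isOpen_dom hα').2
    (memLp_two_dom_of_continuous (contDiff_pdMulti hw α).continuous)

/-- The consistency error of the scheme for the solution of the boundary value problem. -/
theorem IsCoeff.abs_integral_sub_discForm_le (H : IsCoeff Ω A c a g c' M L C₁)
    (hf : MemLp f 2 (volume.restrict Ω.dom)) (hsol : IsSolution Ω A c f u)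
    (hu : MemSobolev 3 2 Ω.dom u) (hγ : 0 ≤ γ) (hT : T.IsRegular γ) (hh : T.meshSize ≤ 1)
    {v : ℝ × ℝ → ℝ} (hv : T.IsTrial v) :
    |(∫ p in Ω.dom, f p * T.dualProj v p) -
      discForm T.nx T.ny T.x T.y a c' (T.dualProj v) (T.nodal u) (T.nodal v)| ≤
    (2 * (2 * (M * (1 + γ) + L * (2 * γ + 1) + M) + (M + 2 * L * γ)) +
      3 * M * √(2 * (Ω.b - Ω.a) ^ 2 * γ)) * T.meshSize ^ 2 *
      (√2 * sobolevNorm 3 Ω.dom u * √(nodalEnergy T.nx T.ny (T.nodal v))) := by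
  obtain ⟨z1, z2, z3, z4⟩ := hv.nodal_eq_zero
  obtain ⟨w, hw, hwu, hlim⟩ := exists_smooth_approx hu hsol.2.1
  have hP := T.isStepOf_dualProj v
  have t1 := H.tendsto_sum_balance hf hsol hu hw hlim hv
  have t2 := H.tendsto_discForm hP T.x_lt T.y_lt (W := T.nodal u) (Z := fun k => T.nodal (w k))
    (fun i hi j hj => hwu _ (T.node_mem_closure hi hj)) (T.nodal v)
  have t3 : Tendsto (fun n => ∑ k ∈ Finset.range 4, ∑ α ∈ Finset.HasAntidiagonal.antidiagonal k,
      ∫ p in Ω.dom, (pdMulti α (w n) p - weakDeriv Ω.dom α u p) ^ 2) atTop (𝓝 0) := by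
    have := tendsto_finsetSum (Finset.range 4) fun k hk => tendsto_finsetSum
      (Finset.HasAntidiagonal.antidiagonal k) fun α hα => hlim α (by
        have h1 := Finset.HasAntidiagonal.mem_antidiagonal.mp hα
        have h2 := Finset.mem_range.mp hk
        omega)
    simpa using this
  set K := 2 * (2 * (M * (1 + γ) + L * (2 * γ + 1) + M) + (M + 2 * L * γ)) +
    3 * M * √(2 * (Ω.b - Ω.a) ^ 2 * γ) with hK
  have hK0 : 0 ≤ K := by
    have := H.M_nonneg
    have := H.L_nonneg
    positivity
  -- The limit of the right sides of the bounds for the smooth approximations; the factor `√2` of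
  -- the conclusion comes from the two in `sobEnergy_le`.
  have t4 := (((((t3.const_mul 2).const_add (2 * sobolevNorm 3 Ω.dom u ^ 2)).sqrt).mul_const
    √(nodalEnergy T.nx T.ny (T.nodal v))).const_mul (K * T.meshSize ^ 2))
  rw [mul_zero, add_zero, Real.sqrt_mul zero_le_two, Real.sqrt_sq (sobolevNorm_nonneg _ _ _)] at t4
  refine le_of_tendsto_of_tendsto' (t1.sub t2).abs t4 fun n => ?_
  rw [H.sum_balance_eq (hw n) hv]
  refine (H.abs_sub_discForm_le hP (hT.isGrid hγ) hγ T.meshSize_pos.le hh (hw n) z1 z2 z3 z4).trans ?_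
  rw [T.x_zero, T.x_last, T.y_zero, T.y_last]
  gcongr
  exact sobEnergy_le hu (hw n)

theorem RectMesh.center_mem (T : RectMesh Ω) {i j : ℕ} (hi : i < T.nx) (hj : j < T.ny) :
    (midpt T.x i, midpt T.y j) ∈ Ω.dom :=
  T.interior_elem_subset hi hj ⟨midpt_mem_Ioo (T.x_lt i hi), midpt_mem_Ioo (T.y_lt j hj)⟩

/-- The discrete energy of the error is of fourth order. -/
theorem IsCoeff.energy_error_le (H : IsCoeff Ω A c a g c' M L C₁)
    (hf : MemLp f 2 (volume.restrict Ω.dom)) (hsol : IsSolution Ω A c f u)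
    (hu : MemSobolev 3 2 Ω.dom u) (hγ : 0 < γ) (hT : T.IsRegular γ) (hh : T.meshSize ≤ 1)
    (hsmall : (8 * L * (γ + 1) + 2 * M * √(2 * (Ω.b - Ω.a) ^ 2 * γ)) * T.meshSize ≤ C₁ / (8 * γ))
    (huh : IsFVESolution T A c f uh) :
    C₁ / (8 * γ) * √(nodalEnergy T.nx T.ny (T.nodal fun p => T.interp u p - uh p)) ≤
      (2 * (2 * (M * (1 + γ) + L * (2 * γ + 1) + M) + (M + 2 * L * γ)) +
        3 * M * √(2 * (Ω.b - Ω.a) ^ 2 * γ)) * √2 * T.meshSize ^ 2 * sobolevNorm 3 Ω.dom u := by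
  set v : ℝ × ℝ → ℝ := fun p => T.interp u p - uh p with hvdef
  have hv : T.IsTrial v := RectMesh.isTrial_interp_sub hsol.2.2.1 huh.1
  obtain ⟨z1, -, -, -⟩ := hv.nodal_eq_zero
  have hP := T.isStepOf_dualProj v
  have hM := H.M_nonneg
  have hL := H.L_nonneg
  have hC := H.C_pos
  have hE := nodalEnergy_nonneg T.nx T.ny (T.nodal v)
  have e1 := huh.2 v hv
  rw [H.fveForm_eq huh.1 hv] at e1
  have e2 := H.abs_integral_sub_discForm_le hf hsol hu hγ.le hT hh hv
  have e3 := H.discForm_self_ge hP (hT.isGrid hγ.le) hγ T.meshSize_pos.le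
    (fun i hi j hj => T.center_mem hi hj) z1
  rw [T.x_zero, T.x_last] at e3
  rw [← e1, abs_sub_comm, H.discForm_sub hP] at e2
  have e4 : discForm T.nx T.ny T.x T.y a c' (T.dualProj v)
      (fun i j => T.nodal u i j - T.nodal uh i j) (T.nodal v) =
      discForm T.nx T.ny T.x T.y a c' (T.dualProj v) (T.nodal v) (T.nodal v) := by
    -- The two nodal functions agree on the grid but not at all indices. Applied to a constant
    -- sequence, the continuity statement serves as a congruence rule.
    refine tendsto_nhds_unique tendsto_const_nhds (H.tendsto_discForm hP T.x_lt T.y_lt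
      (Z := fun _ i j => T.nodal u i j - T.nodal uh i j) (fun i hi j hj => ?_) (T.nodal v))
    rw [((T.isPiecewise_interp u).sub huh.1.isPiecewise).nodal_eq hi hj]
    exact tendsto_const_nhds
  rw [e4] at e2
  -- By `hsmall` the `O(h)` losses use up at most half of the coercivity constant `C₁ / (4 γ)`.
  have e5 : C₁ / (8 * γ) * nodalEnergy T.nx T.ny (T.nodal v) ≤
      (C₁ / (4 * γ) - (8 * L * (γ + 1) + 2 * M * √(2 * (Ω.b - Ω.a) ^ 2 * γ)) * T.meshSize) *
        nodalEnergy T.nx T.ny (T.nodal v) := by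
    refine mul_le_mul_of_nonneg_right ?_ hE
    have : C₁ / (4 * γ) = C₁ / (8 * γ) + C₁ / (8 * γ) := by field_simp; norm_num
    linarith
  have e6 := e5.trans (e3.trans ((le_abs_self _).trans e2))
  set K := 2 * (2 * (M * (1 + γ) + L * (2 * γ + 1) + M) + (M + 2 * L * γ)) +
    3 * M * √(2 * (Ω.b - Ω.a) ^ 2 * γ) with hK
  have hK0 : 0 ≤ K := by positivity
  have hS := sobolevNorm_nonneg 3 Ω.dom u
  -- Coercivity bounds the energy by a multiple of its square root; one factor is cancelled unless
  -- it is zero.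
  rcases hE.eq_or_lt with h0 | hpos
  · rw [← h0, Real.sqrt_zero, mul_zero]; positivity
  · have hs : 0 < √(nodalEnergy T.nx T.ny (T.nodal v)) := Real.sqrt_pos.mpr hpos
    refine le_of_mul_le_mul_right ?_ hs
    rw [mul_assoc, Real.mul_self_sqrt hE]
    linarith

end

end FVE

theorem theorem3p2 (Ω : Rect) (A : ℝ × ℝ → Matrix (Fin 2) (Fin 2) ℝ) (c : ℝ × ℝ → ℝ)
    (hA : ∀ i j, MemSobolev 1 ⊤ Ω.dom (fun p => A p i j))
    (hAcont : ∀ i j, ContinuousOn (fun p => A p i j) Ω.dom)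
    (hAell : UniformlyElliptic Ω.dom A)
    (hc : MemLp c ⊤ (volume.restrict Ω.dom))
    (hc0 : ∀ᵐ p ∂(volume.restrict Ω.dom), 0 ≤ c p)
    (γ : ℝ) (hγ : 0 < γ) :
    ∃ C > 0, ∃ h₀ > 0, ∀ T : RectMesh Ω, T.IsRegular γ → T.meshSize ≤ h₀ →
      ∀ f u uh : ℝ × ℝ → ℝ, MemLp f 2 (volume.restrict Ω.dom) →
        IsSolution Ω A c f u → MemSobolev 3 2 Ω.dom u → IsFVESolution T A c f uh →
          MemSobolev 1 2 Ω.dom (fun p => T.interp u p - uh p) ∧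
          sobolevNorm 1 Ω.dom (fun p => T.interp u p - uh p) ≤
            C * T.meshSize ^ 2 * sobolevNorm 3 Ω.dom u := by
  obtain ⟨a, g, c', M, L, C₁, H⟩ := exists_isCoeff hA hAcont hAell hc hc0
  have hM := H.M_nonneg
  have hL := H.L_nonneg
  have hC := H.C_pos
  set R := √(2 * (Ω.b - Ω.a) ^ 2 * γ) with hR
  set K := (2 * (2 * (M * (1 + γ) + L * (2 * γ + 1) + M) + (M + 2 * L * γ)) + 3 * M * R) * √2 with hK
  set D := 8 * L * (γ + 1) + 2 * M * R with hD
  set B := √(2 * (Ω.b - Ω.a) ^ 2 * γ + 2 * γ) with hB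
  have hK0 : 0 ≤ K := by positivity
  have hD0 : 0 ≤ D := by positivity
  have hα : 0 < C₁ / (8 * γ) := by positivity
  -- The added ones only ensure that the constant is positive and that the denominator is nonzero.
  -- The bound by `1` on the mesh size absorbs higher powers of `h` in the consistency estimate; the
  -- other bound makes the form coercive.
  refine ⟨B * (K / (C₁ / (8 * γ))) + 1, by positivity, min 1 (C₁ / (8 * γ) / (D + 1)),
    lt_min one_pos (by positivity), fun T hT hh f u uh hf hsol hu huh => ?_⟩
  have hh1 : T.meshSize ≤ 1 := hh.trans (min_le_left _ _)
  have hsmall : D * T.meshSize ≤ C₁ / (8 * γ) := by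
    have h1 := (le_div_iff₀ (by linarith : 0 < D + 1)).mp (hh.trans (min_le_right _ _))
    nlinarith [T.meshSize_pos]
  have hpw := (T.isPiecewise_interp u).sub huh.1.isPiecewise
  have hv := RectMesh.isTrial_interp_sub hsol.2.2.1 huh.1
  refine ⟨hpw.memSobolev, ?_⟩
  have h1 := hv.isPiecewise.sobolevNorm_le (hT.isGrid hγ.le) hv.nodal_eq_zero.1
  have h2 := H.energy_error_le hf hsol hu hγ hT hh1 hsmall huh
  set S := sobolevNorm 3 Ω.dom u with hS
  have hS0 : 0 ≤ S := sobolevNorm_nonneg _ _ _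
  have h3 : √(nodalEnergy T.nx T.ny (T.nodal fun p => T.interp u p - uh p)) ≤
      K / (C₁ / (8 * γ)) * (T.meshSize ^ 2 * S) := by
    rw [div_mul_eq_mul_div, le_div_iff₀ hα]
    linarith
  calc sobolevNorm 1 Ω.dom (fun p => T.interp u p - uh p)
      ≤ B * (K / (C₁ / (8 * γ)) * (T.meshSize ^ 2 * S)) :=
        h1.trans (mul_le_mul_of_nonneg_left h3 (Real.sqrt_nonneg _))
    _ ≤ (B * (K / (C₁ / (8 * γ))) + 1) * T.meshSize ^ 2 * S := by
        have : 0 ≤ T.meshSize ^ 2 * S := by positivity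
        nlinarith
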